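/- **Setting.** Let $m,n,N\in\mathbb N$, let $x_1,\dots,x_m\in\{0,1\}^n$ be (binary encodings of) data points with labels $y_i\in\{+1,-1\}$, and let $\Phi:\{0,1\}^n\to\mathbb R^{2^N}$. A *quantum feature map* for $\Phi$ is a unitary $U_\Phi$ on $n+N$ qubits with $U_\Phi|x\rangle|0\rangle=|x\rangle|\Phi(x)\rangle$ for all $x\in\{0,1\}^n$, where $|\Phi(x)\rangle=\frac1{\|\Phi(x)\|}\sum_j\Phi(x)_j|j\rangle$. For $c\in\{0,1\}^m$ put $$\Psi_c=\frac1m\sum_{i=1}^m c_iy_i\Phi(x_i),\qquad \eta_c=\sqrt{\frac{\sum_{i=1}^m c_i\|\Phi(x_i)\|^2}{m}},\qquad R=\max_i\|\Phi(x_i)\|.$$ **Machine model.** A program is a fixed finite text, independent of the problem instance, with integer variables (operations charged by bit length), real variables (arithmetic operations, comparisons and the functions $\sqrt{\ },\exp,\log,\sin,\cos,\arccos$ take unit time), branching, bounded loops, and qubits initially in $|0\rangle$; the gates X, H, T, CNOT, Toffoli and the measurement of a qubit take unit time. A list $v_1,\dots,v_m$ *stored in qRAM* can be accessed through queries $|j\rangle|z\rangle\mapsto|j\rangle|z\oplus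 v_j\rangle$ in superposition (addresses that are out of range hold zeros); if the $v_j$ are real numbers, a query loads the sign bit or one chosen digit of weight $2^e$, $e\in\mathbb Z$, of the binary expansion of $|v_j|$. A query takes time $1+\lceil\log_2m\rceil$, plus $n$ for an $n$-bit word and plus $|e|$ for the digit $2^e$. One use of $U_\Phi$ or of $U_\Phi^{-1}$ takes time $T_\Phi$, where $T_\Phi\ge1$ and $n+N\le2T_\Phi$ (every qubit is touched by one of the at most two-qubit gates of a circuit for $U_\Phi$). **Theorem.** There are a program and constants $K,k\in\mathbb N$ such that the following holds for all $m,n,N,T_\Phi$, all data $(x_i,y_i)$, all quantum feature maps $U_\Phi$ as above, all $c,c'\in\{0,1\}^m$ with $\Psi_c\ne0\ne\Psi_{c'}$, all $\varepsilon>0$ and all $0<\delta<1$. Suppose that, for all $i$, the values $x_i$, $\frac{c_iy_i}{\sqrt m}\|\Phi(x_i)\|$ and $\frac{c'_iy_i}{\sqrt m}\|\Phi(x_i)\|$ are stored in qRAM, and that the program is given only the numbers $m,n,N,\varepsilon,\delta,\eta_c,\eta_{c'}$. Then, with probability at least $1-\delta$, its output $s_{cc'}$ satisfies $$|s_{cc'}-\langle\Psi_c,\Psi_{c'}\rangle|\le\varepsilon,$$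 and its running time is always (on every branch of positive probability) $$\tilde O\!\left(\frac{\log(1/\delta)}{\varepsilon}\,\frac{R^3}{\min\{\|\Psi_c\|,\|\Psi_{c'}\|\}}\,T_\Phi\right);$$ precisely, with $\mu=\min\{\|\Psi_c\|,\|\Psi_{c'}\|\}$, it is at most $$K\left(1+\frac{1+\log(1/\delta)}{\varepsilon}\,\frac{R^3}{\mu}\,T_\Phi\right)\log^k\!\left(2+m+n+N+R+\tfrac1\varepsilon+\tfrac1\delta+\tfrac1\mu\right).$$ -/

import Mathlib

namespace QSVM

/-! ### Data set, feature map and the vectors `Ψ_c` -/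

/-- Bit strings of length `n`, which label the computational basis of `n` qubits. -/
abbrev Bits (n : ℕ) : Type := Fin n → Bool

/-- The real Hilbert space of feature vectors `∑_j v_j |j⟩` on `N` qubits. -/
abbrev Feature (N : ℕ) : Type := EuclideanSpace ℝ (Bits N)

/-- The number `0` or `1` given by a bit. -/
def bit01 (b : Bool) : ℝ := if b then 1 else 0

/-- `U` is a quantum feature map for `Φ`: a unitary on `n + N` qubits with
`U |x⟩|0⟩ = |x⟩|Φ(x)⟩`, where `|Φ(x)⟩ = ‖Φ(x)‖⁻¹ ∑_j Φ(x)_j |j⟩`, for every `x ∈ {0,1}ⁿ`.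
(Unitarity forces `Φ(x) ≠ 0`.) -/
def IsQuantumFeatureMap {n N : ℕ} (U : Matrix (Bits n × Bits N) (Bits n × Bits N) ℂ)
    (Φ : Bits n → Feature N) : Prop :=
  U ∈ Matrix.unitaryGroup (Bits n × Bits N) ℂ ∧
    ∀ (x x' : Bits n) (j : Bits N),
      U (x', j) (x, fun _ => false) = if x' = x then ((Φ x j / ‖Φ x‖ : ℝ) : ℂ) else 0

/-- `Ψ_c = (1/m) ∑ᵢ cᵢ yᵢ Φ(xᵢ)`. -/
noncomputable def Psi {m n N : ℕ} (x : Fin m → Bits n) (y : Fin m → ℝ)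
    (Φ : Bits n → Feature N) (c : Fin m → Bool) : Feature N :=
  (1 / (m : ℝ)) • ∑ i, (bit01 (c i) * y i) • Φ (x i)

/-- `η_c = √((∑ᵢ cᵢ ‖Φ(xᵢ)‖²) / m)`. -/
noncomputable def eta {m n N : ℕ} (x : Fin m → Bits n)
    (Φ : Bits n → Feature N) (c : Fin m → Bool) : ℝ :=
  √((∑ i, bit01 (c i) * ‖Φ (x i)‖ ^ 2) / m)

/-- The weighted norms `cᵢ yᵢ ‖Φ(xᵢ)‖ / √m`. -/
noncomputable def weight {m n N : ℕ} (x : Fin m → Bits n) (y : Fin m → ℝ)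
    (Φ : Bits n → Feature N) (c : Fin m → Bool) (i : Fin m) : ℝ :=
  bit01 (c i) * y i / √(m : ℝ) * ‖Φ (x i)‖

/-- `R = maxᵢ ‖Φ(xᵢ)‖`. -/
noncomputable def maxNorm {m n N : ℕ} (x : Fin m → Bits n) (Φ : Bits n → Feature N) : ℝ :=
  ⨆ i, ‖Φ (x i)‖

/-! ### Quantum memory

The machine has qubits `0, 1, 2, …`, all but finitely many of which are in state `|0⟩`.  The basis
vector labelled by the finite set `s` has exactly the qubits in `s` in state `|1⟩`. -/

/-- (Unnormalised) pure states of the quantum memory. -/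
abbrev Ket : Type := Finset ℕ →₀ ℂ

/-- The basis vector `|s⟩`. -/
noncomputable def ket (s : Finset ℕ) : Ket := Finsupp.single s 1

/-- The squared norm of a state. -/
noncomputable def normSq (ψ : Ket) : ℝ := ψ.sum fun _ a => ‖a‖ ^ 2

/-- The linear map with `|s⟩ ↦ f s`. -/
noncomputable def onBasis (f : Finset ℕ → Ket) : Ket →ₗ[ℂ] Ket := Finsupp.linearCombination ℂ f

/-- The bits held by the `l` qubits `a, …, a + l - 1` in the basis state `|s⟩`. -/
def readReg (a l : ℕ) (s : Finset ℕ) : Bits l := fun k => decide (a + (k : ℕ) ∈ s)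

/-- The qubits among `a, …, a + l - 1` selected by the bit string `v`. -/
def regSet (a : ℕ) {l : ℕ} (v : Bits l) : Finset ℕ :=
  (Finset.univ.filter fun k : Fin l => v k = true).image fun k : Fin l => a + (k : ℕ)

/-- Overwrite the qubits `a, …, a + l - 1` of the basis state `|s⟩` by `v`. -/
def writeReg (a : ℕ) {l : ℕ} (v : Bits l) (s : Finset ℕ) : Finset ℕ :=
  (s.filter fun q => ¬ (a ≤ q ∧ q < a + l)) ∪ regSet a v

/-- `|z⟩ ↦ |z ⊕ v⟩` on the qubits `a, …, a + l - 1`. -/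
def xorReg (a : ℕ) {l : ℕ} (v : Bits l) (s : Finset ℕ) : Finset ℕ := symmDiff s (regSet a v)

/-- The binary number (least significant bit first) held by the qubits `a, …, a + l - 1`. -/
def readNat (a l : ℕ) (s : Finset ℕ) : ℕ := ∑ k : Fin l, if a + (k : ℕ) ∈ s then 2 ^ (k : ℕ) else 0

/-- The registers `[a, a + l)` and `[b, b + l')` do not overlap. -/
def Apart (a l b l' : ℕ) : Prop := a + l ≤ b ∨ b + l' ≤ a

instance (a l b l' : ℕ) : Decidable (Apart a l b l') := by unfold Apart; infer_instance

/-- Projection onto "qubit `q` is in state `|v⟩`". -/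
noncomputable def project (q : ℕ) (v : Bool) (ψ : Ket) : Ket :=
  ψ.filter fun s => decide (q ∈ s) = v

/-- The elementary gates; the arguments are the numbers of the integer variables that hold the
numbers of the qubits. -/
inductive Gate where
  | x (a : ℕ)
  | had (a : ℕ)
  | t (a : ℕ)
  | cnot (a b : ℕ)
  | toffoli (a b c : ℕ)

/-- Action of an elementary gate, `v` being the assignment of qubits to variables.  A controlled
gate whose target is one of its controls does nothing. -/
noncomputable def Gate.apply (v : ℕ → ℕ) : Gate → (Ket →ₗ[ℂ] Ket)
  | .x a => onBasis fun s => ket (symmDiff s {v a})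
  | .had a => onBasis fun s =>
      (((1 / √2 : ℝ) : ℂ)) •
        (ket (s.erase (v a)) + (if v a ∈ s then (-1 : ℂ) else 1) • ket (insert (v a) s))
  | .t a => onBasis fun s =>
      (if v a ∈ s then Complex.exp (Real.pi / 4 * Complex.I) else 1) • ket s
  | .cnot a b => onBasis fun s =>
      if v a ∈ s ∧ v a ≠ v b then ket (symmDiff s {v b}) else ket s
  | .toffoli a b c => onBasis fun s =>
      if v a ∈ s ∧ v b ∈ s ∧ v a ≠ v c ∧ v b ≠ v c then ket (symmDiff s {v c}) else ket s

/-! ### The devices that the machine is attached to -/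

/-- What the machine can access but not read for free: a qRAM holding `m` words `xᵢ` of `n` bits and
two lists `w false`, `w true` of `m` real numbers in binary representation, and the unitary `U` on
`n + N` qubits, one use of which takes time `T`. -/
structure Device where
  m : ℕ
  n : ℕ
  N : ℕ
  T : ℕ
  x : Fin m → Bits n
  w : Bool → Fin m → ℝ
  U : Matrix (Bits n × Bits N) (Bits n × Bits N) ℂ

/-- The number of qubits of a qRAM address. -/
def Device.addrLen (D : Device) : ℕ := Nat.clog 2 D.m

/-- The word at address `j`; addresses that are out of range hold zeros. -/
def Device.word (D : Device) (j : ℕ) : Bits D.n :=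
  if h : j < D.m then D.x ⟨j, h⟩ else fun _ => false

/-- The real number at address `j`. -/
noncomputable def Device.num (D : Device) (b : Bool) (j : ℕ) : ℝ :=
  if h : j < D.m then D.w b ⟨j, h⟩ else 0

/-- The coefficient of `2 ^ k` in the binary expansion of `|r|`. -/
noncomputable def binDigit (r : ℝ) (k : ℤ) : Bool := decide (⌊|r| / 2 ^ k⌋ % 2 = 1)

/-- The qRAM query `|j⟩|z⟩ ↦ |j⟩|z ⊕ x_j⟩`, with address register at `a` and target at `b`. -/
noncomputable def Device.queryWord (D : Device) (a b : ℕ) : Ket →ₗ[ℂ] Ket :=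
  onBasis fun s =>
    if Apart a D.addrLen b D.n then ket (xorReg b (D.word (readNat a D.addrLen s)) s) else ket s

/-- The qRAM query `|j⟩|z⟩ ↦ |j⟩|z ⊕ f(w_j)⟩`, where the bit `f(w_j)` is a binary digit or the sign
bit of the stored number `w_j`. -/
noncomputable def Device.queryBit (D : Device) (c : Bool) (f : ℝ → Bool) (a b : ℕ) :
    Ket →ₗ[ℂ] Ket :=
  onBasis fun s =>
    if Apart a D.addrLen b 1 ∧ f (D.num c (readNat a D.addrLen s)) = true then
      ket (symmDiff s {b}) else ket s

/-- One use of a matrix `V` on the `n` qubits from `a` on and the `N` qubits from `b` on. -/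
noncomputable def applyMatrix {n N : ℕ} (V : Matrix (Bits n × Bits N) (Bits n × Bits N) ℂ)
    (a b : ℕ) : Ket →ₗ[ℂ] Ket :=
  onBasis fun s =>
    if Apart a n b N then
      ∑ z : Bits n × Bits N,
        V z (readReg a n s, readReg b N s) • ket (writeReg b z.2 (writeReg a z.1 s))
    else ket s

/-! ### Programs

A program is a finite text that does not depend on the problem instance.  It computes with integer
variables `0, 1, 2, …` (charged by bit length), real variables `0, 1, 2, …` (a real RAM: one
arithmetic operation or elementary function is one step), and qubits. -/

/-- Arithmetic operations of the real RAM. -/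
inductive BinOp where
  | add | sub | mul | div

/-- Their meaning. -/
noncomputable def BinOp.eval : BinOp → ℝ → ℝ → ℝ
  | .add, r, s => r + s
  | .sub, r, s => r - s
  | .mul, r, s => r * s
  | .div, r, s => r / s

/-- Elementary functions of the real RAM. -/
inductive ElemFun where
  | sqrt | exp | log | sin | cos | arccos

/-- Their meaning. -/
noncomputable def ElemFun.eval : ElemFun → ℝ → ℝ
  | .sqrt => Real.sqrt
  | .exp => Real.exp
  | .log => Real.log
  | .sin => Real.sin
  | .cos => Real.cos
  | .arccos => Real.arccos

/-- Programs.  Natural-number arguments are numbers of variables. -/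
inductive Prog where
  | skip
  | seq (p q : Prog)
  /-- integer `i := z` -/
  | setInt (i : ℕ) (z : ℤ)
  /-- integer `i := j + k` -/
  | addInt (i j k : ℕ)
  /-- integer `i := j - k` -/
  | subInt (i j k : ℕ)
  /-- integer `i := ⌊real r⌋` -/
  | floor (i r : ℕ)
  /-- real `r := integer i` -/
  | cast (r i : ℕ)
  /-- real `r := s op t` -/
  | arith (op : BinOp) (r s t : ℕ)
  /-- real `r := f s` -/
  | elem (f : ElemFun) (r s : ℕ)
  /-- if real `r` is less than real `s` then `p` else `q` -/
  | ifLt (r s : ℕ) (p q : Prog)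
  /-- carry out `p` as often as the integer `i` says on entry -/
  | rep (i : ℕ) (p : Prog)
  /-- elementary gate -/
  | gate (g : Gate)
  /-- measure the qubit whose number is in `q`, and store the outcome in the integer `i` -/
  | measure (q i : ℕ)
  /-- qRAM query for `x`, address register at `a`, target register at `b` -/
  | loadWord (a b : ℕ)
  /-- qRAM query for the digit of weight `2 ^ k` of the numbers in list `c` -/
  | loadDigit (c : Bool) (k a b : ℕ)
  /-- qRAM query for the sign bit of the numbers in list `c` -/
  | loadSign (c : Bool) (a b : ℕ)
  /-- one use of `U`, or of its inverse -/
  | feature (inverse : Bool) (a b : ℕ)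

/-- Configurations: variables, quantum memory, and the time used so far. -/
structure State where
  int : ℕ → ℤ
  real : ℕ → ℝ
  psi : Ket
  time : ℕ

/-- Let time pass. -/
def State.tick (s : State) (t : ℕ) : State := { s with time := s.time + t }

/-- Assign to an integer variable. -/
def State.putInt (s : State) (i : ℕ) (z : ℤ) : State := { s with int := Function.update s.int i z }

/-- Assign to a real variable. -/
noncomputable def State.putReal (s : State) (i : ℕ) (r : ℝ) : State :=
  { s with real := Function.update s.real i r }

/-- The number of a qubit that is held by an integer variable. -/
def State.qubit (s : State) (i : ℕ) : ℕ := (s.int i).toNat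

/-- Apply a linear map to the quantum memory. -/
noncomputable def State.act (s : State) (V : Ket →ₗ[ℂ] Ket) : State := { s with psi := V s.psi }

/-- One step plus the bit length of an integer. -/
def intCost (z : ℤ) : ℕ := 1 + Nat.size z.natAbs

/-- All branches of an execution.  Branches arise from measurements.  The quantum state of a branch
is not renormalised after a measurement, so that its squared norm is the probability of the
branch. -/
noncomputable def run (D : Device) : Prog → State → List State
  | .skip, s => [s]
  | .seq p q, s => (run D p s).flatMap (run D q)
  | .setInt i z, s => [(s.putInt i z).tick (intCost z)]
  | .addInt i j k, s => [(s.putInt i (s.int j + s.int k)).tick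
      (intCost (s.int j) + intCost (s.int k))]
  | .subInt i j k, s => [(s.putInt i (s.int j - s.int k)).tick
      (intCost (s.int j) + intCost (s.int k))]
  | .floor i r, s => [(s.putInt i ⌊s.real r⌋).tick (intCost ⌊s.real r⌋)]
  | .cast r i, s => [(s.putReal r (s.int i)).tick (intCost (s.int i))]
  | .arith op r a b, s => [(s.putReal r (op.eval (s.real a) (s.real b))).tick 1]
  | .elem f r a, s => [(s.putReal r (f.eval (s.real a))).tick 1]
  | .ifLt a b p q, s =>
      open Classical in
      if s.real a < s.real b then run D p (s.tick 1) else run D q (s.tick 1)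
  | .rep i p, s =>
      (fun l : List State => l.flatMap fun t => run D p (t.tick 1))^[(s.int i).toNat]
        [s.tick (intCost (s.int i))]
  | .gate g, s => [(s.act (g.apply s.qubit)).tick 1]
  | .measure q i, s =>
      [(({ s with psi := project (s.qubit q) false s.psi } : State).putInt i 0).tick 1,
       (({ s with psi := project (s.qubit q) true s.psi } : State).putInt i 1).tick 1]
  | .loadWord a b, s =>
      [(s.act (D.queryWord (s.qubit a) (s.qubit b))).tick (1 + D.addrLen + D.n)]
  | .loadDigit c k a b, s =>
      [(s.act (D.queryBit c (fun r => binDigit r (s.int k)) (s.qubit a) (s.qubit b))).tick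
        (1 + D.addrLen + (s.int k).natAbs)]
  | .loadSign c a b, s =>
      [(s.act (D.queryBit c (fun r => decide (r < 0)) (s.qubit a) (s.qubit b))).tick
        (1 + D.addrLen)]
  | .feature inverse a b, s =>
      [(s.act (applyMatrix (if inverse then D.U.conjTranspose else D.U)
        (s.qubit a) (s.qubit b))).tick D.T]

/-- Start with the integers `m, n, N` and the reals `ε, δ, η, η'` in the first variables, zero in the
others, and all qubits in state `|0⟩`. -/
noncomputable def start (m n N : ℕ) (ε δ η η' : ℝ) : State where
  int := fun i => if i = 0 then m else if i = 1 then n else if i = 2 then N else 0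
  real := fun i => if i = 0 then ε else if i = 1 then δ else if i = 2 then η else
    if i = 3 then η' else 0
  psi := ket ∅
  time := 0

/-- The output is the value of the first real variable. -/
def State.output (s : State) : ℝ := s.real 0

open Classical in
/-- The probability that the branch taken satisfies `E`. -/
noncomputable def prob (l : List State) (E : State → Prop) : ℝ :=
  (l.map fun s => if E s then normSq s.psi else 0).sum

/-- The device of the inner product estimation problem: `xᵢ`, `cᵢ yᵢ ‖Φ(xᵢ)‖ / √m` and
`c'ᵢ yᵢ ‖Φ(xᵢ)‖ / √m` are in qRAM, and one use of `U` takes time `T`. -/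
noncomputable def problemDevice {m n N : ℕ} (T : ℕ) (x : Fin m → Bits n) (y : Fin m → ℝ)
    (Φ : Bits n → Feature N) (U : Matrix (Bits n × Bits N) (Bits n × Bits N) ℂ)
    (c c' : Fin m → Bool) : Device where
  m := m
  n := n
  N := N
  T := T
  x := x
  w := fun b => if b then weight x y Φ c' else weight x y Φ c
  U := U

end QSVM

/-!
Write `w_k` and `w'_k` for the two stored lists and `|φ_k⟩` for the unit vector of the `k`-th data
point. Then `⟨Ψ_c, Ψ_c'⟩ = (1 / m) ∑ w_k w'_k' ⟨φ_k, φ_k'⟩`, a sum over all pairs of addresses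
(`inner_Psi_eq`). If `η η' < ε` for `η = η_c` and `η' = η_c'`, then `0` is an acceptable output.
Otherwise both lists are truncated to their `L` leading binary digits, where `L` is logarithmic, which
changes the sum by at most `ε / 4`. It becomes a sum over `L ^ 2` pairs of digits of terms
`2 ^ (e + e') v M ^ 2 / m` with `M` the number of addresses and `v` the mean over the pairs of addresses
of the inner product of the signed digits (`Device.overlap`, `abs_sum_pairTerm_sub_le`). Each term is
estimated up to `ε / (4 L ^ 2)`.

* One Hadamard test exchanges the two addresses under the control of a qubit, so that `|φ_k⟩` in one
  branch meets `|φ_k'⟩` in the other. With one redundant address qubit the outcome `1` has the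
  probability `(1 - cos θ) / 2` with `cos θ = v / 2`, and hence `|cos θ| ≤ 1 / 2` keeps `θ` away from
  the points where the cosine is flat (`hadamard_test`, `normSq_overlapOps`).
* After `j` steps of amplitude amplification the probability is `(1 - cos (K θ)) / 2` with
  `K = 2 j + 1` (`normSq_project_grover`, `ampProb_overlap`). If `θ` is known up to a constant divided
  by `K`, logarithmically many shots with a larger `K'`, chosen such that `sin (K' θ)` is not small,
  and one Newton correction give `θ` up to the same constant divided by `K'` (`newton_step`,
  `err_angle`). The relative frequencies of the shots obey an exponential tail bound (`err_shots`).
* The required `K` is a multiple of the weight `2 ^ (e + e') M ^ 2 / m` times `L ^ 2 / ε`. If both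
  digits occur in the lists, then `2 ^ (e + e') ≤ R ^ 2 / m`, and `K` is at most a multiple of
  `L ^ 2 R ^ 2 / ε`. Whether a digit occurs is found out beforehand with shots at geometrically
  increasing amplification (`detect`): a digit that does not occur is never seen, and a digit that is
  missed with more than a small probability is so rare that, because of
  `∑ w_k ^ 2 ≤ η ^ 2`, its pairs are negligible (`abs_pairTerm_le`, `exists_amplification`).

The number of shots makes the union bound over the failures of all estimates at most `δ`
(`err_sumPairs`, `mul_failProb_le`). If `b` bounds all logarithmic quantities, the time is at most a
multiple of `b ^ 6 T` times the largest amplification (`main_of_bounds`, `exists_bounds`). The bound of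
the theorem follows from `R ^ 2 ≤ R ^ 3 / μ`, as `μ ≤ η ≤ R` (`time_le`, `mainProg_spec`).

The programs share the following variables. Integers: `0`–`2` the inputs, `10`–`25` the numbers of
the qubits, `26` and `27` the exponents of the current digits, `50`–`59` scratch space, `60` the number
of amplification steps, `61` the number of shots, `62` and `63` the numbers `L` and `4 L`. Reals:
`0`–`3` the inputs (and `0` the output), `4` the number `L`, `6` to `9` the largest and the current
exponents, `10` the amplification `2 j + 1`, `11` the angle, `12` the counter, `13` the threshold of
the detection, `14` the number of shots, `15` the factor `M ^ 2 / m`, `16` the sum, `17` the required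
amplification, `18` the weight, `19` the counter for the first digit, `20` the number `L ^ 2 / ε`,
`21` zero, `22` to `27` auxiliary values, `49` and above scratch space.
-/

namespace QSVM

open Finset Function Real

variable {D : Device}

/-! ### Inner product of kets and adjoint pairs -/

/-- The Hermitian inner product of two states, conjugate-linear in the first argument. -/
noncomputable def dot (f g : Ket) : ℂ := f.sum fun s a => (starRingEnd ℂ) a * g s

lemma dot_add_left (f f' g : Ket) : dot (f + f') g = dot f g + dot f' g := by
  unfold dot
  rw [Finsupp.sum_add_index'] <;> intros <;> simp [add_mul]

lemma dot_smul_left (c : ℂ) (f g : Ket) : dot (c • f) g = (starRingEnd ℂ) c * dot f g := by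
  unfold dot
  rw [Finsupp.sum_smul_index' (by simp), Finsupp.mul_sum]
  simp [mul_assoc]

lemma dot_add_right (f g g' : Ket) : dot f (g + g') = dot f g + dot f g' := by
  unfold dot
  rw [← Finsupp.sum_add]
  simp [mul_add]

lemma dot_smul_right (c : ℂ) (f g : Ket) : dot f (c • g) = c * dot f g := by
  unfold dot
  rw [Finsupp.mul_sum]
  refine Finsupp.sum_congr fun s _ => ?_
  simp only [Finsupp.smul_apply, smul_eq_mul]; ring

@[simp] lemma dot_zero_left (g : Ket) : dot 0 g = 0 := by simp [dot]

@[simp] lemma dot_zero_right (f : Ket) : dot f 0 = 0 := by simp [dot]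

lemma dot_sub_left (f f' g : Ket) : dot (f - f') g = dot f g - dot f' g := by
  have := dot_add_left (f - f') f' g
  rw [sub_add_cancel] at this
  rw [this]; ring

lemma dot_sub_right (f g g' : Ket) : dot f (g - g') = dot f g - dot f g' := by
  have := dot_add_right f (g - g') g'
  rw [sub_add_cancel] at this
  rw [this]; ring

lemma dot_sum_left {ι : Type*} (S : Finset ι) (f : ι → Ket) (g : Ket) :
    dot (∑ i ∈ S, f i) g = ∑ i ∈ S, dot (f i) g := by
  classical
  induction S using Finset.induction_on with
  | empty => simp
  | insert a S ha ih => rw [sum_insert ha, sum_insert ha, dot_add_left, ih]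

lemma dot_sum_right {ι : Type*} (S : Finset ι) (f : Ket) (g : ι → Ket) :
    dot f (∑ i ∈ S, g i) = ∑ i ∈ S, dot f (g i) := by
  classical
  induction S using Finset.induction_on with
  | empty => simp
  | insert a S ha ih => rw [sum_insert ha, sum_insert ha, dot_add_right, ih]

lemma dot_ket_left (s : Finset ℕ) (g : Ket) : dot (ket s) g = g s := by
  simp [dot, ket]

lemma dot_ket_right (s : Finset ℕ) (f : Ket) : dot f (ket s) = (starRingEnd ℂ) (f s) := by
  unfold dot ket
  simp only [Finsupp.single_apply, mul_ite, mul_one, mul_zero]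
  rw [Finsupp.sum_ite_eq]
  split_ifs with h
  · rfl
  · rw [Finsupp.notMem_support_iff.1 h]; simp

lemma dot_conj (f g : Ket) : (starRingEnd ℂ) (dot f g) = dot g f := by
  induction f using Finsupp.induction_linear with
  | zero => simp
  | add f f' h h' => rw [dot_add_left, map_add, h, h', dot_add_right]
  | single s a =>
    have : (Finsupp.single s a : Ket) = a • ket s := by simp [ket]
    rw [this, dot_smul_left, dot_smul_right, dot_ket_left, dot_ket_right]
    simp

lemma dot_self (f : Ket) : dot f f = (normSq f : ℂ) := by
  unfold dot normSq Finsupp.sum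
  push_cast
  refine sum_congr rfl fun s _ => ?_
  rw [Complex.conj_mul']

lemma normSq_eq (f : Ket) : normSq f = (dot f f).re := by
  rw [dot_self]; simp

lemma normSq_nonneg (f : Ket) : 0 ≤ normSq f :=
  sum_nonneg fun _ _ => by positivity

lemma normSq_eq_zero {f : Ket} : normSq f = 0 ↔ f = 0 := by
  constructor
  · intro h
    unfold normSq Finsupp.sum at h
    rw [sum_eq_zero_iff_of_nonneg (fun _ _ => by positivity)] at h
    ext s
    by_cases hs : s ∈ f.support
    · simpa using h s hs
    · simpa using hs
  · rintro rfl; simp [normSq]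

@[simp] lemma normSq_zero : normSq 0 = 0 := normSq_eq_zero.2 rfl

lemma normSq_smul (c : ℂ) (f : Ket) : normSq (c • f) = ‖c‖ ^ 2 * normSq f := by
  have : ((normSq (c • f) : ℝ) : ℂ) = ((‖c‖ ^ 2 * normSq f : ℝ) : ℂ) := by
    rw [← dot_self, dot_smul_left, dot_smul_right, dot_self, ← mul_assoc, Complex.conj_mul']
    push_cast; ring
  exact_mod_cast this

@[simp] lemma normSq_ket (s : Finset ℕ) : normSq (ket s) = 1 := by
  rw [normSq_eq, dot_ket_left]; simp [ket]

lemma onBasis_ket (f : Finset ℕ → Ket) (s : Finset ℕ) : onBasis f (ket s) = f s := by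
  simp [onBasis, ket]

lemma ket_apply (s t : Finset ℕ) : ket s t = if s = t then 1 else 0 := by
  simp [ket, Finsupp.single_apply]

lemma ket_ext {V W : Ket →ₗ[ℂ] Ket} (h : ∀ s, V (ket s) = W (ket s)) : V = W := by
  ext1 s
  ext1
  simpa [ket] using h s

/-- `W` is the adjoint of `V`. -/
def Adj (V W : Ket →ₗ[ℂ] Ket) : Prop := ∀ f g, dot (V f) g = dot f (W g)

lemma adj_of_basis {V W : Ket →ₗ[ℂ] Ket}
    (h : ∀ s t, (starRingEnd ℂ) (V (ket s) t) = W (ket t) s) : Adj V W := by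
  intro f g
  induction f using Finsupp.induction_linear with
  | zero => simp
  | add f f' h h' => rw [map_add, dot_add_left, dot_add_left, h, h']
  | single s a =>
    have hs : (Finsupp.single s a : Ket) = a • ket s := by simp [ket]
    rw [hs, map_smul, dot_smul_left, dot_smul_left]
    congr 1
    induction g using Finsupp.induction_linear with
    | zero => simp
    | add f f' h h' => rw [map_add, dot_add_right, dot_add_right, h, h']
    | single t a =>
      have ht : (Finsupp.single t a : Ket) = a • ket t := by simp [ket]
      rw [ht, map_smul, dot_smul_right, dot_smul_right, dot_ket_left, dot_ket_right, h]

lemma adj_onBasis_of_involutive {f : Finset ℕ → Finset ℕ} (hf : Function.Involutive f) :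
    Adj (onBasis fun s => ket (f s)) (onBasis fun s => ket (f s)) := by
  refine adj_of_basis fun s t => ?_
  rw [onBasis_ket, onBasis_ket, ket_apply, ket_apply]
  have : f s = t ↔ f t = s := ⟨fun h => h ▸ hf s, fun h => h ▸ hf t⟩
  by_cases h : f s = t
  · rw [if_pos h, if_pos (this.1 h)]; simp
  · rw [if_neg h, if_neg (fun h' => h (this.2 h'))]; simp

lemma onBasis_comp_of_involutive {f : Finset ℕ → Finset ℕ} (hf : Function.Involutive f) (v : Ket) :
    (onBasis fun s => ket (f s)) ((onBasis fun s => ket (f s)) v) = v := by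
  have : (onBasis fun s => ket (f s)) ∘ₗ (onBasis fun s => ket (f s)) = LinearMap.id := by
    refine ket_ext fun s => ?_
    simp [onBasis_ket, hf s]
  exact congrArg (fun V : Ket →ₗ[ℂ] Ket => V v) this

/-- A linear map that has a left inverse as its adjoint preserves the norm. -/
lemma Adj.normSq {V W : Ket →ₗ[ℂ] Ket} (h : Adj V W) (hW : ∀ f, W (V f) = f) (f : Ket) :
    normSq (V f) = normSq f := by
  rw [normSq_eq, h, hW, ← normSq_eq]

/-! ### Registers -/

lemma mem_regSet {a l q : ℕ} {v : Bits l} :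
    q ∈ regSet a v ↔ ∃ h : a ≤ q ∧ q < a + l, v ⟨q - a, by omega⟩ = true := by
  unfold regSet
  simp only [mem_image, mem_filter, mem_univ, true_and]
  constructor
  · rintro ⟨k, hk, rfl⟩
    refine ⟨⟨by omega, by omega⟩, ?_⟩
    convert hk using 2
    ext; simp
  · rintro ⟨h, hv⟩
    exact ⟨_, hv, by simp; omega⟩

lemma mem_writeReg {a l q : ℕ} {v : Bits l} {s : Finset ℕ} :
    q ∈ writeReg a v s ↔ if h : a ≤ q ∧ q < a + l then v ⟨q - a, by omega⟩ = true else q ∈ s := by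
  unfold writeReg
  rw [mem_union, mem_filter, mem_regSet]
  by_cases h : a ≤ q ∧ q < a + l <;> simp [h]

lemma readReg_writeReg (a : ℕ) {l : ℕ} (v : Bits l) (s : Finset ℕ) :
    readReg a l (writeReg a v s) = v := by
  ext k
  unfold readReg
  have : (a ≤ a + (k : ℕ) ∧ a + (k : ℕ) < a + l) := ⟨by omega, by omega⟩
  rw [Bool.eq_iff_iff, decide_eq_true_iff, mem_writeReg, dif_pos this]
  simp

lemma readReg_congr {a l : ℕ} {s t : Finset ℕ} (h : ∀ q, a ≤ q → q < a + l → (q ∈ s ↔ q ∈ t)) :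
    readReg a l s = readReg a l t := by
  ext k
  unfold readReg
  rw [decide_eq_decide]
  exact h _ (by omega) (by omega)

lemma readNat_congr {a l : ℕ} {s t : Finset ℕ} (h : ∀ q, a ≤ q → q < a + l → (q ∈ s ↔ q ∈ t)) :
    readNat a l s = readNat a l t := by
  unfold readNat
  refine sum_congr rfl fun k _ => ?_
  simp only [h _ (Nat.le_add_right _ _) (Nat.add_lt_add_left k.2 a)]

lemma writeReg_readReg (a l : ℕ) (s : Finset ℕ) : writeReg a (readReg a l s) s = s := by
  ext q
  rw [mem_writeReg]
  split_ifs with h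
  · unfold readReg
    simp [Nat.add_sub_cancel' h.1]
  · rfl

/-- The basis state with the registers `[a, a + n)` and `[b, b + N)` overwritten. -/
noncomputable def write2 {n N : ℕ} (a b : ℕ) (z : Bits n × Bits N) (s : Finset ℕ) : Finset ℕ :=
  writeReg b z.2 (writeReg a z.1 s)

/-- The contents of the registers `[a, a + n)` and `[b, b + N)`. -/
def read2 (n N a b : ℕ) (s : Finset ℕ) : Bits n × Bits N := (readReg a n s, readReg b N s)

lemma read2_write2 {n N a b : ℕ} (hab : Apart a n b N) (z : Bits n × Bits N) (s : Finset ℕ) :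
    read2 n N a b (write2 a b z s) = z := by
  unfold read2 write2
  ext1
  · simp only
    rw [readReg_congr (t := writeReg a z.1 s), readReg_writeReg]
    intro q h1 h2
    rw [mem_writeReg, dif_neg]
    unfold Apart at hab; omega
  · simp only
    rw [readReg_writeReg]

lemma write2_read2 (n N a b : ℕ) (s : Finset ℕ) :
    write2 a b (read2 n N a b s) s = s := by
  unfold write2 read2
  simp only
  rw [writeReg_readReg, writeReg_readReg]

lemma mem_write2 {n N a b q : ℕ} {z : Bits n × Bits N} {s : Finset ℕ} :
    q ∈ write2 a b z s ↔ if h : b ≤ q ∧ q < b + N then z.2 ⟨q - b, by omega⟩ = true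
      else if h : a ≤ q ∧ q < a + n then z.1 ⟨q - a, by omega⟩ = true else q ∈ s := by
  unfold write2
  rw [mem_writeReg]
  split_ifs with h1 h2
  · rfl
  · rw [mem_writeReg, dif_pos h2]
  · rw [mem_writeReg, dif_neg h2]

lemma write2_write2 {n N a b : ℕ} (z z' : Bits n × Bits N) (s : Finset ℕ) :
    write2 a b z (write2 a b z' s) = write2 a b z s := by
  ext q
  rw [mem_write2]
  by_cases h1 : b ≤ q ∧ q < b + N
  · rw [dif_pos h1, mem_write2, dif_pos h1]
  · by_cases h2 : a ≤ q ∧ q < a + n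
    · rw [dif_neg h1, dif_pos h2, mem_write2, dif_neg h1, dif_pos h2]
    · rw [dif_neg h1, dif_neg h2, mem_write2, dif_neg h1, dif_neg h2, mem_write2, dif_neg h1,
        dif_neg h2]

lemma xorReg_involutive (a : ℕ) {l : ℕ} (v : Bits l) : Function.Involutive (xorReg a v) := by
  intro s
  unfold xorReg
  rw [symmDiff_assoc, symmDiff_self]; simp

lemma mem_xorReg {a l q : ℕ} {v : Bits l} {s : Finset ℕ} (h : ¬ (a ≤ q ∧ q < a + l)) :
    q ∈ xorReg a v s ↔ q ∈ s := by
  have : q ∉ regSet a v := fun h' => h (mem_regSet.1 h').1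
  unfold xorReg
  rw [mem_symmDiff]
  tauto

lemma mem_toggle {q a : ℕ} {s : Finset ℕ} (h : q ≠ a) : q ∈ symmDiff s {a} ↔ q ∈ s := by
  rw [mem_symmDiff]
  simp [h]

lemma mem_toggle_self {q : ℕ} {s : Finset ℕ} : q ∈ symmDiff s {q} ↔ q ∉ s := by
  rw [mem_symmDiff]
  simp

lemma toggle_toggle (s : Finset ℕ) (a : ℕ) : symmDiff (symmDiff s {a}) {a} = s := by
  rw [symmDiff_assoc, symmDiff_self]; simp

/-! ### Elementary operations on numbered qubits -/

/-- The unitary operations of the machine, with actual qubit numbers.  The phase gate `Z` stands for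
four gates `T`. -/
inductive Op where
  | x (a : ℕ)
  | had (a : ℕ)
  | z (a : ℕ)
  | cnot (a b : ℕ)
  | toffoli (a b c : ℕ)
  | word (a b : ℕ)
  | digit (c : Bool) (k : ℤ) (a b : ℕ)
  | sign (c : Bool) (a b : ℕ)
  | feature (inverse : Bool) (a b : ℕ)

/-- The linear map of an operation. -/
noncomputable def Op.den (D : Device) : Op → (Ket →ₗ[ℂ] Ket)
  | .x a => onBasis fun s => ket (symmDiff s {a})
  | .had a => onBasis fun s =>
      (((1 / √2 : ℝ) : ℂ)) • (ket (s.erase a) + (if a ∈ s then (-1 : ℂ) else 1) • ket (insert a s))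
  | .z a => onBasis fun s => (if a ∈ s then (-1 : ℂ) else 1) • ket s
  | .cnot a b => onBasis fun s => if a ∈ s ∧ a ≠ b then ket (symmDiff s {b}) else ket s
  | .toffoli a b c => onBasis fun s =>
      if a ∈ s ∧ b ∈ s ∧ a ≠ c ∧ b ≠ c then ket (symmDiff s {c}) else ket s
  | .word a b => D.queryWord a b
  | .digit c k a b => D.queryBit c (fun r => binDigit r k) a b
  | .sign c a b => D.queryBit c (fun r => decide (r < 0)) a b
  | .feature i a b => applyMatrix (if i then D.U.conjTranspose else D.U) a b

/-- The inverse operation. -/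
def Op.inv : Op → Op
  | .feature i a b => .feature (!i) a b
  | o => o

@[simp] lemma Op.inv_inv (o : Op) : o.inv.inv = o := by cases o <;> simp [Op.inv]

lemma Op.den_had_ket (D : Device) (a : ℕ) (s : Finset ℕ) : (Op.had a).den D (ket s) =
      (((1 / √2 : ℝ) : ℂ)) • (ket (s.erase a) + (if a ∈ s then (-1 : ℂ) else 1) • ket (insert a s)) :=
  onBasis_ket _ _

lemma insert_erase_self (s : Finset ℕ) (a : ℕ) : insert a (s.erase a) = insert a s := by
  ext q; by_cases h : q = a <;> simp [h]

lemma had_adj (D : Device) (a : ℕ) : Adj ((Op.had a).den D) ((Op.had a).den D) := by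
  refine adj_of_basis fun s t => ?_
  rw [Op.den_had_ket, Op.den_had_ket]
  simp only [Finsupp.smul_apply, Finsupp.add_apply, ket_apply, smul_eq_mul, map_mul, map_add,
    Complex.conj_ofReal]
  congr 1
  by_cases h : s.erase a = t.erase a
  · have e1 : s.erase a = t ↔ a ∉ t := by
      rw [h]; exact erase_eq_self
    have e2 : t.erase a = s ↔ a ∉ s := by
      rw [← h]; exact erase_eq_self
    have e3 : insert a s = t ↔ a ∈ t := by
      constructor
      · rintro rfl; simp
      · intro ha
        exact (insert_erase_self s a).symm.trans ((congrArg (insert a) h).trans (insert_erase ha))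
    have e4 : insert a t = s ↔ a ∈ s := by
      constructor
      · rintro rfl; simp
      · intro ha
        exact (insert_erase_self t a).symm.trans ((congrArg (insert a) h.symm).trans (insert_erase ha))
    simp only [e1, e2, e3, e4]
    by_cases h1 : a ∈ s <;> by_cases h2 : a ∈ t <;> simp [h1, h2]
  · have e1 : ¬ s.erase a = t := fun h' => h (by rw [← h', erase_idem])
    have e2 : ¬ t.erase a = s := fun h' => h (by rw [← h', erase_idem])
    have e3 : ¬ insert a s = t := fun h' => h (by rw [← h', erase_insert_eq_erase])
    have e4 : ¬ insert a t = s := fun h' => h (by rw [← h', erase_insert_eq_erase])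
    simp [e1, e2, e3, e4]

lemma had_had (D : Device) (a : ℕ) (v : Ket) :
    (Op.had a).den D ((Op.had a).den D v) = v := by
  have : (Op.had a).den D ∘ₗ (Op.had a).den D = LinearMap.id := by
    refine ket_ext fun s => ?_
    rw [LinearMap.comp_apply, Op.den_had_ket, map_smul, map_add, map_smul, Op.den_had_ket,
      Op.den_had_ket, LinearMap.id_apply]
    have hc : (((1 / √2 : ℝ) : ℂ)) * (((1 / √2 : ℝ) : ℂ)) = 1 / 2 := by
      rw [← Complex.ofReal_mul, div_mul_div_comm, mul_self_sqrt (by norm_num)]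
      norm_num
    rw [smul_comm _ (((1 / √2 : ℝ) : ℂ)) (ket _ + _), ← smul_add, smul_smul, hc]
    by_cases h : a ∈ s
    · simp only [erase_idem, mem_erase, ne_eq, not_true_eq_false, false_and,
        if_false, insert_erase h, h, if_true, insert_eq_of_mem h]
      module
    · simp only [erase_idem, mem_erase, ne_eq, not_true_eq_false, false_and,
        if_false, h, mem_insert_self, if_true,
        erase_insert_eq_erase, insert_idem, erase_eq_of_notMem h]
      module
  exact congrArg (fun V : Ket →ₗ[ℂ] Ket => V v) this

lemma applyMatrix_ket {n N : ℕ} (V : Matrix (Bits n × Bits N) (Bits n × Bits N) ℂ) {a b : ℕ}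
    (hab : Apart a n b N) (s : Finset ℕ) : applyMatrix V a b (ket s) =
      ∑ z : Bits n × Bits N, V z (read2 n N a b s) • ket (write2 a b z s) := by
  unfold applyMatrix
  rw [onBasis_ket, if_pos hab]
  rfl

lemma applyMatrix_ket_of_not {n N : ℕ} (V : Matrix (Bits n × Bits N) (Bits n × Bits N) ℂ)
    {a b : ℕ} (hab : ¬ Apart a n b N) (s : Finset ℕ) : applyMatrix V a b (ket s) = ket s := by
  unfold applyMatrix
  rw [onBasis_ket, if_neg hab]

lemma applyMatrix_apply {n N : ℕ} (V : Matrix (Bits n × Bits N) (Bits n × Bits N) ℂ) {a b : ℕ}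
    (hab : Apart a n b N) (s t : Finset ℕ) : applyMatrix V a b (ket s) t =
      if t = write2 a b (read2 n N a b t) s then V (read2 n N a b t) (read2 n N a b s) else 0 := by
  rw [applyMatrix_ket V hab, Finsupp.finsetSum_apply]
  simp only [Finsupp.smul_apply, ket_apply, smul_eq_mul, mul_ite, mul_one, mul_zero]
  rw [sum_eq_single (read2 n N a b t)]
  · simp only [eq_comm]
  · rintro z - hz
    rw [if_neg]
    rintro rfl
    exact hz (read2_write2 hab z s).symm
  · simp

lemma applyMatrix_adj {n N : ℕ} (V : Matrix (Bits n × Bits N) (Bits n × Bits N) ℂ) (a b : ℕ) :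
    Adj (applyMatrix V a b) (applyMatrix V.conjTranspose a b) := by
  refine adj_of_basis fun s t => ?_
  by_cases hab : Apart a n b N
  · rw [applyMatrix_apply V hab, applyMatrix_apply _ hab]
    have key : ∀ s t : Finset ℕ, t = write2 a b (read2 n N a b t) s →
        s = write2 a b (read2 n N a b s) t := by
      intro s t h
      conv_rhs => rw [h]
      rw [write2_write2, write2_read2]
    by_cases h : t = write2 a b (read2 n N a b t) s
    · rw [if_pos h, if_pos (key _ _ h), Matrix.conjTranspose_apply]; rfl
    · rw [if_neg h, if_neg (fun h' => h (key _ _ h')), map_zero]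
  · rw [applyMatrix_ket_of_not _ hab, applyMatrix_ket_of_not _ hab, ket_apply, ket_apply]
    by_cases h : s = t
    · simp [h]
    · simp [h, Ne.symm h]

lemma applyMatrix_comp {n N : ℕ} {V W : Matrix (Bits n × Bits N) (Bits n × Bits N) ℂ}
    (hVW : W * V = 1) (a b : ℕ) (v : Ket) : applyMatrix W a b (applyMatrix V a b v) = v := by
  have : applyMatrix W a b ∘ₗ applyMatrix V a b = LinearMap.id := by
    refine ket_ext fun s => ?_
    rw [LinearMap.comp_apply, LinearMap.id_apply]
    by_cases hab : Apart a n b N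
    · rw [applyMatrix_ket V hab, map_sum]
      simp only [map_smul, applyMatrix_ket W hab, read2_write2 hab, write2_write2,
        smul_sum, smul_smul]
      rw [sum_comm]
      simp only [← sum_smul]
      have hz : ∀ z, ∑ y, V y (read2 n N a b s) * W z y
          = (1 : Matrix (Bits n × Bits N) (Bits n × Bits N) ℂ) z (read2 n N a b s) := by
        intro z
        rw [← hVW, Matrix.mul_apply]
        exact sum_congr rfl fun _ _ => mul_comm _ _
      simp only [hz, Matrix.one_apply, ite_smul, one_smul, zero_smul]
      rw [sum_ite_eq' univ, if_pos (mem_univ _), write2_read2]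
    · rw [applyMatrix_ket_of_not _ hab, applyMatrix_ket_of_not _ hab]
  exact congrArg (fun V : Ket →ₗ[ℂ] Ket => V v) this

lemma toggle_if_involutive (b : ℕ) {P : Finset ℕ → Prop} [DecidablePred P]
    (hP : ∀ s, P (symmDiff s {b}) ↔ P s) :
    Function.Involutive fun s => if P s then symmDiff s {b} else s := by
  intro s
  by_cases h : P s
  · simp only [h, if_true, hP]; exact toggle_toggle _ _
  · simp only [h, if_false]

/-- The classical reversible map of an operation that permutes the basis. -/
noncomputable def Op.perm (D : Device) : Op → Finset ℕ → Finset ℕ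
  | .x a => fun s => symmDiff s {a}
  | .cnot a b => fun s => if a ∈ s ∧ a ≠ b then symmDiff s {b} else s
  | .toffoli a b c => fun s => if a ∈ s ∧ b ∈ s ∧ a ≠ c ∧ b ≠ c then symmDiff s {c} else s
  | .word a b => fun s =>
      if Apart a D.addrLen b D.n then xorReg b (D.word (readNat a D.addrLen s)) s else s
  | .digit c k a b => fun s => if Apart a D.addrLen b 1 ∧
      binDigit (D.num c (readNat a D.addrLen s)) k = true then symmDiff s {b} else s
  | .sign c a b => fun s => if Apart a D.addrLen b 1 ∧
      decide (D.num c (readNat a D.addrLen s) < 0) = true then symmDiff s {b} else s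
  | _ => id

/-- The operation permutes the basis. -/
def Op.IsPerm : Op → Prop
  | .had _ => False
  | .z _ => False
  | .feature _ _ _ => False
  | _ => True

lemma Op.den_eq_perm (D : Device) {o : Op} (ho : o.IsPerm) :
    o.den D = onBasis fun s => ket (o.perm D s) := by
  cases o <;> simp only [Op.IsPerm] at ho <;>
    simp only [Op.den, Op.perm, Device.queryWord, Device.queryBit, apply_ite ket]

lemma Op.perm_involutive (D : Device) (o : Op) : Function.Involutive (o.perm D) := by
  cases o with
  | x a => exact fun s => toggle_toggle s a
  | had a => exact fun s => rfl
  | z a => exact fun s => rfl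
  | feature i a b => exact fun s => rfl
  | cnot a b =>
    refine toggle_if_involutive b fun s => ?_
    by_cases h : a = b
    · simp [h]
    · rw [mem_toggle h]
  | toffoli a b c =>
    refine toggle_if_involutive c fun s => ?_
    by_cases h : a = c
    · simp [h]
    · by_cases h' : b = c
      · simp [h']
      · rw [mem_toggle h, mem_toggle h']
  | word a b =>
    intro s
    simp only [Op.perm]
    split_ifs with h
    · have : readNat a D.addrLen (xorReg b (D.word (readNat a D.addrLen s)) s)
          = readNat a D.addrLen s := by
        refine readNat_congr fun q h1 h2 => ?_
        rw [mem_xorReg]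
        unfold Apart at h; omega
      rw [this, xorReg_involutive]
    · rfl
  | digit c k a b =>
    refine toggle_if_involutive b fun s => ?_
    refine and_congr_right fun h => ?_
    rw [readNat_congr (t := s)]
    intro q h1 h2
    rw [mem_toggle]
    unfold Apart at h; omega
  | sign c a b =>
    refine toggle_if_involutive b fun s => ?_
    refine and_congr_right fun h => ?_
    rw [readNat_congr (t := s)]
    intro q h1 h2
    rw [mem_toggle]
    unfold Apart at h; omega

lemma Op.den_perm_ket (D : Device) {o : Op} (ho : o.IsPerm) (s : Finset ℕ) :
    o.den D (ket s) = ket (o.perm D s) := by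
  rw [Op.den_eq_perm D ho, onBasis_ket]

lemma Op.den_z_ket (D : Device) (a : ℕ) (s : Finset ℕ) :
    (Op.z a).den D (ket s) = (if a ∈ s then (-1 : ℂ) else 1) • ket s := onBasis_ket _ _

lemma Op.adj (D : Device) (o : Op) : Adj (o.den D) (o.inv.den D) := by
  by_cases ho : o.IsPerm
  · have : o.inv = o := by cases o <;> simp_all [Op.IsPerm, Op.inv]
    rw [this, Op.den_eq_perm D ho]
    exact adj_onBasis_of_involutive (o.perm_involutive D)
  · cases o with
    | had a => exact had_adj D a
    | z a =>
      refine adj_of_basis fun s t => ?_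
      simp only [Op.inv]
      rw [Op.den_z_ket, Op.den_z_ket]
      simp only [Finsupp.smul_apply, ket_apply, smul_eq_mul, mul_ite, mul_one, mul_zero]
      by_cases h : s = t
      · subst h; split_ifs <;> simp
      · simp [h, Ne.symm h]
    | feature i a b =>
      cases i
      · exact applyMatrix_adj _ a b
      · have := applyMatrix_adj D.U.conjTranspose a b
        rw [Matrix.conjTranspose_conjTranspose] at this
        exact this
    | _ => exact absurd trivial ho

lemma Op.den_inv_den (hU : D.U ∈ Matrix.unitaryGroup (Bits D.n × Bits D.N) ℂ) (o : Op)
    (v : Ket) : o.inv.den D (o.den D v) = v := by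
  by_cases ho : o.IsPerm
  · have : o.inv = o := by cases o <;> simp_all [Op.IsPerm, Op.inv]
    rw [this, Op.den_eq_perm D ho]
    exact onBasis_comp_of_involutive (o.perm_involutive D) v
  · cases o with
    | had a => exact had_had D a v
    | z a =>
      have : (Op.z a).den D ∘ₗ (Op.z a).den D = LinearMap.id := by
        refine ket_ext fun s => ?_
        rw [LinearMap.comp_apply, Op.den_z_ket, map_smul, Op.den_z_ket, smul_smul]
        split_ifs <;> simp
      exact congrArg (fun V : Ket →ₗ[ℂ] Ket => V v) this
    | feature i a b =>
      cases i
      · exact applyMatrix_comp (Matrix.mem_unitaryGroup_iff'.1 hU) a b v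
      · exact applyMatrix_comp (Matrix.mem_unitaryGroup_iff.1 hU) a b v
    | _ => exact absurd trivial ho

/-- The linear map of a list of operations, the first being carried out first. -/
noncomputable def den (D : Device) : List Op → (Ket →ₗ[ℂ] Ket)
  | [] => LinearMap.id
  | o :: l => den D l ∘ₗ o.den D

@[simp] lemma den_nil (D : Device) (v : Ket) : den D [] v = v := rfl

@[simp] lemma den_cons (D : Device) (o : Op) (l : List Op) (v : Ket) :
    den D (o :: l) v = den D l (o.den D v) := rfl

lemma den_append (D : Device) (l l' : List Op) (v : Ket) :
    den D (l ++ l') v = den D l' (den D l v) := by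
  induction l generalizing v with
  | nil => rfl
  | cons o l ih => simp [ih]

/-- The inverse of a list of operations. -/
def invOps (l : List Op) : List Op := l.reverse.map Op.inv

lemma den_adj (D : Device) (l : List Op) (f g : Ket) :
    dot (den D l f) g = dot f (den D (invOps l) g) := by
  induction l generalizing f g with
  | nil => rfl
  | cons o l ih =>
    rw [den_cons, ih]
    have : invOps (o :: l) = invOps l ++ [o.inv] := by simp [invOps]
    rw [this, den_append, den_cons, den_nil, Op.adj D o]

lemma den_invOps_den (hU : D.U ∈ Matrix.unitaryGroup (Bits D.n × Bits D.N) ℂ)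
    (l : List Op) (f : Ket) : den D (invOps l) (den D l f) = f := by
  induction l generalizing f with
  | nil => rfl
  | cons o l ih =>
    have : invOps (o :: l) = invOps l ++ [o.inv] := by simp [invOps]
    rw [den_cons, this, den_append, den_cons, den_nil, ih, Op.den_inv_den hU]

lemma invOps_invOps (l : List Op) : invOps (invOps l) = l := by
  simp [invOps, Function.comp_def]

lemma den_den_invOps (hU : D.U ∈ Matrix.unitaryGroup (Bits D.n × Bits D.N) ℂ)
    (l : List Op) (f : Ket) : den D l (den D (invOps l) f) = f := by
  have := den_invOps_den hU (invOps l) f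
  rwa [invOps_invOps] at this

lemma den_dot (hU : D.U ∈ Matrix.unitaryGroup (Bits D.n × Bits D.N) ℂ)
    (l : List Op) (f g : Ket) : dot (den D l f) (den D l g) = dot f g := by
  rw [den_adj, den_invOps_den hU]

lemma den_normSq (hU : D.U ∈ Matrix.unitaryGroup (Bits D.n × Bits D.N) ℂ)
    (l : List Op) (f : Ket) : normSq (den D l f) = normSq f := by
  rw [normSq_eq, den_dot hU, ← normSq_eq]

/-! ### Projections -/

lemma project_apply (q : ℕ) (v : Bool) (ψ : Ket) (s : Finset ℕ) :
    project q v ψ s = if decide (q ∈ s) = v then ψ s else 0 := by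
  unfold project
  rw [Finsupp.filter_apply]

lemma project_add (q : ℕ) (v : Bool) (f g : Ket) :
    project q v (f + g) = project q v f + project q v g := by
  ext s
  simp only [project_apply, Finsupp.add_apply]
  split_ifs <;> simp

lemma project_smul (q : ℕ) (v : Bool) (c : ℂ) (f : Ket) :
    project q v (c • f) = c • project q v f := by
  ext s
  simp only [project_apply, Finsupp.smul_apply]
  split_ifs <;> simp

lemma project_ket (q : ℕ) (v : Bool) (s : Finset ℕ) :
    project q v (ket s) = if decide (q ∈ s) = v then ket s else 0 := by
  ext t
  rw [project_apply, ket_apply]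
  by_cases h : s = t
  · subst h; split_ifs <;> simp_all [ket_apply]
  · split_ifs <;> simp [ket_apply, h]

lemma project_false_add_true (q : ℕ) (f : Ket) : project q false f + project q true f = f := by
  ext s
  simp only [project_apply, Finsupp.add_apply]
  by_cases h : q ∈ s <;> simp [h]

lemma project_project (q : ℕ) (v : Bool) (f : Ket) : project q v (project q v f) = project q v f := by
  ext s
  simp only [project_apply]
  split_ifs <;> simp

lemma project_project_ne (q : ℕ) (v : Bool) (f : Ket) : project q v (project q (!v) f) = 0 := by
  ext s
  simp only [project_apply]
  by_cases h : q ∈ s <;> cases v <;> simp [h]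

lemma dot_project (q : ℕ) (v : Bool) (f g : Ket) :
    dot (project q v f) g = dot f (project q v g) := by
  induction f using Finsupp.induction_linear with
  | zero => simp [show project q v 0 = 0 from Finsupp.filter_zero _]
  | add f f' h h' => rw [project_add, dot_add_left, dot_add_left, h, h']
  | single s a =>
    have hs : (Finsupp.single s a : Ket) = a • ket s := by simp [ket]
    rw [hs, project_smul, dot_smul_left, dot_smul_left, project_ket, dot_ket_left, project_apply]
    split_ifs
    · rw [dot_ket_left]
    · simp

lemma dot_project_ne (q : ℕ) (v : Bool) (f g : Ket) :
    dot (project q v f) (project q (!v) g) = 0 := by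
  rw [dot_project, project_project_ne, dot_zero_right]

lemma normSq_project (q : ℕ) (f : Ket) :
    normSq (project q false f) + normSq (project q true f) = normSq f := by
  have h1 := dot_project_ne q false f f
  have h2 := dot_project_ne q true f f
  simp only [Bool.not_false, Bool.not_true] at h1 h2
  conv_rhs => rw [normSq_eq, ← project_false_add_true q f, dot_add_left, dot_add_right,
    dot_add_right, h1, h2]
  simp [normSq_eq]

/-! ### Programs preserve total probability -/

lemma normSq_gate (v : ℕ → ℕ) (g : Gate) (f : Ket) : normSq (g.apply v f) = normSq f := by
  have key : ∀ (D : Device) (o : Op), (∀ f, o.inv.den D (o.den D f) = f) →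
      normSq (o.den D f) = normSq f := fun D o h => (Op.adj D o).normSq h f
  let D : Device := ⟨0, 0, 0, 0, fun _ _ => false, fun _ _ => 0, 1⟩
  have hU : D.U ∈ Matrix.unitaryGroup (Bits D.n × Bits D.N) ℂ := one_mem _
  cases g with
  | x a => exact key D (.x (v a)) (Op.den_inv_den hU _)
  | had a => exact key D (.had (v a)) (Op.den_inv_den hU _)
  | cnot a b => exact key D (.cnot (v a) (v b)) (Op.den_inv_den hU _)
  | toffoli a b c => exact key D (.toffoli (v a) (v b) (v c)) (Op.den_inv_den hU _)
  | t a =>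
    have hT : ∀ g : Ket, ∀ s, (Gate.apply v (.t a)) g s =
        (if v a ∈ s then Complex.exp (Real.pi / 4 * Complex.I) else 1) * g s := by
      intro g s
      induction g using Finsupp.induction_linear with
      | zero => simp
      | add f f' h h' => rw [map_add, Finsupp.add_apply, h, h', Finsupp.add_apply, mul_add]
      | single t b =>
        have ht : (Finsupp.single t b : Ket) = b • ket t := by simp [ket]
        rw [ht, map_smul]
        simp only [Gate.apply, onBasis_ket, Finsupp.smul_apply, ket_apply, smul_eq_mul]
        by_cases h : t = s
        · subst h; simp [mul_comm]
        · simp [h]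
    have hn : ∀ s, ‖(Gate.apply v (.t a)) f s‖ = ‖f s‖ := by
      intro s
      rw [hT, norm_mul]
      have : ‖Complex.exp (Real.pi / 4 * Complex.I)‖ = 1 := by
        have := Complex.norm_exp_ofReal_mul_I (Real.pi / 4)
        push_cast at this
        exact this
      split_ifs
      · rw [this, one_mul]
      · simp
    unfold normSq Finsupp.sum
    have hs : ((Gate.apply v (.t a)) f).support = f.support := by
      ext s
      rw [Finsupp.mem_support_iff, Finsupp.mem_support_iff, ← norm_ne_zero_iff, hn, norm_ne_zero_iff]
    rw [hs]
    exact sum_congr rfl fun s _ => congrArg (· ^ 2) (hn s)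

/-- The expectation of `f` over the branches. -/
noncomputable def wsum (l : List State) (f : State → ℝ) : ℝ :=
  (l.map fun s => normSq s.psi * f s).sum

@[simp] lemma wsum_nil (f : State → ℝ) : wsum [] f = 0 := rfl

@[simp] lemma wsum_cons (s : State) (l : List State) (f : State → ℝ) :
    wsum (s :: l) f = normSq s.psi * f s + wsum l f := by simp [wsum]

lemma wsum_append (l l' : List State) (f : State → ℝ) :
    wsum (l ++ l') f = wsum l f + wsum l' f := by simp [wsum]

lemma prob_eq_wsum (l : List State) (E : State → Prop) [DecidablePred E] :
    prob l E = wsum l (fun s => if E s then 1 else 0) := by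
  unfold prob wsum
  refine congrArg List.sum (List.map_congr_left fun s _ => ?_)
  by_cases h : E s <;> simp [h]

lemma wsum_flatMap (l : List State) (F : State → List State) (f : State → ℝ) :
    wsum (l.flatMap F) f = (l.map fun s => wsum (F s) f).sum := by
  induction l with
  | nil => rfl
  | cons s l ih => simp [List.flatMap_cons, wsum_append, ih]

/-- The device has a unitary `U`. -/
def Device.Unitary (D : Device) : Prop := D.U ∈ Matrix.unitaryGroup (Bits D.n × Bits D.N) ℂ

lemma wsum_one_run (hU : D.Unitary) (p : Prog) (s : State) :
    wsum (run D p s) (fun _ => 1) = normSq s.psi := by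
  have key : ∀ (o : Op) (f : Ket), normSq (o.den D f) = normSq f :=
    fun o f => (Op.adj D o).normSq (Op.den_inv_den hU o) f
  have flat : ∀ (l : List State) (F : State → List State),
      (∀ t, wsum (F t) (fun _ => 1) = normSq t.psi) →
      wsum (l.flatMap F) (fun _ => 1) = wsum l (fun _ => 1) := by
    intro l F h
    rw [wsum_flatMap]
    simp only [h]
    simp [wsum]
  induction p generalizing s with
  | seq p q ihp ihq =>
    simp only [run]
    rw [flat _ _ ihq, ihp]
  | ifLt a b p q ihp ihq =>
    simp only [run]
    split_ifs
    · rw [ihp]; rfl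
    · rw [ihq]; rfl
  | rep i p ih =>
    simp only [run]
    have : ∀ (n : ℕ) (l : List State), wsum ((fun l : List State =>
        l.flatMap fun t => run D p (t.tick 1))^[n] l) (fun _ => 1) = wsum l (fun _ => 1) := by
      intro n
      induction n with
      | zero => intro l; rfl
      | succ n ihn =>
        intro l
        rw [iterate_succ_apply, ihn, flat]
        intro t
        rw [ih]; rfl
    rw [this]
    simp [State.tick]
  | measure q i =>
    simp only [run, wsum_cons, wsum_nil, mul_one, add_zero, State.tick, State.putInt]
    exact normSq_project _ _
  | gate g => simp [run, State.act, State.tick, normSq_gate]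
  | loadWord a b =>
    simpa [run, State.act, State.tick, Op.den] using key (.word (s.qubit a) (s.qubit b)) s.psi
  | loadDigit c k a b =>
    simpa [run, State.act, State.tick, Op.den] using key (.digit c (s.int k) (s.qubit a) (s.qubit b)) s.psi
  | loadSign c a b =>
    simpa [run, State.act, State.tick, Op.den] using key (.sign c (s.qubit a) (s.qubit b)) s.psi
  | feature i a b =>
    simpa [run, State.act, State.tick, Op.den] using key (.feature i (s.qubit a) (s.qubit b)) s.psi
  | _ => simp [run, State.tick, State.putInt, State.putReal]

/-! ### Program logic -/

/-- Every branch of positive probability ends in a state with the property `A`. -/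
def Always (D : Device) (s : State) (p : Prog) (A : State → Prop) : Prop :=
  ∀ t ∈ run D p s, t.psi ≠ 0 → A t

/-- The probability that the final state does not have the property `G` is at most `δ` times the
probability of the initial branch. -/
def Err (D : Device) (s : State) (p : Prog) (δ : ℝ) (G : State → Prop) : Prop :=
  prob (run D p s) (fun t => ¬ G t) ≤ δ * normSq s.psi

/-- The execution does not branch, and the final state has the property `Q`. -/
def Det (D : Device) (s : State) (p : Prog) (Q : State → Prop) : Prop :=
  ∃ t, run D p s = [t] ∧ Q t

lemma wsum_mono {l : List State} {f g : State → ℝ} (h : ∀ t ∈ l, t.psi ≠ 0 → f t ≤ g t) :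
    wsum l f ≤ wsum l g := by
  refine List.sum_le_sum fun t ht => ?_
  by_cases h0 : t.psi = 0
  · simp [h0]
  · exact mul_le_mul_of_nonneg_left (h t ht h0) (normSq_nonneg _)

lemma wsum_congr {l : List State} {f g : State → ℝ} (h : ∀ t ∈ l, t.psi ≠ 0 → f t = g t) :
    wsum l f = wsum l g :=
  le_antisymm (wsum_mono fun t ht h0 => (h t ht h0).le) (wsum_mono fun t ht h0 => (h t ht h0).ge)

lemma wsum_add (l : List State) (f g : State → ℝ) :
    wsum l (fun t => f t + g t) = wsum l f + wsum l g := by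
  induction l with
  | nil => simp
  | cons t l ih => simp only [wsum_cons, ih]; ring

lemma wsum_const_mul (l : List State) (c : ℝ) (f : State → ℝ) :
    wsum l (fun t => c * f t) = c * wsum l f := by
  induction l with
  | nil => simp
  | cons t l ih => simp only [wsum_cons, ih]; ring

lemma wsum_flatMap_le {l : List State} {F : State → List State} {f g : State → ℝ}
    (h : ∀ t ∈ l, wsum (F t) f ≤ normSq t.psi * g t) : wsum (l.flatMap F) f ≤ wsum l g := by
  rw [wsum_flatMap]
  exact List.sum_le_sum h

lemma wsum_flatMap_eq {l : List State} {F : State → List State} {f g : State → ℝ}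
    (h : ∀ t ∈ l, wsum (F t) f = normSq t.psi * g t) : wsum (l.flatMap F) f = wsum l g := by
  rw [wsum_flatMap]
  exact congrArg List.sum (List.map_congr_left h)

lemma psi_eq_zero_of_run (hU : D.Unitary) {p : Prog} {s t : State}
    (hs : s.psi = 0) (ht : t ∈ run D p s) : t.psi = 0 := by
  have h := wsum_one_run hU p s
  rw [hs, normSq_zero] at h
  unfold wsum at h
  simp only [mul_one] at h
  refine normSq_eq_zero.1 (le_antisymm (h ▸ List.single_le_sum ?_ _ ?_) (normSq_nonneg _))
  · simp only [List.mem_map]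
    rintro _ ⟨t, ht, rfl⟩
    exact normSq_nonneg _
  · exact List.mem_map_of_mem (f := fun s : State => normSq s.psi) ht

lemma Always.mono {s : State} {p : Prog} {A B : State → Prop} (h : Always D s p A)
    (hAB : ∀ t, A t → B t) : Always D s p B := fun t ht h0 => hAB t (h t ht h0)

lemma Always.seq (hU : D.Unitary) {s : State} {p q : Prog} {A B : State → Prop}
    (h : Always D s p A) (h' : ∀ t, A t → Always D t q B) : Always D s (.seq p q) B := by
  intro t ht h0
  simp only [run, List.mem_flatMap] at ht
  obtain ⟨r, hr, ht⟩ := ht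
  exact h' r (h r hr fun hz => h0 (psi_eq_zero_of_run hU hz ht)) t ht h0

lemma Always.wsum_eq (hU : D.Unitary) {s : State} {p : Prog} {f : State → ℝ} {c : ℝ}
    (h : Always D s p (fun t => f t = c)) : wsum (run D p s) f = normSq s.psi * c := by
  rw [wsum_congr (g := fun _ => c * 1) (fun t ht h0 => by rw [h t ht h0, mul_one]),
    wsum_const_mul, wsum_one_run hU, mul_comm]

lemma Err.mono {s : State} {p : Prog} {δ δ' : ℝ} {A G G' : State → Prop}
    (h : Err D s p δ G) (hδ : δ ≤ δ') (hA : Always D s p A) (hG : ∀ t, A t → G t → G' t) :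
    Err D s p δ' G' := by
  classical
  refine le_trans ?_ (le_trans h (mul_le_mul_of_nonneg_right hδ (normSq_nonneg _)))
  rw [prob_eq_wsum, prob_eq_wsum]
  refine wsum_mono fun t ht h0 => ?_
  by_cases hg : G t
  · simp [hg, hG t (hA t ht h0) hg]
  · simp only [hg, not_false_eq_true, if_true]
    split_ifs <;> norm_num

lemma Always.err {s : State} {p : Prog} {δ : ℝ} {G : State → Prop}
    (h : Always D s p G) (hδ : 0 ≤ δ) : Err D s p δ G := by
  classical
  unfold Err
  rw [prob_eq_wsum]
  refine le_trans (le_of_eq ?_) (mul_nonneg hδ (normSq_nonneg _))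
  rw [wsum_congr (g := fun _ => 0 * 1) (fun t ht h0 => by simp [h t ht h0]), wsum_const_mul,
    zero_mul]

lemma Err.seq (hU : D.Unitary) {s : State} {p q : Prog} {δ δ' : ℝ} (hδ' : 0 ≤ δ')
    {A G G' : State → Prop} (hA : Always D s p A) (h : Err D s p δ G)
    (h' : ∀ t, A t → G t → Err D t q δ' G') : Err D s (.seq p q) (δ + δ') G' := by
  classical
  have h1 : ∀ t ∈ run D p s, prob (run D q t) (fun r => ¬ G' r) ≤
      normSq t.psi * (δ' * 1 + if ¬ G t then 1 else 0) := by
    intro t ht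
    have hle : prob (run D q t) (fun r => ¬ G' r) ≤ normSq t.psi := by
      rw [prob_eq_wsum, ← wsum_one_run hU q t]
      exact wsum_mono fun _ _ _ => by split_ifs <;> norm_num
    by_cases h0 : t.psi = 0
    · rw [h0, normSq_zero] at hle
      rw [h0, normSq_zero, zero_mul]; exact hle
    · have ha := hA t ht h0
      by_cases hg : G t
      · simp only [hg, not_true_eq_false, if_false, add_zero, mul_one]
        rw [mul_comm]
        exact h' t ha hg
      · simp only [hg, not_false_eq_true, if_true]
        nlinarith [normSq_nonneg t.psi]
  unfold Err
  rw [prob_eq_wsum]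
  simp only [run]
  refine (wsum_flatMap_le fun t ht => by
    rw [← prob_eq_wsum]; exact h1 t ht).trans ?_
  rw [wsum_add, wsum_const_mul, wsum_one_run hU, ← prob_eq_wsum (E := fun t => ¬ G t)]
  unfold Err at h
  linarith

lemma Det.always {s : State} {p : Prog} {Q : State → Prop} (h : Det D s p Q) :
    Always D s p Q := by
  obtain ⟨t, ht, hQ⟩ := h
  intro r hr _
  rw [ht, List.mem_singleton] at hr
  exact hr ▸ hQ

lemma Det.mono {s : State} {p : Prog} {A B : State → Prop} (h : Det D s p A)
    (hAB : ∀ t, A t → B t) : Det D s p B := by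
  obtain ⟨t, ht, hQ⟩ := h
  exact ⟨t, ht, hAB t hQ⟩

lemma Det.seq {s : State} {p q : Prog} {A B : State → Prop} (h : Det D s p A)
    (h' : ∀ t, A t → Det D t q B) : Det D s (.seq p q) B := by
  obtain ⟨t, ht, hA⟩ := h
  obtain ⟨r, hr, hB⟩ := h' t hA
  exact ⟨r, by simp [run, ht, hr], hB⟩

lemma Err.det_seq {s : State} {p q : Prog} {δ : ℝ}
    {A G : State → Prop} (h : Det D s p A) (hpsi : ∀ t, A t → t.psi = s.psi)
    (h' : ∀ t, A t → Err D t q δ G) : Err D s (.seq p q) δ G := by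
  obtain ⟨t, ht, hA⟩ := h
  have := h' t hA
  unfold Err at this ⊢
  simp only [run, ht, List.flatMap_singleton]
  rwa [hpsi t hA] at this

lemma Always.det_seq {s : State} {p q : Prog} {A B : State → Prop} (h : Det D s p A)
    (h' : ∀ t, A t → Always D t q B) : Always D s (.seq p q) B := by
  obtain ⟨t, ht, hA⟩ := h
  have := h' t hA
  unfold Always at this ⊢
  simpa only [run, ht, List.flatMap_singleton] using this

/-- The loop `rep` as an iterated `flatMap`. -/
noncomputable def repRun (D : Device) (p : Prog) (n : ℕ) (l : List State) : List State :=
  (fun l : List State => l.flatMap fun t => run D p (t.tick 1))^[n] l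

lemma run_rep (D : Device) (i : ℕ) (p : Prog) (s : State) :
    run D (.rep i p) s = repRun D p (s.int i).toNat [s.tick (intCost (s.int i))] := rfl

lemma repRun_succ (D : Device) (p : Prog) (n : ℕ) (l : List State) :
    repRun D p (n + 1) l = (repRun D p n l).flatMap fun t => run D p (t.tick 1) := by
  unfold repRun
  rw [iterate_succ_apply']

lemma repRun_inv (hU : D.Unitary) {s : State} {p : Prog} {m : ℕ}
    (I : ℕ → State → Prop) (h0 : I 0 s)
    (hs : ∀ k < m, ∀ t, I k t → Always D (t.tick 1) p (I (k + 1))) :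
    ∀ n ≤ m, ∀ t ∈ repRun D p n [s], t.psi ≠ 0 → I n t := by
  intro n
  induction n with
  | zero =>
    intro _ t ht _
    simp only [repRun, iterate_zero, id_eq, List.mem_singleton] at ht
    exact ht ▸ h0
  | succ n ih =>
    intro hn t ht hz
    rw [repRun_succ, List.mem_flatMap] at ht
    obtain ⟨r, hr, ht⟩ := ht
    have hrz : r.psi ≠ 0 := fun hz' =>
      hz (psi_eq_zero_of_run hU (s := r.tick 1) hz' ht)
    exact hs n hn r (ih (by omega) r hr hrz) t ht hz

lemma always_rep (hU : D.Unitary) {s : State} {i : ℕ} {p : Prog}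
    (I : ℕ → State → Prop) (h0 : I 0 (s.tick (intCost (s.int i))))
    (hs : ∀ k < (s.int i).toNat, ∀ t, I k t → Always D (t.tick 1) p (I (k + 1))) :
    Always D s (.rep i p) (I (s.int i).toNat) :=
  repRun_inv hU I h0 hs _ le_rfl

lemma wsum_eq_zero_of_psi (hU : D.Unitary) {p : Prog} {s : State} (hs : s.psi = 0)
    (f : State → ℝ) : wsum (run D p s) f = 0 := by
  have : wsum (run D p s) f = wsum (run D p s) (fun _ => 0 * 1) :=
    wsum_congr fun t ht h0 => absurd (psi_eq_zero_of_run hU hs ht) h0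
  rw [this, wsum_const_mul, zero_mul]

lemma wsum_rep_le (hU : D.Unitary) {s : State} {i : ℕ} {p : Prog} (f : State → ℝ)
    {ρ : ℝ} (hρ : 0 ≤ ρ) (I : ℕ → State → Prop) (h0 : I 0 (s.tick (intCost (s.int i))))
    (hs : ∀ k < (s.int i).toNat, ∀ t, I k t → Always D (t.tick 1) p (I (k + 1)))
    (hf : ∀ k < (s.int i).toNat, ∀ t, I k t →
      wsum (run D p (t.tick 1)) f ≤ normSq t.psi * (ρ * f t)) :
    wsum (run D (.rep i p) s) f ≤
      ρ ^ (s.int i).toNat * (normSq s.psi * f (s.tick (intCost (s.int i)))) := by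
  have alw := repRun_inv hU I h0 hs
  have : ∀ n ≤ (s.int i).toNat, wsum (repRun D p n [s.tick (intCost (s.int i))]) f ≤
      ρ ^ n * (normSq s.psi * f (s.tick (intCost (s.int i)))) := by
    intro n
    induction n with
    | zero => intro _; simp [repRun, State.tick]
    | succ n ih =>
      intro hn
      rw [repRun_succ]
      refine (wsum_flatMap_le (g := fun t => ρ * f t) fun t ht => ?_).trans ?_
      · by_cases hz : t.psi = 0
        · rw [hz, normSq_zero, zero_mul]
          exact (wsum_eq_zero_of_psi hU (s := t.tick 1) hz f).le
        · exact hf n hn t (alw n (by omega) t ht hz)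
      · rw [wsum_const_mul, pow_succ']
        have := ih (by omega)
        calc ρ * wsum (repRun D p n [s.tick (intCost (s.int i))]) f
            ≤ ρ * (ρ ^ n * (normSq s.psi * f (s.tick (intCost (s.int i))))) :=
              mul_le_mul_of_nonneg_left this hρ
          _ = _ := by ring
  exact this _ le_rfl

lemma det_rep {s : State} {i : ℕ} {p : Prog}
    (I : ℕ → State → Prop) (h0 : I 0 (s.tick (intCost (s.int i))))
    (hs : ∀ k < (s.int i).toNat, ∀ t, I k t → Det D (t.tick 1) p (I (k + 1))) :
    Det D s (.rep i p) (I (s.int i).toNat) := by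
  have : ∀ n ≤ (s.int i).toNat, ∃ t, repRun D p n [s.tick (intCost (s.int i))] = [t] ∧ I n t := by
    intro n
    induction n with
    | zero => exact fun _ => ⟨_, rfl, h0⟩
    | succ n ih =>
      intro hn
      obtain ⟨t, ht, hI⟩ := ih (by omega)
      obtain ⟨r, hr, hI'⟩ := hs n hn t hI
      exact ⟨r, by rw [repRun_succ, ht, List.flatMap_singleton, hr], hI'⟩
  exact this _ le_rfl

lemma err_rep (hU : D.Unitary) {s : State} {i : ℕ} {p : Prog} {δ : ℝ} (hδ : 0 ≤ δ)
    (I G : ℕ → State → Prop) (h0 : I 0 (s.tick (intCost (s.int i))))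
    (hs : ∀ k < (s.int i).toNat, ∀ t, I k t → Always D (t.tick 1) p (I (k + 1)))
    (g0 : G 0 (s.tick (intCost (s.int i))))
    (gs : ∀ k < (s.int i).toNat, ∀ t, I k t → G k t → Err D (t.tick 1) p δ (G (k + 1))) :
    Err D s (.rep i p) ((s.int i).toNat * δ) (G (s.int i).toNat) := by
  classical
  have tot : ∀ n, wsum (repRun D p n [s.tick (intCost (s.int i))]) (fun _ => 1) = normSq s.psi := by
    intro n
    induction n with
    | zero => simp [repRun, State.tick]
    | succ n ih =>
      rw [repRun_succ, wsum_flatMap_eq (g := fun _ => 1), ih]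
      intro t _
      rw [wsum_one_run hU, mul_one]; rfl
  have alw := repRun_inv hU I h0 hs
  have : ∀ n ≤ (s.int i).toNat, wsum (repRun D p n [s.tick (intCost (s.int i))])
      (fun t => if ¬ G n t then 1 else 0) ≤ n * δ * normSq s.psi := by
    intro n
    induction n with
    | zero => intro _; simp [repRun, g0]
    | succ n ih =>
      intro hn
      rw [repRun_succ]
      refine (wsum_flatMap_le (g := fun t => δ * 1 + if ¬ G n t then 1 else 0) fun t ht => ?_).trans ?_
      · have hle : wsum (run D p (t.tick 1)) (fun t => if ¬ G (n + 1) t then 1 else 0)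
            ≤ normSq t.psi := by
          have := wsum_one_run hU p (t.tick 1)
          refine le_trans ?_ this.le
          exact wsum_mono fun _ _ _ => by split_ifs <;> norm_num
        by_cases hz : t.psi = 0
        · rw [hz, normSq_zero] at hle
          rw [hz, normSq_zero, zero_mul]; exact hle
        · by_cases hg : G n t
          · have := gs n hn t (alw n (by omega) t ht hz) hg
            unfold Err at this
            rw [prob_eq_wsum] at this
            simp only [hg, not_true_eq_false, if_false, add_zero, mul_one]
            rw [mul_comm]
            exact this
          · simp only [hg, not_false_eq_true, if_true] at hle ⊢
            nlinarith [normSq_nonneg t.psi]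
      · rw [wsum_add, wsum_const_mul, tot]
        have := ih (by omega)
        push_cast
        linarith
  have h := this _ le_rfl
  unfold Err
  rw [prob_eq_wsum, run_rep]
  exact h

/-! ### Real expressions -/

/-- Real expressions over the real variables. -/
inductive RExp where
  | var (r : ℕ)
  | const (z : ℤ)
  | op (o : BinOp) (a b : RExp)
  | fn (f : ElemFun) (a : RExp)

/-- The value of a real expression. -/
noncomputable def RExp.eval (ρ : ℕ → ℝ) : RExp → ℝ
  | .var r => ρ r
  | .const z => z
  | .op o a b => o.eval (a.eval ρ) (b.eval ρ)
  | .fn f a => f.eval (a.eval ρ)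

/-- A program that evaluates the expression into the real variable `d`; the variables after `d` and
the integer variable `59` are scratch space. -/
def RExp.prog : RExp → ℕ → Prog
  | .var r, d => .seq (.setInt 59 0) (.seq (.cast d 59) (.arith .add d d r))
  | .const z, d => .seq (.setInt 59 z) (.cast d 59)
  | .op o a b, d => .seq (a.prog d) (.seq (b.prog (d + 1)) (.arith o d d (d + 1)))
  | .fn f a, d => .seq (a.prog d) (.elem f d d)

/-- The time that the evaluation takes. -/
def RExp.cost : RExp → ℕ
  | .var _ => intCost 0 + intCost 0 + 1
  | .const z => intCost z + intCost z
  | .op _ a b => a.cost + b.cost + 1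
  | .fn _ a => a.cost + 1

/-- The expression uses only variables below `50`. -/
def RExp.Low : RExp → Prop
  | .var r => r < 50
  | .const _ => True
  | .op _ a b => a.Low ∧ b.Low
  | .fn _ a => a.Low

lemma RExp.eval_congr {ρ σ : ℕ → ℝ} {e : RExp} (he : e.Low) (h : ∀ r < 50, ρ r = σ r) :
    e.eval ρ = e.eval σ := by
  induction e with
  | var r => exact h r he
  | const z => rfl
  | op o a b iha ihb => simp only [RExp.eval, iha he.1, ihb he.2]
  | fn f a iha => simp only [RExp.eval, iha he]

lemma RExp.run_prog (D : Device) {e : RExp} (he : e.Low) {d : ℕ} (hd : 50 ≤ d) (s : State) :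
    Det D s (e.prog d) fun t => t.real d = e.eval s.real ∧ (∀ r < d, t.real r = s.real r) ∧
      (∀ i ≠ 59, t.int i = s.int i) ∧ t.psi = s.psi ∧ t.time = s.time + e.cost := by
  induction e generalizing d s with
  | var r =>
    have hr : r ≠ d := by have : r < 50 := he; omega
    refine ⟨_, rfl, ?_, ?_, ?_, ?_, ?_⟩
    · simp [State.tick, State.putInt, State.putReal, BinOp.eval, hr, RExp.eval]
    · intro q hq
      simp [State.tick, State.putInt, State.putReal, hq.ne]
    · intro i hi
      simp [State.tick, State.putInt, State.putReal, hi]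
    · simp [State.tick, State.putInt, State.putReal]
    · simp [State.tick, State.putInt, State.putReal, RExp.cost]; ring
  | const z =>
    refine ⟨_, rfl, ?_, ?_, ?_, ?_, ?_⟩
    · simp [State.tick, State.putInt, State.putReal, RExp.eval]
    · intro q hq
      simp [State.tick, State.putInt, State.putReal, hq.ne]
    · intro i hi
      simp [State.tick, State.putInt, State.putReal, hi]
    · simp [State.tick, State.putInt, State.putReal]
    · simp [State.tick, State.putInt, State.putReal, RExp.cost]; ring
  | op o a b iha ihb =>
    refine (iha he.1 hd s).seq fun t ht => (ihb he.2 (by omega : 50 ≤ d + 1) t).seq fun r hr => ?_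
    obtain ⟨h1, h2, h3, h4, h5⟩ := ht
    obtain ⟨g1, g2, g3, g4, g5⟩ := hr
    refine ⟨_, rfl, ?_, ?_, ?_, ?_, ?_⟩
    · simp only [State.tick, State.putReal, update_self, RExp.eval]
      rw [g1, g2 d (by omega), h1, RExp.eval_congr he.2 fun q hq => h2 q (by omega)]
    · intro q hq
      simp only [State.tick, State.putReal, update_of_ne hq.ne]
      rw [g2 q (by omega), h2 q hq]
    · intro i hi
      simp only [State.tick, State.putReal]
      rw [g3 i hi, h3 i hi]
    · simp only [State.tick, State.putReal]
      rw [g4, h4]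
    · simp only [State.tick, State.putReal, RExp.cost]
      omega
  | fn f a iha =>
    refine (iha he hd s).seq fun t ht => ?_
    obtain ⟨h1, h2, h3, h4, h5⟩ := ht
    refine ⟨_, rfl, ?_, ?_, ?_, ?_, ?_⟩
    · simp only [State.tick, State.putReal, update_self, RExp.eval]
      rw [h1]
    · intro q hq
      simp only [State.tick, State.putReal, update_of_ne hq.ne]
      exact h2 q hq
    · intro i hi
      simp only [State.tick, State.putReal]
      exact h3 i hi
    · simp only [State.tick, State.putReal]
      exact h4
    · simp only [State.tick, State.putReal, RExp.cost]
      omega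

/-- The integer variables outside of the scratch range agree. -/
def IntFrame (s t : State) : Prop := ∀ i, (i < 50 ∨ 60 ≤ i) → t.int i = s.int i

lemma IntFrame.trans {s t r : State} (h : IntFrame s t) (h' : IntFrame t r) : IntFrame s r :=
  fun i hi => (h' i hi).trans (h i hi)

lemma IntFrame.refl (s : State) : IntFrame s s := fun _ _ => rfl

/-- The assignment of an expression to a real variable. -/
def assign (r : ℕ) (e : RExp) : Prog :=
  .seq (e.prog 50) (.seq (.setInt 59 0) (.seq (.cast r 59) (.arith .add r r 50)))

lemma det_assign (D : Device) {r : ℕ} (hr : r < 50) {e : RExp} (he : e.Low) (s : State) :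
    Det D s (assign r e) fun t => (∀ q < 50, t.real q = if q = r then e.eval s.real else s.real q) ∧
      IntFrame s t ∧ t.psi = s.psi ∧ t.time = s.time + (e.cost + 3) := by
  refine (e.run_prog D he le_rfl s).seq fun t ht => ?_
  obtain ⟨h1, h2, h3, h4, h5⟩ := ht
  refine ⟨_, rfl, ?_, ?_, ?_, ?_⟩
  · intro q hq
    by_cases h : q = r
    · have : (50 : ℕ) ≠ r := by omega
      simp [State.tick, State.putInt, State.putReal, BinOp.eval, h, this, h1]
    · simp [State.tick, State.putInt, State.putReal, h, h2 q hq]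
  · intro i hi
    have : i ≠ 59 := by omega
    simp [State.tick, State.putInt, State.putReal, this, h3 i this]
  · simp [State.tick, State.putInt, State.putReal, h4]
  · simp [State.tick, State.putInt, State.putReal, h5, intCost]; ring

/-- The assignment of the integer part of an expression to an integer variable. -/
def assignFloor (i : ℕ) (e : RExp) : Prog := .seq (e.prog 50) (.floor i 50)

lemma det_assignFloor (D : Device) (i : ℕ) {e : RExp} (he : e.Low) (s : State) :
    Det D s (assignFloor i e) fun t => (∀ q < 50, t.real q = s.real q) ∧
      (∀ j, (j < 50 ∨ 60 ≤ j) → t.int j = if j = i then ⌊e.eval s.real⌋ else s.int j) ∧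
      t.psi = s.psi ∧ t.time = s.time + (e.cost + intCost ⌊e.eval s.real⌋) := by
  refine (e.run_prog D he le_rfl s).seq fun t ht => ?_
  obtain ⟨h1, h2, h3, h4, h5⟩ := ht
  refine ⟨_, rfl, ?_, ?_, ?_, ?_⟩
  · intro q hq
    simp [State.tick, State.putInt, h2 q hq]
  · intro j hj
    by_cases h : j = i
    · simp [State.tick, State.putInt, h, h1]
    · have : j ≠ 59 := by omega
      simp [State.tick, State.putInt, h, h3 j this]
  · simp [State.tick, State.putInt, h4]
  · simp [State.tick, State.putInt, h5, h1]; ring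

/-! ### Circuits

Circuits are written with qubits that are addressed by integer variables below `50`, in loops also
relative to the loop counter. -/

/-- The address of a qubit: the value of an integer variable, plus the loop counter if `ptr`. -/
structure Adr where
  base : Fin 50
  ptr : Bool

/-- The qubit with the address `a`, the values of the variables being `ρ` and the loop counter being
`k`. -/
def Adr.val (ρ : ℕ → ℤ) (k : ℤ) (a : Adr) : ℕ := (ρ a.base + if a.ptr then k else 0).toNat

/-- A program that loads the number of the qubit into the variable `d`. -/
def Adr.load (a : Adr) (d : ℕ) : Prog :=
  if a.ptr then .addInt d a.base 50 else .seq (.setInt d 0) (.addInt d d a.base)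

/-- The gates that may occur in the body of a loop. -/
inductive Atom where
  | x (a : Adr)
  | had (a : Adr)
  | z (a : Adr)
  | cnot (a b : Adr)
  | toffoli (a b c : Adr)

/-- The operation that a gate carries out. -/
def Atom.op (ρ : ℕ → ℤ) (k : ℤ) : Atom → Op
  | .x a => .x (a.val ρ k)
  | .had a => .had (a.val ρ k)
  | .z a => .z (a.val ρ k)
  | .cnot a b => .cnot (a.val ρ k) (b.val ρ k)
  | .toffoli a b c => .toffoli (a.val ρ k) (b.val ρ k) (c.val ρ k)

/-- The program of a gate. -/
def Atom.prog : Atom → Prog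
  | .x a => .seq (a.load 51) (.gate (.x 51))
  | .had a => .seq (a.load 51) (.gate (.had 51))
  | .z a => .seq (a.load 51) (.seq (.gate (.t 51)) (.seq (.gate (.t 51))
      (.seq (.gate (.t 51)) (.gate (.t 51)))))
  | .cnot a b => .seq (a.load 51) (.seq (b.load 52) (.gate (.cnot 51 52)))
  | .toffoli a b c => .seq (a.load 51) (.seq (b.load 52) (.seq (c.load 53)
      (.gate (.toffoli 51 52 53))))

/-- The parts of a circuit.  The body of a loop is carried out for the counter `0, 1, …`, or in the
opposite order if `rev`. -/
inductive Item where
  | gate (a : Atom)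
  | loop (len : Fin 50) (rev : Bool) (body : List Atom)
  | word (a b : Fin 50)
  | digit (c : Bool) (k a b : Fin 50)
  | sign (c : Bool) (a b : Fin 50)
  | feature (inverse : Bool) (a b : Fin 50)

/-- The operations that a part of a circuit carries out. -/
def Item.ops (ρ : ℕ → ℤ) : Item → List Op
  | .gate a => [a.op ρ 0]
  | .loop len rev body =>
      (if rev then (List.range (ρ len).toNat).reverse else List.range (ρ len).toNat).flatMap
        fun k : ℕ => body.map (Atom.op ρ k)
  | .word a b => [.word (ρ a).toNat (ρ b).toNat]
  | .digit c k a b => [.digit c (ρ k) (ρ a).toNat (ρ b).toNat]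
  | .sign c a b => [.sign c (ρ a).toNat (ρ b).toNat]
  | .feature i a b => [.feature i (ρ a).toNat (ρ b).toNat]

/-- Carry out a list of gates. -/
def atomsProg : List Atom → Prog
  | [] => .skip
  | a :: l => .seq a.prog (atomsProg l)

/-- The program of a part of a circuit. -/
def Item.prog : Item → Prog
  | .gate a => .seq (.setInt 50 0) a.prog
  | .loop len false body => .seq (.setInt 50 0)
      (.rep len (.seq (atomsProg body) (.seq (.setInt 54 1) (.addInt 50 50 54))))
  | .loop len true body => .seq (.setInt 54 0) (.seq (.addInt 50 len 54)
      (.rep len (.seq (.setInt 54 1) (.seq (.subInt 50 50 54) (atomsProg body)))))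
  | .word a b => .loadWord a b
  | .digit c k a b => .loadDigit c k a b
  | .sign c a b => .loadSign c a b
  | .feature i a b => .feature i a b

/-- The inverse of a part of a circuit. -/
def Item.inv : Item → Item
  | .loop len rev body => .loop len (!rev) body.reverse
  | .feature i a b => .feature (!i) a b
  | i => i

/-- The program of a circuit. -/
def circProg : List Item → Prog
  | [] => .skip
  | i :: l => .seq i.prog (circProg l)

/-- The operations that a circuit carries out. -/
def circOps (ρ : ℕ → ℤ) (l : List Item) : List Op := l.flatMap (Item.ops ρ)

/-- The inverse circuit. -/
def circInv (l : List Item) : List Item := l.reverse.map Item.inv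

lemma Item.ops_inv (ρ : ℕ → ℤ) (i : Item) : i.inv.ops ρ = invOps (i.ops ρ) := by
  cases i with
  | gate a => cases a <;> rfl
  | loop len rev body =>
    have hop : ∀ k : ℤ, (Op.inv ∘ Atom.op ρ k) = Atom.op ρ k := by
      intro k; ext1 a; cases a <;> rfl
    simp only [Item.inv, Item.ops, invOps, List.reverse_flatMap, List.map_flatMap, List.map_reverse,
      Function.comp_def, List.map_map] at hop ⊢
    simp only [hop]
    cases rev <;> simp
  | _ => rfl

lemma circOps_inv (ρ : ℕ → ℤ) (l : List Item) : circOps ρ (circInv l) = invOps (circOps ρ l) := by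
  unfold circOps circInv
  rw [List.flatMap_map]
  simp only [Item.ops_inv]
  simp [invOps, List.map_flatMap, List.reverse_flatMap, Function.comp_def]

/-- The effect of the program of a circuit with the operations `l` and running time at most `c`. -/
def Acts (D : Device) (s : State) (l : List Op) (c : ℕ) (t : State) : Prop :=
  t.psi = den D l s.psi ∧ IntFrame s t ∧ t.real = s.real ∧ t.time ≤ s.time + c

lemma Acts.trans {s t r : State} {l l' : List Op} {c c' : ℕ} (h : Acts D s l c t)
    (h' : Acts D t l' c' r) : Acts D s (l ++ l') (c + c') r :=
  ⟨by rw [h'.1, h.1, den_append], h.2.1.trans h'.2.1, h'.2.2.1.trans h.2.2.1, by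
    have := h.2.2.2; have := h'.2.2.2; omega⟩

lemma Acts.mono {s t : State} {l : List Op} {c c' : ℕ} (h : Acts D s l c t)
    (hc : c ≤ c') : Acts D s l c' t :=
  ⟨h.1, h.2.1, h.2.2.1, by have := h.2.2.2; omega⟩

/-- All numbers that are held by the variables below `50` have bit length less than `b`. -/
def Short (b : ℕ) (ρ : ℕ → ℤ) : Prop := ∀ i < 50, intCost (ρ i) ≤ b

lemma intCost_le {z z' : ℤ} (h : z.natAbs ≤ z'.natAbs) : intCost z ≤ intCost z' :=
  Nat.add_le_add_left (Nat.size_le_size h) 1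

lemma one_le_intCost (z : ℤ) : 1 ≤ intCost z := by unfold intCost; omega

@[simp] lemma intCost_zero : intCost 0 = 1 := by simp [intCost]

@[simp] lemma intCost_one : intCost 1 = 2 := by simp [intCost]

lemma Adr.load_det (D : Device) (a : Adr) {d : ℕ} (hd : 51 ≤ d) (hd' : d < 60) {s : State}
    {b : ℕ} (hs : Short b s.int) (hp : intCost (s.int 50) ≤ b) :
    Det D s (a.load d) fun t => t.int d = s.int a.base + (if a.ptr then s.int 50 else 0) ∧
      (∀ i ≠ d, t.int i = s.int i) ∧ t.psi = s.psi ∧ t.real = s.real ∧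
      t.time ≤ s.time + 3 * b := by
  have hb := hs a.base a.base.2
  have hne : (a.base : ℕ) ≠ d := by have := a.base.2; omega
  have h1 := one_le_intCost (s.int 50)
  unfold Adr.load
  cases hptr : a.ptr
  · simp only [Bool.false_eq_true, if_false, add_zero]
    refine ⟨_, rfl, ?_, ?_, ?_, ?_, ?_⟩
    · simp [State.tick, State.putInt, hne]
    · intro i hi; simp [State.tick, State.putInt, hi]
    · simp [State.tick, State.putInt]
    · simp [State.tick, State.putInt]
    · simp [State.tick, State.putInt, hne]; omega
  · simp only [if_true]
    refine ⟨_, rfl, ?_, ?_, ?_, ?_, ?_⟩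
    · simp [State.tick, State.putInt]
    · intro i hi; simp [State.tick, State.putInt, hi]
    · simp [State.tick, State.putInt]
    · simp [State.tick, State.putInt]
    · simp [State.tick, State.putInt]; omega

lemma gate_t_ket (v : ℕ → ℕ) (a : ℕ) (s : Finset ℕ) : (Gate.apply v (.t a)) (ket s) =
    (if v a ∈ s then Complex.exp (Real.pi / 4 * Complex.I) else 1) • ket s := onBasis_ket _ _

lemma gate_t_four (D : Device) (v : ℕ → ℕ) (a : ℕ) (f : Ket) :
    (Gate.apply v (.t a)) ((Gate.apply v (.t a)) ((Gate.apply v (.t a)) ((Gate.apply v (.t a)) f)))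
      = (Op.z (v a)).den D f := by
  have hexp : Complex.exp (Real.pi / 4 * Complex.I) * (Complex.exp (Real.pi / 4 * Complex.I) *
      (Complex.exp (Real.pi / 4 * Complex.I) * Complex.exp (Real.pi / 4 * Complex.I))) = -1 := by
    rw [← Complex.exp_add, ← Complex.exp_add, ← Complex.exp_add, ← Complex.exp_pi_mul_I]
    congr 1; ring
  have : (Gate.apply v (.t a)) ∘ₗ (Gate.apply v (.t a)) ∘ₗ (Gate.apply v (.t a)) ∘ₗ
      (Gate.apply v (.t a)) = (Op.z (v a)).den D := by
    refine ket_ext fun s => ?_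
    simp only [LinearMap.comp_apply, gate_t_ket, map_smul, Op.den_z_ket, smul_smul]
    split_ifs
    · rw [mul_assoc, mul_assoc, hexp]
    · simp
  exact congrArg (fun V : Ket →ₗ[ℂ] Ket => V f) this

lemma Atom.prog_det (D : Device) (a : Atom) {s : State} {b : ℕ} (hs : Short b s.int)
    (hp : intCost (s.int 50) ≤ b) :
    Det D s a.prog fun t => Acts D s [a.op s.int (s.int 50)] (10 * b) t ∧
      t.int 50 = s.int 50 := by
  have h1 := one_le_intCost (s.int 50)
  have key : ∀ t : State, (∀ i < 51, t.int i = s.int i) → Short b t.int ∧ intCost (t.int 50) ≤ b := by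
    intro t ht
    exact ⟨fun i hi => by rw [ht i (by omega)]; exact hs i hi, by rw [ht 50 (by omega)]; exact hp⟩
  cases a with
  | x a =>
    refine (a.load_det D (d := 51) (by omega) (by omega) hs hp).seq fun t ht => ⟨_, rfl, ?_⟩
    obtain ⟨ha, hi, hpsi, hr, ht⟩ := ht
    refine ⟨⟨?_, fun i h => hi i (by omega), hr, ?_⟩, hi 50 (by omega)⟩
    · simp [State.tick, State.act, hpsi, Gate.apply, State.qubit, ha, Atom.op, Op.den, Adr.val]
    · simp [State.tick, State.act]; omega
  | had a =>
    refine (a.load_det D (d := 51) (by omega) (by omega) hs hp).seq fun t ht => ⟨_, rfl, ?_⟩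
    obtain ⟨ha, hi, hpsi, hr, ht⟩ := ht
    refine ⟨⟨?_, fun i h => hi i (by omega), hr, ?_⟩, hi 50 (by omega)⟩
    · simp [State.tick, State.act, hpsi, Gate.apply, State.qubit, ha, Atom.op, Op.den, Adr.val]
    · simp [State.tick, State.act]; omega
  | z a =>
    refine (a.load_det D (d := 51) (by omega) (by omega) hs hp).seq fun t ht => ⟨_, rfl, ?_⟩
    obtain ⟨ha, hi, hpsi, hr, ht⟩ := ht
    refine ⟨⟨?_, fun i h => hi i (by omega), hr, ?_⟩, hi 50 (by omega)⟩
    · have := gate_t_four D t.qubit 51 t.psi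
      simp only [State.tick, State.act] at this ⊢
      refine this.trans ?_
      simp [hpsi, State.qubit, ha, Atom.op, Adr.val]
    · simp [State.tick, State.act]; omega
  | cnot a a' =>
    refine (a.load_det D (d := 51) (by omega) (by omega) hs hp).seq fun t ht => ?_
    obtain ⟨ha, hi, hpsi, hr, ht⟩ := ht
    obtain ⟨k1, k2⟩ := key t fun i h => hi i (by omega)
    refine (a'.load_det D (d := 52) (by omega) (by omega) k1 k2).seq fun r hr' => ⟨_, rfl, ?_⟩
    obtain ⟨ga, gi, gpsi, gr, gt⟩ := hr'
    rw [hi 50 (by omega), hi _ (by have := a'.base.2; omega)] at ga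
    refine ⟨⟨?_, fun i h => (gi i (by omega)).trans (hi i (by omega)), gr.trans hr, ?_⟩,
      (gi 50 (by omega)).trans (hi 50 (by omega))⟩
    · have := gi 51 (by omega)
      simp [State.tick, State.act, hpsi, gpsi, Gate.apply, State.qubit, ha, ga, this, Atom.op,
        Op.den, Adr.val]
    · simp [State.tick, State.act]; omega
  | toffoli a a' a'' =>
    refine (a.load_det D (d := 51) (by omega) (by omega) hs hp).seq fun t ht => ?_
    obtain ⟨ha, hi, hpsi, hr, ht⟩ := ht
    obtain ⟨k1, k2⟩ := key t fun i h => hi i (by omega)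
    refine (a'.load_det D (d := 52) (by omega) (by omega) k1 k2).seq fun r hr' => ?_
    obtain ⟨ga, gi, gpsi, gr, gt⟩ := hr'
    rw [hi 50 (by omega), hi _ (by have := a'.base.2; omega)] at ga
    obtain ⟨k1, k2⟩ := key r fun i h => (gi i (by omega)).trans (hi i (by omega))
    refine (a''.load_det D (d := 53) (by omega) (by omega) k1 k2).seq fun u hu => ⟨_, rfl, ?_⟩
    obtain ⟨fa, fi, fpsi, fr, ft⟩ := hu
    rw [gi 50 (by omega), gi _ (by have := a''.base.2; omega), hi 50 (by omega),
      hi _ (by have := a''.base.2; omega)] at fa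
    refine ⟨⟨?_, fun i h => (fi i (by omega)).trans ((gi i (by omega)).trans (hi i (by omega))),
      fr.trans (gr.trans hr), ?_⟩,
      (fi 50 (by omega)).trans ((gi 50 (by omega)).trans (hi 50 (by omega)))⟩
    · have e1 := (fi 51 (by omega)).trans (gi 51 (by omega))
      have e2 := fi 52 (by omega)
      simp [State.tick, State.act, hpsi, gpsi, fpsi, Gate.apply, State.qubit, ha, ga, fa, e1, e2,
        Atom.op, Op.den, Adr.val]
    · simp [State.tick, State.act]; omega

lemma IntFrame.short {s t : State} (h : IntFrame s t) {b : ℕ} (hs : Short b s.int) :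
    Short b t.int := fun i hi => by rw [h i (Or.inl hi)]; exact hs i hi

lemma Atom.op_congr {ρ σ : ℕ → ℤ} (h : ∀ i < 50, ρ i = σ i) (k : ℤ) (a : Atom) :
    a.op ρ k = a.op σ k := by
  cases a <;> simp only [Atom.op, Adr.val, h _ (Fin.is_lt _)]

lemma atomsProg_det (D : Device) (l : List Atom) {s : State} {b : ℕ} (hs : Short b s.int)
    (hp : intCost (s.int 50) ≤ b) :
    Det D s (atomsProg l) fun t => Acts D s (l.map (Atom.op s.int (s.int 50))) (10 * b * l.length) t ∧
      t.int 50 = s.int 50 := by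
  induction l generalizing s with
  | nil => exact ⟨_, rfl, ⟨rfl, IntFrame.refl _, rfl, by simp⟩, rfl⟩
  | cons a l ih =>
    refine (a.prog_det D hs hp).seq fun t ht => ?_
    refine (ih (ht.1.2.1.short hs) (by rw [ht.2]; exact hp)).mono fun r hr => ?_
    rw [ht.2] at hr
    refine ⟨?_, hr.2⟩
    have := ht.1.trans hr.1
    have hmap : l.map (Atom.op t.int (s.int 50)) = l.map (Atom.op s.int (s.int 50)) :=
      List.map_congr_left fun a _ => Atom.op_congr (fun i hi => ht.1.2.1 i (Or.inl hi)) _ a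
    rw [hmap] at this
    refine Acts.mono this ?_
    simp only [List.length_cons]; ring_nf; omega

/-- A bound for the running time of a part of a circuit. -/
def Item.cost (D : Device) (b : ℕ) (ρ : ℕ → ℤ) : Item → ℕ
  | .gate _ => 11 * b
  | .loop len _ body => (ρ len).toNat * ((10 * body.length + 6) * b) + 6 * b
  | .word _ _ => 1 + D.addrLen + D.n
  | .digit _ k _ _ => 1 + D.addrLen + (ρ k).natAbs
  | .sign _ _ _ => 1 + D.addrLen
  | .feature _ _ _ => D.T

lemma Item.prog_det (D : Device) (i : Item) {s : State} {b : ℕ} (hs : Short b s.int) :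
    Det D s i.prog fun t => Acts D s (i.ops s.int) (i.cost D b s.int) t := by
  have hb1 : 1 ≤ b := (one_le_intCost _).trans (hs 0 (by omega))
  cases i with
  | gate a =>
    have h0 : Det D s (.setInt 50 0) fun t => Acts D s [] 1 t ∧ t.int 50 = 0 :=
      ⟨_, rfl, ⟨rfl, fun i hi => by
        have : i ≠ 50 := by omega
        simp [State.tick, State.putInt, this], rfl, by simp [State.tick, State.putInt]⟩,
        by simp [State.tick, State.putInt]⟩
    refine h0.seq fun t ht => ?_
    refine (a.prog_det D (ht.1.2.1.short hs) (by rw [ht.2]; simpa using hb1)).mono fun r hr => ?_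
    have := ht.1.trans hr.1
    rw [ht.2, Atom.op_congr (fun i hi => ht.1.2.1 i (Or.inl hi))] at this
    exact this.mono (by simp only [Item.cost]; omega)
  | loop len rev body =>
    have hlb := hs len len.2
    set n := (s.int len).toNat with hn
    have hcount : ∀ k : ℕ, k ≤ n → intCost (k : ℤ) ≤ b := fun k hk =>
      (intCost_le (by omega)).trans hlb
    cases rev with
    | false =>
      have h0 : Det D s (.setInt 50 0) fun t => Acts D s [] 1 t ∧ t.int 50 = 0 :=
        ⟨_, rfl, ⟨rfl, fun i hi => by
          have : i ≠ 50 := by omega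
          simp [State.tick, State.putInt, this], rfl, by simp [State.tick, State.putInt]⟩,
          by simp [State.tick, State.putInt]⟩
      refine h0.seq fun t0 ht0 => ?_
      have hlen : t0.int len = s.int len := ht0.1.2.1 _ (Or.inl len.2)
      have main := det_rep (D := D) (s := t0) (i := len)
        (p := .seq (atomsProg body) (.seq (.setInt 54 1) (.addInt 50 50 54)))
        (fun k t => Acts D s ((List.range k).flatMap fun k : ℕ => body.map (Atom.op s.int k))
          (1 + b + k * ((10 * body.length + 6) * b)) t ∧ t.int 50 = k) ?_ ?_
      · refine main.mono fun t ht => ?_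
        rw [hlen] at ht
        refine Acts.mono (by simpa [Item.ops] using ht.1) ?_
        simp only [Item.cost]; omega
      · refine ⟨⟨ht0.1.1, ht0.1.2.1, ht0.1.2.2.1, ?_⟩, ht0.2⟩
        have := ht0.1.2.2.2
        rw [hlen]
        simp [State.tick]; omega
      · intro k hk t ht
        rw [hlen] at hk
        obtain ⟨ht, htk⟩ := ht
        have hks := hcount k hk.le
        refine (atomsProg_det D body (s := t.tick 1) (b := b) (ht.2.1.short hs)
          (by rw [show (t.tick 1).int 50 = (k : ℤ) from htk]; exact hks)).seq fun r hr => ?_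
        rw [show (t.tick 1).int 50 = (k : ℤ) from htk] at hr
        refine ⟨_, rfl, ⟨?_, ?_, ?_, ?_⟩, ?_⟩
        · rw [List.range_succ, List.flatMap_append, den_append]
          simp only [State.tick, State.putInt, List.flatMap_singleton]
          rw [hr.1.1, ← ht.1]
          have hmap : body.map (Atom.op (t.tick 1).int k) = body.map (Atom.op s.int k) :=
            List.map_congr_left fun a _ => Atom.op_congr (fun i hi => ht.2.1 i (Or.inl hi)) _ a
          rw [hmap]; rfl
        · intro i hi
          have : i ≠ 50 ∧ i ≠ 54 := by omega
          simp [State.tick, State.putInt, this]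
          exact (hr.1.2.1 i hi).trans (ht.2.1 i hi)
        · exact hr.1.2.2.1.trans ht.2.2.1
        · have h1 := hr.1.2.2.2
          have h2 := ht.2.2.2
          simp only [State.tick, State.putInt] at h1 ⊢
          simp only [update_self, ne_eq, show (50 : ℕ) ≠ 54 by decide, not_false_eq_true,
            update_of_ne, hr.2, intCost_one]
          nlinarith
        · simp [State.tick, State.putInt, hr.2]
    | true =>
      have h0 : Det D s (.seq (.setInt 54 0) (.addInt 50 len 54)) fun t =>
          Acts D s [] (2 + b) t ∧ t.int 50 = s.int len := by
        have hne : (len : ℕ) ≠ 54 := by have := len.2; omega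
        refine ⟨_, rfl, ⟨rfl, fun i hi => ?_, rfl, ?_⟩, ?_⟩
        · have : i ≠ 50 ∧ i ≠ 54 := by omega
          simp [State.tick, State.putInt, this]
        · simp [State.tick, State.putInt, hne]; omega
        · simp [State.tick, State.putInt, hne]
      have hrew : ∀ q, Det D s (.seq (.seq (.setInt 54 0) (.addInt 50 len 54)) q) =
          Det D s (.seq (.setInt 54 0) (.seq (.addInt 50 len 54) q)) := by
        intro q; ext Q; simp [Det, run]
      simp only [Item.prog]
      rw [← hrew]
      refine h0.seq fun t0 ht0 => ?_
      have hlen : t0.int len = s.int len := ht0.1.2.1 _ (Or.inl len.2)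
      have main := det_rep (D := D) (s := t0) (i := len)
        (p := .seq (.setInt 54 1) (.seq (.subInt 50 50 54) (atomsProg body)))
        (fun k t => Acts D s (((List.range n).reverse.take k).flatMap
            fun k : ℕ => body.map (Atom.op s.int k))
          (2 + 2 * b + k * ((10 * body.length + 6) * b)) t ∧ t.int 50 = s.int len - k) ?_ ?_
      · refine main.mono fun t ht => ?_
        rw [hlen] at ht
        have htake : (List.range n).reverse.take (s.int len).toNat = (List.range n).reverse := by
          rw [List.take_of_length_le]; simp [hn]
        rw [htake] at ht
        refine Acts.mono (by simpa [Item.ops] using ht.1) ?_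
        simp only [Item.cost]; omega
      · refine ⟨⟨ht0.1.1, ht0.1.2.1, ht0.1.2.2.1, ?_⟩, by simpa [State.tick] using ht0.2⟩
        have := ht0.1.2.2.2
        rw [hlen]
        simp [State.tick]; omega
      · intro k hk t ht
        rw [hlen] at hk
        obtain ⟨ht, htk⟩ := ht
        have hsl : s.int len = n := by omega
        have hidx : s.int len - (k + 1 : ℕ) = ((n - 1 - k : ℕ) : ℤ) := by omega
        have hks : intCost (s.int len - (k + 1 : ℕ)) ≤ b := by
          rw [hidx]; exact hcount _ (by omega)
        have hks' : intCost (s.int len - k) ≤ b := (intCost_le (by omega)).trans hlb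
        have h1 : Det D (t.tick 1) (.seq (.setInt 54 1) (.subInt 50 50 54)) fun r =>
            Acts D (t.tick 1) [] (4 + b) r ∧ r.int 50 = s.int len - (k + 1 : ℕ) := by
          refine ⟨_, rfl, ⟨rfl, fun i hi => ?_, rfl, ?_⟩, ?_⟩
          · have : i ≠ 50 ∧ i ≠ 54 := by omega
            simp [State.tick, State.putInt, this]
          · simp [State.tick, State.putInt, htk]; omega
          · simp [State.tick, State.putInt, htk]; ring
        have hrew : ∀ q, Det D (t.tick 1) (.seq (.seq (.setInt 54 1) (.subInt 50 50 54)) q) =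
            Det D (t.tick 1) (.seq (.setInt 54 1) (.seq (.subInt 50 50 54) q)) := by
          intro q; ext Q; simp [Det, run]
        rw [← hrew]
        refine h1.seq fun u hu => ?_
        have hsu : Short b u.int := hu.1.2.1.short (s := t.tick 1) (ht.2.1.short hs)
        refine (atomsProg_det D body hsu (by rw [hu.2]; exact hks)).mono fun r hr => ?_
        rw [hu.2] at hr
        refine ⟨⟨?_, ?_, ?_, ?_⟩, hr.2⟩
        · have hmap : body.map (Atom.op u.int (s.int len - (k + 1 : ℕ)))
              = body.map (Atom.op s.int ((n - 1 - k : ℕ) : ℤ)) := by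
            rw [hidx]
            refine List.map_congr_left fun a _ => Atom.op_congr (fun i hi => ?_) _ a
            exact (hu.1.2.1 i (Or.inl hi)).trans (ht.2.1 i (Or.inl hi))
          have htake : (List.range n).reverse.take (k + 1)
              = (List.range n).reverse.take k ++ [n - 1 - k] := by
            have hkn : k < n := by omega
            rw [List.take_add_one, List.getElem?_reverse (by simpa using hkn)]
            simp [List.getElem?_range (show n - 1 - k < n by omega)]
          rw [htake, List.flatMap_append, den_append, List.flatMap_singleton, ← hmap, ← ht.1,
            hr.1.1, hu.1.1]
          rfl
        · exact (ht.2.1.trans (show IntFrame t u from hu.1.2.1)).trans hr.1.2.1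
        · exact hr.1.2.2.1.trans (hu.1.2.2.1.trans ht.2.2.1)
        · have h1 := hr.1.2.2.2
          have h2 := ht.2.2.2
          have h3 := hu.1.2.2.2
          simp only [State.tick] at h1 h2 h3 ⊢
          nlinarith
  | word a b => exact ⟨_, rfl, rfl, fun i _ => rfl, rfl, le_rfl⟩
  | digit c k a b => exact ⟨_, rfl, rfl, fun i _ => rfl, rfl, le_rfl⟩
  | sign c a b => exact ⟨_, rfl, rfl, fun i _ => rfl, rfl, le_rfl⟩
  | feature inv a b => exact ⟨_, rfl, rfl, fun i _ => rfl, rfl, le_rfl⟩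

lemma Item.ops_congr {ρ σ : ℕ → ℤ} (h : ∀ i < 50, ρ i = σ i) (i : Item) :
    i.ops ρ = i.ops σ := by
  cases i <;> simp only [Item.ops, h _ (Fin.is_lt _), Atom.op_congr h,
    funext fun k : ℤ => funext fun a => Atom.op_congr h k a]

lemma circOps_congr {ρ σ : ℕ → ℤ} (h : ∀ i < 50, ρ i = σ i) (l : List Item) :
    circOps ρ l = circOps σ l := by
  unfold circOps
  simp only [funext fun i => Item.ops_congr h i]

/-- A bound for the running time of a circuit. -/
def circCost (D : Device) (b : ℕ) (ρ : ℕ → ℤ) (l : List Item) : ℕ :=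
  (l.map (Item.cost D b ρ)).sum

lemma circCost_congr (D : Device) (b : ℕ) {ρ σ : ℕ → ℤ} (h : ∀ i < 50, ρ i = σ i) (l : List Item) :
    circCost D b ρ l = circCost D b σ l := by
  unfold circCost
  refine congrArg List.sum (List.map_congr_left fun i _ => ?_)
  cases i <;> simp only [Item.cost, h _ (Fin.is_lt _)]

lemma circProg_det (D : Device) (l : List Item) {s : State} {b : ℕ} (hs : Short b s.int) :
    Det D s (circProg l) fun t => Acts D s (circOps s.int l) (circCost D b s.int l) t := by
  induction l generalizing s with
  | nil => exact ⟨_, rfl, rfl, IntFrame.refl _, rfl, le_rfl⟩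
  | cons i l ih =>
    refine (i.prog_det D hs).seq fun t ht => ?_
    refine (ih (ht.2.1.short hs)).mono fun r hr => ?_
    have hc : ∀ i < 50, t.int i = s.int i := fun i hi => ht.2.1 i (Or.inl hi)
    rw [circOps_congr hc, circCost_congr D b hc] at hr
    exact ht.trans hr

/-! ### Supports -/

/-- The states in which only qubits below `Q` may be in state `|1⟩`. -/
noncomputable def below (Q : ℕ) : Submodule ℂ Ket := Finsupp.supported ℂ ℂ {s | s ⊆ range Q}

lemma mem_below {Q : ℕ} {v : Ket} : v ∈ below Q ↔ ∀ s, v s ≠ 0 → s ⊆ range Q := by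
  unfold below
  rw [Finsupp.mem_supported]
  constructor
  · intro h s hs
    exact h (by simpa using hs)
  · intro h s hs
    exact h s (by simpa using hs)

lemma ket_mem_below {Q : ℕ} {s : Finset ℕ} (h : s ⊆ range Q) : ket s ∈ below Q := by
  refine mem_below.2 fun t ht => ?_
  rw [ket_apply] at ht
  have : s = t := by by_contra hst; simp [hst] at ht
  exact this ▸ h

lemma below_eq_span (Q : ℕ) : below Q = Submodule.span ℂ (ket '' {s | s ⊆ range Q}) := by
  unfold below
  rw [Finsupp.supported_eq_span_single]
  rfl

lemma eq_of_mem_below {Q : ℕ} {V W : Ket →ₗ[ℂ] Ket}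
    (h : ∀ s ⊆ range Q, V (ket s) = W (ket s)) {v : Ket} (hv : v ∈ below Q) : V v = W v := by
  rw [below_eq_span] at hv
  refine LinearMap.eqOn_span ?_ hv
  rintro _ ⟨s, hs, rfl⟩
  exact h s hs

lemma map_mem_below {Q : ℕ} {V : Ket →ₗ[ℂ] Ket}
    (h : ∀ s ⊆ range Q, V (ket s) ∈ below Q) {v : Ket} (hv : v ∈ below Q) :
    V v ∈ below Q := by
  have : below Q ≤ (below Q).comap V := by
    conv_lhs => rw [below_eq_span]
    rw [Submodule.span_le]
    rintro _ ⟨s, hs, rfl⟩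
    exact h s hs
  exact this hv

lemma project_mem_below {Q : ℕ} (q : ℕ) (b : Bool) {v : Ket} (hv : v ∈ below Q) :
    project q b v ∈ below Q := by
  rw [mem_below] at hv ⊢
  intro s hs
  rw [project_apply] at hs
  refine hv s fun h0 => hs ?_
  rw [h0, ite_self]

/-- The operation changes only qubits below `Q`. -/
def Op.Below (D : Device) (Q : ℕ) : Op → Prop
  | .x a => a < Q
  | .had a => a < Q
  | .z _ => True
  | .cnot _ b => b < Q
  | .toffoli _ _ c => c < Q
  | .word _ b => b + D.n ≤ Q
  | .digit _ _ _ b => b < Q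
  | .sign _ _ b => b < Q
  | .feature _ a b => a + D.n ≤ Q ∧ b + D.N ≤ Q

lemma symmDiff_singleton_subset {Q a : ℕ} (ha : a < Q) {s : Finset ℕ} (hs : s ⊆ range Q) :
    symmDiff s {a} ⊆ range Q := by
  intro q hq
  rw [mem_symmDiff] at hq
  rcases hq with ⟨h, -⟩ | ⟨h, -⟩
  · exact hs h
  · rw [mem_singleton] at h
    simpa [h] using ha

lemma Op.den_mem_below {Q : ℕ} {o : Op} (ho : o.Below D Q) {v : Ket}
    (hv : v ∈ below Q) : o.den D v ∈ below Q := by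
  refine map_mem_below (fun s hs => ?_) hv
  by_cases hp : o.IsPerm
  · rw [Op.den_perm_ket D hp]
    refine ket_mem_below ?_
    cases o with
    | x a => exact symmDiff_singleton_subset ho hs
    | cnot a b =>
      simp only [Op.perm]; split_ifs
      · exact symmDiff_singleton_subset ho hs
      · exact hs
    | toffoli a b c =>
      simp only [Op.perm]; split_ifs
      · exact symmDiff_singleton_subset ho hs
      · exact hs
    | digit a b c =>
      simp only [Op.perm]; split_ifs
      · exact symmDiff_singleton_subset ho hs
      · exact hs
    | sign a b c =>
      simp only [Op.perm]; split_ifs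
      · exact symmDiff_singleton_subset ho hs
      · exact hs
    | word a b =>
      simp only [Op.perm]; split_ifs
      · intro q hq
        by_cases hq' : b ≤ q ∧ q < b + D.n
        · have : b + D.n ≤ Q := ho
          simp; omega
        · rw [mem_xorReg hq'] at hq
          exact hs hq
      · exact hs
    | _ => exact absurd hp id
  · cases o with
    | had a =>
      rw [Op.den_had_ket]
      have ha : a < Q := ho
      refine Submodule.smul_mem _ _ (Submodule.add_mem _ (ket_mem_below ?_)
        (Submodule.smul_mem _ _ (ket_mem_below ?_)))
      · exact (erase_subset _ _).trans hs
      · exact insert_subset (by simpa using ha) hs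
    | z a =>
      rw [Op.den_z_ket]
      exact Submodule.smul_mem _ _ (ket_mem_below hs)
    | feature i a b =>
      have ho : a + D.n ≤ Q ∧ b + D.N ≤ Q := ho
      simp only [Op.den]
      by_cases hab : Apart a D.n b D.N
      · rw [applyMatrix_ket _ hab]
        refine Submodule.sum_mem _ fun z _ => Submodule.smul_mem _ _ (ket_mem_below ?_)
        intro q hq
        rw [mem_write2] at hq
        by_cases h1 : b ≤ q ∧ q < b + D.N
        · simp; omega
        · by_cases h2 : a ≤ q ∧ q < a + D.n
          · simp; omega
          · rw [dif_neg h1, dif_neg h2] at hq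
            exact hs hq
      · rw [applyMatrix_ket_of_not _ hab]
        exact ket_mem_below hs
    | _ => exact absurd trivial hp

lemma den_mem_below {Q : ℕ} {l : List Op} (hl : ∀ o ∈ l, o.Below D Q) {v : Ket}
    (hv : v ∈ below Q) : den D l v ∈ below Q := by
  induction l generalizing v with
  | nil => exact hv
  | cons o l ih =>
    exact ih (fun o ho => hl o (List.mem_cons_of_mem _ ho))
      (Op.den_mem_below (hl o List.mem_cons_self) hv)

lemma Op.Below.inv {Q : ℕ} {o : Op} (ho : o.Below D Q) : o.inv.Below D Q := by
  cases o <;> exact ho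

lemma invOps_below {Q : ℕ} {l : List Op} (hl : ∀ o ∈ l, o.Below D Q) :
    ∀ o ∈ invOps l, o.Below D Q := by
  intro o ho
  simp only [invOps, List.mem_map, List.mem_reverse] at ho
  obtain ⟨o', ho', rfl⟩ := ho
  exact (hl o' ho').inv

lemma mem_toggle_if {P : Prop} [Decidable P] {q c : ℕ} {s : Finset ℕ} :
    q ∈ (if P then symmDiff s {c} else s) ↔ (q ∈ s ↔ ¬ (P ∧ q = c)) := by
  by_cases hP : P
  · rw [if_pos hP, mem_symmDiff, mem_singleton]; tauto
  · rw [if_neg hP]; tauto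

lemma mem_perm_x {a q : ℕ} {s : Finset ℕ} :
    q ∈ (Op.x a).perm D s ↔ (q ∈ s ↔ ¬ q = a) := by
  simp only [Op.perm, mem_symmDiff, mem_singleton]; tauto

lemma mem_perm_toffoli {a b c q : ℕ} {s : Finset ℕ} :
    q ∈ (Op.toffoli a b c).perm D s ↔
      (q ∈ s ↔ ¬ ((a ∈ s ∧ b ∈ s ∧ a ≠ c ∧ b ≠ c) ∧ q = c)) := mem_toggle_if

/-! ### The reflection in the state `|0 … 0⟩` -/

/-- Compute into the qubits `Q, …, 2 Q` whether the qubits `0, …, k - 1` are all in state `|0⟩`. -/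
def chainOps (Q k : ℕ) : List Op :=
  .x Q :: (List.range k).flatMap fun k => [.x k, .toffoli (Q + k) k (Q + 1 + k), .x k]

/-- The content of the memory after `chainOps`. -/
def chainSet (Q k : ℕ) (s : Finset ℕ) : Finset ℕ :=
  s ∪ ((range (k + 1)).filter fun j => ∀ q ∈ s, j ≤ q).image fun j => Q + j

lemma mem_chainSet {Q k r : ℕ} {s : Finset ℕ} (hs : s ⊆ range Q) :
    r ∈ chainSet Q k s ↔ if r < Q then r ∈ s else r ≤ Q + k ∧ ∀ q ∈ s, r - Q ≤ q := by
  unfold chainSet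
  simp only [mem_union, mem_image, mem_filter, mem_range]
  split_ifs with h
  · constructor
    · rintro (h' | ⟨j, -, hj⟩)
      · exact h'
      · omega
    · exact Or.inl
  · constructor
    · rintro (h' | ⟨j, hj, rfl⟩)
      · exact absurd (mem_range.1 (hs h')) h
      · exact ⟨by omega, fun q hq => by have := hj.2 q hq; omega⟩
    · rintro ⟨h1, h2⟩
      exact Or.inr ⟨r - Q, ⟨by omega, h2⟩, by omega⟩

lemma den_chainOps (D : Device) {Q k : ℕ} (hk : k ≤ Q) {s : Finset ℕ} (hs : s ⊆ range Q) :
    den D (chainOps Q k) (ket s) = ket (chainSet Q k s) := by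
  induction k with
  | zero =>
    simp only [chainOps, List.range_zero, List.flatMap_nil, den_cons, den_nil]
    rw [Op.den_perm_ket D (o := .x Q) trivial]
    congr 1
    ext r
    rw [mem_chainSet hs]
    simp only [Op.perm, mem_symmDiff, mem_singleton]
    have hQ : Q ∉ s := fun h => by simpa using hs h
    split_ifs with h
    · have : r ≠ Q := by omega
      simp [this]
    · have hr : r ∉ s := fun h' => by have := hs h'; simp at this; omega
      simp only [hr, false_and, not_false_eq_true, and_true, false_or]
      constructor
      · rintro rfl; simp
      · rintro ⟨h1, -⟩; omega
  | succ k ih =>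
    have : chainOps Q (k + 1) = chainOps Q k ++ [.x k, .toffoli (Q + k) k (Q + 1 + k), .x k] := by
      simp [chainOps, List.range_succ]
    rw [this, den_append, ih (by omega)]
    simp only [den_cons, den_nil, Op.den_perm_ket D (o := .x k) trivial,
      Op.den_perm_ket D (o := .toffoli (Q + k) k (Q + 1 + k)) trivial]
    congr 1
    ext r
    rw [mem_chainSet hs]
    have hkQ : k < Q := by omega
    have e1 : k ∈ (Op.x k).perm D (chainSet Q k s) ↔ k ∉ s := by
      rw [mem_perm_x, mem_chainSet hs, if_pos hkQ]; simp
    have e2 : Q + k ∈ (Op.x k).perm D (chainSet Q k s) ↔ ∀ q ∈ s, k ≤ q := by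
      rw [mem_perm_x, mem_chainSet hs, if_neg (by omega)]
      have h1 : Q + k ≠ k := by omega
      have h2 : ¬ Q + k = k := h1
      simp only [h2, not_false_eq_true, iff_true, le_refl, true_and, Nat.add_sub_cancel_left]
    have e3 : (Q + k ∈ (Op.x k).perm D (chainSet Q k s) ∧ k ∈ (Op.x k).perm D (chainSet Q k s) ∧
        Q + k ≠ Q + 1 + k ∧ k ≠ Q + 1 + k) ↔ ∀ q ∈ s, k + 1 ≤ q := by
      rw [e1, e2]
      constructor
      · rintro ⟨h1, h2, -⟩ q hq
        have := h1 q hq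
        rcases this.lt_or_eq with h | rfl
        · exact h
        · exact absurd hq h2
      · intro h
        exact ⟨fun q hq => by have := h q hq; omega, fun hk => by have := h k hk; omega, by omega,
          by omega⟩
    rw [mem_perm_x, mem_perm_toffoli, e3, mem_perm_x, mem_chainSet hs]
    by_cases hrk : r = k
    · have : r ≠ Q + 1 + k := by omega
      have h' : r < Q := by omega
      simp [this, h', hrk, hkQ]
    · by_cases hrq : r = Q + 1 + k
      · have h1 : ¬ r < Q := by omega
        have h2 : ¬ r ≤ Q + k := by omega
        have h3 : r ≤ Q + (k + 1) := by omega
        have h4 : r - Q = k + 1 := by omega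
        simp only [if_neg h1, h2, h3, h4, hrk, false_and, true_and, not_false_eq_true, iff_true]
        simp only [hrq, and_true, false_iff, not_not]
      · have h3 : r ≤ Q + (k + 1) ↔ r ≤ Q + k := by omega
        simp only [hrk, hrq, h3]
        simp

/-- The reflection in the state `|0 … 0⟩` of the qubits below `Q`. -/
def reflectOps (Q : ℕ) : List Op := chainOps Q Q ++ (.z (Q + Q) :: invOps (chainOps Q Q))

lemma den_reflectOps (hU : D.Unitary) {Q : ℕ} {v : Ket} (hv : v ∈ below Q) :
    den D (reflectOps Q) v = v - (2 * v ∅) • ket ∅ := by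
  have h := eq_of_mem_below (V := den D (reflectOps Q))
    (W := LinearMap.id - (2 : ℂ) • (Finsupp.lapply ∅ : Ket →ₗ[ℂ] ℂ).smulRight (ket ∅))
    (fun s hs => ?_) hv
  · rw [h]
    simp [mul_smul]
  · rw [reflectOps, den_append, den_cons, den_chainOps D le_rfl hs, Op.den_z_ket, map_smul,
      ← den_chainOps D le_rfl hs, den_invOps_den hU]
    simp only [LinearMap.sub_apply, LinearMap.id_apply, LinearMap.smul_apply,
      LinearMap.smulRight_apply, Finsupp.lapply_apply, ket_apply]
    have hmem := mem_chainSet (k := Q) (r := Q + Q) hs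
    rw [if_neg (by omega)] at hmem
    by_cases h0 : s = ∅
    · subst h0
      rw [if_pos (hmem.2 (by simp)), if_pos rfl]
      module
    · obtain ⟨q, hq⟩ := nonempty_iff_ne_empty.2 h0
      have : ¬ (Q + Q ≤ Q + Q ∧ ∀ q ∈ s, Q + Q - Q ≤ q) := by
        rintro ⟨-, h⟩
        have h1 := h q hq
        have h2 := mem_range.1 (hs hq)
        omega
      rw [if_neg (fun h => this (hmem.1 h)), if_neg h0]
      simp

/-! ### Amplitude amplification -/

/-- One step of amplitude amplification for the state prepared by `l`, the good states being those
in which the qubit `q` is in state `|1⟩`. -/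
def groverOps (Q q : ℕ) (l : List Op) : List Op := .z q :: (invOps l ++ (reflectOps Q ++ l))

lemma den_z (D : Device) (q : ℕ) (v : Ket) :
    (Op.z q).den D v = project q false v - project q true v := by
  induction v using Finsupp.induction_linear with
  | zero => simp [show ∀ b, project q b 0 = 0 from fun _ => Finsupp.filter_zero _]
  | add f g hf hg => rw [map_add, hf, hg, project_add, project_add]; abel
  | single s a =>
    have : (Finsupp.single s a : Ket) = a • ket s := by simp [ket]
    rw [this, map_smul, Op.den_z_ket, project_smul, project_smul, project_ket, project_ket]
    by_cases h : q ∈ s <;> simp [h]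

/-- One step is, up to the sign, a rotation in the plane of the good and the bad part of the state. -/
lemma den_groverOps (hU : D.Unitary) {Q q : ℕ} {l : List Op}
    (hl : ∀ o ∈ l, o.Below D Q) {p : ℝ} (hp : normSq (project q true (den D l (ket ∅))) = p)
    (α β : ℝ) :
    den D (groverOps Q q l) ((α : ℂ) • project q true (den D l (ket ∅)) +
        (β : ℂ) • project q false (den D l (ket ∅))) =
      (-1 : ℂ) • (((α * (1 - 2 * p) + 2 * β * (1 - p) : ℝ) : ℂ) • project q true (den D l (ket ∅)) +
        ((β * (1 - 2 * p) - 2 * α * p : ℝ) : ℂ) • project q false (den D l (ket ∅))) := by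
  set ψ := den D l (ket ∅) with hψ
  set g := project q true ψ with hg
  set b := project q false ψ with hb
  have hψW : ψ ∈ below Q := den_mem_below hl (ket_mem_below (by simp))
  have hgW : g ∈ below Q := project_mem_below _ _ hψW
  have hbW : b ∈ below Q := project_mem_below _ _ hψW
  have hgb : b + g = ψ := project_false_add_true q ψ
  have hn : normSq b + normSq g = 1 := by
    rw [hb, hg, normSq_project, hψ, den_normSq hU, normSq_ket]
  have hz : (Op.z q).den D ((α : ℂ) • g + (β : ℂ) • b) = (-α : ℂ) • g + (β : ℂ) • b := by
    have e1 : project q false g = 0 := by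
      rw [hg]; exact project_project_ne q false ψ
    have e2 : project q true b = 0 := by
      rw [hb]; exact project_project_ne q true ψ
    have e3 : project q true g = g := project_project q true ψ
    have e4 : project q false b = b := project_project q false ψ
    rw [den_z, project_add, project_add, project_smul, project_smul, project_smul, project_smul,
      e1, e2, e3, e4]
    module
  have hvW : (-α : ℂ) • g + (β : ℂ) • b ∈ below Q :=
    Submodule.add_mem _ (Submodule.smul_mem _ _ hgW) (Submodule.smul_mem _ _ hbW)
  have hdot : dot ψ ((-α : ℂ) • g + (β : ℂ) • b) = -α * p + β * (1 - p) := by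
    have h1 : dot b g = 0 := dot_project_ne q false ψ ψ
    have h2 : dot g b = 0 := dot_project_ne q true ψ ψ
    rw [← hgb, dot_add_left, dot_add_right, dot_add_right, dot_smul_right, dot_smul_right,
      dot_smul_right, dot_smul_right, h1, h2, dot_self, dot_self, hp]
    have : normSq b = 1 - p := by rw [← hp]; linarith
    rw [this]
    push_cast; ring
  rw [groverOps, den_cons, hz, den_append, den_append,
    den_reflectOps hU (den_mem_below (invOps_below hl) hvW), map_sub, map_smul, den_den_invOps hU,
    ← hψ, ← dot_ket_left, ← den_adj, ← hψ, hdot, ← hgb]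
  push_cast
  module

lemma den_groverOps_iterate (hU : D.Unitary) {Q q : ℕ} {l : List Op}
    (hl : ∀ o ∈ l, o.Below D Q) {θ : ℝ}
    (hp : normSq (project q true (den D l (ket ∅))) = sin θ ^ 2) (j : ℕ) :
    ∃ α β : ℝ, (den D (groverOps Q q l))^[j] (den D l (ket ∅)) =
      ((-1 : ℂ) ^ j) • ((α : ℂ) • project q true (den D l (ket ∅)) +
        (β : ℂ) • project q false (den D l (ket ∅))) ∧
      α * sin θ = sin ((2 * j + 1) * θ) ∧ β * cos θ = cos ((2 * j + 1) * θ) := by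
  induction j with
  | zero =>
    refine ⟨1, 1, ?_, by simp, by simp⟩
    simp only [iterate_zero, id_eq, pow_zero, Complex.ofReal_one, one_smul]
    rw [add_comm, project_false_add_true]
  | succ j ih =>
    obtain ⟨α, β, h1, h2, h3⟩ := ih
    refine ⟨α * (1 - 2 * sin θ ^ 2) + 2 * β * (1 - sin θ ^ 2),
      β * (1 - 2 * sin θ ^ 2) - 2 * α * sin θ ^ 2, ?_, ?_, ?_⟩
    · rw [iterate_succ_apply', h1, map_smul, den_groverOps hU hl hp, smul_smul, ← pow_succ]
    · have e : (2 * ((j + 1 : ℕ) : ℝ) + 1) * θ = (2 * j + 1) * θ + 2 * θ := by push_cast; ring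
      rw [e, sin_add, ← h2, ← h3, sin_two_mul, cos_two_mul]
      have := sin_sq_add_cos_sq θ
      have hc : cos θ ^ 2 = 1 - sin θ ^ 2 := by linarith
      rw [hc]
      ring_nf
      rw [hc]; ring
    · have e : (2 * ((j + 1 : ℕ) : ℝ) + 1) * θ = (2 * j + 1) * θ + 2 * θ := by push_cast; ring
      rw [e, cos_add, ← h2, ← h3, sin_two_mul, cos_two_mul]
      have := sin_sq_add_cos_sq θ
      have hc : cos θ ^ 2 = 1 - sin θ ^ 2 := by linarith
      rw [hc]
      ring

/-- The probability of a good outcome after `j` steps of amplitude amplification. -/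
lemma normSq_project_grover (hU : D.Unitary) {Q q : ℕ} {l : List Op}
    (hl : ∀ o ∈ l, o.Below D Q) {φ : ℝ}
    (hp : normSq (project q true (den D l (ket ∅))) = (1 - cos φ) / 2) (j : ℕ) :
    normSq (project q true ((den D (groverOps Q q l))^[j] (den D l (ket ∅)))) =
      (1 - cos ((2 * j + 1) * φ)) / 2 := by
  have half : ∀ x : ℝ, (1 - cos x) / 2 = sin (x / 2) ^ 2 := by
    intro x
    rw [sin_sq, cos_sq]
    rw [show 2 * (x / 2) = x by ring]; ring
  rw [half] at hp
  obtain ⟨α, β, h1, h2, -⟩ := den_groverOps_iterate hU hl hp j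
  rw [h1, project_smul, project_add, project_smul, project_smul, project_project,
    show project q true (project q false (den D l (ket ∅))) = 0 from project_project_ne q true _,
    smul_zero, add_zero, normSq_smul, normSq_smul, hp, half]
  rw [show (2 * (j : ℝ) + 1) * φ / 2 = (2 * j + 1) * (φ / 2) by ring, ← h2]
  simp
  ring

/-! ### Layout of the quantum memory -/

/-- The number of qubits of the working memory: five flags, two address registers that are longer
than an address by one qubit, a data word and a feature register. -/
def Device.qubits (D : Device) : ℕ := 7 + 2 * D.addrLen + D.n + D.N

/-- The values of the integer variables that hold the layout of the memory. -/
structure Layout (D : Device) (ρ : ℕ → ℤ) : Prop where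
  h10 : ρ 10 = 0
  h11 : ρ 11 = 1
  h12 : ρ 12 = 2
  h13 : ρ 13 = 3
  h14 : ρ 14 = 4
  h17 : ρ 17 = 5
  h18 : ρ 18 = (6 + D.addrLen : ℕ)
  h19 : ρ 19 = (7 + 2 * D.addrLen : ℕ)
  h20 : ρ 20 = (7 + 2 * D.addrLen + D.n : ℕ)
  h21 : ρ 21 = D.qubits
  h22 : ρ 22 = (D.qubits + 1 : ℕ)
  h23 : ρ 23 = (D.qubits + D.qubits : ℕ)
  h24 : ρ 24 = D.addrLen
  h25 : ρ 25 = (D.addrLen + 1 : ℕ)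

lemma Layout.congr {ρ σ : ℕ → ℤ} (h : Layout D ρ) (hσ : ∀ i, 10 ≤ i → i < 26 → σ i = ρ i) :
    Layout D σ := by
  constructor <;> rw [hσ _ (by omega) (by omega)]
  exacts [h.h10, h.h11, h.h12, h.h13, h.h14, h.h17, h.h18, h.h19, h.h20, h.h21, h.h22, h.h23, h.h24,
    h.h25]

/-- The circuit of `chainOps`. -/
def chainCirc : List Item :=
  [.gate (.x ⟨21, false⟩),
    .loop 21 false [.x ⟨10, true⟩, .toffoli ⟨21, true⟩ ⟨10, true⟩ ⟨22, true⟩, .x ⟨10, true⟩]]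

/-- The circuit of `reflectOps`. -/
def reflectCirc : List Item := chainCirc ++ (.gate (.z ⟨23, false⟩) :: circInv chainCirc)

/-- The circuit of `groverOps`. -/
def groverCirc (A : List Item) : List Item :=
  .gate (.z ⟨10, false⟩) :: (circInv A ++ (reflectCirc ++ A))

lemma circOps_append (ρ : ℕ → ℤ) (l l' : List Item) :
    circOps ρ (l ++ l') = circOps ρ l ++ circOps ρ l' := by simp [circOps]

lemma circOps_cons (ρ : ℕ → ℤ) (i : Item) (l : List Item) :
    circOps ρ (i :: l) = i.ops ρ ++ circOps ρ l := by simp [circOps]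

lemma circOps_chain {ρ : ℕ → ℤ} (h : Layout D ρ) :
    circOps ρ chainCirc = chainOps D.qubits D.qubits := by
  have e1 := h.h10
  have e2 := h.h21
  have e3 := h.h22
  simp only [chainCirc, circOps, List.flatMap_cons, List.flatMap_nil, Item.ops, Atom.op, Adr.val,
    chainOps, List.append_nil, List.singleton_append, Bool.false_eq_true, if_false, if_true,
    List.map_cons, List.map_nil, Fin.isValue]
  simp [e1, e2, e3]
  congr 1

lemma circOps_reflect {ρ : ℕ → ℤ} (h : Layout D ρ) :
    circOps ρ reflectCirc = reflectOps D.qubits := by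
  rw [reflectCirc, circOps_append, circOps_cons, circOps_inv, circOps_chain h, reflectOps]
  have e3 : (ρ 23).toNat = D.qubits + D.qubits := by rw [h.h23]; rfl
  simp [Item.ops, Atom.op, Adr.val, e3]

lemma circOps_grover {ρ : ℕ → ℤ} (h : Layout D ρ) (A : List Item) :
    circOps ρ (groverCirc A) = groverOps D.qubits 0 (circOps ρ A) := by
  rw [groverCirc, circOps_cons, circOps_append, circOps_append, circOps_inv, circOps_reflect h,
    groverOps]
  have e3 := h.h10
  simp [Item.ops, Atom.op, Adr.val, e3]

/-! ### Measurement and reset -/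

/-- Reset all qubits of the working memory to `|0⟩`. -/
def resetProg : Prog :=
  .seq (.setInt 50 0) (.rep 21 (.seq (.addInt 51 10 50) (.seq (.measure 51 56)
    (.seq (.rep 56 (.gate (.x 51))) (.seq (.setInt 54 1) (.addInt 50 50 54))))))

lemma onBasis_perm_apply {f : Finset ℕ → Finset ℕ} (hf : Function.Involutive f) (v : Ket)
    (t : Finset ℕ) : (onBasis fun s => ket (f s)) v t = v (f t) := by
  induction v using Finsupp.induction_linear with
  | zero => simp
  | add f f' h h' => rw [map_add, Finsupp.add_apply, h, h', Finsupp.add_apply]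
  | single s a =>
    have hs : (Finsupp.single s a : Ket) = a • ket s := by simp [ket]
    rw [hs, map_smul, onBasis_ket, Finsupp.smul_apply, Finsupp.smul_apply, ket_apply, ket_apply]
    have : f s = t ↔ s = f t := ⟨fun h => h ▸ (hf s).symm, fun h => h ▸ hf t⟩
    simp only [this]

lemma always_reset (hU : D.Unitary) {s : State} {b : ℕ} (hs : Short b s.int)
    (hl : Layout D s.int) (hpsi : s.psi ∈ below D.qubits) :
    Always D s resetProg fun t => (∃ a : ℂ, t.psi = a • ket ∅) ∧ IntFrame s t ∧ t.real = s.real ∧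
      t.time ≤ s.time + (1 + b + D.qubits * (13 * b)) := by
  have hb1 : 1 ≤ b := (one_le_intCost _).trans (hs 0 (by omega))
  have h0 : Det D s (.setInt 50 0) fun t => t = (s.putInt 50 0).tick 1 :=
    ⟨_, rfl, by simp⟩
  refine Always.det_seq h0 fun t0 ht0 => ?_
  have h21 : t0.int 21 = D.qubits := by
    rw [ht0]; simp [State.tick, State.putInt, hl.h21]
  have hcost : ∀ k : ℕ, k ≤ D.qubits → intCost (k : ℤ) ≤ b := fun k hk => by
    have := hs 21 (by omega)
    rw [hl.h21] at this
    exact (intCost_le (by omega)).trans this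
  refine Always.mono (always_rep (D := D) hU (s := t0) (i := 21) (fun k t =>
    t.psi ∈ below D.qubits ∧ (∀ u, t.psi u ≠ 0 → ∀ q ∈ u, k ≤ q) ∧ IntFrame s t ∧
    t.real = s.real ∧ t.int 50 = k ∧ t.time ≤ s.time + (1 + b + k * (13 * b))) ?_ ?_) ?_
  · refine ⟨by simpa [ht0, State.tick, State.putInt] using hpsi, by simp, ?_, ?_, ?_, ?_⟩
    · intro i hi
      have : i ≠ 50 := by omega
      simp [ht0, State.tick, State.putInt, this]
    · simp [ht0, State.tick, State.putInt]
    · simp [ht0, State.tick, State.putInt]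
    · rw [h21]
      have := hcost D.qubits le_rfl
      simp [ht0, State.tick, State.putInt]; omega
  · intro k hk t ht
    rw [h21] at hk
    obtain ⟨i1, i2, i3, i4, i5, i6⟩ := ht
    have hkQ : k < D.qubits := by omega
    have hck := hcost k hkQ.le
    have h10 : t.int 10 = 0 := (i3 10 (by omega)).trans hl.h10
    have d1 : Det D (t.tick 1) (.addInt 51 10 50) fun r => r.int 51 = k ∧ r.int 50 = k ∧
        IntFrame s r ∧ r.real = s.real ∧ r.psi = t.psi ∧ r.time ≤ t.time + (2 + b) := by
      refine ⟨_, rfl, ?_, ?_, ?_, i4, rfl, ?_⟩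
      · simp [State.tick, State.putInt, h10, i5]
      · simp [State.tick, State.putInt, i5]
      · intro i hi
        have : i ≠ 51 := by omega
        simp [State.tick, State.putInt, this, i3 i hi]
      · simp [State.tick, State.putInt, h10, i5]; omega
    refine Always.det_seq d1 fun r hr => ?_
    obtain ⟨r1, r2, r3, r4, r5, r6⟩ := hr
    have a1 : Always D r (.measure 51 56) fun u => u.int 51 = k ∧ u.int 50 = k ∧
        IntFrame s u ∧ u.real = s.real ∧ u.time ≤ t.time + (3 + b) ∧
        ((u.int 56 = 0 ∧ u.psi = project k false t.psi) ∨
          (u.int 56 = 1 ∧ u.psi = project k true t.psi)) := by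
      intro u hu _
      simp only [run, List.mem_cons, List.not_mem_nil, or_false] at hu
      have hfr : ∀ z, IntFrame s (((r.putInt 56 z).tick 1)) := by
        intro z i hi
        have : i ≠ 56 := by omega
        simp [State.tick, State.putInt, this, r3 i hi]
      rcases hu with rfl | rfl
      · refine ⟨by simp [State.tick, State.putInt, r1], by simp [State.tick, State.putInt, r2],
          hfr 0, r4, by simp [State.tick, State.putInt]; omega, Or.inl ⟨?_, ?_⟩⟩
        · simp [State.tick, State.putInt]
        · simp [State.tick, State.putInt, State.qubit, r1, r5]
      · refine ⟨by simp [State.tick, State.putInt, r1], by simp [State.tick, State.putInt, r2],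
          hfr 1, r4, by simp [State.tick, State.putInt]; omega, Or.inr ⟨?_, ?_⟩⟩
        · simp [State.tick, State.putInt]
        · simp [State.tick, State.putInt, State.qubit, r1, r5]
    refine Always.seq hU a1 fun u hu => ?_
    obtain ⟨u1, u2, u3, u4, u5, u6⟩ := hu
    have d2 : Det D u (.rep 56 (.gate (.x 51))) fun v => v.int = u.int ∧ v.real = s.real ∧
        v.time ≤ t.time + (7 + b) ∧ v.psi ∈ below D.qubits ∧
        (∀ w, v.psi w ≠ 0 → ∀ q ∈ w, k + 1 ≤ q) := by
      rcases u6 with ⟨e, hp⟩ | ⟨e, hp⟩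
      · refine ⟨u.tick (intCost 0), by simp [run, e], rfl, u4, ?_, ?_, ?_⟩
        · simp [State.tick]; omega
        · simp only [State.tick]; rw [hp]; exact project_mem_below _ _ i1
        · intro w hw q hq
          simp only [State.tick] at hw
          rw [hp, project_apply] at hw
          have hkw : k ∉ w := by
            intro h; simp [h] at hw
          rw [if_pos (by simp [hkw])] at hw
          have := i2 w hw q hq
          have : q ≠ k := fun h => hkw (h ▸ hq)
          omega
      · refine ⟨(((u.tick 2).tick 1).act (Gate.apply ((u.tick 2).tick 1).qubit (Gate.x 51))).tick 1,
          by simp [run, e], rfl, u4, ?_, ?_, ?_⟩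
        · simp [State.tick, State.act]; omega
        · have h1 : ((u.tick 2).tick 1).qubit 51 = k := by simp [State.tick, State.qubit, u1]
          simp only [State.tick, State.act] at h1 ⊢
          have : (Gate.apply (State.qubit { u with time := u.time + 2 + 1 }) (.x 51)) u.psi =
            (Op.x k).den D u.psi := by simp only [Gate.apply, Op.den, h1]
          rw [this]
          refine Op.den_mem_below (o := .x k) hkQ ?_
          rw [hp]; exact project_mem_below _ _ i1
        · have h1 : ((u.tick 2).tick 1).qubit 51 = k := by simp [State.tick, State.qubit, u1]
          simp only [State.tick, State.act] at h1 ⊢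
          have : (Gate.apply (State.qubit { u with time := u.time + 2 + 1 }) (.x 51)) u.psi =
            (onBasis fun s => ket (symmDiff s {k})) u.psi := by simp only [Gate.apply, h1]
          intro w hw q hq
          rw [this, onBasis_perm_apply (fun s => toggle_toggle s k), hp, project_apply] at hw
          have hkw : k ∈ symmDiff w {k} := by
            by_contra h; simp [h] at hw
          rw [if_pos (by simp [hkw])] at hw
          rw [mem_toggle_self] at hkw
          have hqk : q ≠ k := fun h => hkw (h ▸ hq)
          have := i2 _ hw q ((mem_toggle hqk).2 hq)
          omega
    refine Always.det_seq d2 fun v hv => ?_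
    obtain ⟨v1, v2, v3, v4, v5⟩ := hv
    refine Det.always ⟨_, rfl, v4, v5, ?_, v2, ?_, ?_⟩
    · intro i hi
      have : i ≠ 50 ∧ i ≠ 54 := by omega
      simp [State.tick, State.putInt, this, v1, u3 i hi]
    · simp [State.tick, State.putInt, v1, u2]
    · simp [State.tick, State.putInt, v1, u2]
      nlinarith
  · rintro t ⟨i1, i2, i3, i4, i5, i6⟩
    rw [h21] at i2 i6
    refine ⟨⟨t.psi ∅, ?_⟩, i3, i4, i6⟩
    ext u
    rw [Finsupp.smul_apply, ket_apply]
    by_cases hu : (∅ : Finset ℕ) = u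
    · subst hu; simp
    · rw [if_neg hu, smul_zero]
      by_contra hne
      obtain ⟨q, hq⟩ := nonempty_iff_ne_empty.2 (Ne.symm hu)
      have h1 := i2 u hne q hq
      have h2 := mem_range.1 ((mem_below.1 i1) u hne hq)
      simp at h1; omega

/-- Add the outcome of the measurement of the flag to the counter, and reset the memory. -/
def countReset : Prog := .seq (.cast 49 55) (.seq (.arith .add 12 12 49) resetProg)

/-- Prepare the state, amplify it as often as the integer variable `60` says, measure the flag, count
the outcome in the real variable `12`, and reset the memory. -/
def shot (A : List Item) : Prog :=
  .seq (circProg A) (.seq (.rep 60 (circProg (groverCirc A))) (.seq (.measure 10 55) countReset))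

/-- The variables after a number of shots: all but the counter are unchanged. -/
def SameButCount (s t : State) : Prop :=
  (∃ a : ℂ, t.psi = a • ket ∅) ∧ IntFrame s t ∧ ∀ r < 49, r ≠ 12 → t.real r = s.real r

/-- A bound for the running time of a shot. -/
def shotCost (D : Device) (b : ℕ) (ρ : ℕ → ℤ) (A : List Item) (j : ℕ) : ℕ :=
  circCost D b ρ A + j * (1 + circCost D b ρ (groverCirc A)) + (13 * D.qubits + 7) * b

lemma always_countReset (hU : D.Unitary) {s : State} {b : ℕ} (hs : Short b s.int)
    (hl : Layout D s.int) (hpsi : s.psi ∈ below D.qubits) (h55 : s.int 55 = 0 ∨ s.int 55 = 1) :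
    Always D s countReset fun t => SameButCount s t ∧ t.real 12 = s.real 12 + s.int 55 ∧
      t.time ≤ s.time + (4 + b + D.qubits * (13 * b)) := by
  have d : Det D s (.seq (.cast 49 55) (.arith .add 12 12 49)) fun t => t.psi = s.psi ∧
      t.int = s.int ∧ (∀ r < 49, r ≠ 12 → t.real r = s.real r) ∧
      t.real 12 = s.real 12 + s.int 55 ∧ t.time ≤ s.time + 3 := by
    refine ⟨_, rfl, rfl, rfl, ?_, ?_, ?_⟩
    · intro r hr hr'
      simp [State.tick, State.putReal, hr', hr.ne]
    · simp [State.tick, State.putReal, BinOp.eval]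
    · rcases h55 with h | h <;> simp [State.tick, State.putReal, h]
  obtain ⟨t, ht, t1, t2, t3, t4, t5⟩ := d
  have hrew : run D countReset s = run D resetProg t := by
    simp only [run, List.flatMap_singleton, List.cons.injEq, and_true] at ht
    simp only [countReset, run, List.flatMap_singleton, ht]
  intro u hu hz
  rw [hrew] at hu
  obtain ⟨u1, u2, u3, u4⟩ := always_reset hU (s := t) (b := b) (by rw [t2]; exact hs)
    (by rw [t2]; exact hl) (by rw [t1]; exact hpsi) u hu hz
  refine ⟨⟨u1, fun i hi => by rw [u2 i hi, t2], fun r hr hr' => by rw [u3, t3 r hr hr']⟩,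
    by rw [u3, t4], by omega⟩

/-- The state in which a shot or a number of shots can be carried out. -/
structure Ready (D : Device) (b : ℕ) (A : List Item) (s : State) : Prop where
  short : Short b s.int
  layout : Layout D s.int
  psi : ∃ a : ℂ, s.psi = a • ket ∅
  below : ∀ o ∈ circOps s.int A, o.Below D D.qubits
  iter : intCost (s.int 60) ≤ b

/-- The probability that a shot counts. -/
noncomputable def shotProb (D : Device) (ρ : ℕ → ℤ) (A : List Item) : ℝ :=
  normSq (project 0 true ((den D (groverOps D.qubits 0 (circOps ρ A)))^[(ρ 60).toNat]
    (den D (circOps ρ A) (ket ∅))))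

lemma Ready.of_same {b : ℕ} {A : List Item} {s t : State} (h : Ready D b A s)
    (hst : SameButCount s t) : Ready D b A t where
  short := hst.2.1.short h.short
  layout := h.layout.congr fun i _ hi => hst.2.1 i (Or.inl (by omega))
  psi := hst.1
  below := by
    rw [circOps_congr fun i hi => hst.2.1 i (Or.inl hi)]
    exact h.below
  iter := by rw [hst.2.1 60 (by omega)]; exact h.iter

lemma shotProb_congr {ρ σ : ℕ → ℤ} (h : ∀ i < 50, ρ i = σ i) (h60 : ρ 60 = σ 60)
    (A : List Item) : shotProb D ρ A = shotProb D σ A := by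
  unfold shotProb
  rw [circOps_congr h, h60]

lemma iterate_smul (V : Ket →ₗ[ℂ] Ket) (n : ℕ) (a : ℂ) (v : Ket) : V^[n] (a • v) = a • V^[n] v := by
  induction n generalizing v with
  | zero => rfl
  | succ n ih => rw [iterate_succ_apply, map_smul, ih, iterate_succ_apply]

lemma normSq_iterate (hU : D.Unitary) (l : List Op) (n : ℕ) (v : Ket) :
    normSq ((den D l)^[n] v) = normSq v := by
  induction n generalizing v with
  | zero => rfl
  | succ n ih => rw [iterate_succ_apply, ih, den_normSq hU]

lemma run_shot (hU : D.Unitary) {b : ℕ} {A : List Item} {s : State}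
    (h : Ready D b A s) : ∃ t0 t1 : State, run D (shot A) s = run D countReset t0 ++
      run D countReset t1 ∧ (∀ t, t = t0 ∨ t = t1 → t.psi ∈ below D.qubits ∧ IntFrame s t ∧
        t.real = s.real ∧ t.time ≤ s.time + (circCost D b s.int A + b +
          (s.int 60).toNat * (1 + circCost D b s.int (groverCirc A)) + 1)) ∧
      t0.int 55 = 0 ∧ t1.int 55 = 1 ∧
      normSq t0.psi = normSq s.psi * (1 - shotProb D s.int A) ∧
      normSq t1.psi = normSq s.psi * shotProb D s.int A := by
  obtain ⟨a, ha⟩ := h.psi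
  have main : Det D s (.seq (circProg A) (.rep 60 (circProg (groverCirc A)))) fun t =>
      t.psi = (den D (groverOps D.qubits 0 (circOps s.int A)))^[(s.int 60).toNat]
        (den D (circOps s.int A) s.psi) ∧ IntFrame s t ∧ t.real = s.real ∧
      t.time ≤ s.time + (circCost D b s.int A + b +
          (s.int 60).toNat * (1 + circCost D b s.int (groverCirc A))) := by
    refine (circProg_det D A h.short).seq fun t ht => ?_
    have h60 : t.int 60 = s.int 60 := ht.2.1 60 (by omega)
    refine (det_rep (D := D) (fun k r =>
      r.psi = (den D (groverOps D.qubits 0 (circOps s.int A)))^[k]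
        (den D (circOps s.int A) s.psi) ∧ IntFrame s r ∧ r.real = s.real ∧
      r.time ≤ s.time + (circCost D b s.int A + b +
          k * (1 + circCost D b s.int (groverCirc A)))) ?_ ?_).mono ?_
    · refine ⟨ht.1, ht.2.1, ht.2.2.1, ?_⟩
      have h1 := ht.2.2.2
      have h2 := h.iter
      rw [h60]
      simp only [State.tick]; omega
    · intro k hk r hr
      have hc : ∀ i < 50, (r.tick 1).int i = s.int i := fun i hi => hr.2.1 i (Or.inl hi)
      refine (circProg_det D (groverCirc A) (s := r.tick 1) (b := b)
        (hr.2.1.short h.short)).mono fun u hu => ?_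
      have hlay : Layout D (r.tick 1).int := h.layout.congr fun i _ hi => hc i (by omega)
      rw [circOps_grover hlay, circOps_congr hc, circCost_congr D b hc] at hu
      refine ⟨?_, hr.2.1.trans (show IntFrame r u from hu.2.1), hu.2.2.1.trans hr.2.2.1, ?_⟩
      · rw [iterate_succ_apply', ← hr.1, hu.1]; rfl
      · have h1 := hu.2.2.2
        have h2 := hr.2.2.2
        simp only [State.tick] at h1
        nlinarith
    · intro r hr
      rw [h60] at hr
      exact hr
  obtain ⟨t, ht, t1, t2, t3, t4⟩ := main
  have hrun : run D (shot A) s = (run D (.measure 10 55) t).flatMap (run D countReset) := by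
    have : run D (.rep 60 (circProg (groverCirc A))) =
      fun x => run D (.rep 60 (circProg (groverCirc A))) x := rfl
    simp only [shot]
    rw [show run D (.seq (circProg A) (.rep 60 (circProg (groverCirc A)))) s
      = (run D (circProg A) s).flatMap (run D (.rep 60 (circProg (groverCirc A)))) from rfl] at ht
    rw [show ∀ q, run D (.seq (circProg A) q) s = (run D (circProg A) s).flatMap (run D q) from
      fun _ => rfl]
    rw [show run D (.seq (.rep 60 (circProg (groverCirc A))) (.seq (.measure 10 55) countReset)) =
      fun x => (run D (.rep 60 (circProg (groverCirc A))) x).flatMap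
        (run D (.seq (.measure 10 55) countReset)) from rfl]
    rw [← List.flatMap_assoc, ht, List.flatMap_singleton]
    rfl
  have hq : t.qubit 10 = 0 := by
    unfold State.qubit
    rw [t2 10 (by omega), h.layout.h10]; rfl
  have hfr : ∀ z, IntFrame s ((t.putInt 55 z).tick 1) := by
    intro z i hi
    have : i ≠ 55 := by omega
    simp [State.tick, State.putInt, this, t2 i hi]
  have hW : t.psi ∈ below D.qubits := by
    have hG : ∀ v ∈ below D.qubits,
        den D (groverOps D.qubits 0 (circOps s.int A)) v ∈ below D.qubits := by
      intro v hv
      rw [groverOps, den_cons, den_append, den_append]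
      have h1 : (Op.z 0).den D v ∈ below D.qubits := Op.den_mem_below (o := .z 0) trivial hv
      have h2 := den_mem_below (invOps_below h.below) h1
      rw [den_reflectOps hU h2]
      refine den_mem_below h.below (Submodule.sub_mem _ h2 (Submodule.smul_mem _ _ ?_))
      exact ket_mem_below (by simp)
    have hI : ∀ n, ∀ v ∈ below D.qubits,
        (den D (groverOps D.qubits 0 (circOps s.int A)))^[n] v ∈ below D.qubits := by
      intro n
      induction n with
      | zero => exact fun v hv => hv
      | succ n ih => exact fun v hv => by rw [iterate_succ_apply]; exact ih _ (hG v hv)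
    rw [t1]
    refine hI _ _ (den_mem_below h.below ?_)
    rw [ha]
    exact Submodule.smul_mem _ _ (ket_mem_below (by simp))
  have hn1 : normSq (project 0 true t.psi) = normSq s.psi * shotProb D s.int A := by
    rw [t1, ha, map_smul, iterate_smul, project_smul, normSq_smul, normSq_smul, normSq_ket, mul_one]
    rfl
  have hn : normSq t.psi = normSq s.psi := by
    rw [t1, normSq_iterate hU, den_normSq hU]
  have hn0 : normSq (project 0 false t.psi) = normSq s.psi * (1 - shotProb D s.int A) := by
    have := normSq_project 0 t.psi
    rw [hn1, hn] at this
    linarith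
  refine ⟨(({ t with psi := project (t.qubit 10) false t.psi } : State).putInt 55 0).tick 1,
    (({ t with psi := project (t.qubit 10) true t.psi } : State).putInt 55 1).tick 1,
    ?_, ?_, ?_, ?_, ?_, ?_⟩
  · rw [hrun]
    simp only [run, List.flatMap_cons, List.flatMap_nil, List.append_nil]
  · rintro u (rfl | rfl)
    · refine ⟨?_, hfr 0, t3, ?_⟩
      · exact project_mem_below _ _ hW
      · simp only [State.tick, State.putInt]; omega
    · refine ⟨?_, hfr 1, t3, ?_⟩
      · exact project_mem_below _ _ hW
      · simp only [State.tick, State.putInt]; omega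
  · simp [State.tick, State.putInt]
  · simp [State.tick, State.putInt]
  · simp only [State.tick, State.putInt, hq]; exact hn0
  · simp only [State.tick, State.putInt, hq]; exact hn1

lemma always_shot (hU : D.Unitary) {b : ℕ} {A : List Item} {s : State}
    (h : Ready D b A s) : Always D s (shot A) fun t => SameButCount s t ∧
      (t.real 12 = s.real 12 ∨ t.real 12 = s.real 12 + 1) ∧
      (shotProb D s.int A = 0 → t.real 12 = s.real 12) ∧
      t.time ≤ s.time + shotCost D b s.int A (s.int 60).toNat := by
  obtain ⟨t0, t1, hrun, hall, h0, h1, n0, n1⟩ := run_shot hU h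
  have hb1 : 1 ≤ b := (one_le_intCost _).trans (h.short 0 (by omega))
  have key : ∀ u, u = t0 ∨ u = t1 → (u.int 55 = 0 ∨ u.int 55 = 1) →
      ∀ t ∈ run D countReset u, t.psi ≠ 0 → SameButCount s t ∧
        t.real 12 = s.real 12 + u.int 55 ∧
        t.time ≤ s.time + shotCost D b s.int A (s.int 60).toNat := by
    intro u hu hu' t ht hz
    obtain ⟨w, i, r, tm⟩ := hall u hu
    obtain ⟨⟨c1, c2, c3⟩, c4, c5⟩ := always_countReset hU (b := b) (i.short h.short)
      (h.layout.congr fun j _ hj => i j (Or.inl (by omega))) w hu' t ht hz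
    rw [r] at c3 c4
    refine ⟨⟨c1, i.trans c2, c3⟩, c4, ?_⟩
    unfold shotCost
    nlinarith
  intro t ht hz
  rw [hrun, List.mem_append] at ht
  rcases ht with ht | ht
  · obtain ⟨k1, k2, k3⟩ := key t0 (Or.inl rfl) (Or.inl h0) t ht hz
    rw [h0, Int.cast_zero, add_zero] at k2
    exact ⟨k1, Or.inl k2, fun _ => k2, k3⟩
  · obtain ⟨k1, k2, k3⟩ := key t1 (Or.inr rfl) (Or.inr h1) t ht hz
    rw [h1, Int.cast_one] at k2
    refine ⟨k1, Or.inr k2, fun hp => ?_, k3⟩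
    rw [hp, mul_zero, normSq_eq_zero] at n1
    exact absurd (psi_eq_zero_of_run hU n1 ht) hz

lemma wsum_shot (hU : D.Unitary) {b : ℕ} {A : List Item} {s : State}
    (h : Ready D b A s) (F : ℝ → ℝ) : wsum (run D (shot A) s) (fun t => F (t.real 12)) =
      normSq s.psi * ((1 - shotProb D s.int A) * F (s.real 12) +
        shotProb D s.int A * F (s.real 12 + 1)) := by
  obtain ⟨t0, t1, hrun, hall, h0, h1, n0, n1⟩ := run_shot hU h
  have key : ∀ u, u = t0 ∨ u = t1 → (u.int 55 = 0 ∨ u.int 55 = 1) →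
      wsum (run D countReset u) (fun t => F (t.real 12)) =
        normSq u.psi * F (s.real 12 + u.int 55) := by
    intro u hu hu'
    obtain ⟨w, i, r, -⟩ := hall u hu
    refine Always.wsum_eq hU ((always_countReset hU (b := b) (i.short h.short)
      (h.layout.congr fun j _ hj => i j (Or.inl (by omega))) w hu').mono fun t ht => ?_)
    rw [ht.2.1, r]
  rw [hrun, wsum_append, key t0 (Or.inl rfl) (Or.inl h0), key t1 (Or.inr rfl) (Or.inr h1), n0, n1,
    h0, h1]
  push_cast
  rw [add_zero]
  ring

lemma shotProb_nonneg (D : Device) (ρ : ℕ → ℤ) (A : List Item) : 0 ≤ shotProb D ρ A :=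
  normSq_nonneg _

lemma shotProb_le_one (hU : D.Unitary) (ρ : ℕ → ℤ) (A : List Item) :
    shotProb D ρ A ≤ 1 := by
  have h1 := normSq_project 0 ((den D (groverOps D.qubits 0 (circOps ρ A)))^[(ρ 60).toNat]
    (den D (circOps ρ A) (ket ∅)))
  rw [normSq_iterate hU, den_normSq hU, normSq_ket] at h1
  have h2 := normSq_nonneg (project 0 false ((den D (groverOps D.qubits 0 (circOps ρ A)))^[(ρ 60).toNat]
    (den D (circOps ρ A) (ket ∅))))
  unfold shotProb
  linarith

/-- Carry out as many shots as the integer variable `61` says. -/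
def shots (A : List Item) : Prog := .rep 61 (shot A)

lemma always_shots (hU : D.Unitary) {b : ℕ} {A : List Item} {s : State}
    (h : Ready D b A s) : Always D s (shots A) fun t => SameButCount s t ∧
      (s.real 12 ≤ t.real 12 ∧ t.real 12 ≤ s.real 12 + (s.int 61).toNat) ∧
      (shotProb D s.int A = 0 → t.real 12 = s.real 12) ∧
      t.time ≤ s.time + (intCost (s.int 61) + (s.int 61).toNat *
        (1 + shotCost D b s.int A (s.int 60).toNat)) := by
  refine always_rep hU (fun k t => SameButCount s t ∧
      (s.real 12 ≤ t.real 12 ∧ t.real 12 ≤ s.real 12 + k) ∧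
      (shotProb D s.int A = 0 → t.real 12 = s.real 12) ∧
      t.time ≤ s.time + (intCost (s.int 61) + k *
        (1 + shotCost D b s.int A (s.int 60).toNat))) ?_ ?_
  · refine ⟨⟨h.psi, fun i _ => rfl, fun r _ _ => rfl⟩, ⟨le_rfl, by simp [State.tick]⟩,
      fun _ => rfl, by simp [State.tick]⟩
  · intro k hk t ht
    obtain ⟨i1, i2, i3, i4⟩ := ht
    have hr : Ready D b A (t.tick 1) := h.of_same i1
    have h50 : ∀ i < 50, (t.tick 1).int i = s.int i := fun i hi => i1.2.1 i (Or.inl hi)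
    have h60 : (t.tick 1).int 60 = s.int 60 := i1.2.1 60 (by omega)
    refine (always_shot hU hr).mono fun u hu => ?_
    rw [shotProb_congr h50 h60] at hu
    obtain ⟨u1, u2, u3, u4⟩ := hu
    have hcost : shotCost D b (t.tick 1).int A ((t.tick 1).int 60).toNat =
        shotCost D b s.int A (s.int 60).toNat := by
      unfold shotCost
      rw [circCost_congr D b h50, circCost_congr D b h50, h60]
    rw [hcost] at u4
    simp only [State.tick] at u2 u3 u4
    refine ⟨⟨u1.1, i1.2.1.trans (show IntFrame t u from u1.2.1), fun r hr hr' =>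
      (u1.2.2 r hr hr').trans (i1.2.2 r hr hr')⟩, ?_, ?_, ?_⟩
    · push_cast
      rcases u2 with h | h <;> rw [h] <;> constructor <;> linarith [i2.1, i2.2]
    · intro hp
      rw [u3 hp, i3 hp]
    · nlinarith

lemma one_sub_add_mul_exp_le {p l : ℝ} (hp : 0 ≤ p) (hp1 : p ≤ 1) (hl : |l| ≤ 1) :
    1 - p + p * exp l ≤ exp (p * l + l ^ 2) := by
  have h1 : exp l ≤ 1 + l + l ^ 2 := by
    have := abs_le.1 (abs_exp_sub_one_sub_id_le hl)
    linarith [this.2]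
  have h2 := add_one_le_exp (p * l + l ^ 2)
  nlinarith [mul_le_mul_of_nonneg_left h1 hp, sq_nonneg l]

/-- Exponential moments of the number of counted shots. -/
lemma wsum_exp_shots (hU : D.Unitary) {b : ℕ} {A : List Item} {s : State}
    (h : Ready D b A s) {l : ℝ} (hl : |l| ≤ 1) :
    wsum (run D (shots A) s) (fun t => exp (l * t.real 12)) ≤
      normSq s.psi * exp (l * s.real 12 + (s.int 61).toNat *
        (shotProb D s.int A * l + l ^ 2)) := by
  have hexp := one_sub_add_mul_exp_le (shotProb_nonneg D s.int A) (shotProb_le_one hU s.int A) hl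
  have := wsum_rep_le hU (s := s) (i := 61) (p := shot A) (fun t => exp (l * t.real 12))
    (ρ := exp (shotProb D s.int A * l + l ^ 2)) (exp_pos _).le
    (fun _ t => SameButCount s t) ⟨h.psi, fun i _ => rfl, fun r _ _ => rfl⟩ ?_ ?_
  · refine this.trans (le_of_eq ?_)
    rw [← exp_nat_mul, exp_add]
    simp only [State.tick]
    ring
  · intro k _ t i1
    have hr : Ready D b A (t.tick 1) := h.of_same i1
    refine (always_shot hU hr).mono fun u hu => ?_
    obtain ⟨u1, -⟩ := hu
    exact ⟨u1.1, i1.2.1.trans (show IntFrame t u from u1.2.1), fun r hr hr' =>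
      (u1.2.2 r hr hr').trans (i1.2.2 r hr hr')⟩
  · intro k _ t i1
    have hr : Ready D b A (t.tick 1) := h.of_same i1
    have h50 : ∀ i < 50, (t.tick 1).int i = s.int i := fun i hi => i1.2.1 i (Or.inl hi)
    have h60 : (t.tick 1).int 60 = s.int 60 := i1.2.1 60 (by omega)
    rw [wsum_shot hU hr (fun x => exp (l * x)), shotProb_congr h50 h60]
    simp only [State.tick]
    refine mul_le_mul_of_nonneg_left ?_ (normSq_nonneg _)
    rw [mul_add, mul_one, exp_add]
    calc _ = exp (l * t.real 12) * (1 - shotProb D s.int A +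
          shotProb D s.int A * exp l) := by ring
      _ ≤ exp (l * t.real 12) * exp (shotProb D s.int A * l + l ^ 2) :=
          mul_le_mul_of_nonneg_left hexp (exp_pos _).le
      _ = _ := by ring

/-- The relative frequency of counted shots is close to their probability. -/
lemma err_shots (hU : D.Unitary) {b : ℕ} {A : List Item} {s : State}
    (h : Ready D b A s) {κ : ℝ} (hκ : 0 < κ) (hκ1 : κ ≤ 2) :
    Err D s (shots A) (2 * exp (-((s.int 61).toNat * κ ^ 2 / 4)))
      (fun t => |t.real 12 - s.real 12 - (s.int 61).toNat * shotProb D s.int A| ≤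
        κ * (s.int 61).toNat) := by
  classical
  set S : ℝ := ((s.int 61).toNat : ℝ) with hS
  set p := shotProb D s.int A with hp
  have hS0 : 0 ≤ S := Nat.cast_nonneg _
  unfold Err
  rw [prob_eq_wsum]
  have h1 := wsum_exp_shots hU h (l := κ / 2) (by rw [abs_of_pos (by positivity)]; linarith)
  have h2 := wsum_exp_shots hU h (l := -(κ / 2))
    (by rw [abs_neg, abs_of_pos (by positivity)]; linarith)
  have hle : wsum (run D (shots A) s) (fun t => if ¬ |t.real 12 - s.real 12 - S * p| ≤ κ * S
        then 1 else 0) ≤ wsum (run D (shots A) s) (fun t =>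
      exp (-(κ / 2) * (s.real 12 + S * p + κ * S)) * exp (κ / 2 * t.real 12) +
      exp (κ / 2 * (s.real 12 + S * p - κ * S)) * exp (-(κ / 2) * t.real 12)) := by
    refine wsum_mono fun t _ _ => ?_
    rw [← exp_add, ← exp_add]
    split_ifs with hc
    · positivity
    · rw [not_le, lt_abs] at hc
      rcases hc with hc | hc
      · refine le_trans ?_ (le_add_of_nonneg_right (exp_pos _).le)
        rw [← exp_zero]
        refine exp_le_exp.2 ?_
        nlinarith
      · refine le_trans ?_ (le_add_of_nonneg_left (exp_pos _).le)
        rw [← exp_zero]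
        refine exp_le_exp.2 ?_
        nlinarith
  refine hle.trans ?_
  rw [wsum_add, wsum_const_mul, wsum_const_mul]
  have g1 := mul_le_mul_of_nonneg_left h1
    (exp_pos (-(κ / 2) * (s.real 12 + S * p + κ * S))).le
  have g2 := mul_le_mul_of_nonneg_left h2
    (exp_pos (κ / 2 * (s.real 12 + S * p - κ * S))).le
  refine (add_le_add g1 g2).trans (le_of_eq ?_)
  have e1 : ∀ a x y : ℝ, exp x * (a * exp y) = a * exp (x + y) := by
    intro a x y; rw [exp_add]; ring
  rw [e1, e1, ← hS, ← hp]
  rw [show -(κ / 2) * (s.real 12 + S * p + κ * S) + (κ / 2 * s.real 12 + S * (p * (κ / 2) + (κ / 2) ^ 2))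
    = -(S * κ ^ 2 / 4) by ring]
  rw [show κ / 2 * (s.real 12 + S * p - κ * S) + (-(κ / 2) * s.real 12 +
    S * (p * -(κ / 2) + (-(κ / 2)) ^ 2)) = -(S * κ ^ 2 / 4) by ring]
  ring

/-! ### Basis states by registers -/

/-- The basis state with flags `F`, contents `t` and `t'` of the address registers (sets of positions
of binary digits), data word `w` and content `z` of the feature register. -/
def Device.enc (D : Device) (F t t' : Finset ℕ) (w : Bits D.n) (z : Bits D.N) : Finset ℕ :=
  (range D.qubits).filter fun q =>
    if q < 5 then q ∈ F else if q < 6 + D.addrLen then q - 5 ∈ t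
    else if q < 7 + 2 * D.addrLen then q - (6 + D.addrLen) ∈ t'
    else if h : 7 + 2 * D.addrLen ≤ q ∧ q < 7 + 2 * D.addrLen + D.n then
      w ⟨q - (7 + 2 * D.addrLen), by omega⟩ = true
    else if h : 7 + 2 * D.addrLen + D.n ≤ q ∧ q < 7 + 2 * D.addrLen + D.n + D.N then
      z ⟨q - (7 + 2 * D.addrLen + D.n), by omega⟩ = true
    else False

section

variable {F t t' : Finset ℕ} {w : Bits D.n} {z : Bits D.N}

lemma enc_below : D.enc F t t' w z ⊆ range D.qubits := filter_subset _ _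

lemma mem_enc_flag {q : ℕ} (hq : q < 5) : q ∈ D.enc F t t' w z ↔ q ∈ F := by
  unfold Device.enc
  rw [mem_filter, if_pos hq]
  simp only [Device.qubits, mem_range, and_iff_right_iff_imp]
  omega

lemma mem_enc_left {k : ℕ} (hk : k ≤ D.addrLen) : 5 + k ∈ D.enc F t t' w z ↔ k ∈ t := by
  unfold Device.enc
  rw [mem_filter, if_neg (by omega), if_pos (by omega)]
  simp only [Device.qubits, mem_range, Nat.add_sub_cancel_left, and_iff_right_iff_imp]
  omega

lemma mem_enc_right {k : ℕ} (hk : k ≤ D.addrLen) :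
    6 + D.addrLen + k ∈ D.enc F t t' w z ↔ k ∈ t' := by
  unfold Device.enc
  rw [mem_filter, if_neg (by omega), if_neg (by omega), if_pos (by omega)]
  simp only [Device.qubits, mem_range, Nat.add_sub_cancel_left, and_iff_right_iff_imp]
  omega

lemma mem_enc_word (k : Fin D.n) :
    7 + 2 * D.addrLen + (k : ℕ) ∈ D.enc F t t' w z ↔ w k = true := by
  unfold Device.enc
  have := k.2
  rw [mem_filter, if_neg (by omega), if_neg (by omega), if_neg (by omega),
    dif_pos ⟨by omega, by omega⟩]
  simp only [Device.qubits, mem_range, Nat.add_sub_cancel_left, Fin.eta,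
    and_iff_right_iff_imp]
  omega

lemma mem_enc_feature (k : Fin D.N) :
    7 + 2 * D.addrLen + D.n + (k : ℕ) ∈ D.enc F t t' w z ↔ z k = true := by
  unfold Device.enc
  have := k.2
  rw [mem_filter, if_neg (by omega), if_neg (by omega), if_neg (by omega),
    dif_neg (by omega), dif_pos ⟨by omega, by omega⟩]
  simp only [Device.qubits, mem_range, Nat.add_sub_cancel_left, Fin.eta,
    and_iff_right_iff_imp]
  omega

lemma eq_enc {s : Finset ℕ} (hs : ∀ q ∈ s, q < D.qubits) (h1 : ∀ q < 5, (q ∈ s ↔ q ∈ F))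
    (h2 : ∀ k ≤ D.addrLen, (5 + k ∈ s ↔ k ∈ t))
    (h3 : ∀ k ≤ D.addrLen, (6 + D.addrLen + k ∈ s ↔ k ∈ t'))
    (h4 : ∀ k : Fin D.n, (7 + 2 * D.addrLen + (k : ℕ) ∈ s ↔ w k = true))
    (h5 : ∀ k : Fin D.N, (7 + 2 * D.addrLen + D.n + (k : ℕ) ∈ s ↔ z k = true)) :
    s = D.enc F t t' w z := by
  ext q
  by_cases hq : q < D.qubits
  · by_cases c1 : q < 5
    · rw [h1 q c1, mem_enc_flag c1]
    by_cases c2 : q < 6 + D.addrLen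
    · obtain ⟨k, rfl⟩ := Nat.exists_eq_add_of_le (show 5 ≤ q by omega)
      rw [h2 k (by omega), mem_enc_left (by omega)]
    by_cases c3 : q < 7 + 2 * D.addrLen
    · obtain ⟨k, rfl⟩ := Nat.exists_eq_add_of_le (show 6 + D.addrLen ≤ q by omega)
      rw [h3 k (by omega), mem_enc_right (by omega)]
    by_cases c4 : q < 7 + 2 * D.addrLen + D.n
    · obtain ⟨k, rfl⟩ := Nat.exists_eq_add_of_le (show 7 + 2 * D.addrLen ≤ q by omega)
      exact (h4 ⟨k, by omega⟩).trans (mem_enc_word ⟨k, by omega⟩).symm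
    · obtain ⟨k, rfl⟩ := Nat.exists_eq_add_of_le (show 7 + 2 * D.addrLen + D.n ≤ q by omega)
      have hk : k < D.N := by unfold Device.qubits at hq; omega
      exact (h5 ⟨k, hk⟩).trans (mem_enc_feature ⟨k, hk⟩).symm
  · constructor
    · intro h; exact absurd (hs q h) hq
    · intro h; exact absurd (mem_range.1 (enc_below h)) hq

lemma lt_of_mem_enc : ∀ q ∈ D.enc F t t' w z, q < D.qubits := fun _ h =>
  mem_range.1 (enc_below h)

lemma enc_inj {F₂ t₂ t₂' : Finset ℕ} {w₂ : Bits D.n} {z₂ : Bits D.N}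
    (hF : F ⊆ range 5) (hF₂ : F₂ ⊆ range 5)
    (ht : t ⊆ range (D.addrLen + 1)) (ht₂ : t₂ ⊆ range (D.addrLen + 1))
    (ht' : t' ⊆ range (D.addrLen + 1)) (ht₂' : t₂' ⊆ range (D.addrLen + 1)) :
    D.enc F t t' w z = D.enc F₂ t₂ t₂' w₂ z₂ ↔ F = F₂ ∧ t = t₂ ∧ t' = t₂' ∧ w = w₂ ∧ z = z₂ := by
  have key : ∀ {A B : Finset ℕ} {m : ℕ}, A ⊆ range m → B ⊆ range m →
      (∀ k < m, (k ∈ A ↔ k ∈ B)) → A = B := by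
    intro A B m hA hB h
    ext k
    exact ⟨fun hk => (h k (mem_range.1 (hA hk))).1 hk,
      fun hk => (h k (mem_range.1 (hB hk))).2 hk⟩
  constructor
  · intro h
    refine ⟨key hF hF₂ fun k hk => ?_, key ht ht₂ fun k hk => ?_, key ht' ht₂' fun k hk => ?_, ?_, ?_⟩
    · rw [← mem_enc_flag (D := D) (t := t) (t' := t') (w := w) (z := z) hk, h, mem_enc_flag hk]
    · rw [← mem_enc_left (D := D) (F := F) (t' := t') (w := w) (z := z) (by omega), h,
        mem_enc_left (by omega)]
    · rw [← mem_enc_right (D := D) (F := F) (t := t) (w := w) (z := z) (by omega), h,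
        mem_enc_right (by omega)]
    · funext k
      rw [Bool.eq_iff_iff, ← mem_enc_word (D := D) (F := F) (t := t) (t' := t') (z := z), h,
        mem_enc_word]
    · funext k
      rw [Bool.eq_iff_iff, ← mem_enc_feature (D := D) (F := F) (t := t) (t' := t') (w := w), h,
        mem_enc_feature]
  · rintro ⟨rfl, rfl, rfl, rfl, rfl⟩; rfl

lemma enc_empty : D.enc ∅ ∅ ∅ (fun _ => false) (fun _ => false) = ∅ :=
  (eq_enc (s := ∅) (by simp) (by simp) (by simp) (by simp) (by simp) (by simp)).symm

lemma enc_toggle_flag {q : ℕ} (hq : q < 5) :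
    symmDiff (D.enc F t t' w z) {q} = D.enc (symmDiff F {q}) t t' w z := by
  refine eq_enc ?_ ?_ ?_ ?_ ?_ ?_
  · intro r hr
    by_cases h : r = q
    · unfold Device.qubits; omega
    · exact lt_of_mem_enc r ((mem_toggle h).1 hr)
  · intro r hr
    rw [mem_symmDiff, mem_symmDiff, mem_enc_flag hr]
  · intro k hk; rw [mem_toggle (by omega), mem_enc_left hk]
  · intro k hk; rw [mem_toggle (by omega), mem_enc_right hk]
  · intro k; rw [mem_toggle (by omega), mem_enc_word]
  · intro k; rw [mem_toggle (by omega), mem_enc_feature]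

lemma enc_toggle_left {l : ℕ} (hl : l ≤ D.addrLen) :
    symmDiff (D.enc F t t' w z) {5 + l} = D.enc F (symmDiff t {l}) t' w z := by
  refine eq_enc ?_ ?_ ?_ ?_ ?_ ?_
  · intro r hr
    by_cases h : r = 5 + l
    · unfold Device.qubits; omega
    · exact lt_of_mem_enc r ((mem_toggle h).1 hr)
  · intro r hr; rw [mem_toggle (by omega), mem_enc_flag hr]
  · intro k hk
    rw [mem_symmDiff, mem_symmDiff, mem_enc_left hk]; simp
  · intro k hk; rw [mem_toggle (by omega), mem_enc_right hk]
  · intro k; rw [mem_toggle (by omega), mem_enc_word]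
  · intro k; rw [mem_toggle (by omega), mem_enc_feature]

lemma enc_toggle_right {l : ℕ} (hl : l ≤ D.addrLen) :
    symmDiff (D.enc F t t' w z) {6 + D.addrLen + l} = D.enc F t (symmDiff t' {l}) w z := by
  refine eq_enc ?_ ?_ ?_ ?_ ?_ ?_
  · intro r hr
    by_cases h : r = 6 + D.addrLen + l
    · unfold Device.qubits; omega
    · exact lt_of_mem_enc r ((mem_toggle h).1 hr)
  · intro r hr; rw [mem_toggle (by omega), mem_enc_flag hr]
  · intro k hk; rw [mem_toggle (by omega), mem_enc_left hk]
  · intro k hk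
    rw [mem_symmDiff, mem_symmDiff, mem_enc_right hk]; simp
  · intro k; rw [mem_toggle (by omega), mem_enc_word]
  · intro k; rw [mem_toggle (by omega), mem_enc_feature]

/-- The number with the binary digits at the positions in `t`. -/
def digitsVal (t : Finset ℕ) : ℕ := ∑ k ∈ t, 2 ^ k

lemma sum_digitsVal {M : Type*} [AddCommMonoid M] (f : ℕ → M) (l : ℕ) :
    ∑ t ∈ (range l).powerset, f (digitsVal t) = ∑ k ∈ range (2 ^ l), f k := by
  induction l generalizing f with
  | zero => simp [digitsVal]
  | succ l ih =>
    rw [range_add_one, sum_powerset_insert (by simp), ih, pow_succ, mul_two,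
      sum_range_add, ← ih (fun k => f (2 ^ l + k))]
    congr 1
    refine sum_congr rfl fun t ht => ?_
    have : l ∉ t := fun h => by
      have := mem_range.1 ((mem_powerset.1 ht) h); omega
    rw [digitsVal, sum_insert this]; rfl

lemma readNat_enc (ht : t ⊆ range D.addrLen) :
    readNat 5 D.addrLen (D.enc F t t' w z) = digitsVal t := by
  unfold readNat digitsVal
  rw [sum_congr rfl fun (k : Fin D.addrLen) _ =>
    if_congr (mem_enc_left (F := F) (t' := t') (w := w) (z := z) k.2.le) rfl rfl]
  rw [Fin.sum_univ_eq_sum_range (fun k => if k ∈ t then 2 ^ k else 0), ← sum_filter]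
  refine sum_congr ?_ fun _ _ => rfl
  ext k
  simp only [mem_filter, mem_range, and_iff_right_iff_imp]
  exact fun hk => mem_range.1 (ht hk)

/-- Superposition of all addresses of length `l` in the first address register. -/
lemma den_hads_left {l : ℕ} (hl : l ≤ D.addrLen) :
    den D ((List.range l).map fun k => Op.had (5 + k)) (ket (D.enc F ∅ t' w z)) =
      (((1 / √2 : ℝ) : ℂ)) ^ l •
        ∑ t ∈ (range l).powerset, ket (D.enc F t t' w z) := by
  induction l with
  | zero => simp
  | succ l ih =>
    rw [List.range_succ, List.map_append, den_append, ih (by omega), map_smul, map_sum]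
    rw [range_add_one, sum_powerset_insert (by simp), ← sum_add_distrib,
      pow_succ, mul_smul, smul_sum (r := (((1 / √2 : ℝ) : ℂ)))]
    congr 1
    refine sum_congr rfl fun t ht => ?_
    have hlt : l ∉ t := fun h => by
      have := mem_range.1 ((mem_powerset.1 ht) h); omega
    have hm : 5 + l ∉ D.enc F t t' w z := by rwa [mem_enc_left (by omega)]
    simp only [List.map_cons, List.map_nil, den_cons, den_nil]
    rw [Op.den_had_ket, if_neg hm, one_smul, erase_eq_of_notMem hm]
    have e : insert (5 + l) (D.enc F t t' w z) = D.enc F (insert l t) t' w z := by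
      have h1 : insert (5 + l) (D.enc F t t' w z) = symmDiff (D.enc F t t' w z) {5 + l} := by
        ext q; by_cases h : q = 5 + l <;> simp [mem_symmDiff, h, hm]
      have h2 : insert l t = symmDiff t {l} := by
        ext q; by_cases h : q = l <;> simp [mem_symmDiff, h, hlt]
      rw [h1, h2, enc_toggle_left (by omega)]
    rw [e]

/-- Superposition of all addresses of length `l` in the second address register. -/
lemma den_hads_right {l : ℕ} (hl : l ≤ D.addrLen + 1) :
    den D ((List.range l).map fun k => Op.had (6 + D.addrLen + k)) (ket (D.enc F t ∅ w z)) =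
      (((1 / √2 : ℝ) : ℂ)) ^ l •
        ∑ t' ∈ (range l).powerset, ket (D.enc F t t' w z) := by
  induction l with
  | zero => simp
  | succ l ih =>
    rw [List.range_succ, List.map_append, den_append, ih (by omega), map_smul, map_sum]
    rw [range_add_one, sum_powerset_insert (by simp), ← sum_add_distrib,
      pow_succ, mul_smul, smul_sum (r := (((1 / √2 : ℝ) : ℂ)))]
    congr 1
    refine sum_congr rfl fun t' ht => ?_
    have hlt : l ∉ t' := fun h => by
      have := mem_range.1 ((mem_powerset.1 ht) h); omega
    have hm : 6 + D.addrLen + l ∉ D.enc F t t' w z := by rwa [mem_enc_right (by omega)]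
    simp only [List.map_cons, List.map_nil, den_cons, den_nil]
    rw [Op.den_had_ket, if_neg hm, one_smul, erase_eq_of_notMem hm]
    have e : insert (6 + D.addrLen + l) (D.enc F t t' w z) = D.enc F t (insert l t') w z := by
      have h1 : insert (6 + D.addrLen + l) (D.enc F t t' w z) =
          symmDiff (D.enc F t t' w z) {6 + D.addrLen + l} := by
        ext q; by_cases h : q = 6 + D.addrLen + l <;> simp [mem_symmDiff, h, hm]
      have h2 : insert l t' = symmDiff t' {l} := by
        ext q; by_cases h : q = l <;> simp [mem_symmDiff, h, hlt]
      rw [h1, h2, enc_toggle_right (by omega)]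
    rw [e]

/-- The query of a data word. -/
lemma den_word_enc (ht : t ⊆ range D.addrLen) :
    (Op.word 5 (7 + 2 * D.addrLen)).den D (ket (D.enc F t t' w z)) =
      ket (D.enc F t t' (fun k => xor (w k) (D.word (digitsVal t) k)) z) := by
  rw [Op.den_perm_ket D (o := .word 5 (7 + 2 * D.addrLen)) trivial]
  simp only [Op.perm]
  rw [if_pos (by unfold Apart; omega), readNat_enc ht]
  have hout : ∀ q, ¬ (7 + 2 * D.addrLen ≤ q ∧ q < 7 + 2 * D.addrLen + D.n) →
      (q ∈ xorReg (7 + 2 * D.addrLen) (D.word (digitsVal t)) (D.enc F t t' w z) ↔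
        q ∈ D.enc F t t' w z) := fun q hq => mem_xorReg hq
  congr 1
  refine eq_enc ?_ ?_ ?_ ?_ ?_ ?_
  · intro q hq
    by_cases h : 7 + 2 * D.addrLen ≤ q ∧ q < 7 + 2 * D.addrLen + D.n
    · unfold Device.qubits; omega
    · exact lt_of_mem_enc q ((hout q h).1 hq)
  · intro q hq; rw [hout q (by omega), mem_enc_flag hq]
  · intro k hk; rw [hout _ (by omega), mem_enc_left hk]
  · intro k hk; rw [hout _ (by omega), mem_enc_right hk]
  · intro k
    unfold xorReg
    rw [mem_symmDiff, mem_enc_word, mem_regSet]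
    have h : 7 + 2 * D.addrLen ≤ 7 + 2 * D.addrLen + (k : ℕ) ∧
      7 + 2 * D.addrLen + (k : ℕ) < 7 + 2 * D.addrLen + D.n := ⟨by omega, by omega⟩
    simp only [h, Nat.add_sub_cancel_left, Fin.eta, and_self, exists_true_left]
    cases w k <;> cases D.word (digitsVal t) k <;> simp
  · intro k; rw [hout _ (by omega), mem_enc_feature]

/-- The feature map of the device produces the unit vectors `φ x`. -/
def Device.HasFeature (D : Device) (φ : Bits D.n → Feature D.N) : Prop :=
  ∀ (x x' : Bits D.n) (j : Bits D.N),
    D.U (x', j) (x, fun _ => false) = if x' = x then ((φ x j : ℝ) : ℂ) else 0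

lemma den_feature_enc {φ : Bits D.n → Feature D.N} (hφ : D.HasFeature φ) :
    (Op.feature false (7 + 2 * D.addrLen) (7 + 2 * D.addrLen + D.n)).den D
      (ket (D.enc F t t' w (fun _ => false))) =
      ∑ z : Bits D.N, ((φ w z : ℝ) : ℂ) • ket (D.enc F t t' w z) := by
  have hap : Apart (7 + 2 * D.addrLen) D.n (7 + 2 * D.addrLen + D.n) D.N := Or.inl le_rfl
  have hread : read2 D.n D.N (7 + 2 * D.addrLen) (7 + 2 * D.addrLen + D.n)
      (D.enc F t t' w (fun _ => false)) = (w, fun _ => false) := by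
    unfold read2 readReg
    ext k
    · simp only [mem_enc_word]; simp
    · simp only [mem_enc_feature]; simp
  have hwrite : ∀ v z, write2 (7 + 2 * D.addrLen) (7 + 2 * D.addrLen + D.n) (v, z)
      (D.enc F t t' w (fun _ => false)) = D.enc F t t' v z := by
    intro v z
    have hout : ∀ q < 7 + 2 * D.addrLen, (q ∈ write2 (7 + 2 * D.addrLen)
        (7 + 2 * D.addrLen + D.n) (v, z) (D.enc F t t' w (fun _ => false)) ↔
        q ∈ D.enc F t t' w (fun _ => false)) := by
      intro q hq
      rw [mem_write2, dif_neg (by omega), dif_neg (by omega)]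
    refine eq_enc ?_ ?_ ?_ ?_ ?_ ?_
    · intro q hq
      rw [mem_write2] at hq
      by_contra hc
      unfold Device.qubits at hc
      rw [dif_neg (by omega), dif_neg (by omega)] at hq
      have := lt_of_mem_enc q hq
      unfold Device.qubits at this; omega
    · intro q hq; rw [hout q (by omega), mem_enc_flag hq]
    · intro k hk; rw [hout _ (by omega), mem_enc_left hk]
    · intro k hk; rw [hout _ (by omega), mem_enc_right hk]
    · intro k
      rw [mem_write2, dif_neg (by omega), dif_pos ⟨by omega, by omega⟩]
      simp
    · intro k
      rw [mem_write2, dif_pos ⟨by omega, by omega⟩]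
      simp
  simp only [Op.den, Bool.false_eq_true, if_false]
  rw [applyMatrix_ket _ hap, hread, Fintype.sum_prod_type]
  have hφ' : ∀ (v : Bits D.n) (j : Bits D.N),
      D.U (v, j) (w, fun _ => false) = if v = w then ((φ w j : ℝ) : ℂ) else 0 := hφ w
  simp only [hwrite, hφ']
  rw [sum_eq_single w]
  · simp
  · intro v _ hv; simp [hv]
  · simp

/-- The addressed data point is embedded into the feature register. -/
lemma den_embed {φ : Bits D.n → Feature D.N} (hφ : D.HasFeature φ)
    (ht : t ⊆ range D.addrLen) :
    den D [.word 5 (7 + 2 * D.addrLen), .feature false (7 + 2 * D.addrLen)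
      (7 + 2 * D.addrLen + D.n), .word 5 (7 + 2 * D.addrLen)]
      (ket (D.enc F t t' (fun _ => false) (fun _ => false))) =
      ∑ z : Bits D.N, ((φ (D.word (digitsVal t)) z : ℝ) : ℂ) •
        ket (D.enc F t t' (fun _ => false) z) := by
  simp only [den_cons, den_nil, den_word_enc ht, Bool.false_xor]
  rw [den_feature_enc hφ]
  simp only [map_sum, map_smul, den_word_enc ht, Bool.xor_self]

/-- A query for a bit that depends on the address in the first register; the target is a flag. -/
lemma den_digit_enc (ht : t ⊆ range D.addrLen) (c : Bool) (e : ℤ) {q : ℕ} (hq : q < 5) :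
    (Op.digit c e 5 q).den D (ket (D.enc F t t' w z)) =
      ket (D.enc (if binDigit (D.num c (digitsVal t)) e = true then symmDiff F {q} else F) t t' w z) := by
  rw [Op.den_perm_ket D (o := .digit c e 5 q) trivial]
  simp only [Op.perm]
  have : Apart 5 D.addrLen q 1 := Or.inr (by omega)
  rw [readNat_enc ht, enc_toggle_flag hq]
  simp only [this, true_and]
  split_ifs <;> rfl

lemma den_sign_enc (ht : t ⊆ range D.addrLen) (c : Bool) {q : ℕ} (hq : q < 5) :
    (Op.sign c 5 q).den D (ket (D.enc F t t' w z)) =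
      ket (D.enc (if decide (D.num c (digitsVal t) < 0) = true then symmDiff F {q} else F)
        t t' w z) := by
  rw [Op.den_perm_ket D (o := .sign c 5 q) trivial]
  simp only [Op.perm]
  have : Apart 5 D.addrLen q 1 := Or.inr (by omega)
  rw [readNat_enc ht, enc_toggle_flag hq]
  simp only [this, true_and]
  split_ifs <;> rfl

lemma den_x_enc {q : ℕ} (hq : q < 5) : (Op.x q).den D (ket (D.enc F t t' w z)) =
    ket (D.enc (symmDiff F {q}) t t' w z) := by
  rw [Op.den_perm_ket D (o := .x q) trivial]
  simp only [Op.perm]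
  rw [enc_toggle_flag hq]

lemma den_z_enc {q : ℕ} (hq : q < 5) : (Op.z q).den D (ket (D.enc F t t' w z)) =
    (if q ∈ F then (-1 : ℂ) else 1) • ket (D.enc F t t' w z) := by
  rw [Op.den_z_ket]
  simp only [mem_enc_flag hq]

lemma den_toffoli_enc {a b c : ℕ} (ha : a < 5) (hb : b < 5) (hc : c < 5) (hac : a ≠ c)
    (hbc : b ≠ c) : (Op.toffoli a b c).den D (ket (D.enc F t t' w z)) =
    ket (D.enc (if a ∈ F ∧ b ∈ F then symmDiff F {c} else F) t t' w z) := by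
  rw [Op.den_perm_ket D (o := .toffoli a b c) trivial]
  simp only [Op.perm, mem_enc_flag ha, mem_enc_flag hb, enc_toggle_flag hc]
  simp only [ne_eq, hac, hbc, not_false_eq_true, and_true]
  split_ifs <;> rfl

end

/-! ### The Hadamard test -/

lemma den_had (D : Device) (q : ℕ) (v : Ket) : (Op.had q).den D v =
    (((1 / √2 : ℝ) : ℂ)) • ((Op.x q).den D v + (Op.z q).den D v) := by
  have h : (Op.had q).den D =
      (((1 / √2 : ℝ) : ℂ)) • ((Op.x q).den D + (Op.z q).den D) := by
    refine ket_ext fun s => ?_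
    rw [Op.den_had_ket, LinearMap.smul_apply, LinearMap.add_apply, Op.den_z_ket,
      Op.den_perm_ket D (o := .x q) trivial]
    simp only [Op.perm]
    congr 1
    by_cases hq : q ∈ s
    · have : symmDiff s {q} = s.erase q := by
        ext r; by_cases hr : r = q <;> simp [mem_symmDiff, hr, hq]
      rw [this, insert_eq_of_mem hq]
    · have : symmDiff s {q} = insert q s := by
        ext r; by_cases hr : r = q <;> simp [mem_symmDiff, hr, hq]
      rw [this, erase_eq_of_notMem hq, if_neg hq, one_smul, one_smul, add_comm]
  rw [h]; rfl

lemma project_x (D : Device) (q : ℕ) (b : Bool) (v : Ket) :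
    project q b ((Op.x q).den D v) = (Op.x q).den D (project q (!b) v) := by
  induction v using Finsupp.induction_linear with
  | zero => simp [show ∀ b, project q b 0 = 0 from fun _ => Finsupp.filter_zero _]
  | add f g hf hg => rw [map_add, project_add, project_add, map_add, hf, hg]
  | single s a =>
    have : (Finsupp.single s a : Ket) = a • ket s := by simp [ket]
    rw [this, map_smul, project_smul, project_smul, map_smul, project_ket,
      Op.den_perm_ket D (o := .x q) trivial, project_ket]
    simp only [Op.perm, mem_toggle_self]
    by_cases h : q ∈ s <;> cases b <;> simp [h, Op.den_perm_ket D (o := .x q) trivial, Op.perm]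

/-- The probability of the outcome `1` in the Hadamard test of two states that are prepared under
the control of the qubit `q`. -/
lemma hadamard_test (hU : D.Unitary) {q : ℕ} {L : List Op} {v w : Ket}
    (hv : den D L (ket ∅) = v) (hw : den D L (ket {q}) = w)
    (h0 : project q true v = 0) (h1 : project q false w = 0) :
    normSq (project q true (den D (.had q :: (L ++ [.had q])) (ket ∅))) =
      (1 - (dot ((Op.x q).den D v) w).re) / 2 := by
  have hv0 : project q false v = v := by
    have := project_false_add_true q v
    rwa [h0, add_zero] at this
  have hw1 : project q true w = w := by
    have := project_false_add_true q w
    rwa [h1, zero_add] at this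
  have hc : (((1 / √2 : ℝ) : ℂ)) * (((1 / √2 : ℝ) : ℂ)) = ((1 / 2 : ℝ) : ℂ) := by
    rw [← Complex.ofReal_mul, div_mul_div_comm, mul_self_sqrt (by norm_num)]
    norm_num
  have e0 : project q true (den D (.had q :: (L ++ [.had q])) (ket ∅)) =
      ((1 / 2 : ℝ) : ℂ) • ((Op.x q).den D v - w) := by
    have h2 : (Op.had q).den D (ket ∅) = (((1 / √2 : ℝ) : ℂ)) • (ket ∅ + ket {q}) := by
      rw [Op.den_had_ket]; simp
    rw [den_cons, den_append, h2, map_smul, map_add, hv, hw, den_cons, den_nil, map_smul,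
      den_had, smul_smul, hc, project_smul]
    congr 1
    simp only [map_add, project_add, project_x, den_z, hv0, hw1, h0, h1, Bool.not_true, map_zero,
      sub_zero, zero_sub]
    have : project q true (-w) = -w := by
      have := project_smul q true (-1) w
      rw [hw1] at this; simpa using this
    rw [this]
    module
  rw [e0, normSq_smul]
  have n0 : normSq ((Op.x q).den D v) = 1 := by
    have h := den_normSq hU [.x q] v
    rw [den_cons, den_nil] at h
    rw [h, ← hv, den_normSq hU, normSq_ket]
  have n1 : normSq w = 1 := by rw [← hw, den_normSq hU, normSq_ket]
  have hre : (dot w ((Op.x q).den D v)).re = (dot ((Op.x q).den D v) w).re := by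
    rw [← dot_conj]; simp
  rw [normSq_eq, dot_sub_left, dot_sub_right, dot_sub_right]
  simp only [Complex.sub_re, ← normSq_eq, n0, n1, hre]
  simp only [Complex.norm_real, norm_eq_abs, sq_abs]
  ring

/-! ### The circuit for the overlap of two digits -/

section

variable {F t t' : Finset ℕ} {w : Bits D.n} {z : Bits D.N}

/-- Under the control of qubit `0`, add the bit provided by the query `o` to qubit `q`. -/
def loadOps (o : Op) (q : ℕ) : List Op := [o, .toffoli 0 4 q, o]

/-- Negate the flag `q`. -/
def negFlag (q : ℕ) (F : Finset ℕ) : Finset ℕ := symmDiff F {q}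

/-- Add the bit `v` to the flag `q` under the control of the flag `0`. -/
def loadFlag (v : Bool) (q : ℕ) (F : Finset ℕ) : Finset ℕ :=
  if v = true ∧ 0 ∈ F then symmDiff F {q} else F

lemma notMem_negFlag {q : ℕ} (hq : q < 4) (h : 4 ∉ F) : 4 ∉ negFlag q F := by
  unfold negFlag; rwa [mem_toggle (by omega)]

lemma notMem_loadFlag {q : ℕ} (hq : q < 4) (v : Bool) (h : 4 ∉ F) : 4 ∉ loadFlag v q F := by
  unfold loadFlag
  split_ifs
  · rwa [mem_toggle (by omega)]
  · exact h

lemma den_loadOps {o : Op} {q : ℕ} {v : Bool} (hq : q < 4) (hq0 : q ≠ 0)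
    (ho : ∀ F, o.den D (ket (D.enc F t t' w z)) =
      ket (D.enc (if v = true then symmDiff F {4} else F) t t' w z)) (hF : 4 ∉ F) :
    den D (loadOps o q) (ket (D.enc F t t' w z)) = ket (D.enc (loadFlag v q F) t t' w z) := by
  simp only [loadOps, den_cons, den_nil, loadFlag]
  rw [ho, den_toffoli_enc (by omega) (by omega) (by omega) (by omega) (by omega), ho]
  congr 2
  have h04 : (0 : ℕ) ≠ 4 := by omega
  cases v
  · simp [hF]
  · simp only [if_true, true_and, mem_toggle h04, mem_toggle_self, hF, not_false_eq_true, and_true]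
    split_ifs
    · rw [symmDiff_right_comm, toggle_toggle]
    · rw [toggle_toggle]

/-- Compute the flags and the sign of a term. -/
def flagOps (e e' : ℤ) : List Op :=
  .x 0 :: (loadOps (.digit false e 5 4) 1 ++ (loadOps (.sign false 5 4) 3 ++
  (.x 0 :: (loadOps (.digit true e' 5 4) 1 ++ (loadOps (.sign true 5 4) 3 ++
  (.z 3 :: (loadOps (.sign true 5 4) 3 ++
  (.x 0 :: (loadOps (.sign false 5 4) 3 ++
  [.x 0, .x 1, .toffoli 0 1 2, .x 1])))))))))

/-- The sign of the number at address `k`. -/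
noncomputable def Device.sgn (D : Device) (c : Bool) (k : ℕ) : ℝ := if D.num c k < 0 then -1 else 1

/-- The signed binary digit of weight `2 ^ e` of the number at address `k`. -/
noncomputable def Device.coef (D : Device) (c : Bool) (e : ℤ) (k : ℕ) : ℝ :=
  if binDigit (D.num c k) e = true then D.sgn c k else 0

/-- The flags after the loading of all bits of a term. -/
def loadedFlags (d d' s s' : Bool) (F : Finset ℕ) : Finset ℕ :=
  loadFlag s' 3 (loadFlag d' 1 (negFlag 0 (loadFlag s 3 (loadFlag d 1 (negFlag 0 F)))))

/-- The flags after the computation of a term. -/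
def finalFlags (d d' s s' : Bool) (F : Finset ℕ) : Finset ℕ :=
  let G := negFlag 1 (negFlag 0 (loadFlag s 3 (negFlag 0 (loadFlag s' 3 (loadedFlags d d' s s' F)))))
  negFlag 1 (if 0 ∈ G ∧ 1 ∈ G then negFlag 2 G else G)

lemma den_flagOps (ht : t ⊆ range D.addrLen) (e e' : ℤ) (hF : 4 ∉ F) :
    den D (flagOps e e') (ket (D.enc F t t' w z)) =
      (if 3 ∈ loadedFlags (binDigit (D.num false (digitsVal t)) e)
          (binDigit (D.num true (digitsVal t)) e') (decide (D.num false (digitsVal t) < 0))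
          (decide (D.num true (digitsVal t) < 0)) F then (-1 : ℂ) else 1) •
        ket (D.enc (finalFlags (binDigit (D.num false (digitsVal t)) e)
          (binDigit (D.num true (digitsVal t)) e') (decide (D.num false (digitsVal t) < 0))
          (decide (D.num true (digitsVal t) < 0)) F) t t' w z) := by
  have ho1 := fun F => den_digit_enc (F := F) (t' := t') (w := w) (z := z) ht false e (q := 4) (by omega)
  have ho2 := fun F => den_digit_enc (F := F) (t' := t') (w := w) (z := z) ht true e' (q := 4) (by omega)
  have ho3 := fun F => den_sign_enc (F := F) (t' := t') (w := w) (z := z) ht false (q := 4) (by omega)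
  have ho4 := fun F => den_sign_enc (F := F) (t' := t') (w := w) (z := z) ht true (q := 4) (by omega)
  have hx : ∀ (q : ℕ) (F : Finset ℕ), q < 5 → (Op.x q).den D (ket (D.enc F t t' w z)) =
    ket (D.enc (negFlag q F) t t' w z) := fun q F hq => den_x_enc hq
  have h0 : (0 : ℕ) < 4 := by omega
  have h1 : (1 : ℕ) < 4 := by omega
  have h3 : (3 : ℕ) < 4 := by omega
  have n0 := notMem_negFlag h0 hF
  have n1 := notMem_loadFlag h1 (binDigit (D.num false (digitsVal t)) e) n0
  have n2 := notMem_loadFlag h3 (decide (D.num false (digitsVal t) < 0)) n1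
  have n3 := notMem_negFlag h0 n2
  have n4 := notMem_loadFlag h1 (binDigit (D.num true (digitsVal t)) e') n3
  have n5 := notMem_loadFlag h3 (decide (D.num true (digitsVal t) < 0)) n4
  have n6 := notMem_loadFlag h3 (decide (D.num true (digitsVal t) < 0)) n5
  have n7 := notMem_negFlag h0 n6
  unfold flagOps
  simp only [den_cons, den_append, den_nil]
  rw [hx _ _ (by omega), den_loadOps h1 (by omega) ho1 n0, den_loadOps h3 (by omega) ho3 n1,
    hx _ _ (by omega), den_loadOps h1 (by omega) ho2 n3, den_loadOps h3 (by omega) ho4 n4,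
    den_z_enc (by omega), map_smul, den_loadOps h3 (by omega) ho4 n5, map_smul,
    hx _ _ (by omega), map_smul, den_loadOps h3 (by omega) ho3 n7]
  simp only [map_smul]
  rw [hx _ _ (by omega), hx _ _ (by omega),
    den_toffoli_enc (by omega) (by omega) (by omega) (by omega) (by omega), hx _ _ (by omega)]
  rfl

lemma den_flagOps_false (ht : t ⊆ range D.addrLen) (e e' : ℤ) :
    den D (flagOps e e') (ket (D.enc ∅ t t' w z)) =
      ((D.sgn false (digitsVal t) : ℝ) : ℂ) •
        ket (D.enc (if binDigit (D.num false (digitsVal t)) e = true then {1} else ∅) t t' w z) := by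
  have h1 : ∀ d d' s s', 3 ∈ loadedFlags d d' s s' ∅ ↔ s = true := by decide
  have h2 : ∀ d d' s s', finalFlags d d' s s' ∅ = if d = true then {1} else ∅ := by decide
  rw [den_flagOps ht e e' (by simp), h2]
  simp only [h1, Device.sgn, decide_eq_true_eq]
  split_ifs <;> simp

lemma den_flagOps_true (ht : t ⊆ range D.addrLen) (e e' : ℤ) :
    den D (flagOps e e') (ket (D.enc {0} t t' w z)) =
      ((D.sgn true (digitsVal t) : ℝ) : ℂ) • ket (D.enc
        (if binDigit (D.num true (digitsVal t)) e' = true then {0, 1} else {0, 2}) t t' w z) := by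
  have h1 : ∀ d d' s s', 3 ∈ loadedFlags d d' s s' {0} ↔ s' = true := by decide
  have h2 : ∀ d d' s s', finalFlags d d' s s' {0} = if d' = true then {0, 1} else {0, 2} := by decide
  rw [den_flagOps ht e e' (by simp), h2]
  simp only [h1, Device.sgn, decide_eq_true_eq]
  split_ifs <;> simp

/-- Exchange the first `l` qubits of the address registers under the control of qubit `0`. -/
def swapOps (a b l : ℕ) : List Op :=
  (List.range l).flatMap fun k => [.cnot (b + k) (a + k), .toffoli 0 (a + k) (b + k),
    .cnot (b + k) (a + k)]

lemma den_cnot_enc {l : ℕ} (hl : l ≤ D.addrLen) :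
    (Op.cnot (6 + D.addrLen + l) (5 + l)).den D (ket (D.enc F t t' w z)) =
      ket (D.enc F (if l ∈ t' then symmDiff t {l} else t) t' w z) := by
  rw [Op.den_perm_ket D (o := .cnot _ _) trivial]
  simp only [Op.perm, mem_enc_right hl, enc_toggle_left hl]
  have : 6 + D.addrLen + l ≠ 5 + l := by omega
  simp only [this, ne_eq, not_false_eq_true, and_true]
  split_ifs <;> rfl

lemma den_swap_toffoli_enc {l : ℕ} (hl : l ≤ D.addrLen) :
    (Op.toffoli 0 (5 + l) (6 + D.addrLen + l)).den D (ket (D.enc F t t' w z)) =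
      ket (D.enc F t (if 0 ∈ F ∧ l ∈ t then symmDiff t' {l} else t') w z) := by
  rw [Op.den_perm_ket D (o := .toffoli _ _ _) trivial]
  have h0 : (0 : ℕ) < 5 := by omega
  simp only [Op.perm, mem_enc_flag h0, mem_enc_left hl, enc_toggle_right hl]
  have h1 : 0 ≠ 6 + D.addrLen + l := by omega
  have h2 : 5 + l ≠ 6 + D.addrLen + l := by omega
  simp only [h1, h2, ne_eq, not_false_eq_true, and_true]
  split_ifs <;> rfl

lemma den_swapOps_of_notMem {l : ℕ} (hl : l ≤ D.addrLen + 1) (hF : 0 ∉ F) :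
    den D (swapOps 5 (6 + D.addrLen) l) (ket (D.enc F t t' w z)) = ket (D.enc F t t' w z) := by
  induction l with
  | zero => simp [swapOps]
  | succ l ih =>
    have : swapOps 5 (6 + D.addrLen) (l + 1) = swapOps 5 (6 + D.addrLen) l ++
        [.cnot (6 + D.addrLen + l) (5 + l), .toffoli 0 (5 + l) (6 + D.addrLen + l),
          .cnot (6 + D.addrLen + l) (5 + l)] := by
      simp [swapOps, List.range_succ]
    rw [this, den_append, ih (by omega)]
    simp only [den_cons, den_nil]
    rw [den_cnot_enc (by omega), den_swap_toffoli_enc (by omega), den_cnot_enc (by omega)]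
    simp only [hF, false_and, if_false]
    congr 2
    split_ifs
    · exact toggle_toggle _ _
    · rfl

lemma den_swapOps_of_mem_aux {l : ℕ} (hl : l ≤ D.addrLen + 1) (hF : 0 ∈ F) :
    den D (swapOps 5 (6 + D.addrLen) l) (ket (D.enc F t t' w z)) =
      ket (D.enc F (t'.filter (· < l) ∪ t.filter (l ≤ ·))
        (t.filter (· < l) ∪ t'.filter (l ≤ ·)) w z) := by
  induction l with
  | zero => simp [swapOps]
  | succ l ih =>
    have : swapOps 5 (6 + D.addrLen) (l + 1) = swapOps 5 (6 + D.addrLen) l ++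
        [.cnot (6 + D.addrLen + l) (5 + l), .toffoli 0 (5 + l) (6 + D.addrLen + l),
          .cnot (6 + D.addrLen + l) (5 + l)] := by
      simp [swapOps, List.range_succ]
    rw [this, den_append, ih (by omega)]
    simp only [den_cons, den_nil]
    rw [den_cnot_enc (by omega), den_swap_toffoli_enc (by omega), den_cnot_enc (by omega)]
    simp only [hF, true_and]
    congr 2
    · ext k
      by_cases h1 : l ∈ t <;> by_cases h2 : l ∈ t' <;>
        grind [mem_symmDiff]
    · ext k
      by_cases h1 : l ∈ t <;> by_cases h2 : l ∈ t' <;>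
        grind [mem_symmDiff]

end

lemma den_swapOps_of_mem {F t t' : Finset ℕ} {w : Bits D.n} {z : Bits D.N}
    (hF : 0 ∈ F) (ht : t ⊆ range (D.addrLen + 1))
    (ht' : t' ⊆ range (D.addrLen + 1)) :
    den D (swapOps 5 (6 + D.addrLen) (D.addrLen + 1)) (ket (D.enc F t t' w z)) =
      ket (D.enc F t' t w z) := by
  rw [den_swapOps_of_mem_aux le_rfl hF]
  have key : ∀ A B : Finset ℕ, A ⊆ range (D.addrLen + 1) →
      B ⊆ range (D.addrLen + 1) →
      A.filter (· < D.addrLen + 1) ∪ B.filter (D.addrLen + 1 ≤ ·) = A := by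
    intro A B hA hB
    rw [filter_true_of_mem fun k hk => mem_range.1 (hA hk),
      filter_false_of_mem fun k hk => by have := mem_range.1 (hB hk); omega,
      union_empty]
  rw [key t' t ht' ht, key t t' ht ht']

/-! ### The circuits for the detection of digits and for the overlap -/

/-- The operations that prepare a superposition of all addresses and load a digit. -/
def detectOps (l : ℕ) (c : Bool) (e : ℤ) : List Op :=
  ((List.range l).map fun k => Op.had (5 + k)) ++ [.digit c e 5 0]

/-- The controlled part of the circuit for the overlap. -/
def pairOps (l n : ℕ) (e e' : ℤ) : List Op :=
  ((List.range l).map fun k => Op.had (5 + k)) ++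
    (((List.range (l + 1)).map fun k => Op.had (6 + l + k)) ++
    ([.word 5 (7 + 2 * l), .feature false (7 + 2 * l) (7 + 2 * l + n), .word 5 (7 + 2 * l)] ++
    (flagOps e e' ++ swapOps 5 (6 + l) (l + 1))))

/-- The circuit for the overlap: a Hadamard test. -/
def overlapOps (l n : ℕ) (e e' : ℤ) : List Op := .had 0 :: (pairOps l n e e' ++ [.had 0])

lemma sqrt_half_pow (k : ℕ) : ‖(((1 / √2 : ℝ) : ℂ)) ^ k‖ ^ 2 = 1 / 2 ^ k := by
  rw [norm_pow, Complex.norm_real, norm_eq_abs, ← pow_mul, mul_comm, pow_mul, sq_abs,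
    div_pow, sq_sqrt (by norm_num), div_pow, one_pow, one_pow]

/-- The squared norm of a superposition of distinct basis states. -/
lemma normSq_sum_ket {ι : Type*} (S : Finset ι) (f : ι → Finset ℕ)
    (hf : ∀ i ∈ S, ∀ j ∈ S, f i = f j → i = j) (a : ι → ℝ) :
    normSq (∑ i ∈ S, (a i : ℂ) • ket (f i)) = ∑ i ∈ S, a i ^ 2 := by
  classical
  rw [normSq_eq, dot_sum_left]
  rw [Complex.re_sum]
  refine sum_congr rfl fun i hi => ?_
  rw [dot_sum_right, sum_eq_single i]
  · rw [dot_smul_left, dot_smul_right, dot_self, normSq_ket]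
    simp [sq]
  · intro j hj hji
    rw [dot_smul_left, dot_smul_right, dot_ket_left, ket_apply,
      if_neg fun h => hji (hf j hj i hi h)]
    simp
  · exact fun h => absurd hi h

/-- The fraction of the addresses at which the digit is set. -/
noncomputable def Device.digitProb (D : Device) (c : Bool) (e : ℤ) : ℝ :=
  (∑ k ∈ range (2 ^ D.addrLen), if binDigit (D.num c k) e = true then (1 : ℝ) else 0) /
    2 ^ D.addrLen

lemma normSq_detectOps (D : Device) (c : Bool) (e : ℤ) :
    normSq (project 0 true (den D (detectOps D.addrLen c e) (ket ∅))) = D.digitProb c e := by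
  unfold detectOps
  rw [den_append, ← enc_empty (D := D), den_hads_left le_rfl, map_smul, map_sum, project_smul,
    normSq_smul, sqrt_half_pow]
  have h1 : ∀ t ∈ (range D.addrLen).powerset,
      den D [.digit c e 5 0] (ket (D.enc ∅ t ∅ (fun _ => false) (fun _ => false))) =
      ket (D.enc (if binDigit (D.num c (digitsVal t)) e = true then {0} else ∅) t ∅
        (fun _ => false) (fun _ => false)) := by
    intro t ht
    rw [den_cons, den_nil, den_digit_enc (mem_powerset.1 ht) c e (by omega)]
    simp [symmDiff]
  have h2 : project 0 true (∑ t ∈ (range D.addrLen).powerset,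
      den D [.digit c e 5 0] (ket (D.enc ∅ t ∅ (fun _ => false) (fun _ => false)))) =
      ∑ t ∈ (range D.addrLen).powerset,
        (((if binDigit (D.num c (digitsVal t)) e = true then 1 else 0 : ℝ)) : ℂ) •
        ket (D.enc {0} t ∅ (fun _ => false) (fun _ => false)) := by
    rw [sum_congr rfl h1]
    have hp : ∀ (S : Finset (Finset ℕ)) (f : Finset ℕ → Ket), project 0 true (∑ t ∈ S, f t) =
        ∑ t ∈ S, project 0 true (f t) := by
      intro S f
      classical
      induction S using Finset.induction_on with
      | empty => exact Finsupp.filter_zero _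
      | insert a S ha ih => rw [sum_insert ha, sum_insert ha, project_add, ih]
    rw [hp]
    refine sum_congr rfl fun t _ => ?_
    rw [project_ket]
    simp only [mem_enc_flag (show 0 < 5 by omega)]
    split_ifs <;> simp_all
  rw [h2, normSq_sum_ket]
  · rw [Device.digitProb, ← sum_digitsVal (fun k => if binDigit (D.num c k) e = true then (1:ℝ) else 0),
      div_mul_eq_mul_div, one_mul]
    congr 1
    refine sum_congr rfl fun t _ => ?_
    split_ifs <;> simp
  · intro t ht r hr h
    have sub : ∀ t ∈ (range D.addrLen).powerset, t ⊆ range (D.addrLen + 1) :=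
      fun t ht => (mem_powerset.1 ht).trans (Finset.range_mono (by omega))
    exact ((enc_inj (by simp) (by simp) (sub t ht) (sub r hr) (by simp) (by simp)).1 h).2.1

/-- The normalised sum of the inner products of the vectors with signed digits. -/
noncomputable def Device.overlap (D : Device) (φ : Bits D.n → Feature D.N) (e e' : ℤ) : ℝ :=
  (∑ k ∈ range (2 ^ D.addrLen), ∑ k' ∈ range (2 ^ D.addrLen),
    D.coef false e k * D.coef true e' k' * inner ℝ (φ (D.word k)) (φ (D.word k'))) /
    (2 ^ D.addrLen) ^ 2

/-- The data point with address `t` in the feature register. -/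
noncomputable def Device.embedded (D : Device) (φ : Bits D.n → Feature D.N) (F r t t' : Finset ℕ) :
    Ket :=
  ∑ z : Bits D.N, ((φ (D.word (digitsVal r)) z : ℝ) : ℂ) • ket (D.enc F t t' (fun _ => false) z)

lemma dot_embedded (φ : Bits D.n → Feature D.N) {F G r s t t' u u' : Finset ℕ}
    (hF : F ⊆ range 5) (hG : G ⊆ range 5)
    (ht : t ⊆ range (D.addrLen + 1)) (hu : u ⊆ range (D.addrLen + 1))
    (ht' : t' ⊆ range (D.addrLen + 1)) (hu' : u' ⊆ range (D.addrLen + 1)) :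
    dot (D.embedded φ F r t t') (D.embedded φ G s u u') =
      if t = u ∧ t' = u' ∧ F = G then
        ((inner ℝ (φ (D.word (digitsVal r))) (φ (D.word (digitsVal s))) : ℝ) : ℂ) else 0 := by
  unfold Device.embedded
  rw [dot_sum_left]
  simp only [dot_sum_right, dot_smul_left, dot_smul_right, dot_ket_left, ket_apply,
    enc_inj hG hF hu ht hu' ht']
  by_cases h : t = u ∧ t' = u' ∧ F = G
  · obtain ⟨rfl, rfl, rfl⟩ := h
    simp only [true_and, and_self, if_true]
    rw [EuclideanSpace.inner_eq_star_dotProduct]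
    push_cast [dotProduct]
    refine sum_congr rfl fun z _ => ?_
    rw [sum_eq_single z]
    · simp [mul_comm]
    · intro z' _ hz; simp [hz]
    · simp
  · rw [if_neg h]
    refine sum_eq_zero fun z _ => sum_eq_zero fun z' _ => ?_
    rw [if_neg (fun h' => h ⟨h'.2.1.symm, h'.2.2.1.symm, h'.1.symm⟩)]
    simp

lemma den_pairOps {φ : Bits D.n → Feature D.N} (hφ : D.HasFeature φ) (e e' : ℤ)
    (F : Finset ℕ) (G : Finset ℕ → Finset ℕ) (σ : Finset ℕ → ℝ) (sw : Bool)
    (hflag : ∀ t ⊆ range D.addrLen, ∀ t' z, den D (flagOps e e')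
      (ket (D.enc F t t' (fun _ => false) z)) =
        ((σ t : ℝ) : ℂ) • ket (D.enc (G t) t t' (fun _ => false) z))
    (hswap : ∀ t ⊆ range (D.addrLen + 1), ∀ t' ⊆ range (D.addrLen + 1), ∀ r z,
      den D (swapOps 5 (6 + D.addrLen) (D.addrLen + 1)) (ket (D.enc (G r) t t' (fun _ => false) z))
        = ket (D.enc (G r) (if sw then t' else t) (if sw then t else t') (fun _ => false) z)) :
    den D (pairOps D.addrLen D.n e e') (ket (D.enc F ∅ ∅ (fun _ => false) (fun _ => false))) =
      (((1 / √2 : ℝ) : ℂ)) ^ (2 * D.addrLen + 1) •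
        ∑ t ∈ (range D.addrLen).powerset, ∑ t' ∈ (range (D.addrLen + 1)).powerset,
          ((σ t : ℝ) : ℂ) • D.embedded φ (G t) t (if sw then t' else t) (if sw then t else t') := by
  unfold pairOps
  rw [den_append, den_hads_left le_rfl, map_smul, map_sum,
    show 2 * D.addrLen + 1 = D.addrLen + (D.addrLen + 1) by omega, pow_add, mul_smul]
  congr 1
  rw [smul_sum]
  refine sum_congr rfl fun t ht => ?_
  have ht := mem_powerset.1 ht
  rw [den_append, den_hads_right le_rfl, map_smul, map_sum]
  congr 1
  refine sum_congr rfl fun t' ht' => ?_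
  rw [den_append, den_embed hφ ht, den_append, map_sum, map_sum, Device.embedded, smul_sum]
  refine sum_congr rfl fun z _ => ?_
  rw [map_smul, map_smul, hflag t ht, map_smul,
    hswap t (ht.trans (Finset.range_mono (by omega))) t' (mem_powerset.1 ht'), smul_comm]

lemma project_sum {ι : Type*} (S : Finset ι) (q : ℕ) (b : Bool) (f : ι → Ket) :
    project q b (∑ t ∈ S, f t) = ∑ t ∈ S, project q b (f t) := by
  classical
  induction S using Finset.induction_on with
  | empty => exact Finsupp.filter_zero _
  | insert a S ha ih => rw [sum_insert ha, sum_insert ha, project_add, ih]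

lemma project_embedded (φ : Bits D.n → Feature D.N) {F r t t' : Finset ℕ} {b : Bool}
    (h : decide (0 ∈ F) = !b) : project 0 b (D.embedded φ F r t t') = 0 := by
  unfold Device.embedded
  rw [project_sum]
  refine sum_eq_zero fun z _ => ?_
  rw [project_smul, project_ket]
  simp only [mem_enc_flag (show 0 < 5 by omega), h]
  simp

lemma sum_dot_embedded (φ : Bits D.n → Feature D.N) {F G t r : Finset ℕ}
    (hF : F ⊆ range 5) (hG : G ⊆ range 5)
    (ht : t ⊆ range (D.addrLen + 1)) (hr : r ⊆ range (D.addrLen + 1)) (a b : ℝ) :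
    ∑ t' ∈ (range (D.addrLen + 1)).powerset,
      ∑ r' ∈ (range (D.addrLen + 1)).powerset,
      dot ((a : ℂ) • D.embedded φ F t t t') ((b : ℂ) • D.embedded φ G r r' r) =
    if F = G then
      ((a * b * inner ℝ (φ (D.word (digitsVal t))) (φ (D.word (digitsVal r))) : ℝ) : ℂ) else 0 := by
  have key : ∀ t' ∈ (range (D.addrLen + 1)).powerset,
      ∀ r' ∈ (range (D.addrLen + 1)).powerset,
      dot ((a : ℂ) • D.embedded φ F t t t') ((b : ℂ) • D.embedded φ G r r' r) =
      if r' = t then if t' = r then if F = G then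
      ((a * b * inner ℝ (φ (D.word (digitsVal t))) (φ (D.word (digitsVal r))) : ℝ) : ℂ) else 0
        else 0 else 0 := by
    intro t' ht' r' hr'
    rw [dot_smul_left, dot_smul_right, dot_embedded φ hF hG ht (mem_powerset.1 hr')
      (mem_powerset.1 ht') hr]
    by_cases h1 : r' = t
    · by_cases h2 : t' = r
      · by_cases h3 : F = G
        · simp [h1, h2, h3, mul_assoc]
        · simp [h3]
      · simp [h2]
    · simp [h1, Ne.symm h1]
  rw [sum_congr rfl fun t' ht' => sum_congr rfl (key t' ht')]
  simp only [sum_ite_eq', mem_powerset, ht, hr, if_true]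

lemma den_x_embedded (φ : Bits D.n → Feature D.N) (F r t t' : Finset ℕ) :
    (Op.x 0).den D (D.embedded φ F r t t') = D.embedded φ (symmDiff F {0}) r t t' := by
  unfold Device.embedded
  simp only [map_sum, map_smul, den_x_enc (show 0 < 5 by omega)]

/-- The probability of the outcome `1` of the circuit for the overlap. -/
lemma normSq_overlapOps (hU : D.Unitary) {φ : Bits D.n → Feature D.N}
    (hφ : D.HasFeature φ) (e e' : ℤ) :
    normSq (project 0 true (den D (overlapOps D.addrLen D.n e e') (ket ∅))) =
      (1 - D.overlap φ e e' / 2) / 2 := by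
  have mono : range D.addrLen ⊆ range (D.addrLen + 1) := Finset.range_mono (by omega)
  have W0 := den_pairOps hφ e e' ∅ (fun t => if binDigit (D.num false (digitsVal t)) e = true
    then {1} else ∅) (fun t => D.sgn false (digitsVal t)) false
    (fun t ht t' z => den_flagOps_false ht e e')
    (fun t _ t' _ r z => den_swapOps_of_notMem le_rfl (by split_ifs <;> simp))
  have W1 := den_pairOps hφ e e' {0} (fun t => if binDigit (D.num true (digitsVal t)) e' = true
    then {0, 1} else {0, 2}) (fun t => D.sgn true (digitsVal t)) true
    (fun t ht t' z => den_flagOps_true ht e e')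
    (fun t ht t' ht' r z => den_swapOps_of_mem (by split_ifs <;> simp) ht ht')
  have he : D.enc {0} ∅ ∅ (fun _ => false) (fun _ => false) = {0} := by
    have := enc_toggle_flag (D := D) (F := ∅) (t := ∅) (t' := ∅) (w := fun _ => false)
      (z := fun _ => false) (q := 0) (by omega)
    rw [enc_empty] at this
    simpa [symmDiff] using this.symm
  rw [enc_empty] at W0
  rw [he] at W1
  simp only [Bool.false_eq_true, if_false, if_true] at W0 W1
  unfold overlapOps
  rw [hadamard_test hU W0 W1]
  · have hX : (Op.x 0).den D ((((1 / √2 : ℝ) : ℂ)) ^ (2 * D.addrLen + 1) •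
        ∑ t ∈ (range D.addrLen).powerset, ∑ t' ∈ (range (D.addrLen + 1)).powerset,
          ((D.sgn false (digitsVal t) : ℝ) : ℂ) • D.embedded φ
            (if binDigit (D.num false (digitsVal t)) e = true then {1} else ∅) t t t') =
        (((1 / √2 : ℝ) : ℂ)) ^ (2 * D.addrLen + 1) •
        ∑ t ∈ (range D.addrLen).powerset, ∑ t' ∈ (range (D.addrLen + 1)).powerset,
          ((D.sgn false (digitsVal t) : ℝ) : ℂ) • D.embedded φ
            (if binDigit (D.num false (digitsVal t)) e = true then {0, 1} else {0}) t t t' := by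
      rw [map_smul, map_sum]
      refine congrArg _ (sum_congr rfl fun t _ => ?_)
      rw [map_sum]
      refine sum_congr rfl fun t' _ => ?_
      rw [map_smul, den_x_embedded]
      refine congrArg (fun F => _ • D.embedded φ F t t t') ?_
      split_ifs <;> decide
    have hdot : ∀ t ∈ (range D.addrLen).powerset,
        ∑ r ∈ (range D.addrLen).powerset,
        ∑ r' ∈ (range (D.addrLen + 1)).powerset,
        ∑ t' ∈ (range (D.addrLen + 1)).powerset,
        dot (((D.sgn false (digitsVal t) : ℝ) : ℂ) • D.embedded φ
            (if binDigit (D.num false (digitsVal t)) e = true then {0, 1} else {0}) t t t')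
          (((D.sgn true (digitsVal r) : ℝ) : ℂ) • D.embedded φ
            (if binDigit (D.num true (digitsVal r)) e' = true then {0, 1} else {0, 2}) r r' r) =
        ∑ r ∈ (range D.addrLen).powerset,
        ((D.coef false e (digitsVal t) * D.coef true e' (digitsVal r) *
          inner ℝ (φ (D.word (digitsVal t))) (φ (D.word (digitsVal r))) : ℝ) : ℂ) := by
      intro t ht
      refine sum_congr rfl fun r hr => ?_
      rw [sum_comm, sum_dot_embedded φ (by split_ifs <;> decide) (by split_ifs <;> decide)
        ((mem_powerset.1 ht).trans mono) ((mem_powerset.1 hr).trans mono)]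
      have a1 : ({0, 1} : Finset ℕ) ≠ {0, 2} := by decide
      have a2 : ({0} : Finset ℕ) ≠ {0, 1} := by decide
      have a3 : ({0} : Finset ℕ) ≠ {0, 2} := by decide
      unfold Device.coef
      clear hX W0 W1
      cases binDigit (D.num false (digitsVal t)) e <;>
        cases binDigit (D.num true (digitsVal r)) e' <;> simp [a1, a2, a3]
    rw [hX, dot_smul_left, dot_smul_right, ← mul_assoc, Complex.conj_mul', ← Complex.ofReal_pow,
      sqrt_half_pow, dot_sum_left]
    simp only [dot_sum_left, dot_sum_right]
    rw [sum_congr rfl hdot]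
    unfold Device.overlap
    rw [← sum_digitsVal (fun k => ∑ k' ∈ range (2 ^ D.addrLen),
      D.coef false e k * D.coef true e' k' * inner ℝ (φ (D.word k)) (φ (D.word k')))]
    simp only [← Complex.ofReal_sum, ← Complex.ofReal_mul, Complex.ofReal_re]
    rw [sum_congr rfl fun t _ => sum_digitsVal (fun k' => D.coef false e (digitsVal t) *
      D.coef true e' k' * inner ℝ (φ (D.word (digitsVal t))) (φ (D.word k'))) D.addrLen]
    rw [pow_succ, pow_mul']
    ring
  · rw [project_smul, project_sum, sum_eq_zero, smul_zero]
    intro t _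
    rw [project_sum]
    refine sum_eq_zero fun t' _ => ?_
    rw [project_smul, project_embedded φ (by split_ifs <;> simp), smul_zero]
  · rw [project_smul, project_sum, sum_eq_zero, smul_zero]
    intro t _
    rw [project_sum]
    refine sum_eq_zero fun t' _ => ?_
    rw [project_smul, project_embedded φ (by split_ifs <;> simp), smul_zero]

/-- The circuit of `detectOps`; the variables `26` and `27` hold the positions of the digits in the
two lists. -/
def detectCirc (c : Bool) : List Item :=
  [.loop 24 false [.had ⟨17, true⟩], .digit c (if c then 27 else 26) 17 10]

/-- The circuit of `loadOps` for a query. -/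
def loadCirc (o : Item) (q : Fin 50) : List Item :=
  [o, .gate (.toffoli ⟨10, false⟩ ⟨14, false⟩ ⟨q, false⟩), o]

/-- The gate `X` on a flag. -/
def xItem (q : Fin 50) : Item := .gate (.x ⟨q, false⟩)

/-- The circuit of `flagOps`. -/
def flagCirc : List Item :=
  xItem 10 :: (loadCirc (.digit false 26 17 14) 11 ++ (loadCirc (.sign false 17 14) 13 ++
  (xItem 10 :: (loadCirc (.digit true 27 17 14) 11 ++ (loadCirc (.sign true 17 14) 13 ++
  (.gate (.z ⟨13, false⟩) :: (loadCirc (.sign true 17 14) 13 ++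
  (xItem 10 :: (loadCirc (.sign false 17 14) 13 ++
  [xItem 10, xItem 11, .gate (.toffoli ⟨10, false⟩ ⟨11, false⟩ ⟨12, false⟩), xItem 11])))))))))

/-- The circuit of `overlapOps`. -/
def overlapCirc : List Item :=
  .gate (.had ⟨10, false⟩) :: (([.loop 24 false [.had ⟨17, true⟩]] ++
    ([.loop 25 false [.had ⟨18, true⟩]] ++ ([.word 17 19, .feature false 19 20, .word 17 19] ++
    (flagCirc ++ [.loop 25 false [.cnot ⟨18, true⟩ ⟨17, true⟩,
      .toffoli ⟨10, false⟩ ⟨17, true⟩ ⟨18, true⟩, .cnot ⟨18, true⟩ ⟨17, true⟩]])))) ++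
    [.gate (.had ⟨10, false⟩)])

lemma circOps_detect {ρ : ℕ → ℤ} (h : Layout D ρ) (c : Bool) :
    circOps ρ (detectCirc c) = detectOps D.addrLen c (ρ (if c then 27 else 26)) := by
  have e1 := h.h10
  have e2 := h.h17
  have e3 := h.h24
  unfold detectCirc detectOps
  rw [circOps_cons, circOps_cons]
  cases c <;>
  simp [Item.ops, Atom.op, Adr.val, circOps, e1, e2, e3] <;>
  · rw [List.map_eq_flatMap]
    exact List.flatMap_congr fun k _ => by simp; omega

lemma circOps_overlap {ρ : ℕ → ℤ} (h : Layout D ρ) :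
    circOps ρ overlapCirc = overlapOps D.addrLen D.n (ρ 26) (ρ 27) := by
  have e1 := h.h10
  have e2 := h.h11
  have e3 := h.h12
  have e4 := h.h13
  have e5 := h.h14
  have e6 := h.h17
  have e7 := h.h18
  have e8 := h.h19
  have e9 := h.h20
  have e10 := h.h24
  have e11 := h.h25
  have a1 : circOps ρ [.loop 24 false [.had ⟨17, true⟩]] =
      (List.range D.addrLen).map fun k => Op.had (5 + k) := by
    simp [Item.ops, Atom.op, Adr.val, circOps, e6, e10]
    rw [List.map_eq_flatMap]
    exact List.flatMap_congr fun k _ => by simp; omega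
  have a2 : circOps ρ [.loop 25 false [.had ⟨18, true⟩]] =
      (List.range (D.addrLen + 1)).map fun k => Op.had (6 + D.addrLen + k) := by
    simp [Item.ops, Atom.op, Adr.val, circOps, e7, e11]
    rw [List.map_eq_flatMap]
    exact List.flatMap_congr fun k _ => by simp; omega
  have a3 : circOps ρ [.word 17 19, .feature false 19 20, .word 17 19] =
      [.word 5 (7 + 2 * D.addrLen), .feature false (7 + 2 * D.addrLen)
        (7 + 2 * D.addrLen + D.n), .word 5 (7 + 2 * D.addrLen)] := by
    simp [Item.ops, circOps, e6, e8, e9]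
    omega
  have a4 : circOps ρ [.loop 25 false [.cnot ⟨18, true⟩ ⟨17, true⟩,
      .toffoli ⟨10, false⟩ ⟨17, true⟩ ⟨18, true⟩, .cnot ⟨18, true⟩ ⟨17, true⟩]] =
      swapOps 5 (6 + D.addrLen) (D.addrLen + 1) := by
    simp [Item.ops, Atom.op, Adr.val, circOps, swapOps, e1, e6, e7, e11]
    exact List.flatMap_congr fun k _ => by simp; omega
  have a5 : circOps ρ flagCirc = flagOps (ρ 26) (ρ 27) := by
    simp [flagCirc, flagOps, loadCirc, loadOps, xItem, circOps, Item.ops, Atom.op, Adr.val, e1, e2,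
      e3, e4, e5, e6]
  have a6 : circOps ρ [.gate (.had ⟨10, false⟩)] = [.had 0] := by
    simp [Item.ops, Atom.op, Adr.val, circOps, e1]
  unfold overlapCirc overlapOps pairOps
  rw [circOps_cons, circOps_append, circOps_append, circOps_append, circOps_append, circOps_append,
    a1, a2, a3, a4, a5, a6]
  simp [Item.ops, Atom.op, Adr.val, e1]

lemma detectOps_below (D : Device) (c : Bool) (e : ℤ) :
    ∀ o ∈ detectOps D.addrLen c e, o.Below D D.qubits := by
  intro o ho
  unfold detectOps at ho
  simp only [List.mem_append, List.mem_map, List.mem_range, List.mem_singleton] at ho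
  rcases ho with ⟨k, hk, rfl⟩ | rfl
  · show _ < _; unfold Device.qubits; omega
  · show _ < _; unfold Device.qubits; omega

lemma overlapOps_below (D : Device) (e e' : ℤ) :
    ∀ o ∈ overlapOps D.addrLen D.n e e', o.Below D D.qubits := by
  intro o ho
  unfold overlapOps pairOps flagOps loadOps swapOps at ho
  simp only [List.mem_append, List.mem_map, List.mem_range, List.mem_cons, List.not_mem_nil,
    or_false, List.mem_flatMap] at ho
  have h4 : 4 < D.qubits := by unfold Device.qubits; omega
  have hw : 7 + 2 * D.addrLen + D.n ≤ D.qubits := by unfold Device.qubits; omega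
  have hf : 7 + 2 * D.addrLen + D.n + D.N ≤ D.qubits := by unfold Device.qubits; omega
  have hl : ∀ k ≤ D.addrLen, 5 + k < D.qubits := by unfold Device.qubits; omega
  have hr : ∀ k ≤ D.addrLen, 6 + D.addrLen + k < D.qubits := by unfold Device.qubits; omega
  rcases ho with rfl | ⟨⟨k, hk, rfl⟩ | ⟨k, hk, rfl⟩ | (rfl | rfl | rfl) | ho | ⟨k, hk, ho⟩⟩ | rfl
  · show _ < _; omega
  · exact hl k hk.le
  · exact hr k (by omega)
  · exact hw
  · exact ⟨hw, hf⟩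
  · exact hw
  · have : ∀ o : Op, (o = .x 0 ∨ o = .x 1 ∨ o = .z 3 ∨ o = .toffoli 0 4 1 ∨ o = .toffoli 0 4 3 ∨
        o = .toffoli 0 1 2 ∨ o = .digit false e 5 4 ∨ o = .digit true e' 5 4 ∨
        o = .sign false 5 4 ∨ o = .sign true 5 4) → o.Below D D.qubits := by
      rintro o (rfl | rfl | rfl | rfl | rfl | rfl | rfl | rfl | rfl | rfl)
      all_goals first | trivial | (show _ < _; omega)
    refine this o ?_
    tauto
  · rcases ho with rfl | rfl | rfl
    · exact hl k (by omega)
    · exact hr k (by omega)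
    · exact hl k (by omega)
  · show _ < _; omega

/-- Bounds for the quantities that determine the running time of the circuits. -/
structure Sized (D : Device) (b : ℕ) (ρ : ℕ → ℤ) : Prop where
  addr : D.addrLen + 1 ≤ b
  digit : (ρ 26).natAbs ≤ b
  digit' : (ρ 27).natAbs ≤ b
  one_le : 1 ≤ D.T
  qubits : D.n + D.N ≤ 2 * D.T

lemma circCost_cons (D : Device) (b : ℕ) (ρ : ℕ → ℤ) (i : Item) (l : List Item) :
    circCost D b ρ (i :: l) = i.cost D b ρ + circCost D b ρ l := by simp [circCost]

lemma circCost_append (D : Device) (b : ℕ) (ρ : ℕ → ℤ) (l l' : List Item) :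
    circCost D b ρ (l ++ l') = circCost D b ρ l + circCost D b ρ l' := by simp [circCost]

lemma circCost_inv (D : Device) (b : ℕ) (ρ : ℕ → ℤ) (l : List Item) :
    circCost D b ρ (circInv l) = circCost D b ρ l := by
  unfold circCost circInv
  rw [List.map_map, ← List.sum_reverse, ← List.map_reverse, List.reverse_reverse]
  refine congrArg List.sum (List.map_congr_left fun i _ => ?_)
  cases i <;> simp [Item.inv, Item.cost]

lemma circCost_detect_le {b : ℕ} {ρ : ℕ → ℤ} (h : Layout D ρ) (hs : Sized D b ρ)
    (c : Bool) : circCost D b ρ (detectCirc c) ≤ 600 * (b ^ 2 * D.T) := by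
  have h1 := hs.addr
  have h2 := hs.digit
  have h3 := hs.digit'
  have h4 := hs.one_le
  have e : (ρ (if c then 27 else 26)).natAbs ≤ b := by cases c <;> simpa
  have e24 : (ρ 24).toNat = D.addrLen := by rw [h.h24]; rfl
  have hcost : circCost D b ρ (detectCirc c) = D.addrLen * (16 * b) + 6 * b +
      (1 + D.addrLen + (ρ (if c then 27 else 26)).natAbs) := by
    cases c <;> simp [circCost, detectCirc, Item.cost, e24]
  rw [hcost]
  have hb : b ≤ b ^ 2 * D.T := by nlinarith
  have hb2 : b * b ≤ b ^ 2 * D.T := by nlinarith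
  have h5 : D.addrLen * (16 * b) ≤ 16 * (b * b) := by nlinarith
  omega

lemma circCost_overlap_le {b : ℕ} {ρ : ℕ → ℤ} (h : Layout D ρ) (hs : Sized D b ρ) :
    circCost D b ρ overlapCirc ≤ 600 * (b ^ 2 * D.T) := by
  have h1 := hs.addr
  have h2 := hs.digit
  have h3 := hs.digit'
  have h4 := hs.one_le
  have h5 := hs.qubits
  have e24 : (ρ 24).toNat = D.addrLen := by rw [h.h24]; rfl
  have e25 : (ρ 25).toNat = D.addrLen + 1 := by rw [h.h25]; rfl
  have hcost : circCost D b ρ overlapCirc ≤ D.addrLen * (16 * b) + (D.addrLen + 1) * (16 * b) +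
      (D.addrLen + 1) * (36 * b) + 300 * b + 20 * (1 + D.addrLen) + 2 * D.n + D.T
       + 4 * ((ρ 26).natAbs + (ρ 27).natAbs) := by
    simp only [circCost, overlapCirc, flagCirc, loadCirc, xItem, List.cons_append, List.nil_append,
      List.map_cons, List.map_nil, List.sum_cons, List.sum_nil, Item.cost, e24, e25,
      List.length_cons, List.length_nil, Fin.isValue]
    simp
    ring_nf
    simp [e24, e25]
    ring_nf
    omega
  have hb : b ≤ b ^ 2 * D.T := by nlinarith
  have hT : D.T ≤ b ^ 2 * D.T :=
    Nat.le_mul_of_pos_left _ (pow_pos (show 0 < b by omega) 2)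
  have hb2 : b * b ≤ b ^ 2 * D.T := by nlinarith
  have h6 : D.addrLen * (16 * b) ≤ 16 * (b * b) := by nlinarith
  have h7 : (D.addrLen + 1) * (16 * b) ≤ 16 * (b * b) := by nlinarith
  have h8 : (D.addrLen + 1) * (36 * b) ≤ 36 * (b * b) := by nlinarith
  omega

lemma circCost_grover_le {b : ℕ} {ρ : ℕ → ℤ} (h : Layout D ρ) (hs : Sized D b ρ)
    {A : List Item} {c : ℕ} (hA : circCost D b ρ A ≤ c * (b ^ 2 * D.T)) :
    circCost D b ρ (groverCirc A) ≤ (2 * c + 900) * (b ^ 2 * D.T) := by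
  have h1 := hs.addr
  have h4 := hs.one_le
  have h5 := hs.qubits
  have e21 : (ρ 21).toNat = D.qubits := by rw [h.h21]; rfl
  have hchain : circCost D b ρ chainCirc = 17 * b + D.qubits * (36 * b) := by
    simp [circCost, chainCirc, Item.cost, e21]; ring
  have hgr : circCost D b ρ (groverCirc A) = 22 * b + 2 * circCost D b ρ chainCirc +
      2 * circCost D b ρ A := by
    unfold groverCirc reflectCirc
    rw [circCost_cons, circCost_append, circCost_append, circCost_append, circCost_cons,
      circCost_inv, circCost_inv]
    simp only [Item.cost]
    ring
  have hQ : D.qubits ≤ 11 * (b * D.T) := by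
    unfold Device.qubits
    have h1' : b ≤ b * D.T := Nat.le_mul_of_pos_right _ h4
    have h2' : D.T ≤ b * D.T := Nat.le_mul_of_pos_left _ (by omega)
    omega
  have hb : b ≤ b ^ 2 * D.T := by nlinarith
  have hQ2 : D.qubits * (36 * b) ≤ 396 * (b ^ 2 * D.T) := by nlinarith
  rw [hgr, hchain, add_mul, mul_assoc]
  omega

lemma shotCost_le {b : ℕ} {ρ : ℕ → ℤ} (h : Layout D ρ) (hs : Sized D b ρ)
    {A : List Item} (hA : circCost D b ρ A ≤ 600 * (b ^ 2 * D.T)) (j : ℕ) :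
    shotCost D b ρ A j ≤ 2200 * ((j + 1) * (b ^ 2 * D.T)) := by
  have h1 := hs.addr
  have h4 := hs.one_le
  have h5 := hs.qubits
  have hg := circCost_grover_le h hs hA
  have hQ : D.qubits ≤ 11 * (b * D.T) := by
    unfold Device.qubits
    have h1' : b ≤ b * D.T := Nat.le_mul_of_pos_right _ h4
    have h2' : D.T ≤ b * D.T := Nat.le_mul_of_pos_left _ (by omega)
    omega
  have hb : b ≤ b ^ 2 * D.T := by nlinarith
  have hQ2 : D.qubits * b ≤ 11 * (b ^ 2 * D.T) := by nlinarith
  unfold shotCost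
  have hj : j * (1 + circCost D b ρ (groverCirc A)) ≤ j * (2101 * (b ^ 2 * D.T)) :=
    Nat.mul_le_mul_left _ (by omega)
  have : (13 * D.qubits + 7) * b = 13 * (D.qubits * b) + 7 * b := by ring
  rw [this]
  nlinarith

/-! ### Notation for expressions -/

instance : Add RExp := ⟨.op .add⟩
instance : Sub RExp := ⟨.op .sub⟩
instance : Mul RExp := ⟨.op .mul⟩
instance : Div RExp := ⟨.op .div⟩

section

variable (ρ : ℕ → ℝ) (a b : RExp)

@[simp] lemma RExp.eval_add : (a + b).eval ρ = a.eval ρ + b.eval ρ := rfl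
@[simp] lemma RExp.eval_sub : (a - b).eval ρ = a.eval ρ - b.eval ρ := rfl
@[simp] lemma RExp.eval_mul : (a * b).eval ρ = a.eval ρ * b.eval ρ := rfl
@[simp] lemma RExp.eval_div : (a / b).eval ρ = a.eval ρ / b.eval ρ := rfl
@[simp] lemma RExp.eval_var (r : ℕ) : (RExp.var r).eval ρ = ρ r := rfl
@[simp] lemma RExp.eval_const (z : ℤ) : (RExp.const z).eval ρ = z := rfl
@[simp] lemma RExp.eval_fn (f : ElemFun) : (RExp.fn f a).eval ρ = f.eval (a.eval ρ) := rfl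
@[simp] lemma RExp.low_add : (a + b).Low ↔ a.Low ∧ b.Low := Iff.rfl
@[simp] lemma RExp.low_sub : (a - b).Low ↔ a.Low ∧ b.Low := Iff.rfl
@[simp] lemma RExp.low_mul : (a * b).Low ↔ a.Low ∧ b.Low := Iff.rfl
@[simp] lemma RExp.low_div : (a / b).Low ↔ a.Low ∧ b.Low := Iff.rfl
@[simp] lemma RExp.low_var (r : ℕ) : (RExp.var r).Low ↔ r < 50 := Iff.rfl
@[simp] lemma RExp.low_const (z : ℤ) : (RExp.const z).Low := trivial
@[simp] lemma RExp.low_fn (f : ElemFun) : (RExp.fn f a).Low ↔ a.Low := Iff.rfl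

end

/-! ### Frames -/

/-- The memory is reset, and the variables other than the integer `60`, the integers of the scratch
space and the reals in `X` are unchanged. -/
def Keeps (X : Finset ℕ) (s t : State) : Prop :=
  (∃ a : ℂ, t.psi = a • ket ∅) ∧ (∀ i, (i < 50 ∨ 61 ≤ i) → t.int i = s.int i) ∧
    ∀ r < 49, r ∉ X → t.real r = s.real r

lemma Keeps.trans {X : Finset ℕ} {s t u : State} (h : Keeps X s t) (h' : Keeps X t u) :
    Keeps X s u :=
  ⟨h'.1, fun i hi => (h'.2.1 i hi).trans (h.2.1 i hi),
    fun r hr hX => (h'.2.2 r hr hX).trans (h.2.2 r hr hX)⟩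

lemma Keeps.mono {X Y : Finset ℕ} {s t : State} (h : Keeps X s t) (hXY : X ⊆ Y) : Keeps Y s t :=
  ⟨h.1, h.2.1, fun r hr hY => h.2.2 r hr fun hX => hY (hXY hX)⟩

lemma Keeps.refl {s : State} (X : Finset ℕ) (h : ∃ a : ℂ, s.psi = a • ket ∅) : Keeps X s s :=
  ⟨h, fun _ _ => rfl, fun _ _ _ => rfl⟩

lemma det_assign_keeps (D : Device) {r : ℕ} (hr : r < 49) {e : RExp} (he : e.Low) {s : State}
    (hs : ∃ a : ℂ, s.psi = a • ket ∅) : Det D s (assign r e) fun t => Keeps {r} s t ∧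
      t.real r = e.eval s.real ∧ t.psi = s.psi ∧ t.time = s.time + (e.cost + 3) := by
  refine (det_assign D (by omega) he s).mono fun t ht => ?_
  obtain ⟨h1, h2, h3, h4⟩ := ht
  refine ⟨⟨h3 ▸ hs, fun i hi => h2 i (by omega), fun q hq hX => ?_⟩, ?_, h3, h4⟩
  · rw [h1 q (by omega), if_neg (by simpa using hX)]
  · rw [h1 r (by omega), if_pos rfl]

lemma always_ifLt {s : State} {a b : ℕ} {p q : Prog} {A : State → Prop}
    (h1 : s.real a < s.real b → Always D (s.tick 1) p A)
    (h2 : ¬ s.real a < s.real b → Always D (s.tick 1) q A) : Always D s (.ifLt a b p q) A := by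
  unfold Always
  simp only [run]
  split_ifs with h
  · exact h1 h
  · exact h2 h

lemma err_ifLt {s : State} {a b : ℕ} {p q : Prog} {δ : ℝ} {A : State → Prop}
    (h1 : s.real a < s.real b → Err D (s.tick 1) p δ A)
    (h2 : ¬ s.real a < s.real b → Err D (s.tick 1) q δ A) : Err D s (.ifLt a b p q) δ A := by
  unfold Err
  simp only [run]
  split_ifs with h
  · exact h1 h
  · exact h2 h

lemma always_skip {s : State} {A : State → Prop} (h : A s) : Always D s .skip A := by
  intro t ht _
  simp only [run, List.mem_singleton] at ht
  exact ht ▸ h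

lemma Always.err_imp {s : State} {p : Prog} {δ : ℝ} {A G : State → Prop}
    (h : Always D s p A) (hδ : 0 ≤ δ) (hG : ∀ t, A t → G t) : Err D s p δ G :=
  (h.mono hG).err hδ

lemma Keeps.real {X : Finset ℕ} {s t : State} (h : Keeps X s t) (r : ℕ) (hr : r < 49 := by omega)
    (hX : r ∉ X := by decide) : t.real r = s.real r := h.2.2 r hr hX

lemma Keeps.int {X : Finset ℕ} {s t : State} (h : Keeps X s t) (i : ℕ)
    (hi : i < 50 ∨ 61 ≤ i := by omega) : t.int i = s.int i := h.2.1 i hi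

/-! ### Shots with a given amplification -/

/-- The state of the machine between the parts of the algorithm.  The number `b` bounds all numbers
that are logarithmic in the parameters, and `W` the number of repetitions of a circuit in a shot. -/
structure Machine (D : Device) (b W : ℕ) (s : State) : Prop where
  short : Short b s.int
  layout : Layout D s.int
  sized : Sized D b s.int
  psi : ∃ a : ℂ, s.psi = a • ket ∅
  one_le : 1 ≤ W
  size_le : intCost W ≤ b
  shots : (s.int 61).toNat ≤ b
  shots_pos : 0 < (s.int 61).toNat
  shots_cost : intCost (s.int 61) ≤ b
  loop : (s.int 63).toNat ≤ b
  loop_cost : intCost (s.int 63) ≤ b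

lemma Machine.of_keeps {b W : ℕ} {s t : State} {X : Finset ℕ} (h : Machine D b W s)
    (hst : Keeps X s t) : Machine D b W t where
  short := fun i hi => by rw [hst.2.1 i (Or.inl hi)]; exact h.short i hi
  layout := h.layout.congr fun i _ hi => hst.2.1 i (Or.inl (by omega))
  sized := by
    have h1 := hst.int 26
    have h2 := hst.int 27
    exact ⟨h.sized.addr, h1 ▸ h.sized.digit, h2 ▸ h.sized.digit', h.sized.one_le, h.sized.qubits⟩
  psi := hst.1
  one_le := h.one_le
  size_le := h.size_le
  shots := by rw [hst.int 61]; exact h.shots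
  shots_pos := by rw [hst.int 61]; exact h.shots_pos
  shots_cost := by rw [hst.int 61]; exact h.shots_cost
  loop := by rw [hst.int 63]; exact h.loop
  loop_cost := by rw [hst.int 63]; exact h.loop_cost

/-- The circuits of the algorithm. -/
def IsCirc (A : List Item) : Prop := A = detectCirc false ∨ A = detectCirc true ∨ A = overlapCirc

lemma IsCirc.cost {A : List Item} (hA : IsCirc A) {b : ℕ} {ρ : ℕ → ℤ}
    (h : Layout D ρ) (hs : Sized D b ρ) : circCost D b ρ A ≤ 600 * (b ^ 2 * D.T) := by
  rcases hA with rfl | rfl | rfl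
  · exact circCost_detect_le h hs false
  · exact circCost_detect_le h hs true
  · exact circCost_overlap_le h hs

lemma IsCirc.below {A : List Item} (hA : IsCirc A) {ρ : ℕ → ℤ} (h : Layout D ρ) :
    ∀ o ∈ circOps ρ A, o.Below D D.qubits := by
  rcases hA with rfl | rfl | rfl
  · rw [circOps_detect h]; exact detectOps_below D _ _
  · rw [circOps_detect h]; exact detectOps_below D _ _
  · rw [circOps_overlap h]; exact overlapOps_below D _ _

/-- Shots in which the circuit is repeated as often as the real variable `10` says. -/
def ampShots (A : List Item) : Prog :=
  .seq (assignFloor 60 ((.var 10 - .const 1) / .const 2)) (shots A)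

/-- The probability that a shot counts after `j` steps of amplitude amplification. -/
noncomputable def ampProb (D : Device) (ρ : ℕ → ℤ) (A : List Item) (j : ℕ) : ℝ :=
  shotProb D (update ρ 60 j) A

lemma ampProb_congr {ρ σ : ℕ → ℤ} (h : ∀ i < 50, ρ i = σ i) (A : List Item) (j : ℕ) :
    ampProb D ρ A j = ampProb D σ A j := by
  unfold ampProb
  refine shotProb_congr (fun i hi => ?_) (by simp) A
  have : i ≠ 60 := by omega
  simp [this, h i hi]

/-- The unit of time in the estimates of the running time. -/
def Device.unitCost (D : Device) (b W : ℕ) : ℕ := b ^ 3 * D.T * W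

lemma le_unitCost {b W : ℕ} {s : State} (h : Machine D b W s) : b ≤ D.unitCost b W := by
  have h1 := h.one_le
  have h2 := h.sized.one_le
  have hb : 1 ≤ b := (one_le_intCost _).trans h.size_le
  unfold Device.unitCost
  calc b = b * 1 * 1 := by ring
    _ ≤ b ^ 3 * D.T * W := Nat.mul_le_mul (Nat.mul_le_mul (Nat.le_self_pow (by omega) b) h2) h1

lemma det_setAmp {b W : ℕ} {s : State} (h : Machine D b W s) {j : ℕ} (hj : j + 1 ≤ W)
    (hK : s.real 10 = 2 * j + 1) :
    Det D s (assignFloor 60 ((.var 10 - .const 1) / .const 2)) fun t => Keeps ∅ s t ∧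
      t.int 60 = j ∧ t.psi = s.psi ∧ t.time ≤ s.time + (30 + b) := by
  have hfl : ⌊((RExp.var 10 - .const 1) / .const 2 : RExp).eval s.real⌋ = j := by
    simp [hK]
  refine (det_assignFloor D 60 (e := (.var 10 - .const 1) / .const 2) (by simp) s).mono
    fun t ht => ?_
  rw [hfl] at ht
  obtain ⟨h1, h2, h3, h4⟩ := ht
  refine ⟨⟨h3 ▸ h.psi, fun i hi => ?_, fun r hr _ => h1 r (by omega)⟩, ?_, h3, ?_⟩
  · rw [h2 i (by omega), if_neg (by omega)]
  · rw [h2 60 (by omega), if_pos rfl]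
  · rw [h4]
    have e1 : ((RExp.var 10 - .const 1) / .const 2 : RExp).cost ≤ 30 := by decide
    have e2 : intCost (j : ℤ) ≤ b := (intCost_le (by omega)).trans h.size_le
    omega

lemma ready_of_setAmp {b W : ℕ} {A : List Item} (hA : IsCirc A) {s t : State}
    (h : Machine D b W s) {j : ℕ} (hj : j + 1 ≤ W) (hst : Keeps ∅ s t) (h60 : t.int 60 = j) :
    Ready D b A t where
  short := (h.of_keeps hst).short
  layout := (h.of_keeps hst).layout
  psi := hst.1
  below := hA.below (h.of_keeps hst).layout
  iter := by
    rw [h60]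
    exact (intCost_le (by omega)).trans h.size_le

lemma shotProb_of_setAmp {A : List Item} {s t : State} {j : ℕ} (hst : Keeps ∅ s t)
    (h60 : t.int 60 = j) : shotProb D t.int A = ampProb D s.int A j := by
  refine shotProb_congr (fun i hi => ?_) (by simp [h60]) A
  have : i ≠ 60 := by omega
  simp [this, hst.2.1 i (Or.inl hi)]

lemma always_ampShots (hU : D.Unitary) {b W : ℕ} {A : List Item} (hA : IsCirc A)
    {s : State} (h : Machine D b W s) {j : ℕ} (hj : j + 1 ≤ W) (hK : s.real 10 = 2 * j + 1) :
    Always D s (ampShots A) fun t => Keeps {12} s t ∧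
      (s.real 12 ≤ t.real 12 ∧ t.real 12 ≤ s.real 12 + (s.int 61).toNat) ∧
      (ampProb D s.int A j = 0 → t.real 12 = s.real 12) ∧
      t.time ≤ s.time + 2300 * D.unitCost b W := by
  refine Always.det_seq (det_setAmp h hj hK) fun t ht => ?_
  obtain ⟨h1, h2, h3, h4⟩ := ht
  have hm := h.of_keeps h1
  have h12 : t.real 12 = s.real 12 := h1.real 12
  have h61 : t.int 61 = s.int 61 := h1.int 61
  refine (always_shots hU (ready_of_setAmp hA h hj h1 h2)).mono fun u hu => ?_
  rw [shotProb_of_setAmp h1 h2, h12, h61, h2, Int.toNat_natCast] at hu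
  obtain ⟨u1, u2, u3, u4⟩ := hu
  refine ⟨⟨u1.1, fun i hi => (u1.2.1 i (by omega)).trans (h1.2.1 i hi), fun r hr hX =>
    (u1.2.2 r hr (by simpa using hX)).trans (h1.2.2 r hr (by simp))⟩, u2, u3, ?_⟩
  have hc := shotCost_le hm.layout hm.sized (hA.cost hm.layout hm.sized) j
  have hb := le_unitCost h
  have hS := h.shots
  have hS' := h.shots_cost
  have hle : (s.int 61).toNat * (1 + shotCost D b t.int A j) ≤
      b + 2200 * D.unitCost b W := by
    have e1 : (j + 1) * (b ^ 2 * D.T) ≤ W * (b ^ 2 * D.T) := Nat.mul_le_mul_right _ hj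
    calc (s.int 61).toNat * (1 + shotCost D b t.int A j)
        ≤ b * (1 + 2200 * (W * (b ^ 2 * D.T))) := Nat.mul_le_mul hS (by omega)
      _ = b + 2200 * D.unitCost b W := by unfold Device.unitCost; ring
  have hb1 : 1 ≤ b := (one_le_intCost _).trans h.size_le
  omega

/-- The accuracy of the relative frequencies, small enough for `newton_step`. -/
noncomputable def tol : ℝ := 1 / 4000

/-- The failure probability of `S` shots. -/
noncomputable def failProb (S : ℕ) : ℝ := 2 * exp (-(S * tol ^ 2 / 4))

lemma failProb_nonneg (S : ℕ) : 0 ≤ failProb S := by unfold failProb; positivity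

lemma err_ampShots (hU : D.Unitary) {b W : ℕ} {A : List Item} (hA : IsCirc A)
    {s : State} (h : Machine D b W s) {j : ℕ} (hj : j + 1 ≤ W) (hK : s.real 10 = 2 * j + 1) :
    Err D s (ampShots A) (failProb (s.int 61).toNat) fun t =>
      |t.real 12 - s.real 12 - (s.int 61).toNat * ampProb D s.int A j| ≤
        tol * (s.int 61).toNat := by
  refine Err.det_seq (det_setAmp h hj hK) (fun t ht => ht.2.2.1) fun t ht => ?_
  obtain ⟨h1, h2, h3, h4⟩ := ht
  have h12 : t.real 12 = s.real 12 := h1.real 12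
  have h61 : t.int 61 = s.int 61 := h1.int 61
  have := err_shots hU (ready_of_setAmp hA h hj h1 h2) (κ := tol) (by norm_num [tol])
    (by norm_num [tol])
  rw [shotProb_of_setAmp h1 h2, h12, h61] at this
  exact this

lemma ampProb_detect (hU : D.Unitary) {ρ : ℕ → ℤ} (h : Layout D ρ) (c : Bool) {φ : ℝ}
    (hφ : D.digitProb c (ρ (if c then 27 else 26)) = (1 - cos φ) / 2) (j : ℕ) :
    ampProb D ρ (detectCirc c) j = (1 - cos ((2 * j + 1) * φ)) / 2 := by
  unfold ampProb shotProb
  have hc : circOps (update ρ 60 (j : ℤ)) (detectCirc c) = circOps ρ (detectCirc c) :=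
    circOps_congr (fun i hi => by
      have : i ≠ 60 := by omega
      simp [this]) _
  rw [hc, circOps_detect h, update_self, Int.toNat_natCast]
  exact normSq_project_grover hU (detectOps_below D _ _) (by rw [normSq_detectOps, hφ]) j

/-- Amplitude amplification multiplies the angle that encodes the overlap by `2 j + 1`. -/
lemma ampProb_overlap (hU : D.Unitary) {φ : Bits D.n → Feature D.N}
    (hφ : D.HasFeature φ) {ρ : ℕ → ℤ} (h : Layout D ρ) {θ : ℝ}
    (hθ : cos θ = D.overlap φ (ρ 26) (ρ 27) / 2) (j : ℕ) :
    ampProb D ρ overlapCirc j = (1 - cos ((2 * j + 1) * θ)) / 2 := by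
  unfold ampProb shotProb
  have hc : circOps (update ρ 60 (j : ℤ)) overlapCirc = circOps ρ overlapCirc :=
    circOps_congr (fun i hi => by
      have : i ≠ 60 := by omega
      simp [this]) _
  rw [hc, circOps_overlap h, update_self, Int.toNat_natCast]
  exact normSq_project_grover hU (overlapOps_below D _ _)
    (by rw [normSq_overlapOps hU hφ, ← hθ]) j

/-! ### Detection of digits -/

/-- One round of the detection: unless the amplification is already strong enough, count the outcomes
of some shots, and amplify three times as much in the next round. -/
def detectBody (c : Bool) : Prog :=
  .seq (assign 22 (.const 2 * .var 13))
    (.ifLt 10 22 (.seq (ampShots (detectCirc c)) (assign 10 (.const 3 * .var 10))) .skip)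

/-- Find out whether a digit is set at one of the addresses: in this case some shots with a suitable
amplification are counted in the real variable `12`. -/
def detect (c : Bool) : Prog :=
  .seq (.seq (assign 10 (.const 1)) (assign 12 (.const 0))) (.rep 63 (detectBody c))

lemma three_pow_eq (i : ℕ) : (3 : ℝ) ^ i = 2 * (((3 ^ i - 1) / 2 : ℕ) : ℝ) + 1 := by
  have h : 3 ^ i = 2 * ((3 ^ i - 1) / 2) + 1 := by
    obtain ⟨k, hk⟩ := (show Odd 3 by decide).pow (n := i)
    omega
  exact_mod_cast h

lemma always_detectBody (hU : D.Unitary) {b W : ℕ} {s : State} (h : Machine D b W s)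
    (c : Bool) {i : ℕ} (hi : s.real 10 = 3 ^ i) (hq : 2 * s.real 13 ≤ W) :
    Always D s (detectBody c) fun t => Keeps {10, 12, 22} s t ∧ s.real 12 ≤ t.real 12 ∧
      ((∀ j, ampProb D s.int (detectCirc c) j = 0) → t.real 12 = s.real 12) ∧
      t.real 10 = (if (3 : ℝ) ^ i < 2 * s.real 13 then 3 ^ (i + 1) else 3 ^ i) ∧
      t.time ≤ s.time + 2400 * D.unitCost b W := by
  have hb1 : 1 ≤ D.unitCost b W := ((one_le_intCost _).trans h.size_le).trans (le_unitCost h)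
  refine Always.det_seq (det_assign_keeps D (r := 22) (by omega) (e := .const 2 * .var 13) (by simp)
    h.psi) fun t ht => ?_
  obtain ⟨h1, h2, h3, h4⟩ := ht
  have e0 : (RExp.const 2 * RExp.var 13 : RExp).cost ≤ 20 := by decide
  have e10 : t.real 10 = 3 ^ i := by rw [h1.real 10, hi]
  have e12 : t.real 12 = s.real 12 := h1.real 12
  simp only [RExp.eval_mul, RExp.eval_const, RExp.eval_var, Int.cast_ofNat] at h2
  have k1 : Keeps {10, 12, 22} s t := h1.mono (by simp)
  have hm : Machine D b W (t.tick 1) := h.of_keeps (show Keeps {22} s (t.tick 1) from h1)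
  have hrho : ∀ j < 50, (t.tick 1).int j = s.int j := fun j hj => h1.2.1 j (Or.inl hj)
  refine always_ifLt (fun hlt => ?_) fun hlt => ?_
  · rw [e10, h2] at hlt
    rw [if_pos hlt]
    have hj := three_pow_eq i
    have hjW : (3 ^ i - 1) / 2 + 1 ≤ W := by
      have h3W : 3 ^ i ≤ W := by exact_mod_cast (hlt.le.trans hq)
      have : 0 < 3 ^ i := by positivity
      omega
    refine Always.seq hU (always_ampShots hU (A := detectCirc c)
      (by cases c <;> simp [IsCirc]) hm hjW (show t.real 10 = _ from e10.trans hj)) fun u hu => ?_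
    obtain ⟨u1, u2, u3, u4⟩ := hu
    simp only [ampProb_congr hrho] at u3
    have u12 : (t.tick 1).real 12 = s.real 12 := e12
    rw [u12] at u2 u3
    refine Det.always ((det_assign_keeps D (r := 10) (by omega) (e := .const 3 * .var 10) (by simp)
      u1.1).mono fun v hv => ?_)
    obtain ⟨v1, v2, v3, v4⟩ := hv
    have v12 : v.real 12 = u.real 12 := v1.real 12
    have u10 : u.real 10 = t.real 10 := u1.real 10
    refine ⟨(k1.trans (show Keeps {10, 12, 22} t u from (Keeps.mono u1 (by simp)))).trans
      (v1.mono (by simp)), by rw [v12]; exact u2.1, fun hp => by rw [v12, u3 (hp _)], ?_, ?_⟩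
    · rw [v2]
      simp only [RExp.eval_mul, RExp.eval_const, RExp.eval_var, Int.cast_ofNat]
      rw [u10, e10, pow_succ]; ring
    · have e3 : (RExp.const 3 * RExp.var 10 : RExp).cost ≤ 20 := by decide
      simp only [State.tick] at u4
      omega
  · rw [e10, h2] at hlt
    rw [if_neg hlt]
    exact always_skip ⟨k1, e12.ge, fun _ => e12, e10, by simp only [State.tick]; omega⟩

lemma err_detectBody (hU : D.Unitary) {b W : ℕ} {s : State} (h : Machine D b W s)
    (c : Bool) {i : ℕ} (hi : s.real 10 = 3 ^ i) (hq : 2 * s.real 13 ≤ W) :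
    Err D s (detectBody c) (failProb (s.int 61).toNat) fun t =>
      (3 : ℝ) ^ i < 2 * s.real 13 →
        1 / 4 ≤ ampProb D s.int (detectCirc c) ((3 ^ i - 1) / 2) → s.real 12 < t.real 12 := by
  refine Err.det_seq (det_assign_keeps D (r := 22) (by omega) (e := .const 2 * .var 13) (by simp)
    h.psi) (fun t ht => ht.2.2.1) fun t ht => ?_
  obtain ⟨h1, h2, h3, h4⟩ := ht
  have e10 : t.real 10 = 3 ^ i := by rw [h1.real 10, hi]
  have e12 : t.real 12 = s.real 12 := h1.real 12
  simp only [RExp.eval_mul, RExp.eval_const, RExp.eval_var, Int.cast_ofNat] at h2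
  have hm : Machine D b W (t.tick 1) := h.of_keeps (show Keeps {22} s (t.tick 1) from h1)
  have hrho : ∀ j < 50, (t.tick 1).int j = s.int j := fun j hj => h1.2.1 j (Or.inl hj)
  have h61 : (t.tick 1).int 61 = s.int 61 := h1.int 61
  refine err_ifLt (fun hlt => ?_) fun hlt => ?_
  · rw [e10, h2] at hlt
    have hj := three_pow_eq i
    have hjW : (3 ^ i - 1) / 2 + 1 ≤ W := by
      have h3W : 3 ^ i ≤ W := by exact_mod_cast (hlt.le.trans hq)
      have : 0 < 3 ^ i := by positivity
      omega
    have hA : IsCirc (detectCirc c) := by cases c <;> simp [IsCirc]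
    have hK : (t.tick 1).real 10 = 2 * (((3 ^ i - 1) / 2 : ℕ) : ℝ) + 1 := e10.trans hj
    have herr := err_ampShots hU hA hm hjW hK
    rw [h61, ampProb_congr hrho] at herr
    have := Err.seq (q := assign 10 (.const 3 * .var 10)) hU (δ' := 0) le_rfl
      (always_ampShots hU hA hm hjW hK) herr (G' := fun v => (3 : ℝ) ^ i < 2 * s.real 13 →
        1 / 4 ≤ ampProb D s.int (detectCirc c) ((3 ^ i - 1) / 2) → s.real 12 < v.real 12) ?_
    · rwa [add_zero] at this
    · intro u hu hG
      refine Always.err_imp (Det.always (det_assign_keeps D (r := 10) (by omega)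
        (e := .const 3 * .var 10) (by simp) hu.1.1)) le_rfl ?_
      intro v hv _ hp
      have v12 : v.real 12 = u.real 12 := hv.1.real 12
      rw [v12, ← e12]
      simp only [State.tick] at hG
      have hS : (0 : ℝ) < (s.int 61).toNat := by exact_mod_cast h.shots_pos
      have := (abs_le.1 hG).1
      unfold tol at this
      nlinarith
  · rw [e10, h2] at hlt
    exact (always_skip (A := fun _ => True) trivial).err_imp (failProb_nonneg _)
      fun _ _ h' => absurd h' hlt

lemma det_detectInit (D : Device) {s : State} (hs : ∃ a : ℂ, s.psi = a • ket ∅) :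
    Det D s (.seq (assign 10 (.const 1)) (assign 12 (.const 0))) fun t => Keeps {10, 12, 22} s t ∧
      t.real 10 = 1 ∧ t.real 12 = 0 ∧ t.psi = s.psi ∧ t.time ≤ s.time + 20 := by
  refine (det_assign_keeps D (r := 10) (by omega) (e := .const 1) (by simp) hs).seq fun t ht => ?_
  obtain ⟨h1, h2, h3, h4⟩ := ht
  refine (det_assign_keeps D (r := 12) (by omega) (e := .const 0) (by simp) h1.1).mono
    fun u hu => ?_
  obtain ⟨u1, u2, u3, u4⟩ := hu
  have e1 : (RExp.const 1).cost ≤ 4 := by decide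
  have e2 : (RExp.const 0).cost ≤ 4 := by decide
  refine ⟨(h1.mono (by simp)).trans (u1.mono (by simp)), ?_, by simpa using u2, u3.trans h3, by omega⟩
  rw [u1.real 10, h2]; simp

/-- The invariant of the loop in the detection. -/
def DetectInv (D : Device) (b W : ℕ) (c : Bool) (s : State) (k : ℕ) (t : State) : Prop :=
  Keeps {10, 12, 22} s t ∧ 0 ≤ t.real 12 ∧
    ((∀ j, ampProb D s.int (detectCirc c) j = 0) → t.real 12 = 0) ∧
    (∃ i ≤ k, t.real 10 = 3 ^ i ∧ (i = k ∨ 2 * s.real 13 ≤ 3 ^ i)) ∧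
    t.time ≤ s.time + (20 + b + k * (2401 * D.unitCost b W))

lemma detectInv_step (hU : D.Unitary) {b W : ℕ} {s : State} (h : Machine D b W s)
    (c : Bool) (hq : 2 * s.real 13 ≤ W) {k : ℕ} {t : State} (ht : DetectInv D b W c s k t) :
    Always D (t.tick 1) (detectBody c) fun u => DetectInv D b W c s (k + 1) u ∧
      t.real 12 ≤ u.real 12 := by
  obtain ⟨h1, h2, h3, ⟨i, hik, h4, h5⟩, h6⟩ := ht
  have e13 : (t.tick 1).real 13 = s.real 13 := h1.real 13
  refine (always_detectBody hU (h.of_keeps (show Keeps _ s (t.tick 1) from h1)) c (i := i) h4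
    (by rw [e13]; exact hq)).mono fun u hu => ?_
  obtain ⟨u1, u2, u3, u4, u5⟩ := hu
  rw [e13] at u4
  simp only [ampProb_congr (ρ := (t.tick 1).int) (σ := s.int)
    (fun j hj => h1.2.1 j (Or.inl hj))] at u3
  have hb1 : 1 ≤ D.unitCost b W := ((one_le_intCost _).trans h.size_le).trans (le_unitCost h)
  simp only [State.tick] at u2 u3 u5
  refine ⟨⟨h1.trans u1, h2.trans u2, fun hp => (u3 hp).trans (h3 hp), ?_, ?_⟩, u2⟩
  · by_cases hlt : (3 : ℝ) ^ i < 2 * s.real 13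
    · rw [if_pos hlt] at u4
      rcases h5 with rfl | h5
      · exact ⟨i + 1, le_rfl, u4, Or.inl rfl⟩
      · exact absurd hlt (not_lt.2 h5)
    · rw [if_neg hlt] at u4
      exact ⟨i, by omega, u4, Or.inr (not_lt.1 hlt)⟩
  · rw [add_mul, one_mul]; omega

lemma detectInv_zero {b W : ℕ} {s : State} (h : Machine D b W s)
    (c : Bool) {t : State} (h1 : Keeps {10, 12, 22} s t) (h2 : t.real 10 = 1) (h3 : t.real 12 = 0)
    (h4 : t.time ≤ s.time + 20) : DetectInv D b W c s 0 (t.tick (intCost (t.int 63))) := by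
  refine ⟨h1, h3.ge, fun _ => h3, ⟨0, le_rfl, by rw [pow_zero]; exact h2, Or.inl rfl⟩, ?_⟩
  have := h.loop_cost
  simp only [State.tick, h1.int 63]
  omega

lemma always_detect (hU : D.Unitary) {b W : ℕ} {s : State} (h : Machine D b W s)
    (c : Bool) (hq : 2 * s.real 13 ≤ W) :
    Always D s (detect c) fun t => Keeps {10, 12, 22} s t ∧ 0 ≤ t.real 12 ∧
      ((∀ j, ampProb D s.int (detectCirc c) j = 0) → t.real 12 = 0) ∧
      t.time ≤ s.time + 2500 * (b * D.unitCost b W) := by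
  refine Always.det_seq (det_detectInit D h.psi) fun t ht => ?_
  obtain ⟨h1, h2, h3, -, h4⟩ := ht
  refine (always_rep hU (DetectInv D b W c s) (detectInv_zero h c h1 h2 h3 h4)
    fun k _ u hu => (detectInv_step hU h c hq hu).mono fun _ h => h.1).mono fun u hu => ?_
  rw [h1.int 63] at hu
  refine ⟨hu.1, hu.2.1, hu.2.2.1, hu.2.2.2.2.trans ?_⟩
  have hb := le_unitCost h
  have hb1 : 1 ≤ b := (one_le_intCost _).trans h.size_le
  have hl : (s.int 63).toNat * (2401 * D.unitCost b W) ≤ b * (2401 * D.unitCost b W) :=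
    Nat.mul_le_mul_right _ h.loop
  have hb' : D.unitCost b W ≤ b * D.unitCost b W := Nat.le_mul_of_pos_left _ hb1
  have : b * (2401 * D.unitCost b W) = 2401 * (b * D.unitCost b W) := by ring
  omega

/-- If the probability is at least `1 / 4` in round `i`, some shot of this round is counted. -/
lemma err_detect (hU : D.Unitary) {b W : ℕ} {s : State} (h : Machine D b W s)
    (c : Bool) (hq : 2 * s.real 13 ≤ W) {i : ℕ} (hi : i < (s.int 63).toNat)
    (hiq : (3 : ℝ) ^ i < 2 * s.real 13)
    (hp : 1 / 4 ≤ ampProb D s.int (detectCirc c) ((3 ^ i - 1) / 2)) :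
    Err D s (detect c) ((s.int 63).toNat * failProb (s.int 61).toNat) fun t => 0 < t.real 12 := by
  refine Err.det_seq (det_detectInit D h.psi) (fun t ht => ht.2.2.2.1) fun t ht => ?_
  obtain ⟨h1, h2, h3, -, h4⟩ := ht
  have h63 : t.int 63 = s.int 63 := h1.int 63
  have := err_rep hU (s := t) (i := 63) (p := detectBody c) (failProb_nonneg (s.int 61).toNat)
    (DetectInv D b W c s) (fun k u => i < k → 0 < u.real 12)
    (detectInv_zero h c h1 h2 h3 h4)
    (fun k _ u hu => (detectInv_step hU h c hq hu).mono fun _ h => h.1)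
    (fun h => absurd h (by omega)) ?_
  · rw [h63] at this
    exact this.mono le_rfl (A := fun _ => True) (fun _ _ _ => trivial) fun _ _ hG => hG hi
  · intro k _ u hu hG
    have hstep := detectInv_step hU h c hq hu
    obtain ⟨k1, k2, k3, ⟨i', hik, k4, k5⟩, k6⟩ := hu
    have e13 : (u.tick 1).real 13 = s.real 13 := k1.real 13
    have e61 : (u.tick 1).int 61 = s.int 61 := k1.int 61
    have herr := err_detectBody hU (h.of_keeps (show Keeps _ s (u.tick 1) from k1)) c (i := i') k4
      (by rw [e13]; exact hq)
    rw [e13, e61, ampProb_congr (ρ := (u.tick 1).int) (σ := s.int)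
      (fun j hj => k1.2.1 j (Or.inl hj))] at herr
    refine herr.mono le_rfl hstep fun v hv hg hik' => ?_
    rcases Nat.lt_succ_iff_lt_or_eq.1 hik' with hlt | rfl
    · exact (hG hlt).trans_le hv.2
    · rcases k5 with rfl | k5
      · exact k2.trans_lt (hg hiq hp)
      · have : (3 : ℝ) ^ i' ≤ 3 ^ i := pow_le_pow_right₀ (by norm_num) hik
        linarith

/-- A digit that is set with probability at least `1 / q ^ 2` is detected with some amplification:
tripling the angle until it exceeds `π / 3` does not overshoot `π`. -/
lemma exists_amplification (hU : D.Unitary) {ρ : ℕ → ℤ} (h : Layout D ρ) (c : Bool)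
    {q : ℝ} (hq : 1 ≤ q) (hp : 1 / q ^ 2 ≤ D.digitProb c (ρ (if c then 27 else 26))) :
    ∃ i : ℕ, (3 : ℝ) ^ i < 2 * q ∧ 1 / 4 ≤ ampProb D ρ (detectCirc c) ((3 ^ i - 1) / 2) := by
  set p := D.digitProb c (ρ (if c then 27 else 26)) with hpdef
  have hp1 : p ≤ 1 := by
    rw [hpdef, ← normSq_detectOps]
    have h1 := normSq_project 0 (den D (detectOps D.addrLen c (ρ (if c then 27 else 26))) (ket ∅))
    rw [den_normSq hU, normSq_ket] at h1
    have h2 := normSq_nonneg (project 0 false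
      (den D (detectOps D.addrLen c (ρ (if c then 27 else 26))) (ket ∅)))
    linarith
  have hq0 : 0 < q := by linarith
  have hp0 : 0 < p := lt_of_lt_of_le (by positivity) hp
  set φ := arccos (1 - 2 * p) with hφ
  have hcos : cos φ = 1 - 2 * p := cos_arccos (by linarith) (by linarith)
  have hφ0 : 0 ≤ φ := arccos_nonneg _
  have hφπ : φ ≤ Real.pi := arccos_le_pi _
  have hlow : 2 / q ≤ φ := by
    have h1 : 1 - φ ^ 2 / 2 ≤ cos φ := one_sub_sq_div_two_le_cos
    rw [hcos] at h1
    have h2 : (2 / q) ^ 2 ≤ φ ^ 2 := by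
      have : (2 / q) ^ 2 = 4 * (1 / q ^ 2) := by field_simp; ring
      rw [this]; linarith
    exact le_of_sq_le_sq h2 hφ0
  have hφpos : 0 < φ := lt_of_lt_of_le (by positivity) hlow
  have hgrow : ∃ i : ℕ, Real.pi / 3 ≤ 3 ^ i * φ := by
    obtain ⟨i, hi⟩ := pow_unbounded_of_one_lt (Real.pi / 3 / φ) (show (1 : ℝ) < 3 by norm_num)
    exact ⟨i, by rw [div_lt_iff₀ hφpos] at hi; exact hi.le⟩
  have hpi3 := pi_gt_three
  have hpi4 := pi_lt_four
  classical
  let i := Nat.find hgrow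
  have hi : Real.pi / 3 ≤ 3 ^ i * φ := Nat.find_spec hgrow
  have hup : 3 ^ i * φ ≤ Real.pi ∧ (3 : ℝ) ^ i < 2 * q := by
    rcases Nat.eq_zero_or_pos i with h0 | h0
    · rw [h0, pow_zero, one_mul]
      exact ⟨hφπ, by linarith⟩
    · have hlt : 3 ^ (i - 1) * φ < Real.pi / 3 := by
        have := Nat.find_min hgrow (show i - 1 < Nat.find hgrow from Nat.sub_lt h0 one_pos)
        exact not_le.1 this
      have h3 : (3 : ℝ) ^ i = 3 * 3 ^ (i - 1) := by
        rw [← pow_succ']; congr 1; omega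
      have hle : 3 ^ i * φ ≤ Real.pi := by rw [h3]; linarith
      refine ⟨hle, ?_⟩
      have h5 : (3 : ℝ) ^ i * (2 / q) ≤ Real.pi :=
        (mul_le_mul_of_nonneg_left hlow (by positivity)).trans hle
      have h6 : (3 : ℝ) ^ i * (2 / q) = 3 ^ i * 2 / q := by ring
      rw [h6, div_le_iff₀ hq0] at h5
      nlinarith
  refine ⟨i, hup.2, ?_⟩
  rw [ampProb_detect hU h c (φ := φ) (by rw [hcos, ← hpdef]; ring), ← three_pow_eq]
  have : cos (3 ^ i * φ) ≤ cos (Real.pi / 3) :=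
    cos_le_cos_of_nonneg_of_le_pi (by positivity) hup.1 hi
  rw [cos_pi_div_three] at this
  linarith

/-- A digit that is not set at any address is never detected. -/
lemma ampProb_eq_zero (hU : D.Unitary) {ρ : ℕ → ℤ} (h : Layout D ρ) (c : Bool)
    (hp : D.digitProb c (ρ (if c then 27 else 26)) = 0) (j : ℕ) :
    ampProb D ρ (detectCirc c) j = 0 := by
  rw [ampProb_detect hU h c (φ := 0) (by rw [hp]; simp)]
  simp

/-! ### Newton's method for the amplitude -/

lemma abs_cos_add_sub_le {a d : ℝ} (hd : |d| ≤ 1) :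
    |cos (a + d) - cos a + sin a * d| ≤ d ^ 2 / 2 + |d| ^ 3 / 4 := by
  have h1 : |cos d - 1| ≤ d ^ 2 / 2 := by
    rw [abs_le]
    have := one_sub_sq_div_two_le_cos (x := d)
    have := cos_le_one d
    constructor <;> nlinarith [sq_nonneg d]
  have h2 : |sin d - d| ≤ |d| ^ 3 / 4 := by
    have key : ∀ x : ℝ, 0 < x → |sin x - x| ≤ x ^ 3 / 4 := by
      intro x h0
      have e1 := sin_gt_sub_cube h0
      have e2 := sin_lt h0
      rw [abs_le]; constructor <;> nlinarith [pow_pos h0 3]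
    rcases lt_trichotomy d 0 with h | h | h
    · have := key (-d) (by linarith)
      rw [sin_neg, abs_of_neg h] at *
      rw [show sin d - d = -(-sin d - -d) by ring, abs_neg]
      exact this
    · simp [h]
    · rw [abs_of_pos h] at *
      exact key d h
  rw [cos_add, show cos a * cos d - sin a * sin d - cos a +
    sin a * d = cos a * (cos d - 1) - sin a * (sin d - d) by ring]
  refine (abs_sub _ _).trans (add_le_add ?_ ?_)
  · rw [abs_mul]
    exact (mul_le_of_le_one_left (abs_nonneg _) (abs_cos_le_one a)).trans h1
  · rw [abs_mul]
    exact (mul_le_of_le_one_left (abs_nonneg _) (abs_sin_le_one a)).trans h2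

/-- The next amplification, at which the cosine is steep. -/
noncomputable def nextAmp (K φ : ℝ) : ℝ :=
  if sin ((2 * K + 1) * φ) ^ 2 < 1 / 16 then 2 * (2 * K + 1) + 1 else 2 * K + 1

/-- If `x = (2 K + 1) φ` is close to a zero of the sine, then `φ + 2 x` is not, as `φ` itself is not. -/
lemma sin_nextAmp {K φ : ℝ} (hφ : |cos φ| ≤ 3 / 5) :
    1 / 4 ≤ |sin (nextAmp K φ * φ)| := by
  unfold nextAmp
  split_ifs with h
  · set x := (2 * K + 1) * φ with hx
    have e : (2 * (2 * K + 1) + 1) * φ = φ + 2 * x := by rw [hx]; ring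
    rw [e, sin_add, cos_two_mul, sin_two_mul]
    have hx1 : |sin x| ≤ 1 / 4 := by
      apply abs_le_of_sq_le_sq _ (by norm_num)
      linarith
    have hcx : cos x ^ 2 = 1 - sin x ^ 2 := by
      have := sin_sq_add_cos_sq x; linarith
    have hsφ : 4 / 5 ≤ |sin φ| := by
      have h1 := sin_sq_add_cos_sq φ
      have h2 : cos φ ^ 2 ≤ (3 / 5) ^ 2 := by
        rw [← sq_abs]; exact pow_le_pow_left₀ (abs_nonneg _) hφ 2
      apply le_of_sq_le_sq _ (abs_nonneg _)
      rw [sq_abs]; linarith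
    have t1 : 7 / 10 ≤ |sin φ * (2 * cos x ^ 2 - 1)| := by
      rw [abs_mul, hcx, abs_of_nonneg (by linarith : (0:ℝ) ≤ 2 * (1 - sin x ^ 2) - 1)]
      have : (7 : ℝ) / 8 ≤ 2 * (1 - sin x ^ 2) - 1 := by linarith
      nlinarith [abs_nonneg (sin φ)]
    have t2 : |cos φ * (2 * sin x * cos x)| ≤ 3 / 10 := by
      rw [abs_mul, abs_mul, abs_mul, abs_two]
      have hc := abs_cos_le_one x
      have h3 : 2 * |sin x| * |cos x| ≤ 1 / 2 := by
        nlinarith [abs_nonneg (sin x), abs_nonneg (cos x)]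
      calc |cos φ| * (2 * |sin x| * |cos x|) ≤ 3 / 5 * (1 / 2) :=
            mul_le_mul hφ h3 (by positivity) (by norm_num)
        _ = 3 / 10 := by norm_num
    have := abs_sub_abs_le_abs_add (sin φ * (2 * cos x ^ 2 - 1))
      (cos φ * (2 * sin x * cos x))
    linarith
  · rw [not_lt] at h
    apply le_of_sq_le_sq _ (abs_nonneg _)
    rw [sq_abs]; linarith

lemma nextAmp_bounds {K φ : ℝ} (hK : 1 ≤ K) : 2 * K ≤ nextAmp K φ ∧ nextAmp K φ ≤ 7 * K := by
  unfold nextAmp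
  split_ifs <;> constructor <;> linarith

/-- The constant in the estimates of the error of the angle. -/
noncomputable def angleTol : ℝ := 1 / 200

lemma abs_cos_le_of_close {θ φ : ℝ} (hθ : |cos θ| ≤ 1 / 2) (h : |θ - φ| ≤ angleTol) :
    |cos φ| ≤ 3 / 5 := by
  have h1 := abs_cos_sub_cos_le θ φ
  have h2 := abs_sub_abs_le_abs_sub (cos φ) (cos θ)
  rw [abs_sub_comm] at h2
  unfold angleTol at h
  linarith

/-- One step of Newton's method improves the estimate of the angle in proportion to the
amplification. -/
lemma newton_step {θ φ K C : ℝ} (hθ : |cos θ| ≤ 1 / 2) (hK : 1 ≤ K)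
    (h : |θ - φ| ≤ angleTol / K) (hC : |C - cos (nextAmp K φ * θ)| ≤ 2 * tol) :
    |θ - (φ + (cos (nextAmp K φ * φ) - C) / (nextAmp K φ * sin (nextAmp K φ * φ)))| ≤
      angleTol / nextAmp K φ := by
  have hφ : |cos φ| ≤ 3 / 5 := abs_cos_le_of_close hθ
    (h.trans (div_le_self (by norm_num [angleTol]) hK))
  have hs := sin_nextAmp (K := K) hφ
  obtain ⟨hK1, hK2⟩ := nextAmp_bounds (φ := φ) hK
  set K' := nextAmp K φ with hK'
  have hK'0 : 0 < K' := by linarith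
  set d := K' * (θ - φ) with hd
  have hdle : |d| ≤ 7 * angleTol := by
    rw [hd, abs_mul, abs_of_pos hK'0]
    calc K' * |θ - φ| ≤ 7 * K * (angleTol / K) := mul_le_mul hK2 h (abs_nonneg _) (by linarith)
      _ = 7 * angleTol := by field_simp
  have hd1 : |d| ≤ 1 := hdle.trans (by norm_num [angleTol])
  have hT := abs_cos_add_sub_le (a := K' * φ) hd1
  rw [show K' * φ + d = K' * θ by rw [hd]; ring] at hT
  set S := sin (K' * φ) with hS
  have hS0 : S ≠ 0 := by
    intro h0; rw [h0, abs_zero] at hs; norm_num at hs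
  have key : (θ - (φ + (cos (K' * φ) - C) / (K' * S))) * (K' * S) =
      (cos (K' * θ) - cos (K' * φ) + S * d) + (C - cos (K' * θ)) := by
    rw [hd]; field_simp; ring
  rw [le_div_iff₀ hK'0]
  have h1 : |θ - (φ + (cos (K' * φ) - C) / (K' * S))| * K' * (1 / 4) ≤
      |θ - (φ + (cos (K' * φ) - C) / (K' * S))| * K' * |S| :=
    mul_le_mul_of_nonneg_left hs (mul_nonneg (abs_nonneg _) hK'0.le)
  have h2 : |θ - (φ + (cos (K' * φ) - C) / (K' * S))| * K' * |S| ≤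
      d ^ 2 / 2 + |d| ^ 3 / 4 + 2 * tol := by
    rw [mul_assoc, ← abs_of_pos hK'0, ← abs_mul, ← abs_mul, abs_of_pos hK'0, key]
    exact (abs_add_le _ _).trans (add_le_add hT hC)
  have h3 : d ^ 2 / 2 + |d| ^ 3 / 4 ≤ (7 * angleTol) ^ 2 / 2 + (7 * angleTol) ^ 3 / 4 := by
    rw [← sq_abs]
    gcongr
  unfold angleTol tol at *
  norm_num at h1 h2 h3 ⊢
  linarith

/-- The first estimate of the angle, without amplification. -/
lemma newton_start {θ C : ℝ} (hθ0 : 0 ≤ θ) (hθπ : θ ≤ Real.pi) (hθ : |cos θ| ≤ 1 / 2)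
    (hC : |C - cos θ| ≤ 2 * tol) (hC1 : -1 ≤ C) (hC2 : C ≤ 1) :
    |θ - arccos C| ≤ angleTol := by
  set φ := arccos C with hφ
  have hcos : cos φ = C := cos_arccos hC1 hC2
  have hφ0 : 0 ≤ φ := arccos_nonneg _
  have hφπ : φ ≤ Real.pi := arccos_le_pi _
  have hpi3 := pi_gt_three
  have hpi4 := pi_lt_four
  have hθ3 : Real.pi / 3 ≤ θ ∧ θ ≤ Real.pi - Real.pi / 3 := by
    have habs := abs_le.1 hθ
    constructor
    · by_contra hlt
      have := cos_lt_cos_of_nonneg_of_le_pi hθ0 (by linarith) (not_le.1 hlt)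
      rw [cos_pi_div_three] at this
      linarith
    · by_contra hlt
      have := cos_lt_cos_of_nonneg_of_le_pi (by linarith) hθπ (not_le.1 hlt)
      rw [cos_pi_sub, cos_pi_div_three] at this
      linarith
  have hmid : 1 / 2 ≤ sin ((φ + θ) / 2) := by
    rw [← cos_pi_div_three, ← cos_sub_pi_div_two, ← cos_abs ((φ + θ) / 2 - _)]
    refine cos_le_cos_of_nonneg_of_le_pi (abs_nonneg _) (by linarith) ?_
    rw [abs_le]; constructor <;> linarith
  have hdiff : 2 / Real.pi * (|θ - φ| / 2) ≤ |sin ((φ - θ) / 2)| := by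
    have hle : |θ - φ| ≤ Real.pi := by rw [abs_le]; constructor <;> linarith
    have h1 := mul_le_sin (x := |θ - φ| / 2) (by positivity) (by linarith)
    refine h1.trans ?_
    rcases le_total θ φ with h | h
    · rw [abs_of_nonpos (by linarith)]
      rw [show -(θ - φ) / 2 = (φ - θ) / 2 by ring]; exact le_abs_self _
    · rw [abs_of_nonneg (by linarith), show (φ - θ) / 2 = -((θ - φ) / 2) by ring, sin_neg,
        abs_neg]
      exact le_abs_self _
  have heq : |C - cos θ| = 2 * |sin ((φ + θ) / 2)| * |sin ((φ - θ) / 2)| := by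
    rw [← hcos, cos_sub_cos, abs_mul, abs_mul, abs_neg, abs_two]
  have h2 : 2 / Real.pi * (|θ - φ| / 2) ≤ |C - cos θ| := by
    rw [heq]
    have : 1 ≤ 2 * |sin ((φ + θ) / 2)| := by
      have := le_abs_self (sin ((φ + θ) / 2)); linarith
    nlinarith [abs_nonneg (sin ((φ - θ) / 2))]
  have h3 : |θ - φ| / Real.pi ≤ 2 * tol := by
    refine le_trans (le_of_eq ?_) (h2.trans hC)
    ring
  rw [div_le_iff₀ pi_pos] at h3
  unfold tol at h3
  unfold angleTol
  nlinarith

/-! ### Estimation of the overlap -/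

attribute [local irreducible] assign assignFloor

lemma det_ifLt {s : State} {a b : ℕ} {p q : Prog} {A : State → Prop}
    (h1 : s.real a < s.real b → Det D (s.tick 1) p A)
    (h2 : ¬ s.real a < s.real b → Det D (s.tick 1) q A) : Det D s (.ifLt a b p q) A := by
  unfold Det
  simp only [run]
  split_ifs with h
  · exact h1 h
  · exact h2 h

/-- The squared sine that governs the choice of the next amplification. -/
def sinSqExp : RExp := .fn .sin (.var 22 * .var 11) * .fn .sin (.var 22 * .var 11)

/-- The part of `anglePrep` that chooses between the two candidates. -/
def chooseAmp : Prog :=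
  .ifLt 23 24 (assign 10 (.const 2 * .var 22 + .const 1)) (assign 10 (.var 22))

/-- Compute the next amplification. -/
def anglePrep : Prog :=
  .seq (assign 22 (.const 2 * .var 10 + .const 1))
    (.seq (assign 23 sinSqExp)
    (.seq (assign 24 (.const 1 / .const 16))
    (.seq chooseAmp
      (assign 12 (.const 0)))))

/-- The expression for the cosine that was estimated from the shots. -/
def cosExp : RExp := .const 1 - .const 2 * .var 12 / .var 14

/-- The expression for the improved angle. -/
def newtonExp : RExp :=
  .var 11 + (.fn .cos (.var 10 * .var 11) - cosExp) / (.var 10 * .fn .sin (.var 10 * .var 11))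

/-- Improve the estimate of the angle by means of shots with a larger amplification. -/
def angleStep : Prog :=
  .seq anglePrep (.seq (ampShots overlapCirc) (assign 11 newtonExp))

/-- A first estimate of the angle. -/
def angleInit : Prog :=
  .seq (.seq (assign 10 (.const 1)) (assign 12 (.const 0)))
    (.seq (ampShots overlapCirc) (assign 11 (.fn .arccos cosExp)))

/-- Estimate the angle that encodes the overlap, until the amplification exceeds the real variable
`17`. -/
def angle : Prog := .seq angleInit (.rep 63 (.ifLt 10 17 angleStep .skip))

/-- The real variables that are changed. -/
def angleVars : Finset ℕ := {10, 11, 12, 22, 23, 24}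

lemma det_chooseAmp (D : Device) {s : State} {K φ : ℝ} (hs : ∃ a : ℂ, s.psi = a • ket ∅)
    (e22 : s.real 22 = 2 * K + 1) (e23 : s.real 23 = sin ((2 * K + 1) * φ) ^ 2)
    (e24 : s.real 24 = 1 / 16) :
    Det D s chooseAmp fun t => Keeps {10} s t ∧ t.real 10 = nextAmp K φ ∧ t.psi = s.psi ∧
      t.time ≤ s.time + 30 := by
  have f1 : (RExp.const 2 * RExp.var 22 + RExp.const 1 : RExp).cost ≤ 20 := by decide
  have f2 : (RExp.var 22).cost ≤ 20 := by decide
  refine det_ifLt (fun h => ?_) fun h => ?_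
  · rw [e23, e24] at h
    refine (det_assign_keeps D (r := 10) (by omega) (e := .const 2 * .var 22 + .const 1) (by simp)
      (s := s.tick 1) hs).mono fun t ht => ?_
    obtain ⟨d1, d2, d3, d4⟩ := ht
    refine ⟨d1, ?_, d3, by simp only [State.tick] at d4; omega⟩
    rw [d2, nextAmp, if_pos h]
    simp [State.tick, e22]
  · rw [e23, e24] at h
    refine (det_assign_keeps D (r := 10) (by omega) (e := .var 22) (by simp)
      (s := s.tick 1) hs).mono fun t ht => ?_
    obtain ⟨d1, d2, d3, d4⟩ := ht
    refine ⟨d1, ?_, d3, by simp only [State.tick] at d4; omega⟩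
    rw [d2, nextAmp, if_neg h]
    simp [State.tick, e22]

lemma cost_sinSqExp : sinSqExp.cost ≤ 40 := by
  decide

lemma low_sinSqExp : sinSqExp.Low := by
  simp [sinSqExp]

lemma eval_sinSqExp (ρ : ℕ → ℝ) : sinSqExp.eval ρ = sin (ρ 22 * ρ 11) ^ 2 := by
  simp only [sinSqExp, RExp.eval_mul, RExp.eval_fn, ElemFun.eval, RExp.eval_var]
  ring

lemma det_anglePrep (D : Device) {s : State} (hs : ∃ a : ℂ, s.psi = a • ket ∅) :
    Det D s anglePrep fun t => Keeps angleVars s t ∧ t.real 10 = nextAmp (s.real 10) (s.real 11) ∧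
      t.real 11 = s.real 11 ∧ t.real 12 = 0 ∧ t.psi = s.psi ∧ t.time ≤ s.time + 200 := by
  have f1 : (RExp.const 2 * RExp.var 10 + RExp.const 1 : RExp).cost ≤ 20 := by decide
  have f2 := cost_sinSqExp
  have f3 : (RExp.const 1 / RExp.const 16 : RExp).cost ≤ 40 := by decide
  have f4 : (RExp.const 0).cost ≤ 10 := by decide
  unfold anglePrep
  refine (det_assign_keeps D (r := 22) (by omega) (e := .const 2 * .var 10 + .const 1) (by simp)
    hs).seq fun t1 ht1 => ?_
  obtain ⟨a1, a2, a3, a4⟩ := ht1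
  refine (det_assign_keeps D (r := 23) (by omega)
    low_sinSqExp a1.1).seq fun t2 ht2 => ?_
  obtain ⟨b1, b2, b3, b4⟩ := ht2
  refine (det_assign_keeps D (r := 24) (by omega) (e := .const 1 / .const 16) (by simp)
    b1.1).seq fun t3 ht3 => ?_
  obtain ⟨c1, c2, c3, c4⟩ := ht3
  have e22 : t3.real 22 = 2 * s.real 10 + 1 := by
    rw [c1.real 22, b1.real 22, a2]; simp
  have e11 : t3.real 11 = s.real 11 := by
    rw [c1.real 11, b1.real 11,
      a1.real 11]
  have e23 : t3.real 23 = sin ((2 * s.real 10 + 1) * s.real 11) ^ 2 := by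
    rw [c1.real 23, b2, eval_sinSqExp, a2, a1.real 11]
    simp
  have e24 : t3.real 24 = 1 / 16 := by rw [c2]; simp
  have k3 : Keeps angleVars s t3 := ((a1.mono (by decide)).trans (b1.mono (by decide))).trans
    (c1.mono (by decide))
  refine Det.seq (det_chooseAmp D c1.1 e22 e23 e24) fun t4 ht4 => ?_
  obtain ⟨d1, d2, d3, d4⟩ := ht4
  have k4 : Keeps angleVars s t4 := k3.trans (d1.mono (by decide))
  refine (det_assign_keeps D (r := 12) (by omega) (e := .const 0) (by simp) k4.1).mono
    fun t ht => ?_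
  obtain ⟨g1, g2, g3, g4⟩ := ht
  refine ⟨k4.trans (g1.mono (by decide)), (g1.real 10).trans d2, ?_, ?_,
    g3.trans (d3.trans (c3.trans (b3.trans a3))), ?_⟩
  · rw [g1.real 11, d1.real 11, e11]
  · rw [g2]; simp
  · omega

lemma eval_cosExp (ρ : ℕ → ℝ) : cosExp.eval ρ = 1 - 2 * ρ 12 / ρ 14 := by
  simp [cosExp]

lemma eval_newtonExp (ρ : ℕ → ℝ) : newtonExp.eval ρ = ρ 11 +
    (cos (ρ 10 * ρ 11) - (1 - 2 * ρ 12 / ρ 14)) / (ρ 10 * sin (ρ 10 * ρ 11)) := by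
  simp [newtonExp, eval_cosExp, ElemFun.eval]

/-- The cosine that is estimated from the shots. -/
lemma cos_of_count {S p c : ℝ} (hS : 0 < S) {x : ℝ} (hp : p = (1 - cos x) / 2)
    (h : |c - 0 - S * p| ≤ tol * S) : |1 - 2 * c / S - cos x| ≤ 2 * tol := by
  have e : 1 - 2 * c / S - cos x = -(2 / S) * (c - 0 - S * p) := by
    rw [hp]; field_simp; ring
  rw [e, abs_mul, abs_neg, abs_of_pos (by positivity)]
  calc 2 / S * |c - 0 - S * p| ≤ 2 / S * (tol * S) := mul_le_mul_of_nonneg_left h (by positivity)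
    _ = 2 * tol := by field_simp

/-- The estimate of the angle by means of the shots for one amplification. -/
def measureAngle (e : RExp) : Prog := .seq (ampShots overlapCirc) (assign 11 e)

lemma always_measureAngle (hU : D.Unitary) {b W : ℕ} {s : State}
    (h : Machine D b W s) {e : RExp} (he : e.Low) (hcost : e.cost ≤ 90) {j : ℕ} (hj : j + 1 ≤ W)
    (hK : s.real 10 = 2 * j + 1) :
    Always D s (measureAngle e) fun t => Keeps angleVars s t ∧ t.real 10 = s.real 10 ∧
      t.time ≤ s.time + 2400 * D.unitCost b W := by
  refine Always.seq hU (always_ampShots hU (Or.inr (Or.inr rfl)) h hj hK) fun u hu => ?_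
  obtain ⟨u1, -, -, u4⟩ := hu
  refine Det.always ((det_assign_keeps D (r := 11) (by omega) he u1.1).mono fun v hv => ?_)
  obtain ⟨v1, v2, v3, v4⟩ := hv
  have hb1 : 1 ≤ D.unitCost b W := ((one_le_intCost _).trans h.size_le).trans (le_unitCost h)
  refine ⟨(u1.mono (by decide)).trans (v1.mono (by decide)), ?_, by omega⟩
  rw [v1.real 10, u1.real 10]

lemma err_measureAngle (hU : D.Unitary) {b W : ℕ} {s : State}
    (h : Machine D b W s) {e : RExp} (he : e.Low) {j : ℕ} (hj : j + 1 ≤ W)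
    (hK : s.real 10 = 2 * j + 1) (h12 : s.real 12 = 0) {φ : Bits D.n → Feature D.N}
    (hφ : D.HasFeature φ) {θ : ℝ}
    (hθ : cos θ = D.overlap φ (s.int 26) (s.int 27) / 2) :
    Err D s (measureAngle e) (failProb (s.int 61).toNat) fun t =>
      ∃ ρ : ℕ → ℝ, t.real 11 = e.eval ρ ∧ ρ 10 = s.real 10 ∧ ρ 11 = s.real 11 ∧
        ρ 14 = s.real 14 ∧ (0 ≤ ρ 12 ∧ ρ 12 ≤ (s.int 61).toNat) ∧
        |1 - 2 * ρ 12 / (s.int 61).toNat - cos (s.real 10 * θ)| ≤ 2 * tol := by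
  have herr := err_ampShots hU (A := overlapCirc) (Or.inr (Or.inr rfl)) h hj hK
  have hS : (0 : ℝ) < (s.int 61).toNat := by exact_mod_cast h.shots_pos
  have := Err.seq (q := assign 11 e) hU (δ' := 0) le_rfl
      (always_ampShots hU (Or.inr (Or.inr rfl)) h hj hK) herr (G' := fun t =>
      ∃ ρ : ℕ → ℝ, t.real 11 = e.eval ρ ∧ ρ 10 = s.real 10 ∧ ρ 11 = s.real 11 ∧
        ρ 14 = s.real 14 ∧ (0 ≤ ρ 12 ∧ ρ 12 ≤ (s.int 61).toNat) ∧
        |1 - 2 * ρ 12 / (s.int 61).toNat - cos (s.real 10 * θ)| ≤ 2 * tol) ?_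
  · rwa [add_zero] at this
  · intro u hu hG
    refine Always.err_imp (Det.always (det_assign_keeps D (r := 11) (by omega) he hu.1.1)) le_rfl ?_
    intro v hv
    obtain ⟨u1, u2, -, -⟩ := hu
    rw [h12] at u2 hG
    rw [zero_add] at u2
    refine ⟨u.real, hv.2.1, u1.real 10, u1.real 11,
      u1.real 14, u2, cos_of_count hS ?_ hG⟩
    rw [ampProb_overlap hU hφ h.layout hθ, ← hK]

/-- The invariant of the loop in the estimation of the angle. -/
def AngleInv (D : Device) (b W : ℕ) (s : State) (k : ℕ) (t : State) : Prop :=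
  Keeps angleVars s t ∧ (∃ j : ℕ, t.real 10 = 2 * j + 1) ∧
    (2 ^ k ≤ t.real 10 ∨ s.real 17 ≤ t.real 10) ∧
    t.time ≤ s.time + (2500 * D.unitCost b W + k * (2700 * D.unitCost b W))

lemma exists_nextAmp (j : ℕ) (φ : ℝ) : ∃ j' : ℕ, nextAmp (2 * j + 1) φ = 2 * j' + 1 := by
  unfold nextAmp
  split_ifs
  · exact ⟨2 * (2 * j + 1) + 1, by push_cast; ring⟩
  · exact ⟨2 * j + 1, by push_cast; ring⟩

lemma angleStep_ready {b W : ℕ} {s : State} (h : Machine D b W s)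
    (hW : 7 * s.real 17 ≤ W) {k : ℕ} {t u : State} (ht : AngleInv D b W s k t)
    (hlt : t.real 10 < s.real 17)
    (hu : Keeps angleVars t u ∧ u.real 10 = nextAmp (t.real 10) (t.real 11)) :
    Machine D b W u ∧ ∃ j : ℕ, j + 1 ≤ W ∧ u.real 10 = 2 * j + 1 := by
  obtain ⟨t1, ⟨j, hj⟩, t3, t4⟩ := ht
  obtain ⟨u1, u2⟩ := hu
  obtain ⟨j', hj'⟩ := exists_nextAmp j (t.real 11)
  have hK1 : 1 ≤ t.real 10 := by rw [hj]; have : (0 : ℝ) ≤ j := Nat.cast_nonneg j; linarith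
  have hb := nextAmp_bounds (φ := t.real 11) hK1
  refine ⟨h.of_keeps (t1.trans u1), j', ?_, by rw [u2, hj, hj']⟩
  rw [hj] at hb hlt
  rw [hj'] at hb
  have : (2 * j' + 1 : ℝ) ≤ W := by linarith
  have h' : 2 * j' + 1 ≤ W := by exact_mod_cast this
  omega

lemma cost_newtonExp : newtonExp.cost ≤ 90 := by decide

lemma low_newtonExp : newtonExp.Low := by simp [newtonExp, cosExp]

lemma always_angleBody (hU : D.Unitary) {b W : ℕ} {s : State} (h : Machine D b W s)
    (hW : 7 * s.real 17 ≤ W) {k : ℕ} {t : State} (ht : AngleInv D b W s k t) :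
    Always D (t.tick 1) (.ifLt 10 17 angleStep .skip) (AngleInv D b W s (k + 1)) := by
  have hb1 : 1 ≤ D.unitCost b W := ((one_le_intCost _).trans h.size_le).trans (le_unitCost h)
  have e17 : t.real 17 = s.real 17 := ht.1.real 17
  have hinv := ht
  obtain ⟨t1, ⟨j, hj⟩, t3, t4⟩ := ht
  have hK1 : 1 ≤ t.real 10 := by rw [hj]; have : (0 : ℝ) ≤ j := Nat.cast_nonneg j; linarith
  refine always_ifLt (fun hlt => ?_) fun hlt => ?_
  · change t.real 10 < t.real 17 at hlt
    rw [e17] at hlt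
    refine Always.det_seq (det_anglePrep D (s := (t.tick 1).tick 1) t1.1) fun u hu => ?_
    obtain ⟨u1, u2, u3, u4, u5, u6⟩ := hu
    obtain ⟨hm, j', hj', hK'⟩ := angleStep_ready h hW hinv hlt (u := u) ⟨u1, u2⟩
    refine (always_measureAngle hU hm low_newtonExp cost_newtonExp hj' hK').mono fun v hv => ?_
    obtain ⟨v1, v2, v3⟩ := hv
    simp only [State.tick] at u2 u6
    refine ⟨(t1.trans (show Keeps angleVars t u from u1)).trans v1, ⟨j', v2.trans hK'⟩, ?_, ?_⟩
    · rw [v2, u2]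
      have := (nextAmp_bounds (φ := t.real 11) hK1).1
      rcases t3 with t3 | t3
      · left; rw [pow_succ]; linarith
      · linarith
    · rw [add_mul, one_mul]; omega
  · change ¬ t.real 10 < t.real 17 at hlt
    rw [e17] at hlt
    refine always_skip ⟨t1, ⟨j, hj⟩, Or.inr (not_lt.1 hlt), ?_⟩
    simp only [State.tick]
    rw [add_mul, one_mul]; omega

lemma err_angleBody (hU : D.Unitary) {b W : ℕ} {s : State} (h : Machine D b W s)
    (hW : 7 * s.real 17 ≤ W) (h14 : s.real 14 = (s.int 61).toNat) {φ : Bits D.n → Feature D.N}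
    (hφ : D.HasFeature φ) {θ : ℝ}
    (hθ : cos θ = D.overlap φ (s.int 26) (s.int 27) / 2) (hθ1 : |cos θ| ≤ 1 / 2)
    {k : ℕ} {t : State} (ht : AngleInv D b W s k t)
    (hG : |θ - t.real 11| ≤ angleTol / t.real 10) :
    Err D (t.tick 1) (.ifLt 10 17 angleStep .skip) (failProb (s.int 61).toNat)
      fun u => |θ - u.real 11| ≤ angleTol / u.real 10 := by
  have e17 : t.real 17 = s.real 17 := ht.1.real 17
  have hinv := ht
  obtain ⟨t1, ⟨j, hj⟩, t3, t4⟩ := ht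
  have hK1 : 1 ≤ t.real 10 := by rw [hj]; have : (0 : ℝ) ≤ j := Nat.cast_nonneg j; linarith
  refine err_ifLt (fun hlt => ?_) fun hlt => ?_
  · change t.real 10 < t.real 17 at hlt
    rw [e17] at hlt
    refine Err.det_seq (det_anglePrep D (s := (t.tick 1).tick 1) t1.1) (fun u hu => hu.2.2.2.2.1)
      fun u hu => ?_
    obtain ⟨u1, u2, u3, u4, u5, u6⟩ := hu
    obtain ⟨hm, j', hj', hK'⟩ := angleStep_ready h hW hinv hlt (u := u) ⟨u1, u2⟩
    have k1 : Keeps angleVars s u := t1.trans (show Keeps angleVars t u from u1)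
    have e61 : u.int 61 = s.int 61 := k1.int 61
    have e14 : u.real 14 = s.real 14 := k1.real 14
    simp only [State.tick] at u2 u3
    have herr := err_measureAngle hU hm low_newtonExp hj' hK' u4 hφ (θ := θ)
      (by rw [k1.int 26, k1.int 27]; exact hθ)
    rw [e61] at herr
    refine herr.mono le_rfl (always_measureAngle hU hm low_newtonExp cost_newtonExp hj' hK') ?_
    intro v hv hg
    obtain ⟨ρ, r1, r2, r3, r4, -, r6⟩ := hg
    rw [r1, hv.2.1, eval_newtonExp, r2, r3, r4, e14, h14, u2, u3]
    rw [u2] at r6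
    exact newton_step hθ1 hK1 hG r6
  · exact (always_skip (A := fun u => u = (t.tick 1).tick 1) rfl).err_imp (failProb_nonneg _)
      fun u hu => by rw [hu]; exact hG

lemma det_angleInit (D : Device) {s : State} (hs : ∃ a : ℂ, s.psi = a • ket ∅) :
    Det D s (.seq (assign 10 (.const 1)) (assign 12 (.const 0))) fun t => Keeps angleVars s t ∧
      t.real 10 = 1 ∧ t.real 12 = 0 ∧ t.psi = s.psi ∧ t.time ≤ s.time + 20 :=
  (det_detectInit D hs).mono fun _ ht => ⟨ht.1.mono (by decide), ht.2⟩

lemma always_angle (hU : D.Unitary) {b W : ℕ} {s : State} (h : Machine D b W s)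
    (hW : 7 * s.real 17 ≤ W) :
    Always D s angle fun t => Keeps angleVars s t ∧ 1 ≤ t.real 10 ∧
      (2 ^ (s.int 63).toNat ≤ t.real 10 ∨ s.real 17 ≤ t.real 10) ∧
      t.time ≤ s.time + 5300 * (b * D.unitCost b W) := by
  have hb := le_unitCost h
  have hb1 : 1 ≤ b := (one_le_intCost _).trans h.size_le
  have hinit : Always D s angleInit fun t => Keeps angleVars s t ∧ t.real 10 = 1 ∧
      t.time ≤ s.time + 2420 * D.unitCost b W := by
    refine Always.det_seq (det_angleInit D h.psi) fun t ht => ?_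
    obtain ⟨h1, h2, h3, -, h4⟩ := ht
    refine (always_measureAngle hU (h.of_keeps h1) (e := .fn .arccos cosExp) (by simp [cosExp])
      (by decide) (j := 0) h.one_le (by rw [h2]; simp)).mono fun u hu => ?_
    obtain ⟨u1, u2, u3⟩ := hu
    exact ⟨h1.trans u1, u2.trans h2, by omega⟩
  refine Always.seq hU hinit fun t ht => ?_
  obtain ⟨h1, h2, h3⟩ := ht
  have h63 : t.int 63 = s.int 63 := h1.int 63
  have hrep := always_rep hU (s := t) (i := 63) (AngleInv D b W s)
    ⟨h1, ⟨0, by rw [Nat.cast_zero, mul_zero, zero_add]; exact h2⟩, Or.inl (by rw [pow_zero]; exact h2.ge), by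
      simp only [State.tick, h63]
      have := h.loop_cost
      omega⟩ fun k _ u hu => always_angleBody hU h hW hu
  rw [h63] at hrep
  refine hrep.mono fun u hu => ?_
  obtain ⟨u1, ⟨j, hj⟩, u3, u4⟩ := hu
  refine ⟨u1, ?_, u3, u4.trans ?_⟩
  · rw [hj]; have : (0 : ℝ) ≤ j := Nat.cast_nonneg j; linarith
  · have hl : (s.int 63).toNat * (2700 * D.unitCost b W) ≤ b * (2700 * D.unitCost b W) :=
      Nat.mul_le_mul_right _ h.loop
    have hb' : D.unitCost b W ≤ b * D.unitCost b W := Nat.le_mul_of_pos_left _ hb1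
    have : b * (2700 * D.unitCost b W) = 2700 * (b * D.unitCost b W) := by ring
    omega

lemma err_angle (hU : D.Unitary) {b W : ℕ} {s : State} (h : Machine D b W s)
    (hW : 7 * s.real 17 ≤ W) (h14 : s.real 14 = (s.int 61).toNat) {φ : Bits D.n → Feature D.N}
    (hφ : D.HasFeature φ) {θ : ℝ} (hθ0 : 0 ≤ θ) (hθπ : θ ≤ Real.pi)
    (hθ : cos θ = D.overlap φ (s.int 26) (s.int 27) / 2) (hθ1 : |cos θ| ≤ 1 / 2) :
    Err D s angle (((s.int 63).toNat + 1) * failProb (s.int 61).toNat)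
      fun t => |θ - t.real 11| ≤ angleTol / t.real 10 := by
  have hb := le_unitCost h
  have hb1 : 1 ≤ b := (one_le_intCost _).trans h.size_le
  have hS : (0 : ℝ) < (s.int 61).toNat := by exact_mod_cast h.shots_pos
  have hlow : (RExp.fn .arccos cosExp).Low := by simp [cosExp]
  have hinit : Always D s angleInit fun t => Keeps angleVars s t ∧ t.real 10 = 1 ∧
      t.time ≤ s.time + 2420 * D.unitCost b W := by
    refine Always.det_seq (det_angleInit D h.psi) fun t ht => ?_
    obtain ⟨h1, h2, h3, -, h4⟩ := ht
    refine (always_measureAngle hU (h.of_keeps h1) (e := .fn .arccos cosExp) hlow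
      (by decide) (j := 0) h.one_le (by rw [h2]; simp)).mono fun u hu => ?_
    obtain ⟨u1, u2, u3⟩ := hu
    exact ⟨h1.trans u1, u2.trans h2, by omega⟩
  have einit : Err D s angleInit (failProb (s.int 61).toNat)
      fun t => |θ - t.real 11| ≤ angleTol := by
    refine Err.det_seq (det_angleInit D h.psi) (fun t ht => ht.2.2.2.1) fun t ht => ?_
    obtain ⟨h1, h2, h3, -, h4⟩ := ht
    have e61 : t.int 61 = s.int 61 := h1.int 61
    have e14 : t.real 14 = s.real 14 := h1.real 14
    have herr := err_measureAngle hU (h.of_keeps h1) (e := .fn .arccos cosExp) hlow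
      (j := 0) h.one_le (by rw [h2]; simp) h3 hφ (θ := θ)
      (by rw [h1.int 26, h1.int 27]; exact hθ)
    rw [e61] at herr
    refine herr.mono le_rfl (A := fun _ => True) (fun _ _ _ => trivial) ?_
    rintro u - ⟨ρ, r1, r2, r3, r4, r5, r6⟩
    rw [h2, one_mul] at r6
    rw [r1, RExp.eval_fn, eval_cosExp, r4, e14, h14]
    refine newton_start hθ0 hθπ hθ1 r6 ?_ ?_
    · have : 2 * ρ 12 / (s.int 61).toNat ≤ 2 := by
        rw [div_le_iff₀ hS]; linarith [r5.2]
      linarith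
    · have : 0 ≤ 2 * ρ 12 / (s.int 61).toNat := div_nonneg (by linarith [r5.1]) hS.le
      linarith
  have := Err.seq hU (q := .rep 63 (.ifLt 10 17 angleStep .skip))
    (δ' := (s.int 63).toNat * failProb (s.int 61).toNat)
    (mul_nonneg (Nat.cast_nonneg _) (failProb_nonneg _)) hinit einit
    (G' := fun t => |θ - t.real 11| ≤ angleTol / t.real 10) ?_
  · refine this.mono (le_of_eq (by ring)) (A := fun _ => True) (fun _ _ _ => trivial)
      fun _ _ h => h
  · intro t ht hg
    obtain ⟨h1, h2, h3⟩ := ht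
    have h63 : t.int 63 = s.int 63 := h1.int 63
    have := err_rep hU (s := t) (i := 63) (p := .ifLt 10 17 angleStep .skip)
      (failProb_nonneg (s.int 61).toNat) (AngleInv D b W s)
      (fun k u => |θ - u.real 11| ≤ angleTol / u.real 10)
      ⟨h1, ⟨0, by rw [Nat.cast_zero, mul_zero, zero_add]; exact h2⟩,
        Or.inl (by rw [pow_zero]; exact h2.ge), by
        simp only [State.tick, h63]
        have := h.loop_cost
        omega⟩ (fun k _ u hu => always_angleBody hU h hW hu)
      (by simp only [State.tick]; rw [h2, div_one]; exact hg)
      fun k _ u hu hG => err_angleBody hU h hW h14 hφ hθ hθ1 hu hG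
    rwa [h63] at this

/-! ### The sum over pairs of digits -/

/-- The memory is reset, and the variables other than the integers `26`, `27`, `60`, the integers of
the scratch space and the reals in `X` are unchanged. -/
def Frame (X : Finset ℕ) (s t : State) : Prop :=
  (∃ a : ℂ, t.psi = a • ket ∅) ∧
    (∀ i, (i < 50 ∨ 61 ≤ i) → i ≠ 26 → i ≠ 27 → t.int i = s.int i) ∧
    ∀ r < 49, r ∉ X → t.real r = s.real r

lemma Frame.trans {X : Finset ℕ} {s t u : State} (h : Frame X s t) (h' : Frame X t u) :
    Frame X s u :=
  ⟨h'.1, fun i hi h6 h7 => (h'.2.1 i hi h6 h7).trans (h.2.1 i hi h6 h7),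
    fun r hr hX => (h'.2.2 r hr hX).trans (h.2.2 r hr hX)⟩

lemma Frame.mono {X Y : Finset ℕ} {s t : State} (h : Frame X s t) (hXY : X ⊆ Y) : Frame Y s t :=
  ⟨h.1, h.2.1, fun r hr hY => h.2.2 r hr fun hX => hY (hXY hX)⟩

lemma Frame.real {X : Finset ℕ} {s t : State} (h : Frame X s t) (r : ℕ) (hr : r < 49 := by omega)
    (hX : r ∉ X := by decide) : t.real r = s.real r := h.2.2 r hr hX

lemma Frame.int {X : Finset ℕ} {s t : State} (h : Frame X s t) (i : ℕ)
    (hi : i < 50 ∨ 61 ≤ i := by omega) (h6 : i ≠ 26 := by omega) (h7 : i ≠ 27 := by omega) :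
    t.int i = s.int i := h.2.1 i hi h6 h7

lemma Keeps.frame {X : Finset ℕ} {s t : State} (h : Keeps X s t) : Frame X s t :=
  ⟨h.1, fun i hi _ _ => h.2.1 i hi, h.2.2⟩

lemma intCost_le_natAbs (z : ℤ) : intCost z ≤ z.natAbs + 1 := by
  have : Nat.size z.natAbs ≤ z.natAbs := Nat.size_le.2 Nat.lt_two_pow_self
  unfold intCost; omega

lemma Machine.of_frame {b W : ℕ} {s t : State} {X : Finset ℕ} (h : Machine D b W s)
    (hst : Frame X s t) (h26 : (t.int 26).natAbs + 1 ≤ b) (h27 : (t.int 27).natAbs + 1 ≤ b) :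
    Machine D b W t where
  short := fun i hi => by
    by_cases h6 : i = 26
    · exact h6 ▸ (intCost_le_natAbs _).trans h26
    by_cases h7 : i = 27
    · exact h7 ▸ (intCost_le_natAbs _).trans h27
    rw [hst.2.1 i (Or.inl hi) h6 h7]; exact h.short i hi
  layout := h.layout.congr fun i _ hi => hst.2.1 i (Or.inl (by omega)) (by omega) (by omega)
  sized := ⟨h.sized.addr, by omega, by omega, h.sized.one_le, h.sized.qubits⟩
  psi := hst.1
  one_le := h.one_le
  size_le := h.size_le
  shots := by rw [hst.int 61]; exact h.shots
  shots_pos := by rw [hst.int 61]; exact h.shots_pos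
  shots_cost := by rw [hst.int 61]; exact h.shots_cost
  loop := by rw [hst.int 63]; exact h.loop
  loop_cost := by rw [hst.int 63]; exact h.loop_cost

lemma exp_mul_log_two (z : ℤ) : exp (z * log 2) = 2 ^ z := by
  rw [mul_comm, exp_mul, exp_log (by norm_num), rpow_intCast]

/-- Decrease the exponent in the real variable `r`, and copy it to the integer variable `i`. -/
def nextDigit (i r : ℕ) : Prog := .seq (assign r (.var r - .const 1)) (assignFloor i (.var r))

lemma det_nextDigit (D : Device) {i r : ℕ} (hi : i = 26 ∨ i = 27) (hr : r < 49) {s : State}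
    (hs : ∃ a : ℂ, s.psi = a • ket ∅) {z : ℤ} (hz : s.real r = z + 1) {b : ℕ}
    (hb : z.natAbs + 1 ≤ b) :
    Det D s (nextDigit i r) fun t => Frame {r} s t ∧ t.real r = z ∧ t.int i = z ∧
      (∀ j < 50, j ≠ i → t.int j = s.int j) ∧ t.psi = s.psi ∧ t.time ≤ s.time + (40 + b) := by
  unfold nextDigit
  have f1 : ∀ r, (RExp.var r - RExp.const 1 : RExp).cost = (RExp.var 0 - RExp.const 1 : RExp).cost :=
    fun r => rfl
  have f2 : (RExp.var 0 - RExp.const 1 : RExp).cost ≤ 20 := by decide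
  have f3 : ∀ r, (RExp.var r).cost = (RExp.var 0).cost := fun r => rfl
  have f4 : (RExp.var 0).cost ≤ 10 := by decide
  refine (det_assign_keeps D hr (e := .var r - .const 1) (by simp; omega) hs).seq fun t ht => ?_
  obtain ⟨h1, h2, h3, h4⟩ := ht
  have hr' : t.real r = z := by rw [h2]; simp [hz]
  refine (det_assignFloor D i (e := .var r) (by simp; omega) t).mono fun u hu => ?_
  obtain ⟨u1, u2, u3, u4⟩ := hu
  rw [RExp.eval_var, hr', Int.floor_intCast] at u2 u4
  have hc := intCost_le_natAbs z
  rw [f1] at h4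
  rw [f3] at u4
  refine ⟨⟨u3 ▸ h1.1, fun j hj h6 h7 => ?_, fun q hq hX => ?_⟩, ?_, ?_, fun j hj hji => ?_,
    u3.trans h3, by omega⟩
  · rw [u2 j (by omega), if_neg (by omega), h1.2.1 j hj]
  · rw [u1 q (by omega), h1.2.2 q hq hX]
  · rw [u1 r (by omega), hr']
  · rw [u2 i (by omega), if_pos rfl]
  · rw [u2 j (by omega), if_neg hji, h1.2.1 j (by omega)]

/-- The weight of a pair of digits, computed from the exponents. -/
def weightExp : RExp := .fn .exp ((.var 8 + .var 9) * .fn .log (.const 2)) * .var 15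

/-- Estimate the contribution of a pair of digits, and add it to the sum in the real variable `16`. -/
def pairBody : Prog :=
  .seq (.seq (assign 18 weightExp) (assign 17 (.var 18 * .var 20)))
    (.seq angle (assign 16 (.var 16 + .var 18 * (.const 2 * .fn .cos (.var 11)))))

/-- The weight of the pair of digits with exponents `e` and `e'`. -/
noncomputable def pairWeight (e e' : ℤ) (v : ℝ) : ℝ := 2 ^ (e + e') * v

lemma eval_weightExp {ρ : ℕ → ℝ} {e e' : ℤ} (h8 : ρ 8 = e) (h9 : ρ 9 = e') :
    weightExp.eval ρ = pairWeight e e' (ρ 15) := by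
  simp only [weightExp, RExp.eval_mul, RExp.eval_fn, RExp.eval_add, RExp.eval_var, RExp.eval_const,
    ElemFun.eval, h8, h9, pairWeight]
  rw [← exp_mul_log_two]
  push_cast
  rfl

lemma low_weightExp : weightExp.Low := by simp [weightExp]

lemma cost_weightExp : weightExp.cost ≤ 40 := by decide

/-- The real variables that are changed by `pairBody`. -/
def pairVars : Finset ℕ := {10, 11, 12, 16, 17, 18, 22, 23, 24}

lemma det_pairInit (D : Device) {s : State} (hs : ∃ a : ℂ, s.psi = a • ket ∅) {e e' : ℤ}
    (h8 : s.real 8 = e) (h9 : s.real 9 = e') :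
    Det D s (.seq (assign 18 weightExp) (assign 17 (.var 18 * .var 20))) fun t =>
      Keeps {17, 18} s t ∧ t.real 18 = pairWeight e e' (s.real 15) ∧
      t.real 17 = pairWeight e e' (s.real 15) * s.real 20 ∧ t.psi = s.psi ∧
      t.time ≤ s.time + 100 := by
  have f1 : (RExp.var 18 * RExp.var 20 : RExp).cost ≤ 20 := by decide
  have f2 := cost_weightExp
  refine (det_assign_keeps D (r := 18) (by omega) low_weightExp hs).seq fun t ht => ?_
  obtain ⟨h1, h2, h3, h4⟩ := ht
  rw [eval_weightExp h8 h9] at h2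
  refine (det_assign_keeps D (r := 17) (by omega) (e := .var 18 * .var 20) (by simp) h1.1).mono
    fun u hu => ?_
  obtain ⟨u1, u2, u3, u4⟩ := hu
  refine ⟨(h1.mono (by decide)).trans (u1.mono (by decide)), ?_, ?_, u3.trans h3, by omega⟩
  · rw [u1.real 18, h2]
  · rw [u2, RExp.eval_mul, RExp.eval_var, RExp.eval_var, h2, h1.real 20]

lemma det_accumulate (D : Device) {s : State} (hs : ∃ a : ℂ, s.psi = a • ket ∅) :
    Det D s (assign 16 (.var 16 + .var 18 * (.const 2 * .fn .cos (.var 11)))) fun t =>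
      Keeps {16} s t ∧ t.real 16 = s.real 16 + s.real 18 * (2 * cos (s.real 11)) ∧
      t.time ≤ s.time + 60 := by
  have f1 : (RExp.var 16 + RExp.var 18 * (RExp.const 2 * RExp.fn .cos (RExp.var 11)) : RExp).cost
    ≤ 50 := by decide
  refine (det_assign_keeps D (r := 16) (by omega)
    (e := .var 16 + .var 18 * (.const 2 * .fn .cos (.var 11))) (by simp) hs).mono fun t ht => ?_
  obtain ⟨h1, h2, h3, h4⟩ := ht
  exact ⟨h1, by rw [h2]; simp [ElemFun.eval], by omega⟩

lemma always_pairBody (hU : D.Unitary) {b W : ℕ} {s : State} (h : Machine D b W s)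
    {e e' : ℤ} (h8 : s.real 8 = e) (h9 : s.real 9 = e')
    (hW : 7 * (pairWeight e e' (s.real 15) * s.real 20) ≤ W) :
    Always D s pairBody fun t => Keeps pairVars s t ∧
      t.time ≤ s.time + 5500 * (b * D.unitCost b W) := by
  have hb := le_unitCost h
  have hb1 : 1 ≤ b := (one_le_intCost _).trans h.size_le
  have hb' : D.unitCost b W ≤ b * D.unitCost b W := Nat.le_mul_of_pos_left _ hb1
  refine Always.det_seq (det_pairInit D h.psi h8 h9) fun t ht => ?_
  obtain ⟨h1, h2, h3, -, h4⟩ := ht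
  refine Always.seq hU (always_angle hU (h.of_keeps h1) (by rw [h3]; exact hW)) fun u hu => ?_
  obtain ⟨u1, -, -, u4⟩ := hu
  refine Det.always ((det_accumulate D u1.1).mono fun v hv => ?_)
  exact ⟨((h1.mono (by decide)).trans (u1.mono (by decide))).trans (hv.1.mono (by decide)),
    by have := hv.2.2; omega⟩

lemma err_pairBody (hU : D.Unitary) {b W : ℕ} {s : State} (h : Machine D b W s)
    {e e' : ℤ} (h8 : s.real 8 = e) (h9 : s.real 9 = e') (h26 : s.int 26 = e) (h27 : s.int 27 = e')
    (h15 : 0 < s.real 15) (h20 : 0 < s.real 20)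
    (hW : 7 * (pairWeight e e' (s.real 15) * s.real 20) ≤ W)
    (hL : pairWeight e e' (s.real 15) * s.real 20 ≤ 2 ^ (s.int 63).toNat)
    (h14 : s.real 14 = (s.int 61).toNat) {φ : Bits D.n → Feature D.N}
    (hφ : D.HasFeature φ) (hv : |D.overlap φ e e'| ≤ 1) :
    Err D s pairBody (((s.int 63).toNat + 1) * failProb (s.int 61).toNat) fun t =>
      |t.real 16 - s.real 16 - pairWeight e e' (s.real 15) * D.overlap φ e e'| ≤
        1 / (4 * s.real 20) := by
  refine Err.det_seq (det_pairInit D h.psi h8 h9) (fun t ht => ht.2.2.2.1) fun t ht => ?_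
  obtain ⟨h1, h2, h3, -, h4⟩ := ht
  have hm := h.of_keeps h1
  have e61 : t.int 61 = s.int 61 := h1.int 61
  have e63 : t.int 63 = s.int 63 := h1.int 63
  have e26 : t.int 26 = e := (h1.int 26).trans h26
  have e27 : t.int 27 = e' := (h1.int 27).trans h27
  have hv' := abs_le.1 hv
  set θ := arccos (D.overlap φ e e' / 2) with hθ
  have hcos : cos θ = D.overlap φ e e' / 2 := cos_arccos (by linarith) (by linarith)
  have hcos1 : |cos θ| ≤ 1 / 2 := by rw [hcos, abs_le]; constructor <;> linarith
  have hW' : 7 * t.real 17 ≤ W := by rw [h3]; exact hW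
  have herr := err_angle hU hm hW' (by rw [e61, h1.real 14, h14]) hφ (θ := θ)
    (arccos_nonneg _) (arccos_le_pi _) (by rw [e26, e27]; exact hcos) hcos1
  rw [e61, e63] at herr
  have := Err.seq hU (δ' := 0) le_rfl (always_angle hU hm hW') herr
    (q := assign 16 (.var 16 + .var 18 * (.const 2 * .fn .cos (.var 11))))
    (G' := fun t => |t.real 16 - s.real 16 - pairWeight e e' (s.real 15) * D.overlap φ e e'| ≤
        1 / (4 * s.real 20)) ?_
  · rwa [add_zero] at this
  · intro u hu hg
    obtain ⟨u1, u2, u3, u4⟩ := hu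
    refine Always.err_imp (Det.always (det_accumulate D u1.1)) le_rfl fun v hv => ?_
    obtain ⟨v1, v2, v3⟩ := hv
    have e18 : u.real 18 = pairWeight e e' (s.real 15) :=
      (u1.real 18).trans h2
    have e16 : u.real 16 = s.real 16 :=
      (u1.real 16).trans (h1.real 16)
    rw [v2, e18, e16]
    set κ := pairWeight e e' (s.real 15) with hκ
    have hκ0 : 0 < κ := by rw [hκ]; unfold pairWeight; positivity
    have hK : κ * s.real 20 ≤ u.real 10 := by
      rcases u3 with u3 | u3
      · rw [e63] at u3; exact hL.trans u3
      · rw [h3] at u3; exact u3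
    have hd : |cos θ - cos (u.real 11)| ≤ |θ - u.real 11| := abs_cos_sub_cos_le _ _
    have hfin : |θ - u.real 11| ≤ angleTol / (κ * s.real 20) :=
      hg.trans (div_le_div_of_nonneg_left (by norm_num [angleTol]) (by positivity) hK)
    have heq : s.real 16 + κ * (2 * cos (u.real 11)) - s.real 16 - κ * D.overlap φ e e' =
        -(2 * κ) * (cos θ - cos (u.real 11)) := by rw [hcos]; ring
    rw [heq, abs_mul, abs_neg, abs_of_pos (by positivity)]
    calc 2 * κ * |cos θ - cos (u.real 11)|
        ≤ 2 * κ * (angleTol / (κ * s.real 20)) :=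
          mul_le_mul_of_nonneg_left (hd.trans hfin) (by positivity)
      _ = 2 * angleTol / s.real 20 := by field_simp
      _ ≤ 1 / (4 * s.real 20) := by
        rw [div_le_div_iff₀ h20 (by positivity)]
        norm_num [angleTol]
        nlinarith

/-- The contribution of the next digit of the second list. -/
def innerBody : Prog :=
  .seq (.seq (nextDigit 27 9) (detect true)) (.ifLt 21 19 (.ifLt 21 12 pairBody .skip) .skip)

/-- The part of `outerBody` before the inner loop. -/
def outerInit : Prog :=
  .seq (.seq (nextDigit 26 8) (detect false))
    (.seq (assign 19 (.var 12)) (assign 9 (.var 7 + .const 1)))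

/-- The contribution of the next digit of the first list. -/
def outerBody : Prog := .seq outerInit (.rep 62 innerBody)

/-- The sum of the contributions of all pairs of digits. -/
def sumPairs : Prog :=
  .seq (.seq (assign 16 (.const 0)) (assign 8 (.var 6 + .const 1))) (.rep 62 outerBody)

/-- The real variables that are changed by `innerBody`. -/
def innerVars : Finset ℕ := {9, 10, 11, 12, 16, 17, 18, 22, 23, 24}

/-- The real variables that are changed by `sumPairs`. -/
def loopVars : Finset ℕ := {8, 9, 10, 11, 12, 16, 17, 18, 19, 22, 23, 24}

/-- What the loops over the digits rely on.  The digits have the exponents `E - u` and `E' - u` for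
`u < L`, the real variable `13` holds the threshold of the detection, `15` the normalisation of the
weights, and `20` the inverse `L ^ 2 / ε` of the accuracy for a single pair.  By `large`, the
amplification that a pair of digits that occur requires stays below `W`; by `small`, pairs with a
digit that is too rare to be detected are negligible. -/
structure LoopReady (D : Device) (b W : ℕ) (φ : Bits D.n → Feature D.N) (L : ℕ) (E E' : ℤ)
    (s : State) : Prop where
  machine : Machine D b W s
  digit : (s.int 26).natAbs + 1 ≤ b
  digit' : (s.int 27).natAbs + 1 ≤ b
  count : s.int 62 = L
  loop : s.int 63 = 4 * L
  r6 : s.real 6 = E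
  r7 : s.real 7 = E'
  r14 : s.real 14 = (s.int 61).toNat
  r15 : 0 < s.real 15
  r20 : 0 < s.real 20
  r21 : s.real 21 = 0
  threshold : 1 ≤ s.real 13
  threshold_le : 2 * s.real 13 ≤ W
  threshold_pow : 2 * s.real 13 ≤ 2 ^ (4 * L)
  exponent : ∀ u < L, (E - u : ℤ).natAbs + 1 ≤ b
  exponent' : ∀ u < L, (E' - u : ℤ).natAbs + 1 ≤ b
  large : ∀ u < L, ∀ v < L, D.digitProb false (E - u) ≠ 0 → D.digitProb true (E' - v) ≠ 0 →
    7 * (pairWeight (E - u) (E' - v) (s.real 15) * s.real 20) ≤ W ∧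
      pairWeight (E - u) (E' - v) (s.real 15) * s.real 20 ≤ 2 ^ (4 * L)
  small : ∀ u < L, ∀ v < L, (D.digitProb false (E - u) < 1 / s.real 13 ^ 2 ∨
    D.digitProb true (E' - v) < 1 / s.real 13 ^ 2) →
    |pairWeight (E - u) (E' - v) (s.real 15) * D.overlap φ (E - u) (E' - v)| ≤
      1 / (4 * s.real 20)

section

variable {b W : ℕ} {φ : Bits D.n → Feature D.N} {L : ℕ} {E E' : ℤ} {s t : State}

lemma LoopReady.of_frame (h : LoopReady D b W φ L E E' s) (hst : Frame loopVars s t)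
    (h26 : (t.int 26).natAbs + 1 ≤ b) (h27 : (t.int 27).natAbs + 1 ≤ b) :
    LoopReady D b W φ L E E' t := by
  have e13 : t.real 13 = s.real 13 := hst.real 13
  have e15 : t.real 15 = s.real 15 := hst.real 15
  have e20 : t.real 20 = s.real 20 := hst.real 20
  have e62 : t.int 62 = s.int 62 := hst.int 62
  have e63 : t.int 63 = s.int 63 := hst.int 63
  exact
  { machine := h.machine.of_frame hst h26 h27
    digit := h26
    digit' := h27
    count := e62.trans h.count
    loop := e63.trans h.loop
    r6 := (hst.real 6).trans h.r6
    r7 := (hst.real 7).trans h.r7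
    r14 := by
      rw [hst.real 14, hst.int 61]
      exact h.r14
    r15 := e15 ▸ h.r15
    r20 := e20 ▸ h.r20
    r21 := (hst.real 21).trans h.r21
    threshold := e13 ▸ h.threshold
    threshold_le := e13 ▸ h.threshold_le
    threshold_pow := e13 ▸ h.threshold_pow
    exponent := h.exponent
    exponent' := h.exponent'
    large := by rw [e15, e20]; exact h.large
    small := by rw [e13, e15, e20]; exact h.small }

lemma LoopReady.of_keeps {X : Finset ℕ} (h : LoopReady D b W φ L E E' s) (hst : Keeps X s t)
    (hX : X ⊆ loopVars) : LoopReady D b W φ L E E' t :=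
  h.of_frame (hst.frame.mono hX) (by rw [hst.int 26]; exact h.digit)
    (by rw [hst.int 27]; exact h.digit')

lemma LoopReady.loop_toNat (h : LoopReady D b W φ L E E' s) : (s.int 63).toNat = 4 * L := by
  rw [h.loop]; omega

lemma LoopReady.count_toNat (h : LoopReady D b W φ L E E' s) : (s.int 62).toNat = L := by
  rw [h.count]; omega

lemma LoopReady.le (h : LoopReady D b W φ L E E' s) : 4 * L ≤ b := by
  rw [← h.loop_toNat]; exact h.machine.loop

lemma LoopReady.count_cost (h : LoopReady D b W φ L E E' s) : intCost (s.int 62) ≤ b := by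
  refine (intCost_le ?_).trans h.machine.loop_cost
  rw [h.count, h.loop]; omega

lemma LoopReady.le_cost (h : LoopReady D b W φ L E E' s) :
    1 ≤ b ∧ b ≤ D.unitCost b W ∧ D.unitCost b W ≤ b * D.unitCost b W := by
  have hb1 : 1 ≤ b := (one_le_intCost _).trans h.machine.size_le
  exact ⟨hb1, le_unitCost h.machine, Nat.le_mul_of_pos_left _ hb1⟩

/-- Detection of a digit, stated in terms of the probability of the digit. -/
lemma LoopReady.always_detect (hU : D.Unitary) (h : LoopReady D b W φ L E E' s) (c : Bool) :
    Always D s (detect c) fun t => Keeps {10, 12, 22} s t ∧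
      (D.digitProb c (s.int (if c then 27 else 26)) = 0 → t.real 12 = 0) ∧
      t.time ≤ s.time + 2500 * (b * D.unitCost b W) :=
  (QSVM.always_detect hU h.machine c h.threshold_le).mono fun _ ht =>
    ⟨ht.1, fun hp => ht.2.2.1 (ampProb_eq_zero hU h.machine.layout c hp), ht.2.2.2⟩

lemma LoopReady.err_detect (hU : D.Unitary) (h : LoopReady D b W φ L E E' s) (c : Bool) :
    Err D s (detect c) (4 * L * failProb (s.int 61).toNat) fun t =>
      1 / s.real 13 ^ 2 ≤ D.digitProb c (s.int (if c then 27 else 26)) → 0 < t.real 12 := by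
  by_cases hp : 1 / s.real 13 ^ 2 ≤ D.digitProb c (s.int (if c then 27 else 26))
  · obtain ⟨i, h1, h2⟩ := exists_amplification hU h.machine.layout c h.threshold hp
    have hi : i < (s.int 63).toNat := by
      rw [h.loop_toNat]
      have h3 : (2 : ℝ) ^ i < 2 ^ (4 * L) :=
        (pow_le_pow_left₀ (by norm_num) (by norm_num) i).trans_lt (h1.trans_le h.threshold_pow)
      exact (pow_lt_pow_iff_right₀ (by norm_num)).1 h3
    have := QSVM.err_detect hU h.machine c h.threshold_le hi h1 h2
    rw [h.loop_toNat] at this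
    push_cast at this
    exact this.mono le_rfl (A := fun _ => True) (fun _ _ _ => trivial) fun _ _ hg _ => hg
  · exact (QSVM.always_detect hU h.machine c h.threshold_le).err_imp
      (mul_nonneg (by positivity) (failProb_nonneg _)) fun _ _ h' => absurd h' hp

/-- The contribution of a pair of digits. -/
noncomputable def pairTerm (D : Device) (φ : Bits D.n → Feature D.N) (v : ℝ) (e e' : ℤ) : ℝ :=
  pairWeight e e' v * D.overlap φ e e'

lemma always_innerBody (hU : D.Unitary) (h : LoopReady D b W φ L E E' s) {u k : ℕ}
    (hu : u < L) (hk : k < L) (h26 : s.int 26 = E - u) (h8 : s.real 8 = (E - u : ℤ))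
    (h9 : s.real 9 = (E' - k : ℤ) + 1) (h19 : D.digitProb false (E - u) = 0 → s.real 19 = 0) :
    Always D s innerBody fun t => Frame innerVars s t ∧ LoopReady D b W φ L E E' t ∧
      t.int 26 = E - u ∧ t.real 9 = (E' - k : ℤ) ∧
      t.time ≤ s.time + 8100 * (b * D.unitCost b W) := by
  obtain ⟨hb1, hb2, hb3⟩ := h.le_cost
  have hfirst : Always D s (.seq (nextDigit 27 9) (detect true)) fun t =>
      Frame innerVars s t ∧ LoopReady D b W φ L E E' t ∧ t.int 26 = E - u ∧
      t.real 9 = (E' - k : ℤ) ∧ (D.digitProb true (E' - k) = 0 → t.real 12 = 0) ∧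
      t.time ≤ s.time + 2560 * (b * D.unitCost b W) := by
    refine Always.det_seq (det_nextDigit D (Or.inr rfl) (by omega) h.machine.psi h9
      (h.exponent' k hk)) fun t ht => ?_
    obtain ⟨h1, h2, h3, h4, -, h5⟩ := ht
    have ht26 : t.int 26 = s.int 26 := h4 26 (by omega) (by omega)
    have hr : LoopReady D b W φ L E E' t := h.of_frame (h1.mono (by decide))
      (by rw [ht26]; exact h.digit) (by rw [h3]; exact h.exponent' k hk)
    refine (hr.always_detect hU true).mono fun v hv => ?_
    obtain ⟨v1, v2, v3⟩ := hv
    rw [if_pos rfl, h3] at v2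
    exact ⟨(h1.mono (by decide)).trans (v1.frame.mono (by decide)), hr.of_keeps v1 (by decide),
      (v1.int 26).trans (ht26.trans h26),
      (v1.real 9).trans h2, v2, by omega⟩
  refine Always.seq hU hfirst fun t ht => ?_
  obtain ⟨h1, hr, h2, h3, h4, h5⟩ := ht
  have e19 : t.real 19 = s.real 19 := h1.real 19
  refine always_ifLt (fun hlt => ?_) fun _ => ?_
  · refine always_ifLt (fun hlt' => ?_) fun _ => ?_
    · rw [hr.r21, e19] at hlt
      change t.real 21 < t.real 12 at hlt'
      rw [hr.r21] at hlt'
      have hl := (hr.large u hu k hk (fun h0 => hlt.ne' (h19 h0)) (fun h0 => hlt'.ne' (h4 h0))).1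
      have e8 : t.real 8 = s.real 8 := h1.real 8
      refine (always_pairBody hU (s := (t.tick 1).tick 1)
        (hr.machine.of_keeps (Keeps.refl (s := t) ∅ h1.1)) (e8.trans h8) h3 hl).mono
        fun v hv => ?_
      obtain ⟨v1, v2⟩ := hv
      replace v1 : Keeps pairVars t v := v1
      simp only [State.tick] at v2
      exact ⟨h1.trans (v1.frame.mono (by decide)), hr.of_keeps v1 (by decide),
        (v1.int 26).trans h2, (v1.real 9).trans h3, by omega⟩
    · exact always_skip ⟨h1, hr.of_keeps (t := (t.tick 1).tick 1) (Keeps.refl (s := t) ∅ h1.1)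
        (by decide), h2, h3, by simp only [State.tick]; omega⟩
  · exact always_skip ⟨h1, hr.of_keeps (t := t.tick 1) (Keeps.refl (s := t) ∅ h1.1)
      (by decide), h2, h3, by simp only [State.tick]; omega⟩

/-- Up to the failures of the detection and of the estimate, the sum changes by the contribution of
the pair, also if the pair is skipped. -/
lemma err_innerBody (hU : D.Unitary) (h : LoopReady D b W φ L E E' s) (hφ : D.HasFeature φ)
    (hov : ∀ e e', |D.overlap φ e e'| ≤ 1) {u k : ℕ}
    (hu : u < L) (hk : k < L) (h26 : s.int 26 = E - u) (h8 : s.real 8 = (E - u : ℤ))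
    (h9 : s.real 9 = (E' - k : ℤ) + 1) (h19 : D.digitProb false (E - u) = 0 → s.real 19 = 0)
    (h19' : 1 / s.real 13 ^ 2 ≤ D.digitProb false (E - u) → 0 < s.real 19) :
    Err D s innerBody ((8 * L + 1) * failProb (s.int 61).toNat) fun t =>
      |t.real 16 - s.real 16 - pairTerm D φ (s.real 15) (E - u) (E' - k)| ≤
        1 / (4 * s.real 20) := by
  have hfail := failProb_nonneg (s.int 61).toNat
  -- The first part of the body, with the frame that both estimates need.
  have hdet := det_nextDigit D (i := 27) (Or.inr rfl) (by omega) h.machine.psi h9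
    (h.exponent' k hk)
  have hready : ∀ t, Frame {9} s t → t.int 27 = E' - k → (∀ j < 50, j ≠ 27 → t.int j = s.int j) →
      LoopReady D b W φ L E E' t := fun t h1 h3 h4 =>
    h.of_frame (h1.mono (by decide))
      (by rw [h4 26 (by omega) (by omega)]; exact h.digit) (by rw [h3]; exact h.exponent' k hk)
  have hA : Always D s (.seq (nextDigit 27 9) (detect true)) fun t =>
      Frame {9, 10, 12, 22} s t ∧ LoopReady D b W φ L E E' t ∧ t.int 26 = E - u ∧
      t.int 27 = E' - k ∧ t.real 9 = (E' - k : ℤ) ∧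
      (D.digitProb true (E' - k) = 0 → t.real 12 = 0) := by
    refine Always.det_seq hdet fun t ht => ?_
    obtain ⟨h1, h2, h3, h4, -, -⟩ := ht
    have hr := hready t h1 h3 h4
    refine (hr.always_detect hU true).mono fun v hv => ?_
    obtain ⟨v1, v2, -⟩ := hv
    rw [if_pos rfl, h3] at v2
    exact ⟨(h1.mono (by decide)).trans (v1.frame.mono (by decide)), hr.of_keeps v1 (by decide),
      (v1.int 26).trans ((h4 26 (by omega) (by omega)).trans h26),
      (v1.int 27).trans h3, (v1.real 9).trans h2, v2⟩
  have hG : Err D s (.seq (nextDigit 27 9) (detect true))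
      (4 * L * failProb (s.int 61).toNat) fun t =>
      1 / s.real 13 ^ 2 ≤ D.digitProb true (E' - k) → 0 < t.real 12 := by
    refine Err.det_seq hdet (fun t ht => ht.2.2.2.2.1) fun t ht => ?_
    obtain ⟨h1, h2, h3, h4, -, -⟩ := ht
    have := (hready t h1 h3 h4).err_detect hU true
    rwa [if_pos rfl, h3, h1.real 13,
      h1.int 61] at this
  have := Err.seq hU (q := .ifLt 21 19 (.ifLt 21 12 pairBody .skip) .skip)
    (δ' := (4 * L + 1) * failProb (s.int 61).toNat) (mul_nonneg (by positivity) hfail) hA hG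
    (G' := fun t => |t.real 16 - s.real 16 - pairTerm D φ (s.real 15) (E - u) (E' - k)| ≤
        1 / (4 * s.real 20)) ?_
  · exact this.mono (le_of_eq (by ring)) (A := fun _ => True) (fun _ _ _ => trivial)
      fun _ _ hg => hg
  intro t ht hg
  obtain ⟨h1, hr, h2, h27, h3, h4⟩ := ht
  have e13 : t.real 13 = s.real 13 := h1.real 13
  have e15 : t.real 15 = s.real 15 := h1.real 15
  have e16 : t.real 16 = s.real 16 := h1.real 16
  have e19 : t.real 19 = s.real 19 := h1.real 19
  have e20 : t.real 20 = s.real 20 := h1.real 20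
  have e61 : t.int 61 = s.int 61 := h1.int 61
  -- A pair that is skipped contributes little, since one of its digits is rare.
  have hskip : (D.digitProb false (E - u) < 1 / s.real 13 ^ 2 ∨
      D.digitProb true (E' - k) < 1 / s.real 13 ^ 2) → ∀ v : State, v.real = t.real →
      |v.real 16 - s.real 16 - pairTerm D φ (s.real 15) (E - u) (E' - k)| ≤
        1 / (4 * s.real 20) := by
    intro hrare v hv
    rw [hv, e16, sub_self, zero_sub, abs_neg]
    exact h.small u hu k hk hrare
  have hδ : 0 ≤ (4 * L + 1) * failProb (s.int 61).toNat := mul_nonneg (by positivity) hfail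
  refine err_ifLt (fun hlt => ?_) fun hlt => ?_
  · rw [hr.r21, e19] at hlt
    refine err_ifLt (fun hlt' => ?_) fun hlt' => ?_
    · change t.real 21 < t.real 12 at hlt'
      rw [hr.r21] at hlt'
      have hl := hr.large u hu k hk (fun h0 => hlt.ne' (h19 h0)) (fun h0 => hlt'.ne' (h4 h0))
      have e8 : t.real 8 = s.real 8 := h1.real 8
      have := err_pairBody hU (s := (t.tick 1).tick 1)
        (hr.machine.of_keeps (Keeps.refl (s := t) ∅ h1.1)) (e8.trans h8) h3 h2 h27
        hr.r15 hr.r20 hl.1 (hl.2.trans_eq (by simp only [State.tick]; rw [hr.loop_toNat]))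
        hr.r14 hφ (hov _ _)
      simp only [State.tick, e15, e16, e20, e61, hr.loop_toNat] at this
      push_cast at this
      exact this
    · change ¬ t.real 21 < t.real 12 at hlt'
      rw [hr.r21] at hlt'
      refine (always_skip (A := fun v => v = (t.tick 1).tick 1) rfl).err_imp hδ fun v hv => ?_
      refine hskip (Or.inr (not_le.1 fun hp => hlt' (hg hp))) v ?_
      rw [hv]; rfl
  · rw [hr.r21, e19] at hlt
    refine (always_skip (A := fun v => v = t.tick 1) rfl).err_imp hδ fun v hv => ?_
    refine hskip (Or.inl (not_le.1 fun hp => hlt (h19' hp))) v ?_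
    rw [hv]; rfl

end

section

variable {b W : ℕ} {φ : Bits D.n → Feature D.N} {L : ℕ} {E E' : ℤ} {s t : State}

/-- The invariant of the loop over the digits of the second list. -/
def InnerInv (D : Device) (b W : ℕ) (φ : Bits D.n → Feature D.N) (L : ℕ) (E E' : ℤ) (u : ℕ)
    (s : State) (k : ℕ) (t : State) : Prop :=
  Frame innerVars s t ∧ LoopReady D b W φ L E E' t ∧ t.int 26 = E - u ∧
    t.real 9 = (E' - k : ℤ) + 1 ∧ t.time ≤ s.time + (b + k * (8101 * (b * D.unitCost b W)))

lemma innerInv_zero (h : LoopReady D b W φ L E E' s) {u : ℕ} (h26 : s.int 26 = E - u)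
    (h9 : s.real 9 = E' + 1) :
    InnerInv D b W φ L E E' u s 0 (s.tick (intCost (s.int 62))) := by
  have hk := Keeps.refl ∅ h.machine.psi
  have hc := h.count_cost
  refine ⟨hk.frame.mono (by decide), h.of_keeps (t := s.tick _) hk (by decide), h26, ?_, ?_⟩
  · rw [Nat.cast_zero, sub_zero]; exact h9
  · simp only [State.tick]; omega

lemma innerInv_step (hU : D.Unitary) {u k : ℕ} (hu : u < L) (hk : k < L)
    (h8 : s.real 8 = (E - u : ℤ)) (h19 : D.digitProb false (E - u) = 0 → s.real 19 = 0)
    (ht : InnerInv D b W φ L E E' u s k t) :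
    Always D (t.tick 1) innerBody (InnerInv D b W φ L E E' u s (k + 1)) := by
  obtain ⟨h1, hr, h2, h3, h4⟩ := ht
  have hr' : LoopReady D b W φ L E E' (t.tick 1) :=
    hr.of_keeps (t := t.tick 1) (Keeps.refl (s := t) ∅ h1.1) (by decide)
  have e8 : t.real 8 = s.real 8 := h1.real 8
  have e19 : t.real 19 = s.real 19 := h1.real 19
  refine (always_innerBody hU hr' hu hk h2 (e8.trans h8) h3 fun h0 => e19.trans (h19 h0)).mono
    fun v hv => ?_
  obtain ⟨v1, v2, v3, v4, v5⟩ := hv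
  obtain ⟨hb1, hb2, hb3⟩ := hr.le_cost
  refine ⟨h1.trans (show Frame innerVars t v from v1), v2, v3, ?_, ?_⟩
  · rw [v4]; push_cast; ring
  · simp only [State.tick] at v5
    rw [add_mul, one_mul]; omega

lemma always_innerLoop (hU : D.Unitary) (h : LoopReady D b W φ L E E' s) {u : ℕ} (hu : u < L)
    (h26 : s.int 26 = E - u) (h8 : s.real 8 = (E - u : ℤ)) (h9 : s.real 9 = E' + 1)
    (h19 : D.digitProb false (E - u) = 0 → s.real 19 = 0) :
    Always D s (.rep 62 innerBody) fun t => Frame innerVars s t ∧ LoopReady D b W φ L E E' t ∧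
      t.time ≤ s.time + 8200 * (b * (b * D.unitCost b W)) := by
  have := always_rep hU (InnerInv D b W φ L E E' u s) (innerInv_zero h h26 h9)
    fun k hk t ht => innerInv_step hU hu (by rw [h.count_toNat] at hk; exact hk) h8 h19 ht
  rw [h.count_toNat] at this
  refine this.mono fun t ht => ⟨ht.1, ht.2.1, ht.2.2.2.2.trans ?_⟩
  obtain ⟨hb1, hb2, hb3⟩ := h.le_cost
  have hL := h.le
  have e1 : L * (8101 * (b * D.unitCost b W)) ≤ b * (8101 * (b * D.unitCost b W)) :=
    Nat.mul_le_mul_right _ (by omega)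
  have e2 : b * (8101 * (b * D.unitCost b W)) = 8101 * (b * (b * D.unitCost b W)) := by ring
  have e3 : b * D.unitCost b W ≤ b * (b * D.unitCost b W) := Nat.le_mul_of_pos_left _ hb1
  omega

lemma err_innerLoop (hU : D.Unitary) (h : LoopReady D b W φ L E E' s) (hφ : D.HasFeature φ)
    (hov : ∀ e e', |D.overlap φ e e'| ≤ 1) {u : ℕ} (hu : u < L)
    (h26 : s.int 26 = E - u) (h8 : s.real 8 = (E - u : ℤ)) (h9 : s.real 9 = E' + 1)
    (h19 : D.digitProb false (E - u) = 0 → s.real 19 = 0)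
    (h19' : 1 / s.real 13 ^ 2 ≤ D.digitProb false (E - u) → 0 < s.real 19) :
    Err D s (.rep 62 innerBody) (L * ((8 * L + 1) * failProb (s.int 61).toNat)) fun t =>
      |t.real 16 - s.real 16 - ∑ k ∈ range L, pairTerm D φ (s.real 15) (E - u) (E' - k)| ≤
        L * (1 / (4 * s.real 20)) := by
  have := err_rep hU (s := s) (i := 62) (p := innerBody)
    (δ := (8 * L + 1) * failProb (s.int 61).toNat)
    (mul_nonneg (by positivity) (failProb_nonneg _)) (InnerInv D b W φ L E E' u s)
    (fun n t => |t.real 16 - s.real 16 -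
      ∑ k ∈ range n, pairTerm D φ (s.real 15) (E - u) (E' - k)| ≤ n * (1 / (4 * s.real 20)))
    (innerInv_zero h h26 h9)
    (fun k hk t ht => innerInv_step hU hu (by rw [h.count_toNat] at hk; exact hk) h8 h19 ht)
    (by simp [State.tick]) ?_
  · rwa [h.count_toNat] at this
  intro k hk t ht hG
  rw [h.count_toNat] at hk
  obtain ⟨h1, hr, h2, h3, h4⟩ := ht
  have hr' : LoopReady D b W φ L E E' (t.tick 1) :=
    hr.of_keeps (t := t.tick 1) (Keeps.refl (s := t) ∅ h1.1) (by decide)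
  have e8 : t.real 8 = s.real 8 := h1.real 8
  have e13 : t.real 13 = s.real 13 := h1.real 13
  have e15 : t.real 15 = s.real 15 := h1.real 15
  have e19 : t.real 19 = s.real 19 := h1.real 19
  have e20 : t.real 20 = s.real 20 := h1.real 20
  have e61 : t.int 61 = s.int 61 := h1.int 61
  have := err_innerBody hU hr' hφ hov hu hk h2 (e8.trans h8) h3 (fun h0 => e19.trans (h19 h0))
    (fun h0 => (h19' (by simpa only [State.tick, e13] using h0)).trans_eq e19.symm)
  simp only [State.tick, e15, e20, e61] at this
  refine this.mono le_rfl (A := fun _ => True) (fun _ _ _ => trivial) fun v _ hv => ?_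
  rw [sum_range_succ]
  push_cast
  rw [add_mul, one_mul]
  refine le_trans (le_of_eq ?_) ((abs_add_le _ _).trans (add_le_add hG hv))
  congr 1; ring

lemma det_outerSet (D : Device) {s : State} (hs : ∃ a : ℂ, s.psi = a • ket ∅) :
    Det D s (.seq (assign 19 (.var 12)) (assign 9 (.var 7 + .const 1))) fun t =>
      Keeps {9, 19} s t ∧ t.real 19 = s.real 12 ∧ t.real 9 = s.real 7 + 1 ∧
      t.time ≤ s.time + 50 := by
  have f1 : (RExp.var 12).cost ≤ 10 := by decide
  have f2 : (RExp.var 7 + RExp.const 1 : RExp).cost ≤ 20 := by decide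
  refine (det_assign_keeps D (r := 19) (by omega) (e := .var 12) (by simp) hs).seq fun t ht => ?_
  obtain ⟨h1, h2, -, h4⟩ := ht
  refine (det_assign_keeps D (r := 9) (by omega) (e := .var 7 + .const 1) (by simp) h1.1).mono
    fun u hu => ?_
  obtain ⟨u1, u2, -, u4⟩ := hu
  refine ⟨(h1.mono (by decide)).trans (u1.mono (by decide)), ?_, ?_, by omega⟩
  · rw [u1.real 19, h2, RExp.eval_var]
  · rw [u2, RExp.eval_add, RExp.eval_var, RExp.eval_const, h1.real 7]
    simp

lemma always_nextDetect (hU : D.Unitary) (h : LoopReady D b W φ L E E' s) {u : ℕ} (hu : u < L)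
    (h8 : s.real 8 = (E - u : ℤ) + 1) :
    Always D s (.seq (nextDigit 26 8) (detect false)) fun t => Frame {8, 10, 12, 22} s t ∧
      LoopReady D b W φ L E E' t ∧ t.int 26 = E - u ∧ t.real 8 = (E - u : ℤ) ∧
      (D.digitProb false (E - u) = 0 → t.real 12 = 0) ∧
      t.time ≤ s.time + 2550 * (b * D.unitCost b W) := by
  obtain ⟨hb1, hb2, hb3⟩ := h.le_cost
  refine Always.det_seq (det_nextDigit D (Or.inl rfl) (by omega) h.machine.psi h8
    (h.exponent u hu)) fun t ht => ?_
  obtain ⟨h1, h2, h3, h4, -, h5⟩ := ht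
  have hr : LoopReady D b W φ L E E' t := h.of_frame (h1.mono (by decide))
    (by rw [h3]; exact h.exponent u hu) (by rw [h4 27 (by omega) (by omega)]; exact h.digit')
  refine (hr.always_detect hU false).mono fun v hv => ?_
  obtain ⟨v1, v2, v3⟩ := hv
  rw [if_neg (by simp), h3] at v2
  exact ⟨(h1.mono (by decide)).trans (v1.frame.mono (by decide)), hr.of_keeps v1 (by decide),
    (v1.int 26).trans h3, (v1.real 8).trans h2, v2, by omega⟩

lemma err_nextDetect (hU : D.Unitary) (h : LoopReady D b W φ L E E' s) {u : ℕ} (hu : u < L)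
    (h8 : s.real 8 = (E - u : ℤ) + 1) :
    Err D s (.seq (nextDigit 26 8) (detect false)) (4 * L * failProb (s.int 61).toNat) fun t =>
      1 / s.real 13 ^ 2 ≤ D.digitProb false (E - u) → 0 < t.real 12 := by
  refine Err.det_seq (det_nextDigit D (Or.inl rfl) (by omega) h.machine.psi h8
    (h.exponent u hu)) (fun t ht => ht.2.2.2.2.1) fun t ht => ?_
  obtain ⟨h1, h2, h3, h4, -, h5⟩ := ht
  have hr : LoopReady D b W φ L E E' t := h.of_frame (h1.mono (by decide))
    (by rw [h3]; exact h.exponent u hu) (by rw [h4 27 (by omega) (by omega)]; exact h.digit')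
  have := hr.err_detect hU false
  rwa [if_neg (by simp), h3, h1.real 13,
    h1.int 61] at this

lemma always_outerInit (hU : D.Unitary) (h : LoopReady D b W φ L E E' s) {u : ℕ} (hu : u < L)
    (h8 : s.real 8 = (E - u : ℤ) + 1) :
    Always D s outerInit fun t => Frame {8, 9, 10, 12, 19, 22} s t ∧
      LoopReady D b W φ L E E' t ∧ t.int 26 = E - u ∧ t.real 8 = (E - u : ℤ) ∧
      t.real 9 = E' + 1 ∧ (D.digitProb false (E - u) = 0 → t.real 19 = 0) ∧
      t.time ≤ s.time + 2600 * (b * D.unitCost b W) := by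
  obtain ⟨hb1, hb2, hb3⟩ := h.le_cost
  refine Always.seq hU (always_nextDetect hU h hu h8) fun t ht => ?_
  obtain ⟨h1, hr, h2, h3, h4, h5⟩ := ht
  refine Det.always ((det_outerSet D h1.1).mono fun v hv => ?_)
  obtain ⟨v1, v2, v3, v4⟩ := hv
  exact ⟨(h1.mono (by decide)).trans (v1.frame.mono (by decide)), hr.of_keeps v1 (by decide),
    (v1.int 26).trans h2, (v1.real 8).trans h3, by rw [v3, hr.r7],
    fun h0 => v2.trans (h4 h0), by omega⟩

lemma err_outerInit (hU : D.Unitary) (h : LoopReady D b W φ L E E' s) {u : ℕ} (hu : u < L)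
    (h8 : s.real 8 = (E - u : ℤ) + 1) :
    Err D s outerInit (4 * L * failProb (s.int 61).toNat) fun t =>
      1 / s.real 13 ^ 2 ≤ D.digitProb false (E - u) → 0 < t.real 19 := by
  have := Err.seq hU (δ' := 0) le_rfl (always_nextDetect hU h hu h8) (err_nextDetect hU h hu h8)
    (q := .seq (assign 19 (.var 12)) (assign 9 (.var 7 + .const 1)))
    (G' := fun t => 1 / s.real 13 ^ 2 ≤ D.digitProb false (E - u) → 0 < t.real 19)
    fun t ht hg => Always.err_imp (Det.always (det_outerSet D ht.1.1)) le_rfl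
      fun v hv h0 => (hg h0).trans_eq hv.2.1.symm
  rwa [add_zero] at this

lemma always_outerBody (hU : D.Unitary) (h : LoopReady D b W φ L E E' s) {u : ℕ} (hu : u < L)
    (h8 : s.real 8 = (E - u : ℤ) + 1) :
    Always D s outerBody fun t => Frame loopVars s t ∧ LoopReady D b W φ L E E' t ∧
      t.real 8 = (E - u : ℤ) ∧ t.time ≤ s.time + 10900 * (b * (b * D.unitCost b W)) := by
  obtain ⟨hb1, hb2, hb3⟩ := h.le_cost
  refine Always.seq hU (always_outerInit hU h hu h8) fun t ht => ?_
  obtain ⟨h1, hr, h2, h3, h4, h5, h6⟩ := ht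
  refine (always_innerLoop hU hr hu h2 h3 h4 h5).mono fun v hv => ?_
  obtain ⟨v1, v2, v3⟩ := hv
  have e3 : b * D.unitCost b W ≤ b * (b * D.unitCost b W) := Nat.le_mul_of_pos_left _ hb1
  exact ⟨(h1.mono (by decide)).trans (v1.mono (by decide)), v2,
    (v1.real 8).trans h3, by omega⟩

lemma err_outerBody (hU : D.Unitary) (h : LoopReady D b W φ L E E' s) (hφ : D.HasFeature φ)
    (hov : ∀ e e', |D.overlap φ e e'| ≤ 1) {u : ℕ} (hu : u < L)
    (h8 : s.real 8 = (E - u : ℤ) + 1) :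
    Err D s outerBody ((4 * L + L * (8 * L + 1)) * failProb (s.int 61).toNat) fun t =>
      |t.real 16 - s.real 16 - ∑ k ∈ range L, pairTerm D φ (s.real 15) (E - u) (E' - k)| ≤
        L * (1 / (4 * s.real 20)) := by
  have := Err.seq hU (q := .rep 62 innerBody)
    (δ' := L * ((8 * L + 1) * failProb (s.int 61).toNat))
    (mul_nonneg (by positivity) (mul_nonneg (by positivity) (failProb_nonneg _)))
    (always_outerInit hU h hu h8) (err_outerInit hU h hu h8)
    (G' := fun t => |t.real 16 - s.real 16 -
      ∑ k ∈ range L, pairTerm D φ (s.real 15) (E - u) (E' - k)| ≤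
        L * (1 / (4 * s.real 20))) ?_
  · exact this.mono (le_of_eq (by ring)) (A := fun _ => True) (fun _ _ _ => trivial)
      fun _ _ hg => hg
  intro t ht hg
  obtain ⟨h1, hr, h2, h3, h4, h5, -⟩ := ht
  have e13 : t.real 13 = s.real 13 := h1.real 13
  have e15 : t.real 15 = s.real 15 := h1.real 15
  have e16 : t.real 16 = s.real 16 := h1.real 16
  have e20 : t.real 20 = s.real 20 := h1.real 20
  have e61 : t.int 61 = s.int 61 := h1.int 61
  have := err_innerLoop hU hr hφ hov hu h2 h3 h4 h5 (by rw [e13]; exact hg)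
  rwa [e15, e16, e20, e61] at this

/-- The invariant of the loop over the digits of the first list. -/
def OuterInv (D : Device) (b W : ℕ) (φ : Bits D.n → Feature D.N) (L : ℕ) (E E' : ℤ)
    (s : State) (k : ℕ) (t : State) : Prop :=
  Frame loopVars s t ∧ LoopReady D b W φ L E E' t ∧ t.real 8 = (E - k : ℤ) + 1 ∧
    t.time ≤ s.time + (b + k * (10901 * (b * (b * D.unitCost b W))))

lemma outerInv_zero (h : LoopReady D b W φ L E E' s) (h8 : s.real 8 = E + 1) :
    OuterInv D b W φ L E E' s 0 (s.tick (intCost (s.int 62))) := by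
  have hk := Keeps.refl ∅ h.machine.psi
  have hc := h.count_cost
  refine ⟨hk.frame.mono (by decide), h.of_keeps (t := s.tick _) hk (by decide), ?_, ?_⟩
  · rw [Nat.cast_zero, sub_zero]; exact h8
  · simp only [State.tick]; omega

lemma outerInv_step (hU : D.Unitary) {k : ℕ} (hk : k < L) (ht : OuterInv D b W φ L E E' s k t) :
    Always D (t.tick 1) outerBody (OuterInv D b W φ L E E' s (k + 1)) := by
  obtain ⟨h1, hr, h3, h4⟩ := ht
  have hr' : LoopReady D b W φ L E E' (t.tick 1) :=
    hr.of_keeps (t := t.tick 1) (Keeps.refl (s := t) ∅ h1.1) (by decide)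
  refine (always_outerBody hU hr' hk h3).mono fun v hv => ?_
  obtain ⟨v1, v2, v4, v5⟩ := hv
  obtain ⟨hb1, hb2, hb3⟩ := hr.le_cost
  have e3 : b * D.unitCost b W ≤ b * (b * D.unitCost b W) := Nat.le_mul_of_pos_left _ hb1
  refine ⟨h1.trans (show Frame loopVars t v from v1), v2, ?_, ?_⟩
  · rw [v4]; push_cast; ring
  · simp only [State.tick] at v5
    rw [add_mul, one_mul]; omega

lemma det_sumInit (D : Device) {s : State} (hs : ∃ a : ℂ, s.psi = a • ket ∅) :
    Det D s (.seq (assign 16 (.const 0)) (assign 8 (.var 6 + .const 1))) fun t =>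
      Keeps {8, 16} s t ∧ t.real 16 = 0 ∧ t.real 8 = s.real 6 + 1 ∧ t.psi = s.psi ∧
      t.time ≤ s.time + 50 := by
  have f1 : (RExp.const 0).cost ≤ 10 := by decide
  have f2 : (RExp.var 6 + RExp.const 1 : RExp).cost ≤ 20 := by decide
  refine (det_assign_keeps D (r := 16) (by omega) (e := .const 0) (by simp) hs).seq fun t ht => ?_
  obtain ⟨h1, h2, h3, h4⟩ := ht
  refine (det_assign_keeps D (r := 8) (by omega) (e := .var 6 + .const 1) (by simp) h1.1).mono
    fun u hu => ?_
  obtain ⟨u1, u2, u3, u4⟩ := hu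
  refine ⟨(h1.mono (by decide)).trans (u1.mono (by decide)), ?_, ?_, u3.trans h3, by omega⟩
  · rw [u1.real 16, h2]; simp
  · rw [u2, RExp.eval_add, RExp.eval_var, RExp.eval_const, h1.real 6]
    simp

lemma always_sumPairs (hU : D.Unitary) (h : LoopReady D b W φ L E E' s) :
    Always D s sumPairs fun t => Frame loopVars s t ∧
      t.time ≤ s.time + 11000 * (b * (b * (b * D.unitCost b W))) := by
  refine Always.det_seq (det_sumInit D h.machine.psi) fun t ht => ?_
  obtain ⟨h1, h2, h3, -, h4⟩ := ht
  have hr : LoopReady D b W φ L E E' t := h.of_keeps h1 (by decide)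
  have := always_rep hU (OuterInv D b W φ L E E' t) (outerInv_zero hr (by rw [h3, h.r6]))
    fun k hk u hu => outerInv_step hU (by rw [hr.count_toNat] at hk; exact hk) hu
  rw [hr.count_toNat] at this
  refine this.mono fun u hu => ⟨(h1.frame.mono (by decide)).trans hu.1, hu.2.2.2.trans ?_⟩
  obtain ⟨hb1, hb2, hb3⟩ := h.le_cost
  have hL := h.le
  have e1 : L * (10901 * (b * (b * D.unitCost b W))) ≤ b * (10901 * (b * (b * D.unitCost b W))) :=
    Nat.mul_le_mul_right _ (by omega)
  have e2 : b * (10901 * (b * (b * D.unitCost b W))) =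
    10901 * (b * (b * (b * D.unitCost b W))) := by ring
  have e3 : b * D.unitCost b W ≤ b * (b * D.unitCost b W) := Nat.le_mul_of_pos_left _ hb1
  have e4 : b * (b * D.unitCost b W) ≤ b * (b * (b * D.unitCost b W)) :=
    Nat.le_mul_of_pos_left _ hb1
  omega

/-- The sum over all pairs of digits, up to an error `1 / 4` of the accuracy for each pair. -/
lemma err_sumPairs (hU : D.Unitary) (h : LoopReady D b W φ L E E' s) (hφ : D.HasFeature φ)
    (hov : ∀ e e', |D.overlap φ e e'| ≤ 1) :
    Err D s sumPairs (L * ((4 * L + L * (8 * L + 1)) * failProb (s.int 61).toNat)) fun t =>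
      |t.real 16 - ∑ u ∈ range L, ∑ k ∈ range L,
        pairTerm D φ (s.real 15) (E - u) (E' - k)| ≤ L * (L * (1 / (4 * s.real 20))) := by
  refine Err.det_seq (det_sumInit D h.machine.psi) (fun t ht => ht.2.2.2.1) fun t ht => ?_
  obtain ⟨h1, h2, h3, -, h4⟩ := ht
  have hr : LoopReady D b W φ L E E' t := h.of_keeps h1 (by decide)
  have s15 : t.real 15 = s.real 15 := h1.real 15
  have s20 : t.real 20 = s.real 20 := h1.real 20
  have s61 : t.int 61 = s.int 61 := h1.int 61
  have := err_rep hU (s := t) (i := 62) (p := outerBody)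
    (δ := (4 * L + L * (8 * L + 1)) * failProb (s.int 61).toNat)
    (mul_nonneg (by positivity) (failProb_nonneg _)) (OuterInv D b W φ L E E' t)
    (fun n v => |v.real 16 - ∑ u ∈ range n, ∑ k ∈ range L,
      pairTerm D φ (s.real 15) (E - u) (E' - k)| ≤ n * (L * (1 / (4 * s.real 20))))
    (outerInv_zero hr (by rw [h3, h.r6]))
    (fun k hk u hu => outerInv_step hU (by rw [hr.count_toNat] at hk; exact hk) hu)
    (by simp [State.tick, h2]) ?_
  · rwa [hr.count_toNat] at this
  intro k hk v hv hG
  rw [hr.count_toNat] at hk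
  obtain ⟨v1, vr, v3, v4⟩ := hv
  have hr' : LoopReady D b W φ L E E' (v.tick 1) :=
    vr.of_keeps (t := v.tick 1) (Keeps.refl (s := v) ∅ v1.1) (by decide)
  have e15 : v.real 15 = s.real 15 := (v1.real 15).trans s15
  have e20 : v.real 20 = s.real 20 := (v1.real 20).trans s20
  have e61 : v.int 61 = s.int 61 :=
    (v1.int 61).trans s61
  have := err_outerBody hU hr' hφ hov hk v3
  simp only [State.tick, e15, e20, e61] at this
  refine this.mono le_rfl (A := fun _ => True) (fun _ _ _ => trivial) fun w _ hw => ?_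
  rw [sum_range_succ]
  push_cast
  rw [add_mul, one_mul]
  refine le_trans (le_of_eq ?_) ((abs_add_le _ _).trans (add_le_add hG hw))
  congr 1; ring

end

/-! ### Binary expansions and the inner product -/

lemma two_zpow_le_of_binDigit {r : ℝ} {e : ℤ} (h : binDigit r e = true) : (2 : ℝ) ^ e ≤ |r| := by
  by_contra hlt
  push Not at hlt
  have h0 : ⌊|r| / 2 ^ e⌋ = 0 := by
    rw [Int.floor_eq_zero_iff]
    exact ⟨by positivity, (div_lt_one (by positivity)).2 hlt⟩
  simp [binDigit, h0] at h

lemma sum_binDigit (r : ℝ) {E : ℤ} (hE : |r| < 2 ^ (E + 1)) (L : ℕ) :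
    ∑ u ∈ range L, (if binDigit r (E - u) = true then (1 : ℝ) else 0) * 2 ^ (E - u) =
      ⌊|r| / 2 ^ (E + 1 - L)⌋ * 2 ^ (E + 1 - L) := by
  induction L with
  | zero =>
    have h0 : ⌊|r| / 2 ^ (E + 1)⌋ = 0 := by
      rw [Int.floor_eq_zero_iff]
      exact ⟨by positivity, (div_lt_one (by positivity)).2 hE⟩
    simp [h0]
  | succ L ih =>
    rw [sum_range_succ, ih]
    have e1 : E + 1 - ((L + 1 : ℕ) : ℤ) = E - L := by push_cast; ring
    have e2 : (2 : ℝ) ^ (E + 1 - (L : ℤ)) = 2 ^ (E - L) * 2 := by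
      rw [show E + 1 - (L : ℤ) = E - L + 1 by ring, zpow_add_one₀ (by norm_num)]
    have e3 : ⌊|r| / 2 ^ (E + 1 - (L : ℤ))⌋ = ⌊|r| / 2 ^ (E - (L : ℤ))⌋ / 2 := by
      rw [e2, ← div_div]
      exact_mod_cast Int.floor_div_natCast (|r| / 2 ^ (E - (L : ℤ))) 2
    rw [e1, e3, e2]
    set z := ⌊|r| / 2 ^ (E - (L : ℤ))⌋ with hz
    have hdig : binDigit r (E - L) = decide (z % 2 = 1) := rfl
    have hz2 : z = 2 * (z / 2) + z % 2 := by omega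
    have : (if binDigit r (E - L) = true then (1 : ℝ) else 0) = ((z % 2 : ℤ) : ℝ) := by
      rw [hdig]
      rcases Int.emod_two_eq_zero_or_one z with h | h <;> simp [h]
    rw [this]
    have hzr : (z : ℝ) = 2 * ((z / 2 : ℤ) : ℝ) + ((z % 2 : ℤ) : ℝ) := by exact_mod_cast hz2
    rw [hzr]; ring

/-- The stored number truncated to its digits of the weights `2 ^ (E - u)` with `u < L`. -/
noncomputable def Device.truncated (D : Device) (c : Bool) (E : ℤ) (L k : ℕ) : ℝ :=
  ∑ u ∈ range L, D.coef c (E - u) k * 2 ^ (E - u)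

lemma Device.coef_eq (D : Device) (c : Bool) (e : ℤ) (k : ℕ) : D.coef c e k =
    D.sgn c k * (if binDigit (D.num c k) e = true then (1 : ℝ) else 0) := by
  unfold Device.coef
  split_ifs <;> simp

lemma Device.sgn_mul_abs (D : Device) (c : Bool) (k : ℕ) : D.sgn c k * |D.num c k| = D.num c k := by
  unfold Device.sgn
  split_ifs with h
  · rw [abs_of_neg h]; ring
  · rw [abs_of_nonneg (not_lt.1 h)]; ring

lemma Device.abs_sgn (D : Device) (c : Bool) (k : ℕ) : |D.sgn c k| = 1 := by
  unfold Device.sgn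
  split_ifs <;> simp

lemma Device.truncated_eq (D : Device) (c : Bool) {E : ℤ} {k : ℕ} (h : |D.num c k| < 2 ^ (E + 1))
    (L : ℕ) : D.truncated c E L k =
      D.sgn c k * (⌊|D.num c k| / 2 ^ (E + 1 - L)⌋ * 2 ^ (E + 1 - L)) := by
  rw [← sum_binDigit _ h, mul_sum]
  unfold Device.truncated
  refine sum_congr rfl fun u _ => ?_
  rw [D.coef_eq, mul_assoc]

lemma Device.abs_truncated_le (D : Device) (c : Bool) {E : ℤ} {k : ℕ}
    (h : |D.num c k| < 2 ^ (E + 1)) (L : ℕ) : |D.truncated c E L k| ≤ |D.num c k| := by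
  have hp : (0 : ℝ) < 2 ^ (E + 1 - (L : ℤ)) := by positivity
  rw [D.truncated_eq c h, abs_mul, D.abs_sgn, one_mul, abs_of_nonneg]
  · rw [← le_div_iff₀ hp]; exact Int.floor_le _
  · exact mul_nonneg (by exact_mod_cast Int.floor_nonneg.2 (by positivity)) hp.le

lemma Device.abs_sub_truncated_le (D : Device) (c : Bool) {E : ℤ} {k : ℕ}
    (h : |D.num c k| < 2 ^ (E + 1)) (L : ℕ) :
    |D.num c k - D.truncated c E L k| ≤ 2 ^ (E + 1 - L) := by
  have hp : (0 : ℝ) < 2 ^ (E + 1 - (L : ℤ)) := by positivity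
  rw [D.truncated_eq c h]
  nth_rw 1 [← D.sgn_mul_abs c k]
  rw [← mul_sub, abs_mul, D.abs_sgn, one_mul]
  set p : ℝ := 2 ^ (E + 1 - (L : ℤ))
  set w := |D.num c k|
  have h1 := Int.floor_le (w / p)
  have h2 := Int.lt_floor_add_one (w / p)
  rw [le_div_iff₀ hp] at h1
  rw [div_lt_iff₀ hp] at h2
  rw [abs_le]
  constructor <;> nlinarith

lemma sum_sum_sum_comm (A B : Finset ℕ) (F : ℕ → ℕ → ℕ → ℕ → ℝ) :
    ∑ u ∈ A, ∑ u' ∈ A, ∑ k ∈ B, ∑ k' ∈ B, F u u' k k' =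
      ∑ k ∈ B, ∑ k' ∈ B, ∑ u ∈ A, ∑ u' ∈ A, F u u' k k' := by
  calc ∑ u ∈ A, ∑ u' ∈ A, ∑ k ∈ B, ∑ k' ∈ B, F u u' k k'
      = ∑ u ∈ A, ∑ k ∈ B, ∑ u' ∈ A, ∑ k' ∈ B, F u u' k k' :=
        sum_congr rfl fun _ _ => sum_comm
    _ = ∑ k ∈ B, ∑ u ∈ A, ∑ u' ∈ A, ∑ k' ∈ B, F u u' k k' := sum_comm
    _ = ∑ k ∈ B, ∑ u ∈ A, ∑ k' ∈ B, ∑ u' ∈ A, F u u' k k' :=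
        sum_congr rfl fun _ _ => sum_congr rfl fun _ _ => sum_comm
    _ = _ := sum_congr rfl fun _ _ => sum_comm

/-- The sum of the contributions of all pairs of digits belongs to the truncated numbers. -/
lemma sum_pairTerm (D : Device) (φ : Bits D.n → Feature D.N) (v : ℝ) (E E' : ℤ) (L : ℕ) :
    ∑ u ∈ range L, ∑ u' ∈ range L, pairTerm D φ v (E - u) (E' - u') =
      v / (2 ^ D.addrLen) ^ 2 * ∑ k ∈ range (2 ^ D.addrLen),
        ∑ k' ∈ range (2 ^ D.addrLen), D.truncated false E L k * D.truncated true E' L k' *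
          inner ℝ (φ (D.word k)) (φ (D.word k')) := by
  have h1 : ∀ u u' : ℕ, pairTerm D φ v (E - u) (E' - u') = ∑ k ∈ range (2 ^ D.addrLen),
      ∑ k' ∈ range (2 ^ D.addrLen), v / (2 ^ D.addrLen) ^ 2 *
        (((D.coef false (E - u) k * 2 ^ (E - u)) * (D.coef true (E' - u') k' * 2 ^ (E' - u'))) *
          inner ℝ (φ (D.word k)) (φ (D.word k'))) := by
    intro u u'
    unfold pairTerm pairWeight Device.overlap
    rw [zpow_add₀ (by norm_num), mul_div_assoc', mul_sum, sum_div]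
    refine sum_congr rfl fun k _ => ?_
    rw [mul_sum, sum_div]
    refine sum_congr rfl fun k' _ => ?_
    ring
  simp only [h1]
  rw [sum_sum_sum_comm, mul_sum]
  refine sum_congr rfl fun k _ => ?_
  rw [mul_sum]
  refine sum_congr rfl fun k' _ => ?_
  unfold Device.truncated
  rw [sum_mul_sum]
  simp only [← mul_sum, ← sum_mul]

lemma Device.num_eq_zero (D : Device) (c : Bool) {k : ℕ} (h : D.m ≤ k) : D.num c k = 0 := by
  unfold Device.num
  rw [dif_neg (by omega)]

lemma sum_range_of_le {a b : ℕ} (hab : a ≤ b) {f : ℕ → ℝ} (hf : ∀ k, a ≤ k → f k = 0) :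
    ∑ k ∈ range b, f k = ∑ k ∈ range a, f k :=
  (sum_subset (Finset.range_mono hab) fun k _ hk => hf k (by simpa using hk)).symm

lemma Device.le_two_pow (D : Device) : D.m ≤ 2 ^ D.addrLen := Nat.le_pow_clog (by norm_num) _

lemma Device.two_pow_le (D : Device) (hm : 0 < D.m) : 2 ^ D.addrLen ≤ 2 * D.m := by
  unfold Device.addrLen
  rcases Nat.lt_or_ge 1 D.m with h | h
  · have := Nat.pow_pred_clog_lt_self (b := 2) (by norm_num) h
    have h2 : 0 < Nat.clog 2 D.m := Nat.clog_pos (by norm_num) h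
    have : 2 ^ Nat.clog 2 D.m = 2 * 2 ^ (Nat.clog 2 D.m).pred := by
      rw [← pow_succ']; congr 1
      exact (Nat.succ_pred_eq_of_pos h2).symm
    omega
  · rw [Nat.clog_of_right_le_one h]; omega

lemma abs_inner_le_one {N : ℕ} {a b : Feature N} (ha : ‖a‖ = 1) (hb : ‖b‖ = 1) :
    |(inner ℝ a b : ℝ)| ≤ 1 := by
  have := abs_real_inner_le_norm a b
  rwa [ha, hb, one_mul] at this

/-- The error caused by the truncation of the stored numbers. -/
lemma abs_sum_truncated_sub_le (D : Device) {φ : Bits D.n → Feature D.N} (hφ : ∀ x, ‖φ x‖ = 1)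
    {η η' : ℝ} (hη : ∀ k, |D.num false k| ≤ η) (hη' : ∀ k, |D.num true k| ≤ η') {E E' : ℤ}
    (hE : 2 ^ E ≤ η) (hE' : 2 ^ E' ≤ η') (hEη : η < 2 ^ (E + 1)) (hEη' : η' < 2 ^ (E' + 1))
    (L : ℕ) :
    |∑ k ∈ range (2 ^ D.addrLen), ∑ k' ∈ range (2 ^ D.addrLen),
        D.truncated false E L k * D.truncated true E' L k' *
          inner ℝ (φ (D.word k)) (φ (D.word k')) -
      ∑ k ∈ range D.m, ∑ k' ∈ range D.m, D.num false k * D.num true k' *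
          inner ℝ (φ (D.word k)) (φ (D.word k'))| ≤ D.m ^ 2 * (4 * (η * η') / 2 ^ L) := by
  have b1 : ∀ k, |D.num false k| < 2 ^ (E + 1) := fun k => (hη k).trans_lt hEη
  have b2 : ∀ k, |D.num true k| < 2 ^ (E' + 1) := fun k => (hη' k).trans_lt hEη'
  have z1 : ∀ k, D.m ≤ k → D.truncated false E L k = 0 := fun k hk => by
    have := D.abs_truncated_le false (b1 k) L
    rw [D.num_eq_zero false hk, abs_zero] at this
    exact abs_nonpos_iff.1 this
  have z2 : ∀ k, D.m ≤ k → D.truncated true E' L k = 0 := fun k hk => by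
    have := D.abs_truncated_le true (b2 k) L
    rw [D.num_eq_zero true hk, abs_zero] at this
    exact abs_nonpos_iff.1 this
  have η0 : 0 ≤ η := (abs_nonneg _).trans (hη 0)
  have η0' : 0 ≤ η' := (abs_nonneg _).trans (hη' 0)
  have p1 : ∀ {E : ℤ} {η : ℝ}, (2 : ℝ) ^ E ≤ η → (2 : ℝ) ^ (E + 1 - (L : ℤ)) ≤ 2 * η / 2 ^ L := by
    intro E η h
    rw [zpow_sub₀ (by norm_num), zpow_add_one₀ (by norm_num), zpow_natCast]
    exact div_le_div_of_nonneg_right (by linarith) (by positivity)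
  rw [sum_range_of_le D.le_two_pow (fun k hk => by simp [z1 k hk])]
  rw [← sum_sub_distrib]
  refine (abs_sum_le_sum_abs _ _).trans ?_
  have key : ∀ k ∈ range D.m, |∑ k' ∈ range (2 ^ D.addrLen),
        D.truncated false E L k * D.truncated true E' L k' *
          inner ℝ (φ (D.word k)) (φ (D.word k')) -
      ∑ k' ∈ range D.m, D.num false k * D.num true k' *
          inner ℝ (φ (D.word k)) (φ (D.word k'))| ≤ D.m * (4 * (η * η') / 2 ^ L) := by
    intro k _
    rw [sum_range_of_le D.le_two_pow (fun k' hk => by simp [z2 k' hk]), ← sum_sub_distrib]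
    refine (abs_sum_le_sum_abs _ _).trans ?_
    refine (sum_le_card_nsmul _ _ (4 * (η * η') / 2 ^ L) fun k' _ => ?_).trans_eq (by simp)
    rw [← sub_mul, abs_mul]
    have h1 : |D.truncated false E L k - D.num false k| ≤ 2 * η / 2 ^ L := by
      rw [abs_sub_comm]; exact (D.abs_sub_truncated_le false (b1 k) L).trans (p1 hE)
    have h2 : |D.truncated true E' L k' - D.num true k'| ≤ 2 * η' / 2 ^ L := by
      rw [abs_sub_comm]; exact (D.abs_sub_truncated_le true (b2 k') L).trans (p1 hE')
    have h3 : D.truncated false E L k * D.truncated true E' L k' - D.num false k * D.num true k' =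
      (D.truncated false E L k - D.num false k) * D.truncated true E' L k' +
        D.num false k * (D.truncated true E' L k' - D.num true k') := by ring
    calc |D.truncated false E L k * D.truncated true E' L k' - D.num false k * D.num true k'| *
          |inner ℝ (φ (D.word k)) (φ (D.word k'))|
        ≤ |D.truncated false E L k * D.truncated true E' L k' - D.num false k * D.num true k'| * 1 :=
          mul_le_mul_of_nonneg_left (abs_inner_le_one (hφ _) (hφ _)) (abs_nonneg _)
      _ ≤ 2 * η / 2 ^ L * η' + η * (2 * η' / 2 ^ L) := by
          rw [mul_one, h3]
          refine (abs_add_le _ _).trans (add_le_add ?_ ?_)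
          · rw [abs_mul]
            exact mul_le_mul h1 ((D.abs_truncated_le true (b2 k') L).trans (hη' k')) (abs_nonneg _)
              (by positivity)
          · rw [abs_mul]
            exact mul_le_mul (hη k) h2 (abs_nonneg _) η0
      _ = 4 * (η * η') / 2 ^ L := by ring
  refine (sum_le_card_nsmul _ _ _ key).trans_eq ?_
  rw [card_range, nsmul_eq_mul]; ring

/-! ### The size of the contributions -/

lemma abs_coef_eq (D : Device) (c : Bool) (e : ℤ) (k : ℕ) :
    |D.coef c e k| = if binDigit (D.num c k) e = true then (1 : ℝ) else 0 := by
  rw [D.coef_eq, abs_mul, D.abs_sgn]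
  split_ifs <;> simp

lemma abs_overlap_le (D : Device) {φ : Bits D.n → Feature D.N} (hφ : ∀ x, ‖φ x‖ = 1) (e e' : ℤ) :
    |D.overlap φ e e'| ≤ D.digitProb false e * D.digitProb true e' := by
  unfold Device.overlap Device.digitProb
  rw [abs_div, abs_of_nonneg (a := ((2 : ℝ) ^ D.addrLen) ^ 2) (by positivity), div_mul_div_comm,
    ← sq, sum_mul_sum]
  refine div_le_div_of_nonneg_right ?_ (by positivity)
  refine (abs_sum_le_sum_abs _ _).trans (sum_le_sum fun k _ => ?_)
  refine (abs_sum_le_sum_abs _ _).trans (sum_le_sum fun k' _ => ?_)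
  rw [abs_mul, abs_mul, abs_coef_eq, abs_coef_eq]
  refine mul_le_of_le_one_right (by positivity) (abs_inner_le_one (hφ _) (hφ _))

lemma digitProb_nonneg (D : Device) (c : Bool) (e : ℤ) : 0 ≤ D.digitProb c e := by
  unfold Device.digitProb
  positivity

lemma digitProb_le_one (D : Device) (c : Bool) (e : ℤ) : D.digitProb c e ≤ 1 := by
  unfold Device.digitProb
  rw [div_le_one (by positivity)]
  refine (sum_le_card_nsmul _ _ 1 fun k _ => by split_ifs <;> norm_num).trans_eq ?_
  simp

lemma abs_overlap_le_one (D : Device) {φ : Bits D.n → Feature D.N} (hφ : ∀ x, ‖φ x‖ = 1)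
    (e e' : ℤ) : |D.overlap φ e e'| ≤ 1 :=
  (abs_overlap_le D hφ e e').trans
    (mul_le_one₀ (digitProb_le_one _ _ _) (digitProb_nonneg _ _ _) (digitProb_le_one _ _ _))

/-- A digit that is set somewhere is bounded by the stored numbers. -/
lemma two_zpow_le_of_digitProb {c : Bool} {e : ℤ} (h : D.digitProb c e ≠ 0) {B : ℝ}
    (hB : ∀ k, |D.num c k| ≤ B) : (2 : ℝ) ^ e ≤ B := by
  by_contra hlt
  push Not at hlt
  refine h ?_
  unfold Device.digitProb
  rw [sum_eq_zero, zero_div]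
  intro k _
  rw [if_neg]
  exact fun hd => (hlt.trans_le (two_zpow_le_of_binDigit hd)).not_ge (hB k)

/-- Rare digits contribute little to the sum of the squares of the stored numbers. -/
lemma digitProb_mul_le {c : Bool} (e : ℤ) {η : ℝ}
    (h : ∑ k ∈ range (2 ^ D.addrLen), D.num c k ^ 2 ≤ η ^ 2) :
    D.digitProb c e * (2 ^ D.addrLen * (2 ^ e) ^ 2) ≤ η ^ 2 := by
  refine le_trans ?_ h
  unfold Device.digitProb
  rw [← mul_assoc, div_mul_cancel₀ _ (by positivity), sum_mul]
  refine sum_le_sum fun k _ => ?_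
  split_ifs with hd
  · rw [one_mul, ← sq_abs (D.num c k)]
    exact pow_le_pow_left₀ (by positivity) (two_zpow_le_of_binDigit hd) 2
  · rw [zero_mul]; positivity

/-- The contribution of a pair with a rare digit is small. -/
lemma abs_pairTerm_le {φ : Bits D.n → Feature D.N} (hφ : ∀ x, ‖φ x‖ = 1)
    (hm : 0 < D.m) {η η' q : ℝ} (hη0 : 0 ≤ η) (hη0' : 0 ≤ η') (hq : 0 < q)
    (h : ∑ k ∈ range (2 ^ D.addrLen), D.num false k ^ 2 ≤ η ^ 2)
    (h' : ∑ k ∈ range (2 ^ D.addrLen), D.num true k ^ 2 ≤ η' ^ 2) {e e' : ℤ}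
    (hp : D.digitProb false e < 1 / q ^ 2 ∨ D.digitProb true e' < 1 / q ^ 2) :
    |pairTerm D φ ((2 ^ D.addrLen) ^ 2 / D.m) e e'| ≤ 2 * (η * η') / q := by
  have hm' : (0 : ℝ) < D.m := by exact_mod_cast hm
  set M : ℝ := 2 ^ D.addrLen with hM
  have hM0 : 0 < M := by positivity
  have hM2 : M ≤ 2 * D.m := by rw [hM]; exact_mod_cast D.two_pow_le hm
  set p := D.digitProb false e with hpd
  set p' := D.digitProb true e' with hpd'
  have p0 : 0 ≤ p := digitProb_nonneg _ _ _
  have p0' : 0 ≤ p' := digitProb_nonneg _ _ _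
  have p1 : p ≤ 1 := digitProb_le_one _ _ _
  have p1' : p' ≤ 1 := digitProb_le_one _ _ _
  have hpp : p * p' ≤ 1 / q ^ 2 := by
    rcases hp with hp | hp
    · exact (mul_le_of_le_one_right p0 p1').trans hp.le
    · exact (mul_le_of_le_one_left p0' p1).trans hp.le
  have h1 : p * (M * (2 ^ e) ^ 2) ≤ η ^ 2 := digitProb_mul_le e h
  have h2 : p' * (M * (2 ^ e') ^ 2) ≤ η' ^ 2 := digitProb_mul_le e' h'
  have hstep : |pairTerm D φ (M ^ 2 / D.m) e e'| ≤ 2 ^ (e + e') * (M ^ 2 / D.m) * (p * p') := by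
    unfold pairTerm pairWeight
    rw [abs_mul, abs_of_nonneg (a := (2 : ℝ) ^ (e + e') * (M ^ 2 / D.m)) (by positivity)]
    exact mul_le_mul_of_nonneg_left (abs_overlap_le D hφ e e') (by positivity)
  refine hstep.trans ?_
  rw [zpow_add₀ (by norm_num)]
  set a : ℝ := 2 ^ e
  set a' : ℝ := 2 ^ e'
  have ha : 0 ≤ a := by positivity
  have ha' : 0 ≤ a' := by positivity
  have h3 : (a * a' * M * (p * p')) ^ 2 ≤ (η * η' / q) ^ 2 := by
    calc (a * a' * M * (p * p')) ^ 2
        = (p * (M * a ^ 2)) * (p' * (M * a' ^ 2)) * (p * p') := by ring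
      _ ≤ η ^ 2 * η' ^ 2 * (1 / q ^ 2) := by gcongr
      _ = (η * η' / q) ^ 2 := by field_simp
  have h4 : a * a' * M * (p * p') ≤ η * η' / q := le_of_sq_le_sq h3 (by positivity)
  have h5 : M / D.m ≤ 2 := by rw [div_le_iff₀ hm']; exact hM2
  calc a * a' * (M ^ 2 / D.m) * (p * p') = (M / D.m) * (a * a' * M * (p * p')) := by ring
    _ ≤ 2 * (η * η' / q) := mul_le_mul h5 h4 (by positivity) (by norm_num)
    _ = 2 * (η * η') / q := by ring

/-! ### The inner product estimation problem -/

lemma inner_smul_sum {m N : ℕ} (a : ℝ) (v v' : Fin m → ℝ) (f : Fin m → Feature N) :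
    (inner ℝ (a • ∑ i, v i • f i) (a • ∑ i, v' i • f i) : ℝ) =
      a ^ 2 * ∑ i, ∑ j, v i * v' j * inner ℝ (f i) (f j) := by
  rw [real_inner_smul_left, real_inner_smul_right, sum_inner, ← mul_assoc, ← sq]
  congr 1
  refine sum_congr rfl fun i _ => ?_
  rw [inner_sum]
  refine sum_congr rfl fun j _ => ?_
  rw [real_inner_smul_left, real_inner_smul_right]
  ring

section

variable {m n N T : ℕ} {x : Fin m → Bits n} {y : Fin m → ℝ} {Φ : Bits n → Feature N}
  {U : Matrix (Bits n × Bits N) (Bits n × Bits N) ℂ} {c c' : Fin m → Bool}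

/-- The unit vectors `|Φ(x)⟩`. -/
noncomputable def unitFeature (Φ : Bits n → Feature N) (x : Bits n) : Feature N :=
  ‖Φ x‖⁻¹ • Φ x

lemma ne_zero_of_isQuantumFeatureMap (h : IsQuantumFeatureMap U Φ) (x : Bits n) : Φ x ≠ 0 := by
  intro h0
  have hcol : ∀ z, U z (x, fun _ => false) = 0 := by
    rintro ⟨x', j⟩
    rw [h.2, h0]
    simp
  have h1 := congrFun (congrFun (Matrix.mem_unitaryGroup_iff'.1 h.1) (x, fun _ => false))
    (x, fun _ => false)
  rw [Matrix.mul_apply, Matrix.one_apply_eq, sum_eq_zero] at h1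
  · exact zero_ne_one h1
  · intro z _
    rw [hcol, mul_zero]

lemma norm_unitFeature (h : IsQuantumFeatureMap U Φ) (x : Bits n) : ‖unitFeature Φ x‖ = 1 := by
  have := norm_ne_zero_iff.2 (ne_zero_of_isQuantumFeatureMap h x)
  rw [unitFeature, norm_smul, norm_inv, norm_norm, inv_mul_cancel₀ this]

lemma hasFeature_problemDevice (h : IsQuantumFeatureMap U Φ) :
    (problemDevice T x y Φ U c c').HasFeature (unitFeature Φ) := by
  have key : ∀ (x : Bits n) (j : Bits N), unitFeature Φ x j = Φ x j / ‖Φ x‖ := fun x j => by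
    rw [unitFeature, PiLp.smul_apply, smul_eq_mul, inv_mul_eq_div]
  have key' : ∀ (x x' : Bits n) (j : Bits N), U (x', j) (x, fun _ => false) =
      if x' = x then ((unitFeature Φ x j : ℝ) : ℂ) else 0 := fun x x' j => by rw [h.2, key]
  exact key'

lemma unitary_problemDevice (h : IsQuantumFeatureMap U Φ) :
    (problemDevice T x y Φ U c c').Unitary := h.1

/-- The coefficients of the problem: `c` for the first list and `c'` for the second. -/
def chooseCoeff (c c' : Fin m → Bool) (b : Bool) : Fin m → Bool := if b then c' else c

lemma num_problemDevice (b : Bool) (i : Fin m) : (problemDevice T x y Φ U c c').num b i =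
    weight x y Φ (chooseCoeff c c' b) i := by
  unfold Device.num
  rw [dif_pos (show (i : ℕ) < (problemDevice T x y Φ U c c').m from i.2)]
  cases b <;> rfl

lemma word_problemDevice (i : Fin m) : (problemDevice T x y Φ U c c').word i = x i := by
  unfold Device.word
  rw [dif_pos (show (i : ℕ) < (problemDevice T x y Φ U c c').m from i.2)]
  rfl

lemma weight_smul_unitFeature (h : IsQuantumFeatureMap U Φ) (i : Fin m) :
    weight x y Φ c i • unitFeature Φ (x i) = (√(m : ℝ))⁻¹ • ((bit01 (c i) * y i) • Φ (x i)) := by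
  have := norm_ne_zero_iff.2 (ne_zero_of_isQuantumFeatureMap h (x i))
  rw [weight, unitFeature, smul_smul, smul_smul]
  congr 1
  field_simp

lemma Psi_eq (h : IsQuantumFeatureMap U Φ) (c : Fin m → Bool) :
    Psi x y Φ c = (√(m : ℝ))⁻¹ • ∑ i, weight x y Φ c i • unitFeature Φ (x i) := by
  simp only [weight_smul_unitFeature h]
  rw [← smul_sum, smul_smul, Psi]
  congr 1
  rw [← mul_inv, mul_self_sqrt (Nat.cast_nonneg m), one_div]

/-- The inner product in terms of the stored numbers. -/
lemma inner_Psi_eq (h : IsQuantumFeatureMap U Φ) :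
    (inner ℝ (Psi x y Φ c) (Psi x y Φ c') : ℝ) = 1 / m *
      ∑ k ∈ range (problemDevice T x y Φ U c c').m,
        ∑ k' ∈ range (problemDevice T x y Φ U c c').m,
          (problemDevice T x y Φ U c c').num false k * (problemDevice T x y Φ U c c').num true k' *
          inner ℝ (unitFeature Φ ((problemDevice T x y Φ U c c').word k))
            (unitFeature Φ ((problemDevice T x y Φ U c c').word k')) := by
  rw [Psi_eq h, Psi_eq h, inner_smul_sum, inv_pow, sq_sqrt (Nat.cast_nonneg m), one_div]
  congr 1
  change _ = ∑ k ∈ range m, ∑ k' ∈ range m, _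
  rw [sum_range]
  refine sum_congr rfl fun i _ => ?_
  rw [sum_range]
  refine sum_congr rfl fun j _ => ?_
  rw [num_problemDevice, num_problemDevice, word_problemDevice, word_problemDevice]
  rfl

lemma sq_weight (hy : ∀ i, y i = 1 ∨ y i = -1) (i : Fin m) :
    weight x y Φ c i ^ 2 = bit01 (c i) * ‖Φ (x i)‖ ^ 2 / m := by
  have hy2 : y i ^ 2 = 1 := by rcases hy i with h | h <;> rw [h] <;> norm_num
  have hb : bit01 (c i) ^ 2 = bit01 (c i) := by unfold bit01; split_ifs <;> norm_num
  rw [weight, mul_pow, div_pow, mul_pow, hy2, hb, sq_sqrt (Nat.cast_nonneg m)]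
  ring

lemma sq_eta : eta x Φ c ^ 2 = (∑ i, bit01 (c i) * ‖Φ (x i)‖ ^ 2) / m := by
  unfold eta
  rw [sq_sqrt]
  refine div_nonneg (sum_nonneg fun i _ => mul_nonneg ?_ (sq_nonneg _)) (Nat.cast_nonneg _)
  unfold bit01; split_ifs <;> norm_num

lemma sum_sq_num (hy : ∀ i, y i = 1 ∨ y i = -1) (b : Bool) :
    ∑ k ∈ range (2 ^ (problemDevice T x y Φ U c c').addrLen),
      (problemDevice T x y Φ U c c').num b k ^ 2 = eta x Φ (chooseCoeff c c' b) ^ 2 := by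
  rw [sum_range_of_le (Device.le_two_pow _) fun k hk => by rw [Device.num_eq_zero _ _ hk]; norm_num]
  change ∑ k ∈ range m, _ = _
  rw [sum_range, sq_eta, sum_div]
  refine sum_congr rfl fun i _ => ?_
  rw [num_problemDevice, sq_weight hy]

lemma eta_nonneg : 0 ≤ eta x Φ c := sqrt_nonneg _

lemma abs_num_le_eta (hy : ∀ i, y i = 1 ∨ y i = -1) (b : Bool) (k : ℕ) :
    |(problemDevice T x y Φ U c c').num b k| ≤ eta x Φ (chooseCoeff c c' b) := by
  by_cases hk : (problemDevice T x y Φ U c c').m ≤ k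
  · rw [Device.num_eq_zero _ _ hk, abs_zero]; exact eta_nonneg
  · refine abs_le_of_sq_le_sq ?_ eta_nonneg
    rw [← sum_sq_num (T := T) (U := U) hy b]
    refine single_le_sum (f := fun k => (problemDevice T x y Φ U c c').num b k ^ 2)
      (fun _ _ => sq_nonneg _) (mem_range.2 ?_)
    exact (not_le.1 hk).trans_le (Device.le_two_pow _)

lemma norm_le_maxNorm (i : Fin m) : ‖Φ (x i)‖ ≤ maxNorm x Φ :=
  le_ciSup (f := fun i => ‖Φ (x i)‖) (Set.finite_range _).bddAbove i

lemma maxNorm_nonneg : 0 ≤ maxNorm x Φ := iSup_nonneg fun _ => norm_nonneg _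

lemma abs_num_le_maxNorm (hy : ∀ i, y i = 1 ∨ y i = -1) (b : Bool) (k : ℕ) :
    |(problemDevice T x y Φ U c c').num b k| ≤ maxNorm x Φ / √(m : ℝ) := by
  by_cases hk : k < m
  · have h0 : 0 ≤ maxNorm x Φ / √(m : ℝ) := div_nonneg maxNorm_nonneg (sqrt_nonneg _)
    refine abs_le_of_sq_le_sq ?_ h0
    rw [num_problemDevice b ⟨k, hk⟩, sq_weight hy, div_pow, sq_sqrt (Nat.cast_nonneg m)]
    refine div_le_div_of_nonneg_right ?_ (Nat.cast_nonneg m)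
    have h1 : bit01 (chooseCoeff c c' b ⟨k, hk⟩) ≤ 1 := by unfold bit01; split_ifs <;> norm_num
    exact (mul_le_of_le_one_left (sq_nonneg _) h1).trans
      (pow_le_pow_left₀ (norm_nonneg _) (norm_le_maxNorm _) 2)
  · rw [Device.num_eq_zero _ _ (not_lt.1 hk), abs_zero]
    exact div_nonneg maxNorm_nonneg (sqrt_nonneg _)

lemma pos_of_Psi_ne_zero (h : Psi x y Φ c ≠ 0) : 0 < m := by
  rcases Nat.eq_zero_or_pos m with rfl | h0
  · exact absurd (by simp [Psi]) h
  · exact h0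

lemma eta_le_maxNorm (hm : 0 < m) : eta x Φ c ≤ maxNorm x Φ := by
  have hm' : (0 : ℝ) < m := by exact_mod_cast hm
  refine le_of_sq_le_sq ?_ maxNorm_nonneg
  rw [sq_eta, div_le_iff₀ hm']
  refine (sum_le_card_nsmul _ _ (maxNorm x Φ ^ 2) fun i _ => ?_).trans_eq ?_
  · have h1 : bit01 (c i) ≤ 1 := by unfold bit01; split_ifs <;> norm_num
    exact (mul_le_of_le_one_left (sq_nonneg _) h1).trans
      (pow_le_pow_left₀ (norm_nonneg _) (norm_le_maxNorm _) 2)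
  · rw [card_univ, Fintype.card_fin, nsmul_eq_mul, mul_comm]

/-- The norm of `Ψ_c` is at most `η_c`, by the inequality between the means. -/
lemma norm_Psi_le_eta (hy : ∀ i, y i = 1 ∨ y i = -1) (hm : 0 < m) :
    ‖Psi x y Φ c‖ ≤ eta x Φ c := by
  have hm' : (0 : ℝ) < m := by exact_mod_cast hm
  refine le_of_sq_le_sq ?_ eta_nonneg
  have h1 : ‖Psi x y Φ c‖ ≤ 1 / m * ∑ i, bit01 (c i) * ‖Φ (x i)‖ := by
    rw [Psi, norm_smul, norm_of_nonneg (by positivity)]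
    refine mul_le_mul_of_nonneg_left ((norm_sum_le _ _).trans (sum_le_sum fun i _ => ?_))
      (by positivity)
    rw [norm_smul, norm_mul]
    have h2 : ‖y i‖ = 1 := by rcases hy i with h | h <;> rw [h] <;> simp
    have h3 : ‖bit01 (c i)‖ = bit01 (c i) :=
      norm_of_nonneg (by unfold bit01; split_ifs <;> norm_num)
    rw [h2, h3, mul_one]
  have h2 : (∑ i, bit01 (c i) * ‖Φ (x i)‖) ^ 2 ≤ m * ∑ i, bit01 (c i) * ‖Φ (x i)‖ ^ 2 := by
    have := sq_sum_le_card_mul_sum_sq (s := univ) (f := fun i => bit01 (c i) * ‖Φ (x i)‖)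
    rw [card_univ, Fintype.card_fin] at this
    refine this.trans_eq ?_
    congr 1
    refine sum_congr rfl fun i _ => ?_
    have hb : bit01 (c i) ^ 2 = bit01 (c i) := by unfold bit01; split_ifs <;> norm_num
    rw [mul_pow, hb]
  calc ‖Psi x y Φ c‖ ^ 2 ≤ (1 / m * ∑ i, bit01 (c i) * ‖Φ (x i)‖) ^ 2 :=
        pow_le_pow_left₀ (norm_nonneg _) h1 2
    _ = (∑ i, bit01 (c i) * ‖Φ (x i)‖) ^ 2 / m ^ 2 := by ring
    _ ≤ m * (∑ i, bit01 (c i) * ‖Φ (x i)‖ ^ 2) / m ^ 2 :=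
        div_le_div_of_nonneg_right h2 (by positivity)
    _ = eta x Φ c ^ 2 := by rw [sq_eta]; field_simp

end

/-! ### The initial part of the program -/

/-- The variables outside of the scratch space have the values `ι` and `ρ`, the integers among them
have at most `b` bits, the memory is in its initial state, and the time used is at most `τ`. -/
def At (b : ℕ) (ι : ℕ → ℤ) (ρ : ℕ → ℝ) (τ : ℕ) (s : State) : Prop :=
  (∀ j, (j < 50 ∨ 61 ≤ j) → s.int j = ι j ∧ intCost (ι j) ≤ b) ∧
    (∀ q < 50, s.real q = ρ q) ∧ s.psi = ket ∅ ∧ s.time ≤ τ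

/-- Assign the integer part of an expression to an integer variable and to a real variable. -/
def floorTo (i r : ℕ) (e : RExp) : Prog := .seq (assignFloor i e) (.cast r i)

section

variable {b τ : ℕ} {ι : ℕ → ℤ} {ρ : ℕ → ℝ} {s : State}

lemma At.mono (h : At b ι ρ τ s) {τ' : ℕ} (hτ : τ ≤ τ') : At b ι ρ τ' s :=
  ⟨h.1, h.2.1, h.2.2.1, h.2.2.2.trans hτ⟩

lemma At.assign (h : At b ι ρ τ s) {r : ℕ} (hr : r < 50) {e : RExp} (he : e.Low) {v : ℝ}
    (hv : e.eval ρ = v) :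
    Det D s (assign r e) (At b ι (update ρ r v) (τ + (e.cost + 3))) := by
  obtain ⟨h1, h2, h3, h4⟩ := h
  refine (det_assign D hr he s).mono fun t ht => ?_
  obtain ⟨t1, t2, t3, t4⟩ := ht
  refine ⟨fun j hj => ?_, fun q hq => ?_, t3.trans h3, by omega⟩
  · rw [t2 j (by omega)]; exact h1 j hj
  · rw [t1 q hq, RExp.eval_congr he h2, hv, h2 q hq, update_apply]

lemma At.cast (h : At b ι ρ τ s) {r i : ℕ} (hi : i < 50 ∨ 61 ≤ i) :
    Det D s (.cast r i) (At b ι (update ρ r (ι i)) (τ + b)) := by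
  obtain ⟨h1, h2, h3, h4⟩ := h
  obtain ⟨e1, e2⟩ := h1 i hi
  refine ⟨_, rfl, fun j hj => h1 j hj, fun q hq => ?_, h3, ?_⟩
  · simp only [State.tick, State.putReal, update_apply, e1, h2 q hq]
  · simp only [State.tick, State.putReal, e1]; omega

lemma At.floorTo (h : At b ι ρ τ s) {i r : ℕ} (hi : i < 50 ∨ 61 ≤ i) {e : RExp} (he : e.Low)
    {z : ℤ} (hz : ⌊e.eval ρ⌋ = z) (hb : intCost z ≤ b) :
    Det D s (floorTo i r e) (At b (update ι i z) (update ρ r z)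
      (τ + (e.cost + 2 * b))) := by
  have hfl : Det D s (assignFloor i e) (At b (update ι i z) ρ (τ + (e.cost + b))) := by
    obtain ⟨h1, h2, h3, h4⟩ := h
    refine (det_assignFloor D i he s).mono fun t ht => ?_
    rw [RExp.eval_congr he h2, hz] at ht
    obtain ⟨t1, t2, t3, t4⟩ := ht
    refine ⟨fun j hj => ?_, fun q hq => (t1 q hq).trans (h2 q hq), t3.trans h3, by omega⟩
    rw [t2 j (by omega), update_apply]
    split_ifs
    · exact ⟨rfl, hb⟩
    · exact h1 j hj
  refine hfl.seq fun t ht => (ht.cast hi).mono fun u hu => ?_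
  rw [update_self] at hu
  exact hu.mono (by omega)

lemma At.putInt {t : ℕ} (h : At b ι ρ τ s) (i : ℕ) {z : ℤ} (hb : intCost z ≤ b) {k : ℕ}
    (ht : t ≤ k) : At b (update ι i z) ρ (τ + k) ((s.putInt i z).tick t) := by
  obtain ⟨h1, h2, h3, h4⟩ := h
  refine ⟨fun j hj => ?_, h2, h3, ?_⟩
  · simp only [State.tick, State.putInt, update_apply]
    split_ifs
    · exact ⟨rfl, hb⟩
    · exact h1 j hj
  · simp only [State.tick, State.putInt]; omega

lemma At.setInt (h : At b ι ρ τ s) (i : ℕ) {z : ℤ} (hb : intCost z ≤ b) :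
    Det D s (.setInt i z) (At b (update ι i z) ρ (τ + b)) :=
  ⟨_, rfl, h.putInt i hb hb⟩

lemma At.addInt (h : At b ι ρ τ s) (i : ℕ) {j k : ℕ} (hj : j < 50) (hk : k < 50) {z : ℤ}
    (hz : ι j + ι k = z) (hb : intCost z ≤ b) :
    Det D s (.addInt i j k) (At b (update ι i z) ρ (τ + 2 * b)) := by
  have e1 := h.1 j (Or.inl hj)
  have e2 := h.1 k (Or.inl hk)
  refine ⟨_, rfl, ?_⟩
  rw [e1.1, e2.1, hz]
  exact h.putInt i hb (by omega)

lemma At.subInt (h : At b ι ρ τ s) (i : ℕ) {j k : ℕ} (hj : j < 50) (hk : k < 50) {z : ℤ}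
    (hz : ι j - ι k = z) (hb : intCost z ≤ b) :
    Det D s (.subInt i j k) (At b (update ι i z) ρ (τ + 2 * b)) := by
  have e1 := h.1 j (Or.inl hj)
  have e2 := h.1 k (Or.inl hk)
  refine ⟨_, rfl, ?_⟩
  rw [e1.1, e2.1, hz]
  exact h.putInt i hb (by omega)

end

/-- Compute the numbers of the qubits, where the integer variable `30` holds the opposite of the
length of an address. -/
def layoutInit : Prog :=
  .seq (.setInt 11 1) (.seq (.setInt 12 2) (.seq (.setInt 13 3) (.seq (.setInt 14 4)
    (.seq (.setInt 17 5) (.seq (.setInt 32 6) (.seq (.subInt 24 31 30) (.seq (.addInt 25 24 11)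
    (.seq (.addInt 18 32 24) (.seq (.addInt 19 18 25) (.seq (.addInt 20 19 1)
    (.seq (.addInt 21 20 2) (.seq (.addInt 22 21 11) (.addInt 23 21 21)))))))))))))

lemma det_layoutInit {b τ : ℕ} {ι : ℕ → ℤ} {ρ : ℕ → ℝ} {s : State}
    (h : At b ι ρ τ s) (h1 : ι 1 = D.n) (h2 : ι 2 = D.N) (h10 : ι 10 = 0)
    (h30 : ι 30 = -(D.addrLen : ℤ)) (h31 : ι 31 = 0)
    (hb : ∀ z : ℤ, z.natAbs ≤ 2 * D.qubits → intCost z ≤ b) :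
    Det D s layoutInit fun t => ∃ ι', At b ι' ρ (τ + 22 * b) t ∧ Layout D ι' := by
  have hq : D.qubits = 7 + 2 * D.addrLen + D.n + D.N := rfl
  refine (h.setInt 11 (hb 1 (by omega))).seq fun s h => ?_
  refine (h.setInt 12 (hb 2 (by omega))).seq fun s h => ?_
  refine (h.setInt 13 (hb 3 (by omega))).seq fun s h => ?_
  refine (h.setInt 14 (hb 4 (by omega))).seq fun s h => ?_
  refine (h.setInt 17 (hb 5 (by omega))).seq fun s h => ?_
  refine (h.setInt 32 (hb 6 (by omega))).seq fun s h => ?_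
  refine (h.subInt 24 (by omega) (by omega) (z := (D.addrLen : ℤ)) (by simp [h30, h31])
    (hb _ (by omega))).seq fun s h => ?_
  refine (h.addInt 25 (by omega) (by omega) (z := ((D.addrLen + 1 : ℕ) : ℤ)) (by simp)
    (hb _ (by omega))).seq fun s h => ?_
  refine (h.addInt 18 (by omega) (by omega) (z := ((6 + D.addrLen : ℕ) : ℤ)) (by simp)
    (hb _ (by omega))).seq fun s h => ?_
  refine (h.addInt 19 (by omega) (by omega) (z := ((7 + 2 * D.addrLen : ℕ) : ℤ))
    (by simp; ring) (hb _ (by omega))).seq fun s h => ?_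
  refine (h.addInt 20 (by omega) (by omega) (z := ((7 + 2 * D.addrLen + D.n : ℕ) : ℤ))
    (by simp [h1]) (hb _ (by omega))).seq fun s h => ?_
  refine (h.addInt 21 (by omega) (by omega) (z := (D.qubits : ℤ)) (by simp [h2, hq])
    (hb _ (by omega))).seq fun s h => ?_
  refine (h.addInt 22 (by omega) (by omega) (z := ((D.qubits + 1 : ℕ) : ℤ)) (by simp)
    (hb _ (by omega))).seq fun s h => ?_
  refine (h.addInt 23 (by omega) (by omega) (z := ((D.qubits + D.qubits : ℕ) : ℤ)) (by simp)
    (hb _ (by omega))).mono fun s h => ?_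
  refine ⟨_, h.mono (by omega), ?_⟩
  constructor <;> simp [h10]

/-- The integer part of the binary logarithm. -/
noncomputable def floorLog (r : ℝ) : ℤ := ⌊log r / log 2⌋

lemma floor_neg_log_eq {m : ℕ} :
    ⌊(0 - log m) / log 2⌋ = -(Nat.clog 2 m : ℤ) := by
  have h : (0 - log m) / log 2 = -logb 2 m := by rw [logb]; ring
  rw [h, Int.floor_neg]
  have := ceil_logb_natCast (b := 2) (r := (m : ℝ)) (Nat.cast_nonneg m)
  rw [Int.clog_natCast, Nat.cast_ofNat] at this
  rw [this]

/-- Compute the length of an address as `-⌊-log₂ m⌋`, since only integer parts are available. -/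
def addrInit : Prog :=
  .seq (.cast 25 0) (floorTo 30 26 ((.const 0 - .fn .log (.var 25)) / .fn .log (.const 2)))

/-- Compute the number of digits, the normalisation of the weights, the inverse of the accuracy, and
the threshold of the detection. -/
def realInit : Prog :=
  .seq (assign 15 (.fn .exp ((.const 0 - .const 2 * .var 26) * .fn .log (.const 2)) / .var 25))
    (.seq (floorTo 62 4 (.fn .log (.const 16 * .var 25 * (.var 2 * .var 3) / .var 0) /
      .fn .log (.const 2) + .const 1))
    (.seq (floorTo 63 27 (.const 4 * .var 4))
    (.seq (assign 20 (.var 4 * .var 4 / .var 0)) (assign 13 (.const 8 * .var 20 * (.var 2 * .var 3))))))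

/-- Compute the largest exponents of the digits and the number of shots. -/
def shotsInit : Prog :=
  .seq (floorTo 26 6 (.fn .log (.var 2) / .fn .log (.const 2)))
    (.seq (floorTo 27 7 (.fn .log (.var 3) / .fn .log (.const 2)))
    (floorTo 61 14 (.const 64000000 * .fn .log (.const 26 * (.var 4 * (.var 4 * .var 4)) / .var 1) +
      .const 1)))

/-- Compute all parameters of the algorithm. -/
def mainInit : Prog := .seq (.seq addrInit layoutInit) (.seq realInit shotsInit)

/-- The number `L` of digits that are taken into account: the digits of lower weight contribute at most
`4 m η η' / 2 ^ L ≤ ε / 4` to the inner product. -/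
noncomputable def numDigits (m : ℕ) (ε p : ℝ) : ℤ := floorLog (16 * m * p / ε) + 1

/-- The number of shots: the factor is `4 / tol ^ 2`, so that `failProb` is at most `δ / (13 L ^ 3)`,
where `13 L ^ 3` bounds the number of the estimates. -/
noncomputable def numShots (L : ℤ) (δ : ℝ) : ℤ :=
  ⌊64000000 * log (26 * (L * (L * L)) / δ)⌋ + 1

/-- What holds at the end of `mainInit`. -/
structure InitDone (D : Device) (b : ℕ) (ε δ η η' : ℝ) (L S : ℤ) (t : State) : Prop where
  psi : t.psi = ket ∅
  layout : Layout D t.int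
  short : Short b t.int
  i26 : t.int 26 = floorLog η
  i27 : t.int 27 = floorLog η'
  i61 : t.int 61 = S
  i62 : t.int 62 = L
  i63 : t.int 63 = 4 * L
  r6 : t.real 6 = floorLog η
  r7 : t.real 7 = floorLog η'
  r13 : t.real 13 = 8 * (L * L / ε) * (η * η')
  r14 : t.real 14 = S
  r15 : t.real 15 = (2 ^ D.addrLen) ^ 2 / D.m
  r20 : t.real 20 = L * L / ε
  r21 : t.real 21 = 0

section

variable {b τ : ℕ} {ι : ℕ → ℤ} {ρ : ℕ → ℝ} {s : State} {ε δ η η' : ℝ}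

lemma det_addrInit (h : At b ι ρ τ s) (h0 : ι 0 = D.m) (hb : intCost (-(D.addrLen : ℤ)) ≤ b) :
    Det D s addrInit (At b (update ι 30 (-(D.addrLen : ℤ)))
      (update (update ρ 25 D.m) 26 (-(D.addrLen : ℝ))) (τ + (60 + 3 * b))) := by
  have f1 : ((RExp.const 0 - .fn .log (.var 25)) / .fn .log (.const 2) : RExp).cost ≤ 60 := by decide
  refine (h.cast (r := 25) (i := 0) (by omega)).seq fun s h => ?_
  rw [h0] at h
  refine (h.floorTo (i := 30) (r := 26) (by omega) (z := -(D.addrLen : ℤ)) (by simp) ?_ hb).mono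
    fun t ht => ?_
  · simp only [RExp.eval_div, RExp.eval_sub, RExp.eval_const, RExp.eval_fn, ElemFun.eval,
      RExp.eval_var, update_self, Int.cast_zero, Int.cast_natCast, Int.cast_ofNat]
    exact floor_neg_log_eq
  · push_cast at ht
    exact ht.mono (by omega)

lemma det_realInit (h : At b ι ρ τ s) (hr0 : ρ 0 = ε) (hr2 : ρ 2 = η) (hr3 : ρ 3 = η')
    (hr25 : ρ 25 = D.m) (hr26 : ρ 26 = -(D.addrLen : ℝ))
    {L : ℤ} (hL : numDigits D.m ε (η * η') = L) (hbL : intCost L ≤ b) (hbL' : intCost (4 * L) ≤ b) :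
    Det D s realInit (At b (update (update ι 62 L) 63 (4 * L))
      (update (update (update (update (update ρ
        15 ((2 ^ D.addrLen) ^ 2 / D.m)) 4 L) 27 ((4 * L : ℤ) : ℝ)) 20 (L * L / ε))
        13 (8 * (L * L / ε) * (η * η'))) (τ + (400 + 4 * b))) := by
  have f1 : (RExp.fn .exp ((.const 0 - .const 2 * .var 26) * .fn .log (.const 2)) / .var 25 :
    RExp).cost ≤ 80 := by decide
  have f2 : (RExp.fn .log (.const 16 * .var 25 * (.var 2 * .var 3) / .var 0) /
      .fn .log (.const 2) + .const 1 : RExp).cost ≤ 100 := by decide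
  have f3 : (RExp.const 4 * RExp.var 4 : RExp).cost ≤ 30 := by decide
  have f4 : (RExp.var 4 * .var 4 / .var 0 : RExp).cost ≤ 30 := by decide
  have f5 : (RExp.const 8 * .var 20 * (.var 2 * .var 3) : RExp).cost ≤ 50 := by decide
  refine (h.assign (r := 15) (by omega) (v := (2 ^ D.addrLen) ^ 2 / D.m) (by simp) ?_).seq
    fun s h => ?_
  · have := exp_mul_log_two (2 * D.addrLen)
    push_cast at this
    simp only [RExp.eval_div, RExp.eval_sub, RExp.eval_mul, RExp.eval_const, RExp.eval_fn,
      ElemFun.eval, RExp.eval_var, hr25, hr26]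
    push_cast
    rw [show (0 - 2 * -(D.addrLen : ℝ)) = 2 * D.addrLen by ring, this, ← pow_mul, mul_comm _ 2]
    norm_cast
  refine (h.floorTo (i := 62) (r := 4) (by omega) (z := L) (by simp) ?_ hbL).seq fun s h => ?_
  · rw [← hL]
    simp [ElemFun.eval, hr0, hr2, hr3, hr25, numDigits, floorLog]
  refine (h.floorTo (i := 63) (r := 27) (by omega) (z := 4 * L) (by simp) ?_ hbL').seq
    fun s h => ?_
  · simp only [RExp.eval_mul, RExp.eval_const, RExp.eval_var, update_self]
    exact_mod_cast Int.floor_intCast (R := ℝ) (4 * L)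
  refine (h.assign (r := 20) (by omega) (v := L * L / ε) (by simp) (by simp [hr0])).seq
    fun s h => ?_
  refine (h.assign (r := 13) (by omega) (v := 8 * (L * L / ε) * (η * η')) (by simp)
    (by simp [hr2, hr3])).mono fun s h => ?_
  exact h.mono (by omega)

lemma det_shotsInit (h : At b ι ρ τ s) (hr1 : ρ 1 = δ) (hr2 : ρ 2 = η) (hr3 : ρ 3 = η') {L : ℤ}
    (hr4 : ρ 4 = L) (hbE : intCost (floorLog η) ≤ b) (hbE' : intCost (floorLog η') ≤ b)
    {S : ℤ} (hS : numShots L δ = S) (hbS : intCost S ≤ b) :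
    Det D s shotsInit (At b
      (update (update (update ι 26 (floorLog η)) 27 (floorLog η')) 61 S)
      (update (update (update ρ 6 (floorLog η)) 7 (floorLog η')) 14 S)
      (τ + (400 + 6 * b))) := by
  have f1 : (RExp.fn .log (.var 2) / .fn .log (.const 2) : RExp).cost ≤ 30 := by decide
  have f2 : (RExp.fn .log (.var 3) / .fn .log (.const 2) : RExp).cost ≤ 30 := by decide
  have f3 : (RExp.const 64000000 * .fn .log (.const 26 * (.var 4 * (.var 4 * .var 4)) / .var 1) +
      .const 1 : RExp).cost ≤ 200 := by decide
  refine (h.floorTo (i := 26) (r := 6) (by omega) (z := floorLog η) (by simp) ?_ hbE).seq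
    fun s h => ?_
  · simp [ElemFun.eval, hr2, floorLog]
  refine (h.floorTo (i := 27) (r := 7) (by omega) (z := floorLog η') (by simp) ?_ hbE').seq
    fun s h => ?_
  · simp [ElemFun.eval, hr3, floorLog]
  refine (h.floorTo (i := 61) (r := 14) (by omega) (z := S) (by simp) ?_ hbS).mono fun s h => ?_
  · rw [← hS]
    simp [ElemFun.eval, hr1, hr4, numShots]
  exact h.mono (by omega)

lemma det_mainInit (h : At b ι ρ τ s) (h0 : ι 0 = D.m) (h1 : ι 1 = D.n) (h2 : ι 2 = D.N)
    (h10 : ι 10 = 0) (h31 : ι 31 = 0) (hr0 : ρ 0 = ε) (hr1 : ρ 1 = δ) (hr2 : ρ 2 = η)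
    (hr3 : ρ 3 = η') (hr21 : ρ 21 = 0) (hb : ∀ z : ℤ, z.natAbs ≤ 2 * D.qubits → intCost z ≤ b)
    {L S : ℤ} (hL : numDigits D.m ε (η * η') = L) (hS : numShots L δ = S)
    (hbL : intCost L ≤ b) (hbL' : intCost (4 * L) ≤ b) (hbE : intCost (floorLog η) ≤ b)
    (hbE' : intCost (floorLog η') ≤ b) (hbS : intCost S ≤ b) :
    Det D s mainInit fun t => InitDone D b ε δ η η' L S t ∧ t.time ≤ τ + (1000 + 40 * b) := by
  have hq : D.qubits = 7 + 2 * D.addrLen + D.n + D.N := rfl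
  have hA : Det D s (.seq addrInit layoutInit) fun t => ∃ ι', At b ι'
      (update (update ρ 25 D.m) 26 (-(D.addrLen : ℝ))) (τ + (60 + 25 * b)) t ∧
      Layout D ι' := by
    refine (det_addrInit h h0 (hb _ (by omega))).seq fun t ht => ?_
    refine (det_layoutInit ht (by simp [h1]) (by simp [h2]) (by simp [h10]) (by simp)
      (by simp [h31]) hb).mono fun u hu => ?_
    obtain ⟨ι', h5, h6⟩ := hu
    exact ⟨ι', h5.mono (by omega), h6⟩
  refine hA.seq fun t ht => ?_
  obtain ⟨ι', h5, h6⟩ := ht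
  refine (det_realInit h5 (ε := ε) (η := η) (η' := η') (by simp [hr0]) (by simp [hr2])
    (by simp [hr3]) (by simp) (by simp) hL hbL hbL').seq fun u hu => ?_
  refine (det_shotsInit hu (δ := δ) (η := η) (η' := η') (L := L) (by simp [hr1]) (by simp [hr2])
    (by simp [hr3]) (by simp) hbE hbE' hS hbS).mono fun v hv => ?_
  obtain ⟨v1, v2, v3, v4⟩ := hv
  refine ⟨⟨v3, ?_, fun i hi => ?_, ?_, ?_, ?_, ?_, ?_, ?_, ?_, ?_, ?_, ?_, ?_, ?_⟩, by omega⟩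
  · refine h6.congr fun i _ hi => ?_
    rw [(v1 i (by omega)).1]
    simp only [update_apply]
    rw [if_neg (by omega), if_neg (by omega), if_neg (by omega), if_neg (by omega),
      if_neg (by omega)]
  · rw [(v1 i (by omega)).1]; exact (v1 i (by omega)).2
  all_goals first
    | (rw [(v1 _ (by omega)).1]; simp)
    | (rw [v2 _ (by omega)]; simp [hr21])

end

/-! ### The choice of the parameters -/

lemma two_zpow_floorLog_le {r : ℝ} (hr : 0 < r) : (2 : ℝ) ^ floorLog r ≤ r := by
  have h2 : 0 < log 2 := log_pos (by norm_num)
  rw [← exp_mul_log_two]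
  refine (exp_le_exp.2 ?_).trans_eq (exp_log hr)
  rw [← le_div_iff₀ h2]
  exact Int.floor_le _

lemma lt_two_zpow_floorLog {r : ℝ} (hr : 0 < r) : r < (2 : ℝ) ^ (floorLog r + 1) := by
  have h2 : 0 < log 2 := log_pos (by norm_num)
  rw [← exp_mul_log_two]
  refine (exp_log hr).symm.trans_lt (exp_lt_exp.2 ?_)
  rw [← div_lt_iff₀ h2]
  push_cast
  exact Int.lt_floor_add_one _

/-- What is known about the stored numbers: `η` and `η'` are at least the Euclidean norms of the two
lists, and no entry exceeds `R / √m`. -/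
structure Stored (D : Device) (φ : Bits D.n → Feature D.N) (η η' R : ℝ) : Prop where
  pos : 0 < D.m
  norm_feature : ∀ x, ‖φ x‖ = 1
  eta_pos : 0 < η
  eta_pos' : 0 < η'
  eta_le : η ≤ R
  eta_le' : η' ≤ R
  sum_sq : ∑ k ∈ range (2 ^ D.addrLen), D.num false k ^ 2 ≤ η ^ 2
  sum_sq' : ∑ k ∈ range (2 ^ D.addrLen), D.num true k ^ 2 ≤ η' ^ 2
  abs_le : ∀ k, |D.num false k| ≤ η
  abs_le' : ∀ k, |D.num true k| ≤ η'
  abs_le_max : ∀ c k, |D.num c k| ≤ R / √(D.m : ℝ)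

/-- The number of repetitions that suffices for all circuits. -/
noncomputable def maxRepeat (L : ℕ) (R ε : ℝ) : ℕ := ⌈28 * (L * L * R ^ 2 / ε)⌉₊ + 1

/-- The conditions on the bound `b` for the logarithmic quantities. -/
structure Bounds (D : Device) (b : ℕ) (R ε η η' : ℝ) (L S : ℕ) : Prop where
  addr : D.addrLen + 1 ≤ b
  exponent : ∀ u < L, (floorLog η - u).natAbs + 1 ≤ b
  exponent' : ∀ u < L, (floorLog η' - u).natAbs + 1 ≤ b
  loop : 4 * L + 1 ≤ b
  shots : S + 1 ≤ b
  size : intCost (maxRepeat L R ε) ≤ b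

section

variable {φ : Bits D.n → Feature D.N} {η η' R ε δ : ℝ} {L S b : ℕ}

lemma lt_two_pow_numDigits (h : Stored D φ η η' R) (hε : 0 < ε)
    (hL : numDigits D.m ε (η * η') = L) : 16 * D.m * (η * η') / ε < 2 ^ L := by
  have hm : (0 : ℝ) < D.m := by exact_mod_cast h.pos
  have h1 := h.eta_pos
  have h2 := h.eta_pos'
  have := lt_two_zpow_floorLog (r := 16 * D.m * (η * η') / ε) (by positivity)
  rw [← numDigits, hL, zpow_natCast] at this
  exact this

lemma numDigits_pos (h : Stored D φ η η' R) (hε : 0 < ε) (hp : ε ≤ η * η') :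
    0 < numDigits D.m ε (η * η') := by
  have hm : (1 : ℝ) ≤ D.m := by exact_mod_cast h.pos
  have h1 : 1 ≤ η * η' / ε := (one_le_div hε).2 hp
  have hy : 1 ≤ 16 * D.m * (η * η') / ε := by
    rw [mul_div_assoc]
    nlinarith
  have : 0 ≤ floorLog (16 * D.m * (η * η') / ε) :=
    Int.floor_nonneg.2 (div_nonneg (log_nonneg hy) (log_nonneg (by norm_num)))
  unfold numDigits
  omega

lemma loopReady_of_initDone (h : Stored D φ η η' R) (hε : 0 < ε) (hp : ε ≤ η * η')
    (hL : numDigits D.m ε (η * η') = L) (hS : 0 < S) (hB : Bounds D b R ε η η' L S)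
    (hT : 1 ≤ D.T) (hq : D.n + D.N ≤ 2 * D.T) {t : State}
    (ht : InitDone D b ε δ η η' L S t) :
    LoopReady D b (maxRepeat L R ε) φ L (floorLog η) (floorLog η') t := by
  have hm : (0 : ℝ) < D.m := by exact_mod_cast h.pos
  have h1 := h.eta_pos
  have h2 := h.eta_pos'
  have hL0 : 0 < L := by have := numDigits_pos h hε hp; omega
  have hLr : (1 : ℝ) ≤ L := by exact_mod_cast hL0
  have hY := lt_two_pow_numDigits h hε hL
  have hW : 28 * (L * L * R ^ 2 / ε) ≤ (maxRepeat L R ε : ℝ) := by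
    unfold maxRepeat
    push_cast
    linarith [Nat.le_ceil (28 * (L * L * R ^ 2 / ε))]
  have hL2 : (L : ℝ) * L ≤ 2 ^ (2 * L) := by
    have : (L : ℝ) ≤ 2 ^ L := by exact_mod_cast Nat.lt_two_pow_self.le
    rw [two_mul, pow_add]
    exact mul_le_mul this this (by positivity) (by positivity)
  have hpR : η * η' ≤ R ^ 2 := by
    rw [sq]; exact mul_le_mul h.eta_le h.eta_le' h2.le (h1.le.trans h.eta_le)
  have hratio : 1 ≤ η * η' / ε := (one_le_div hε).2 hp
  have hm1 : (1 : ℝ) ≤ D.m := by exact_mod_cast h.pos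
  have hM2 : (2 : ℝ) ^ D.addrLen ≤ 2 * D.m := by exact_mod_cast D.two_pow_le h.pos
  have hMm : ((2 : ℝ) ^ D.addrLen) ^ 2 / D.m ≤ 4 * D.m := by
    rw [div_le_iff₀ hm]
    calc ((2 : ℝ) ^ D.addrLen) ^ 2 ≤ (2 * D.m) ^ 2 := pow_le_pow_left₀ (by positivity) hM2 2
      _ = 4 * D.m * D.m := by ring
  have e13 : t.real 13 = 8 * (L * L / ε) * (η * η') := by rw [ht.r13]; push_cast; ring
  have e20 : t.real 20 = L * L / ε := by rw [ht.r20]; push_cast; ring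
  have hE0 : (t.int 26).natAbs + 1 ≤ b := by
    rw [ht.i26]; simpa using hB.exponent 0 hL0
  have hE0' : (t.int 27).natAbs + 1 ≤ b := by
    rw [ht.i27]; simpa using hB.exponent' 0 hL0
  have h63 : (t.int 63).toNat = 4 * L := by rw [ht.i63]; omega
  have h61 : (t.int 61).toNat = S := by rw [ht.i61]; omega
  have hthr : 8 * (L * L / ε) * (η * η') = 8 * (L * L) * (η * η' / ε) := by ring
  refine
  { machine :=
    { short := ht.short
      layout := ht.layout
      sized := ⟨hB.addr, by omega, by omega, hT, hq⟩
      psi := ⟨1, by rw [ht.psi, one_smul]⟩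
      one_le := by unfold maxRepeat; omega
      size_le := hB.size
      shots := by rw [h61]; have := hB.shots; omega
      shots_pos := by rw [h61]; exact hS
      shots_cost := by
        rw [ht.i61]
        refine (intCost_le_natAbs _).trans ?_
        have := hB.shots
        omega
      loop := by rw [h63]; have := hB.loop; omega
      loop_cost := by
        rw [ht.i63]
        refine (intCost_le_natAbs _).trans ?_
        have := hB.loop
        omega }
    digit := hE0
    digit' := hE0'
    count := ht.i62
    loop := ht.i63
    r6 := ht.r6
    r7 := ht.r7
    r14 := by rw [ht.r14, h61]; rfl
    r15 := by rw [ht.r15]; positivity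
    r20 := by rw [e20]; positivity
    r21 := ht.r21
    threshold := ?_
    threshold_le := ?_
    threshold_pow := ?_
    exponent := hB.exponent
    exponent' := hB.exponent'
    large := ?_
    small := ?_ }
  · rw [e13, hthr]
    nlinarith [mul_le_mul hLr hLr (by norm_num) (by linarith)]
  · rw [e13]
    refine le_trans ?_ hW
    calc 2 * (8 * (L * L / ε) * (η * η')) ≤ 2 * (8 * (L * L / ε) * R ^ 2) := by gcongr
      _ = 16 * (L * L * R ^ 2 / ε) := by ring
      _ ≤ 28 * (L * L * R ^ 2 / ε) := mul_le_mul_of_nonneg_right (by norm_num) (by positivity)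
  · rw [e13]
    calc 2 * (8 * (L * L / ε) * (η * η')) = L * L * (16 * 1 * (η * η') / ε) := by ring
      _ ≤ L * L * (16 * D.m * (η * η') / ε) := by gcongr
      _ ≤ 2 ^ (2 * L) * 2 ^ L := mul_le_mul hL2 hY.le (by positivity) (by positivity)
      _ = 2 ^ (3 * L) := by rw [← pow_add]; congr 1; ring
      _ ≤ 2 ^ (4 * L) := pow_le_pow_right₀ (by norm_num) (by omega)
  · intro u hu v hv hd hd'
    rw [ht.r15, e20]
    unfold pairWeight
    rw [zpow_add₀ (by norm_num)]
    constructor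
    · refine le_trans ?_ hW
      have b1 := two_zpow_le_of_digitProb hd (h.abs_le_max false)
      have b2 := two_zpow_le_of_digitProb hd' (h.abs_le_max true)
      have hs : √(D.m : ℝ) * √(D.m : ℝ) = D.m := mul_self_sqrt hm.le
      have b3 : (2 : ℝ) ^ (floorLog η - u) * 2 ^ (floorLog η' - v) ≤ R ^ 2 / D.m := by
        refine (mul_le_mul b1 b2 (by positivity)
          (div_nonneg (h1.le.trans h.eta_le) (sqrt_nonneg _))).trans_eq ?_
        rw [div_mul_div_comm, hs, sq]
      calc 7 * ((2 : ℝ) ^ (floorLog η - u) * 2 ^ (floorLog η' - v) *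
            ((2 ^ D.addrLen) ^ 2 / D.m) * (L * L / ε))
          ≤ 7 * (R ^ 2 / D.m * (4 * D.m) * (L * L / ε)) := by gcongr
        _ = 28 * (L * L * R ^ 2 / ε) := by field_simp; ring
    · have b1 := two_zpow_le_of_digitProb hd h.abs_le
      have b2 := two_zpow_le_of_digitProb hd' h.abs_le'
      calc (2 : ℝ) ^ (floorLog η - u) * 2 ^ (floorLog η' - v) *
            ((2 ^ D.addrLen) ^ 2 / D.m) * (L * L / ε)
          ≤ η * η' * (4 * D.m) * (L * L / ε) := by gcongr
        _ = L * L * (4 * D.m * (η * η') / ε) := by ring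
        _ ≤ L * L * (16 * D.m * (η * η') / ε) := by gcongr; norm_num
        _ ≤ 2 ^ (2 * L) * 2 ^ L := mul_le_mul hL2 hY.le (by positivity) (by positivity)
        _ = 2 ^ (3 * L) := by rw [← pow_add]; congr 1; ring
        _ ≤ 2 ^ (4 * L) := pow_le_pow_right₀ (by norm_num) (by omega)
  · intro u hu v hv hrare
    rw [e13] at hrare
    rw [ht.r15, e20]
    refine (abs_pairTerm_le h.norm_feature h.pos h1.le h2.le (by positivity) h.sum_sq h.sum_sq'
      hrare).trans_eq ?_
    field_simp
    norm_num

/-- The sum of the contributions of all pairs approximates the inner product. -/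
lemma abs_sum_pairTerm_sub_le (h : Stored D φ η η' R) (hε : 0 < ε)
    (hL : numDigits D.m ε (η * η') = L) :
    |∑ u ∈ range L, ∑ k ∈ range L,
        pairTerm D φ ((2 ^ D.addrLen) ^ 2 / D.m) (floorLog η - u) (floorLog η' - k) -
      1 / D.m * ∑ k ∈ range D.m, ∑ k' ∈ range D.m, D.num false k * D.num true k' *
          inner ℝ (φ (D.word k)) (φ (D.word k'))| ≤ ε / 4 := by
  have hm : (0 : ℝ) < D.m := by exact_mod_cast h.pos
  have h1 := h.eta_pos
  have h2 := h.eta_pos'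
  have hY := lt_two_pow_numDigits h hε hL
  have hv : ((2 : ℝ) ^ D.addrLen) ^ 2 / D.m / (2 ^ D.addrLen) ^ 2 = 1 / D.m := by field_simp
  rw [sum_pairTerm, hv, ← mul_sub, abs_mul, abs_of_pos (by positivity)]
  calc 1 / (D.m : ℝ) * _ ≤ 1 / (D.m : ℝ) * (D.m ^ 2 * (4 * (η * η') / 2 ^ L)) :=
        mul_le_mul_of_nonneg_left (abs_sum_truncated_sub_le D h.norm_feature h.abs_le h.abs_le'
          (two_zpow_floorLog_le h1) (two_zpow_floorLog_le h2) (lt_two_zpow_floorLog h1)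
          (lt_two_zpow_floorLog h2) L) (by positivity)
    _ = ε * (16 * D.m * (η * η') / ε) / 4 / 2 ^ L := by field_simp; norm_num
    _ ≤ ε * 2 ^ L / 4 / 2 ^ L := by gcongr
    _ = ε / 4 := by field_simp

/-- The number of shots makes the total failure probability at most `δ`. -/
lemma mul_failProb_le (hδ : 0 < δ) (hL : 0 < L) (hS : numShots L δ = S) :
    L * ((4 * L + L * (8 * L + 1)) * failProb S) ≤ δ := by
  have hLr : (1 : ℝ) ≤ L := by exact_mod_cast hL
  have h0 : (0 : ℝ) < 26 * (L * (L * L)) / δ := by positivity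
  have h1 : 64000000 * log (26 * (L * (L * L)) / δ) ≤ S := by
    have h2 : ((numShots L δ : ℤ) : ℝ) = S := by rw [hS]; rfl
    rw [← h2, numShots]
    push_cast
    exact (Int.lt_floor_add_one _).le
  have h2 : failProb S ≤ 2 * (δ / (26 * (L * (L * L)))) := by
    unfold failProb
    refine mul_le_mul_of_nonneg_left ?_ (by norm_num)
    rw [← inv_div (26 * ((L : ℝ) * (L * L))) δ, ← exp_log h0, ← exp_neg]
    refine exp_le_exp.2 (neg_le_neg ?_)
    unfold tol
    linarith
  calc (L : ℝ) * ((4 * L + L * (8 * L + 1)) * failProb S)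
      ≤ L * ((13 * (L * L)) * (2 * (δ / (26 * (L * (L * L)))))) := by
        refine mul_le_mul_of_nonneg_left (mul_le_mul ?_ h2 (failProb_nonneg S) (by positivity))
          (by positivity)
        nlinarith
    _ = δ := by field_simp; norm_num

end

/-! ### Logarithmic bounds -/

section

variable {Z : ℝ}

lemma two_thirds_le_log (hZ : 2 ≤ Z) : 2 / 3 ≤ log Z := by
  have h1 : log 2 ≤ log Z := log_le_log (by norm_num) hZ
  have := log_two_gt_d9
  linarith

lemma div_log_two_le (hZ : 2 ≤ Z) {a j : ℝ} (h : a ≤ j * log Z) (hj : 0 ≤ j) :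
    a / log 2 ≤ 3 / 2 * j * log Z := by
  have h2 := log_two_gt_d9
  have h3 := two_thirds_le_log hZ
  rw [div_le_iff₀ (by linarith)]
  have : 0 ≤ j * log Z := by positivity
  nlinarith

/-- A number whose power of two is polynomial in `Z` is logarithmic in `Z`. -/
lemma le_of_two_pow_le (hZ : 2 ≤ Z) {k j : ℕ} (h : (2 : ℝ) ^ k ≤ Z ^ j) :
    (k : ℝ) ≤ 3 / 2 * j * log Z := by
  have h1 := log_le_log (by positivity) h
  rw [log_pow, log_pow] at h1
  have h2 := log_two_gt_d9
  have := div_log_two_le hZ h1 (Nat.cast_nonneg j)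
  rwa [mul_div_assoc, div_self (by linarith), mul_one] at this

lemma intCost_le_log (hZ : 2 ≤ Z) {z : ℤ} {j : ℕ} (h : (z.natAbs : ℝ) ≤ Z ^ j) :
    (intCost z : ℝ) ≤ (3 / 2 * j + 3) * log Z := by
  have h3 := two_thirds_le_log hZ
  unfold intCost
  rcases Nat.eq_zero_or_pos (Nat.size z.natAbs) with h0 | h0
  · rw [h0]
    have : 0 ≤ 3 / 2 * (j : ℝ) * log Z := by positivity
    push_cast
    nlinarith
  · have h1 : 2 ^ (Nat.size z.natAbs - 1) ≤ z.natAbs := Nat.lt_size.1 (by omega)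
    have h2 : (2 : ℝ) ^ (Nat.size z.natAbs - 1) ≤ Z ^ j := le_trans (by exact_mod_cast h1) h
    have h4 := le_of_two_pow_le hZ h2
    rw [Nat.cast_sub (by omega)] at h4
    push_cast at h4 ⊢
    nlinarith

/-- The quantity in the logarithm of the bound on the running time dominates all parameters. -/
structure Dominates (Z : ℝ) (D : Device) (R ε δ η η' : ℝ) : Prop where
  two_le : 2 ≤ Z
  card : 2 + (D.m + D.n + D.N : ℝ) ≤ Z
  max_le : R ≤ Z
  inv_eps : 1 / ε ≤ Z
  inv_delta : 1 / δ ≤ Z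
  inv_eta : 1 / η ≤ Z
  inv_eta' : 1 / η' ≤ Z

lemma natAbs_floorLog_le (hZ : 2 ≤ Z) {η R : ℝ} (hη : 0 < η) (hη' : η ≤ R) (hR : R ≤ Z)
    (hi : 1 / η ≤ Z) : ((floorLog η).natAbs : ℝ) ≤ 3 * log Z := by
  have h3 := two_thirds_le_log hZ
  have h2 := log_two_gt_d9
  have h4 : log η ≤ log Z := log_le_log hη (hη'.trans hR)
  have h5 : -log η ≤ log Z := by
    rw [← log_inv, ← one_div]
    exact log_le_log (by positivity) hi
  have h6 := div_log_two_le hZ (j := 1) (a := log η) (by rwa [one_mul]) (by norm_num)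
  have h7 := div_log_two_le hZ (j := 1) (a := -log η) (by rwa [one_mul]) (by norm_num)
  have h8 := Int.floor_le (log η / log 2)
  have h9 := Int.lt_floor_add_one (log η / log 2)
  rw [neg_div] at h7
  rw [Nat.cast_natAbs, Int.cast_abs, abs_le]
  unfold floorLog
  constructor <;> linarith

/-- All logarithmic quantities are bounded by a multiple of `log Z`. -/
lemma exists_bounds {φ : Bits D.n → Feature D.N} {R ε δ η η' : ℝ}
    (h : Stored D φ η η' R) (hε : 0 < ε) (hδ : 0 < δ) (hδ1 : δ < 1) (hp : ε ≤ η * η')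
    (hZ : Dominates Z D R ε δ η η') :
    ∃ b L S : ℕ, (b : ℝ) ≤ 2 * 10 ^ 10 * log Z ∧ numDigits D.m ε (η * η') = L ∧
      numShots L δ = S ∧ 0 < L ∧ 0 < S ∧ Bounds D b R ε η η' L S ∧ intCost D.m ≤ b ∧
      ∀ z : ℤ, z.natAbs ≤ 2 * D.qubits → intCost z ≤ b := by
  obtain ⟨z2, zc, zR, zε, zδ, zη, zη'⟩ := hZ
  have h3 := two_thirds_le_log z2
  set l := log Z with hl
  have hZ1 : 1 ≤ Z := by linarith
  have hm0 : (0 : ℝ) ≤ D.m := Nat.cast_nonneg _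
  have hn0 : (0 : ℝ) ≤ D.n := Nat.cast_nonneg _
  have hN0 : (0 : ℝ) ≤ D.N := Nat.cast_nonneg _
  have hη := h.eta_pos
  have hη' := h.eta_pos'
  have hm1 : 0 < D.m := h.pos
  have hmr : (0 : ℝ) < D.m := by exact_mod_cast h.pos
  have hR0 : 0 ≤ R := hη.le.trans h.eta_le
  have hpR : η * η' ≤ Z ^ 2 := by
    rw [sq]
    exact mul_le_mul (h.eta_le.trans zR) (h.eta_le'.trans zR) hη'.le (by linarith)
  obtain ⟨L, hL⟩ := Int.eq_ofNat_of_zero_le (numDigits_pos h hε hp).le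
  have hL0 : 0 < L := by have := numDigits_pos h hε hp; omega
  have hLr : (1 : ℝ) ≤ L := by exact_mod_cast hL0
  -- The number of digits.
  have hLZ : (2 : ℝ) ^ L ≤ Z ^ 9 := by
    have h1 := two_zpow_floorLog_le (r := 16 * D.m * (η * η') / ε) (by positivity)
    have h4 : (2 : ℝ) ^ L = 2 * 2 ^ floorLog (16 * D.m * (η * η') / ε) := by
      rw [mul_comm, ← zpow_add_one₀ (by norm_num), ← numDigits, hL, zpow_natCast]
    have h5 : (16 : ℝ) ≤ Z ^ 4 := by
      calc (16 : ℝ) = 2 ^ 4 := by norm_num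
        _ ≤ Z ^ 4 := pow_le_pow_left₀ (by norm_num) z2 4
    rw [h4]
    calc 2 * (2 : ℝ) ^ floorLog (16 * D.m * (η * η') / ε)
        ≤ 2 * (16 * D.m * (η * η') / ε) := by linarith
      _ = 2 * (16 * D.m * (η * η') * (1 / ε)) := by ring
      _ ≤ Z * (Z ^ 4 * Z * Z ^ 2 * Z) := by gcongr; linarith
      _ = Z ^ 9 := by ring
  have hLl := le_of_two_pow_le z2 hLZ
  rw [← hl] at hLl
  have hLZ' : (L : ℝ) ≤ Z ^ 9 := le_trans (by exact_mod_cast Nat.lt_two_pow_self.le) hLZ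
  -- The number of shots.
  have hq0 : (1 : ℝ) ≤ 26 * (L * (L * L)) / δ := by
    rw [one_le_div hδ]
    have : (1 : ℝ) ≤ L * (L * L) := one_le_mul_of_one_le_of_one_le hLr
      (one_le_mul_of_one_le_of_one_le hLr hLr)
    linarith
  have hlog0 := log_nonneg hq0
  have hS0 : 0 < numShots L δ := by
    have : 0 ≤ ⌊64000000 * log (26 * ((L : ℤ) * ((L : ℤ) * (L : ℤ)) : ℝ) / δ)⌋ :=
      Int.floor_nonneg.2 (mul_nonneg (by norm_num) (by exact_mod_cast hlog0))
    unfold numShots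
    omega
  obtain ⟨S, hS⟩ := Int.eq_ofNat_of_zero_le hS0.le
  have hSl : (S : ℝ) ≤ 64000000 * (33 * l) + 1 := by
    have h1 : ((numShots L δ : ℤ) : ℝ) = S := by rw [hS]; rfl
    have h4 : log (26 * (L * (L * L)) / δ) ≤ 33 * l := by
      have h5 : 26 * (L * (L * L)) / δ ≤ Z ^ 33 := by
        calc 26 * ((L : ℝ) * (L * L)) / δ = 26 * (L * (L * L)) * (1 / δ) := by ring
          _ ≤ Z ^ 5 * (Z ^ 9 * (Z ^ 9 * Z ^ 9)) * Z := by
            gcongr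
            calc (26 : ℝ) ≤ 2 ^ 5 := by norm_num
              _ ≤ Z ^ 5 := pow_le_pow_left₀ (by norm_num) z2 5
          _ = Z ^ 33 := by ring
      have := log_le_log (by linarith) h5
      rw [log_pow] at this
      exact_mod_cast this
    rw [← h1, numShots]
    push_cast
    have := Int.floor_le (64000000 * log (26 * (L * (L * L)) / δ))
    linarith
  -- The number of repetitions.
  have hW : ((maxRepeat L R ε : ℤ).natAbs : ℝ) ≤ Z ^ 27 := by
    rw [Int.natAbs_natCast]
    unfold maxRepeat
    have h1 : 28 * (L * L * R ^ 2 / ε) ≤ Z ^ 26 := by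
      calc 28 * (L * L * R ^ 2 / ε) = 28 * (L * L * R ^ 2 * (1 / ε)) := by ring
        _ ≤ Z ^ 5 * (Z ^ 9 * Z ^ 9 * Z ^ 2 * Z) := by
          gcongr
          calc (28 : ℝ) ≤ 2 ^ 5 := by norm_num
            _ ≤ Z ^ 5 := pow_le_pow_left₀ (by norm_num) z2 5
        _ = Z ^ 26 := by ring
    have h4 := Nat.ceil_lt_add_one (show 0 ≤ 28 * (L * L * R ^ 2 / ε) by positivity)
    have h5 : (2 : ℝ) ≤ Z ^ 26 := z2.trans (le_self_pow₀ hZ1 (by norm_num))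
    have h6 : 2 * Z ^ 26 ≤ Z ^ 27 := by
      rw [pow_succ' Z 26]; exact mul_le_mul_of_nonneg_right z2 (by positivity)
    push_cast
    linarith
  have hWl := intCost_le_log z2 hW
  have haddr : (2 : ℝ) ^ D.addrLen ≤ Z ^ 2 := by
    have : (2 : ℝ) ^ D.addrLen ≤ 2 * D.m := by exact_mod_cast D.two_pow_le hm1
    nlinarith
  have hal := le_of_two_pow_le z2 haddr
  have hE := natAbs_floorLog_le z2 hη h.eta_le zR zη
  have hE' := natAbs_floorLog_le z2 hη' h.eta_le' zR zη'
  rw [← hl] at hWl hal hE hE'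
  push_cast at hLl hWl hal
  have hexp : ∀ (E : ℤ), (E.natAbs : ℝ) ≤ 3 * l → ∀ u < L,
      (E - u).natAbs + 1 ≤ ⌈(10 : ℝ) ^ 10 * l⌉₊ := by
    intro E hE u hu
    have h1 : (E - u).natAbs ≤ E.natAbs + L := by omega
    have h4 : (((E - u).natAbs + 1 : ℕ) : ℝ) ≤ (10 : ℝ) ^ 10 * l := by
      have : ((E - u).natAbs : ℝ) ≤ E.natAbs + L := by exact_mod_cast h1
      push_cast
      linarith
    exact Nat.cast_le.1 (h4.trans (Nat.le_ceil _))
  have hto : ∀ a : ℕ, (a : ℝ) ≤ (10 : ℝ) ^ 10 * l → a ≤ ⌈(10 : ℝ) ^ 10 * l⌉₊ := fun a ha =>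
    Nat.cast_le.1 (ha.trans (Nat.le_ceil _))
  refine ⟨⌈(10 : ℝ) ^ 10 * l⌉₊, L, S, ?_, hL, hS, hL0, by omega,
    ⟨hto _ ?_, hexp _ hE, hexp _ hE', hto _ ?_, hto _ ?_, hto _ ?_⟩, hto _ ?_,
    fun z hz => hto _ ?_⟩
  · have := Nat.ceil_lt_add_one (show 0 ≤ (10 : ℝ) ^ 10 * l by positivity)
    linarith
  · push_cast; linarith
  · push_cast; linarith
  · push_cast; linarith
  · linarith
  · have := intCost_le_log z2 (z := (D.m : ℤ)) (j := 1) (by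
      rw [Int.natAbs_natCast]; linarith)
    rw [← hl] at this
    push_cast at this
    linarith
  · have h1 : (D.addrLen : ℝ) ≤ 2 * D.m := by
      have : D.addrLen ≤ 2 * D.m := Nat.lt_two_pow_self.le.trans (D.two_pow_le hm1)
      exact_mod_cast this
    have h4 : (z.natAbs : ℝ) ≤ 2 * (7 + 2 * D.addrLen + D.n + D.N) := by
      have hq : D.qubits = 7 + 2 * D.addrLen + D.n + D.N := rfl
      rw [hq] at hz
      exact_mod_cast hz
    have := intCost_le_log z2 (z := z) (j := 4) (by
      have h5 : (8 : ℝ) ≤ Z ^ 3 := by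
        calc (8 : ℝ) = 2 ^ 3 := by norm_num
          _ ≤ Z ^ 3 := pow_le_pow_left₀ (by norm_num) z2 3
      calc (z.natAbs : ℝ) ≤ 8 * Z := by linarith
        _ ≤ Z ^ 3 * Z := mul_le_mul_of_nonneg_right h5 (by linarith)
        _ = Z ^ 4 := by ring)
    rw [← hl] at this
    push_cast at this
    linarith

end

/-! ### The algorithm -/

/-- Sum the estimates of the contributions of all pairs of digits, unless `ε` is so large that `0` is
an acceptable output. -/
def mainProg : Prog :=
  .seq (assign 12 (.var 2 * .var 3)) (.ifLt 12 0 (assign 0 (.const 0))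
    (.seq mainInit (.seq sumPairs (assign 0 (.var 16)))))

section

variable {φ : Bits D.n → Feature D.N} {η η' R ε δ : ℝ}

/-- The initial state of the machine. -/
noncomputable def startState (D : Device) (ε δ η η' : ℝ) : State := start D.m D.n D.N ε δ η η'

lemma at_start {b : ℕ} (hm : intCost D.m ≤ b)
    (hb : ∀ z : ℤ, z.natAbs ≤ 2 * D.qubits → intCost z ≤ b) :
    At b (startState D ε δ η η').int (startState D ε δ η η').real 0 (startState D ε δ η η') := by
  refine ⟨fun j _ => ⟨rfl, ?_⟩, fun _ _ => rfl, rfl, le_rfl⟩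
  have hq : D.qubits = 7 + 2 * D.addrLen + D.n + D.N := rfl
  simp only [startState, start]
  split_ifs
  · exact hm
  · exact hb _ (by omega)
  · exact hb _ (by omega)
  · exact hb _ (by omega)

lemma det_product (D : Device) (ε δ η η' : ℝ) : Det D (startState D ε δ η η')
    (assign 12 (.var 2 * .var 3)) fun t =>
      (∀ j, (j < 50 ∨ 61 ≤ j) → t.int j = (startState D ε δ η η').int j) ∧
      (∀ q < 50, t.real q = update (startState D ε δ η η').real 12 (η * η') q) ∧
      t.psi = ket ∅ ∧ t.time ≤ 20 := by
  have f1 : (RExp.var 2 * RExp.var 3 : RExp).cost ≤ 10 := by decide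
  refine (det_assign D (r := 12) (by omega) (e := .var 2 * .var 3) (by simp) _).mono fun t ht => ?_
  obtain ⟨h1, h2, h3, h4⟩ := ht
  refine ⟨fun j hj => h2 j (by omega), fun q hq => ?_, h3, ?_⟩
  · rw [h1 q hq, update_apply]
    rfl
  · rw [h4]
    simp only [startState, start]
    omega

/-- If `η η' < ε`, the output is `0`, after a bounded time. -/
lemma det_mainProg_of_lt (hp : η * η' < ε) :
    Det D (startState D ε δ η η') mainProg fun t => t.output = 0 ∧ t.time ≤ 50 := by
  refine (det_product D ε δ η η').seq fun t ht => ?_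
  obtain ⟨h1, h2, h3, h4⟩ := ht
  have e0 : t.real 0 = ε := by rw [h2 0 (by omega)]; rfl
  have e12 : t.real 12 = η * η' := by rw [h2 12 (by omega), update_self]
  have f1 : (RExp.const 0).cost ≤ 10 := by decide
  refine det_ifLt (fun _ => ?_) fun h => absurd (by rwa [e0, e12]) h
  refine (det_assign D (r := 0) (by omega) (e := .const 0) (by simp) _).mono fun u hu => ?_
  obtain ⟨u1, -, -, u4⟩ := hu
  refine ⟨(u1 0 (by omega)).trans (by simp), ?_⟩
  rw [u4]; simp only [State.tick]; omega

/-- The running time and the error of the algorithm, in terms of a bound `b` for the quantities that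
are logarithmic in the parameters. -/
lemma main_of_bounds (hU : D.Unitary) (hφ : D.HasFeature φ) (h : Stored D φ η η' R) (hε : 0 < ε)
    (hδ : 0 < δ) (hp : ε ≤ η * η') (hT : 1 ≤ D.T) (hq : D.n + D.N ≤ 2 * D.T) {b L S : ℕ}
    (hL : numDigits D.m ε (η * η') = L) (hS : numShots L δ = S) (hL0 : 0 < L) (hS0 : 0 < S)
    (hB : Bounds D b R ε η η' L S) (hm : intCost D.m ≤ b)
    (hb : ∀ z : ℤ, z.natAbs ≤ 2 * D.qubits → intCost z ≤ b) :
    (Always D (startState D ε δ η η') mainProg fun t =>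
      t.time ≤ 12500 * (b ^ 6 * D.T * maxRepeat L R ε)) ∧
    Err D (startState D ε δ η η') mainProg δ fun t =>
      |t.output - 1 / D.m * ∑ k ∈ range D.m, ∑ k' ∈ range D.m,
        D.num false k * D.num true k' * inner ℝ (φ (D.word k)) (φ (D.word k'))| ≤ ε := by
  have hov := abs_overlap_le_one D h.norm_feature
  have hinit : ∀ t : State, (∀ j, (j < 50 ∨ 61 ≤ j) → t.int j = (startState D ε δ η η').int j) →
      (∀ q < 50, t.real q = update (startState D ε δ η η').real 12 (η * η') q) →
      t.psi = ket ∅ → t.time ≤ 20 → Det D (t.tick 1) mainInit fun u =>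
        LoopReady D b (maxRepeat L R ε) φ L (floorLog η) (floorLog η') u ∧
        InitDone D b ε δ η η' L S u ∧ u.time ≤ 1100 + 40 * b := by
    intro t h1 h2 h3 h4
    have hat : At b (startState D ε δ η η').int
        (update (startState D ε δ η η').real 12 (η * η')) 21 (t.tick 1) :=
      ⟨fun j hj => ⟨h1 j hj, ((at_start hm hb).1 j hj).2⟩, h2, h3, by
        simp only [State.tick]; omega⟩
    have hb4 := hB.loop
    have hbE := (intCost_le_natAbs _).trans (hB.exponent 0 hL0)
    have hbE' := (intCost_le_natAbs _).trans (hB.exponent' 0 hL0)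
    rw [Nat.cast_zero, sub_zero] at hbE hbE'
    refine (det_mainInit hat rfl rfl rfl rfl rfl rfl rfl rfl rfl rfl hb hL hS
      ((intCost_le_natAbs _).trans (by omega)) ((intCost_le_natAbs _).trans (by omega)) hbE hbE'
      ((intCost_le_natAbs _).trans (by have := hB.shots; omega))).mono fun u hu => ?_
    exact ⟨loopReady_of_initDone h hε hp hL hS0 hB hT hq hu.1, hu.1, by omega⟩
  have f1 : (RExp.var 16).cost ≤ 10 := by decide
  have hout : ∀ t : State, Det D t (assign 0 (.var 16)) fun u =>
      u.output = t.real 16 ∧ u.time ≤ t.time + 20 := by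
    intro t
    refine (det_assign D (r := 0) (by omega) (e := .var 16) (by simp) t).mono fun u hu => ?_
    exact ⟨(hu.1 0 (by omega)).trans (by simp), by omega⟩
  constructor
  · refine Always.det_seq (det_product D ε δ η η') fun t ht => ?_
    obtain ⟨h1, h2, h3, h4⟩ := ht
    have e0 : t.real 0 = ε := by rw [h2 0 (by omega)]; rfl
    have e12 : t.real 12 = η * η' := by rw [h2 12 (by omega), update_self]
    refine always_ifLt (fun hlt => absurd hlt (by rw [e0, e12]; exact not_lt.2 hp)) fun _ => ?_
    refine Always.det_seq (hinit t h1 h2 h3 h4) fun u hu => ?_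
    obtain ⟨u1, u2, u3⟩ := hu
    refine Always.seq hU (always_sumPairs hU u1) fun v hv => ?_
    refine Det.always ((hout v).mono fun w hw => ?_)
    have hb1 : 1 ≤ b := by have := hB.addr; omega
    have h5 := le_unitCost u1.machine
    have h6 : D.unitCost b (maxRepeat L R ε) ≤
        b * (b * (b * D.unitCost b (maxRepeat L R ε))) :=
      (Nat.le_mul_of_pos_left _ hb1).trans (Nat.mul_le_mul_left _
        ((Nat.le_mul_of_pos_left _ hb1).trans (Nat.mul_le_mul_left _
          (Nat.le_mul_of_pos_left _ hb1))))
    have h7 : b * (b * (b * D.unitCost b (maxRepeat L R ε))) =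
        b ^ 6 * D.T * maxRepeat L R ε := by unfold Device.unitCost; ring
    have h8 := hv.2
    have h9 := hw.2
    rw [h7] at h6 h8
    omega
  · refine Err.det_seq (det_product D ε δ η η') (fun t ht => ht.2.2.1) fun t ht => ?_
    obtain ⟨h1, h2, h3, h4⟩ := ht
    have e0 : t.real 0 = ε := by rw [h2 0 (by omega)]; rfl
    have e12 : t.real 12 = η * η' := by rw [h2 12 (by omega), update_self]
    refine err_ifLt (fun hlt => absurd hlt (by rw [e0, e12]; exact not_lt.2 hp)) fun _ => ?_
    refine Err.det_seq (hinit t h1 h2 h3 h4) (fun u hu => hu.2.1.psi.trans h3.symm) fun u hu => ?_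
    obtain ⟨u1, u2, u3⟩ := hu
    have herr := err_sumPairs hU u1 hφ hov
    rw [u2.i61, Int.toNat_natCast, u2.r15, u2.r20] at herr
    have := Err.seq hU (δ' := 0) le_rfl (always_sumPairs hU u1) herr (q := assign 0 (.var 16))
      (G' := fun t => |t.output - 1 / D.m * ∑ k ∈ range D.m, ∑ k' ∈ range D.m,
        D.num false k * D.num true k' * inner ℝ (φ (D.word k)) (φ (D.word k'))| ≤ ε) ?_
    · exact this.mono (by rw [add_zero]; exact mul_failProb_le hδ hL0 hS) (A := fun _ => True)
        (fun _ _ _ => trivial) fun _ _ hg => hg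
    · intro v _ hg
      refine Always.err_imp (Det.always (hout v)) le_rfl fun w hw => ?_
      have hL' : (L : ℝ) ≠ 0 := by exact_mod_cast hL0.ne'
      have e : (L : ℝ) * (L * (1 / (4 * (((L : ℤ) : ℝ) * ((L : ℤ) : ℝ) / ε)))) = ε / 4 := by
        push_cast
        field_simp
      rw [e] at hg
      rw [hw.1]
      refine (abs_sub_le _ _ _).trans
        ((add_le_add hg (abs_sum_pairTerm_sub_le h hε hL)).trans (by linarith))

end

lemma Err.one_sub_le_prob (hU : D.Unitary) {s : State} (hs : normSq s.psi = 1) {p : Prog}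
    {δ : ℝ} {G : State → Prop} (h : Err D s p δ G) : 1 - δ ≤ prob (run D p s) G := by
  classical
  have h1 := wsum_one_run hU p s
  unfold Err at h
  rw [prob_eq_wsum, hs, mul_one] at h
  rw [prob_eq_wsum]
  have h2 : wsum (run D p s) (fun _ => 1) = wsum (run D p s) (fun t => if G t then 1 else 0) +
      wsum (run D p s) (fun t => if ¬ G t then 1 else 0) := by
    rw [← wsum_add]
    exact wsum_congr fun t _ _ => by by_cases hg : G t <;> simp [hg]
  rw [h1, hs] at h2
  linarith

/-- The final estimate of the running time. -/
lemma time_le {b T L : ℕ} {R ε δ μ l : ℝ} (hε : 0 < ε) (hδ : 0 < δ) (hδ1 : δ < 1) (hμ : 0 < μ)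
    (hμR : μ ≤ R) (hεR : ε ≤ R ^ 2) (hb : (b : ℝ) ≤ 2 * 10 ^ 10 * l) (hb1 : 1 ≤ b) (hL : L ≤ b)
    {t : ℕ} (ht : t ≤ 12500 * (b ^ 6 * T * maxRepeat L R ε)) :
    (t : ℝ) ≤ (375000 * (2 * 10 ^ 10) ^ 8 : ℕ) *
      (1 + (1 + log (1 / δ)) / ε * (R ^ 3 / μ) * T) * l ^ 8 := by
  have hb1' : (1 : ℝ) ≤ b := by exact_mod_cast hb1
  have hL' : (L : ℝ) ≤ b := by exact_mod_cast hL
  have hR : 0 < R := hμ.trans_le hμR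
  have hratio : 1 ≤ R ^ 2 / ε := (one_le_div hε).2 hεR
  have hlog : 0 ≤ log (1 / δ) := log_nonneg ((one_le_div hδ).2 hδ1.le)
  have hl : 0 ≤ l := by
    by_contra hneg
    push Not at hneg
    linarith
  have hW : (maxRepeat L R ε : ℝ) ≤ 30 * (b ^ 2 * (R ^ 2 / ε)) := by
    unfold maxRepeat
    have h1 := Nat.ceil_lt_add_one (show 0 ≤ 28 * (L * L * R ^ 2 / ε) by positivity)
    have h2 : (L : ℝ) * L * R ^ 2 / ε ≤ b ^ 2 * (R ^ 2 / ε) := by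
      rw [mul_div_assoc, sq (b : ℝ)]
      gcongr
    have h3 : 1 ≤ (b : ℝ) ^ 2 * (R ^ 2 / ε) :=
      one_le_mul_of_one_le_of_one_le (one_le_pow₀ hb1') hratio
    push_cast
    linarith
  have hcube : R ^ 2 / ε ≤ (1 + log (1 / δ)) / ε * (R ^ 3 / μ) := by
    have h1 : R ^ 2 ≤ R ^ 3 / μ := by
      rw [le_div_iff₀ hμ, pow_succ R 2]
      exact mul_le_mul_of_nonneg_left hμR (by positivity)
    calc R ^ 2 / ε = 1 / ε * R ^ 2 := by ring
      _ ≤ (1 + log (1 / δ)) / ε * (R ^ 3 / μ) := by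
        gcongr
        linarith
  calc (t : ℝ) ≤ 12500 * ((b : ℝ) ^ 6 * T * maxRepeat L R ε) := by exact_mod_cast ht
    _ ≤ 12500 * ((b : ℝ) ^ 6 * T * (30 * (b ^ 2 * (R ^ 2 / ε)))) := by gcongr
    _ = 375000 * (b : ℝ) ^ 8 * (R ^ 2 / ε * T) := by ring
    _ ≤ 375000 * (2 * 10 ^ 10 * l) ^ 8 * (R ^ 2 / ε * T) := by gcongr
    _ = (375000 * (2 * 10 ^ 10) ^ 8 : ℕ) * (R ^ 2 / ε * T) * l ^ 8 := by push_cast; ring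
    _ ≤ (375000 * (2 * 10 ^ 10) ^ 8 : ℕ) *
        (1 + (1 + log (1 / δ)) / ε * (R ^ 3 / μ) * T) * l ^ 8 := by
      gcongr
      have : R ^ 2 / ε * T ≤ (1 + log (1 / δ)) / ε * (R ^ 3 / μ) * T := by gcongr
      linarith

/-- The output and the running time of the algorithm for all instances of the problem. -/
lemma mainProg_spec {m n N T : ℕ} {x : Fin m → Bits n} {y : Fin m → ℝ} {Φ : Bits n → Feature N}
    {U : Matrix (Bits n × Bits N) (Bits n × Bits N) ℂ} {c c' : Fin m → Bool} {ε δ : ℝ}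
    (hy : ∀ i, y i = 1 ∨ y i = -1) (hU : IsQuantumFeatureMap U Φ) (hT : 1 ≤ T)
    (hq : n + N ≤ 2 * T) (hc : Psi x y Φ c ≠ 0) (hc' : Psi x y Φ c' ≠ 0) (hε : 0 < ε)
    (hδ : 0 < δ) (hδ1 : δ < 1) {R μ : ℝ} (hR : R = maxNorm x Φ)
    (hμ : μ = min ‖Psi x y Φ c‖ ‖Psi x y Φ c'‖) {branches : List State}
    (hbr : branches = run (problemDevice T x y Φ U c c') mainProg
      (start m n N ε δ (eta x Φ c) (eta x Φ c'))) :
    1 - δ ≤ prob branches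
        (fun s => |s.output - inner ℝ (Psi x y Φ c) (Psi x y Φ c')| ≤ ε) ∧
      ∀ s ∈ branches, s.psi ≠ 0 →
        (s.time : ℝ) ≤ (375000 * (2 * 10 ^ 10) ^ 8 : ℕ) *
          (1 + (1 + log (1 / δ)) / ε * (R ^ 3 / μ) * T) *
          log (2 + m + n + N + R + 1 / ε + 1 / δ + 1 / μ) ^ 8 := by
  set D := problemDevice T x y Φ U c c' with hD
  have hm := pos_of_Psi_ne_zero hc
  have hnorm := norm_Psi_le_eta (Φ := Φ) (x := x) (c := c) hy hm
  have hnorm' := norm_Psi_le_eta (Φ := Φ) (x := x) (c := c') hy hm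
  have hμ0 : 0 < μ := hμ ▸ lt_min (norm_pos_iff.2 hc) (norm_pos_iff.2 hc')
  have hμη : μ ≤ eta x Φ c := hμ ▸ (min_le_left _ _).trans hnorm
  have hμη' : μ ≤ eta x Φ c' := hμ ▸ (min_le_right _ _).trans hnorm'
  have hηR : eta x Φ c ≤ R := hR ▸ eta_le_maxNorm hm
  have hηR' : eta x Φ c' ≤ R := hR ▸ eta_le_maxNorm hm
  have hUD : D.Unitary := unitary_problemDevice hU
  have hpsi : normSq (startState D ε δ (eta x Φ c) (eta x Φ c')).psi = 1 := normSq_ket ∅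
  have hR0 : 0 < R := hμ0.trans_le (hμη.trans hηR)
  have hlog : 0 ≤ log (1 / δ) := log_nonneg ((one_le_div hδ).2 hδ1.le)
  have hnn : (0 : ℝ) ≤ m + n + N := by positivity
  have i1 : 0 < 1 / ε := by positivity
  have i2 : 0 < 1 / δ := by positivity
  have i3 : 0 < 1 / μ := by positivity
  set Z : ℝ := 2 + m + n + N + R + 1 / ε + 1 / δ + 1 / μ with hZ
  have hZ2 : 2 ≤ Z := by linarith
  have hl := two_thirds_le_log hZ2
  change branches = run D mainProg (startState D ε δ (eta x Φ c) (eta x Φ c')) at hbr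
  rw [hbr]
  rcases lt_or_ge (eta x Φ c * eta x Φ c') ε with hp | hp
  · have hdet := det_mainProg_of_lt (D := D) (δ := δ) hp
    refine ⟨Err.one_sub_le_prob hUD hpsi (Always.err_imp hdet.always hδ.le fun t ht => ?_),
      fun s hs h0 => ?_⟩
    · rw [ht.1, zero_sub, abs_neg]
      exact (abs_real_inner_le_norm _ _).trans
        ((mul_le_mul hnorm hnorm' (norm_nonneg _) eta_nonneg).trans hp.le)
    · have h1 : (s.time : ℝ) ≤ 50 := by exact_mod_cast (hdet.always s hs h0).2
      have h2 : 0 ≤ (1 + log (1 / δ)) / ε * (R ^ 3 / μ) * T := by positivity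
      have h3 : (2 / 3 : ℝ) ^ 8 ≤ log Z ^ 8 := pow_le_pow_left₀ (by norm_num) hl 8
      refine h1.trans ?_
      calc (50 : ℝ) ≤ (375000 * (2 * 10 ^ 10) ^ 8 : ℕ) * 1 * (2 / 3 : ℝ) ^ 8 := by norm_num
        _ ≤ _ := by gcongr; linarith
  · have hst : Stored D (unitFeature Φ) (eta x Φ c) (eta x Φ c') R :=
    { pos := hm
      norm_feature := norm_unitFeature hU
      eta_pos := hμ0.trans_le hμη
      eta_pos' := hμ0.trans_le hμη'
      eta_le := hηR
      eta_le' := hηR'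
      sum_sq := (sum_sq_num hy false).le
      sum_sq' := (sum_sq_num hy true).le
      abs_le := abs_num_le_eta hy false
      abs_le' := abs_num_le_eta hy true
      abs_le_max := fun b k => hR ▸ abs_num_le_maxNorm hy b k }
    have hdom : Dominates Z D R ε δ (eta x Φ c) (eta x Φ c') :=
    { two_le := hZ2
      card := by
        change 2 + ((m : ℝ) + n + N) ≤ Z
        linarith
      max_le := by linarith
      inv_eps := by linarith
      inv_delta := by linarith
      inv_eta := (one_div_le_one_div_of_le hμ0 hμη).trans (by linarith)
      inv_eta' := (one_div_le_one_div_of_le hμ0 hμη').trans (by linarith) }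
    obtain ⟨b, L, S, hb, hL, hS, hL0, hS0, hB, hbm, hbq⟩ := exists_bounds hst hε hδ hδ1 hp hdom
    obtain ⟨htime, herr⟩ := main_of_bounds hUD (hasFeature_problemDevice hU) hst hε hδ hp hT hq hL
      hS hL0 hS0 hB hbm hbq
    refine ⟨?_, fun s hs h0 => ?_⟩
    · rw [inner_Psi_eq (T := T) hU]
      exact Err.one_sub_le_prob hUD hpsi herr
    · have hb4 := hB.loop
      refine time_le hε hδ hδ1 hμ0 (hμη.trans hηR) (hp.trans ?_) hb (by omega) (by omega)
        (htime s hs h0)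
      rw [sq]
      exact mul_le_mul hηR hηR' eta_nonneg hR0.le

end QSVM

theorem mainTheorem4 :
    ∃ (P : QSVM.Prog) (K k : ℕ),
      ∀ (m n N T : ℕ) (x : Fin m → QSVM.Bits n) (y : Fin m → ℝ)
        (Φ : QSVM.Bits n → QSVM.Feature N)
        (U : Matrix (QSVM.Bits n × QSVM.Bits N) (QSVM.Bits n × QSVM.Bits N) ℂ)
        (c c' : Fin m → Bool) (ε δ : ℝ),
        (∀ i, y i = 1 ∨ y i = -1) →
        QSVM.IsQuantumFeatureMap U Φ →
        1 ≤ T → n + N ≤ 2 * T →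
        QSVM.Psi x y Φ c ≠ 0 → QSVM.Psi x y Φ c' ≠ 0 →
        0 < ε → 0 < δ → δ < 1 →
        let R : ℝ := QSVM.maxNorm x Φ
        let μ : ℝ := min ‖QSVM.Psi x y Φ c‖ ‖QSVM.Psi x y Φ c'‖
        let branches : List QSVM.State :=
          QSVM.run (QSVM.problemDevice T x y Φ U c c') P
            (QSVM.start m n N ε δ (QSVM.eta x Φ c) (QSVM.eta x Φ c'))
        1 - δ ≤ QSVM.prob branches
            (fun s => |s.output - inner ℝ (QSVM.Psi x y Φ c) (QSVM.Psi x y Φ c')| ≤ ε) ∧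
        ∀ s ∈ branches, s.psi ≠ 0 →
          (s.time : ℝ) ≤ K * (1 + (1 + Real.log (1 / δ)) / ε * (R ^ 3 / μ) * T) *
            Real.log (2 + m + n + N + R + 1 / ε + 1 / δ + 1 / μ) ^ k := by
  refine ⟨QSVM.mainProg, 375000 * (2 * 10 ^ 10) ^ 8, 8, ?_⟩
  intro m n N T x y Φ U c c' ε δ hy hU hT hq hc hc' hε hδ hδ1
  exact QSVM.mainProg_spec hy hU hT hq hc hc' hε hδ hδ1 rfl rfl rfl
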